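/- Let $r=|x|$, $\omega=x/|x|$ for $x\in\mathbb{R}^3\setminus\{0\}$, and let $X=[\mathbb{R}^3;\{0\}]=[0,\infty)_r\times\mathbb{S}^2$. Let $m\in\mathbb{R}$, let $\mathsf{Z}=\mathsf{Z}(t)$ be a smooth function on $\mathbb{R}$, let $V,A_1,A_2,A_3\in C^\infty(X)$ (i.e. smooth functions of $(r,\omega)\in[0,\infty)\times\mathbb{S}^2$), and put $A_0=\mathsf{Z}(t)/r+V$. Let $\gamma^0=\begin{pmatrix}I&0\\0&-I\end{pmatrix}$, $\gamma^j=\begin{pmatrix}0&\sigma_j\\-\sigma_j&0\end{pmatrix}$ with the Pauli matrices $\sigma_j$, let $D\!\!\!\!/_{\mathbf A}=\gamma^\mu(\partial_\mu+iA_\mu)$, acting on $\mathbb{C}^4$-valued functions of $(t,x)\in\mathbb{R}\times(\mathbb{R}^3\setminus\{0\})$, and let $$P=-(iD\!\!\!\!/_{\mathbf A}+m)(iD\!\!\!\!/_{\mathbf A}-m)$$ be the squared Dirac–Coulomb wave operator. **Spectral admissibility.** Let $P$ be an operator on $\mathbb{C}^4$-valued functions of the form $$r^2P=r^2(-D_t^2+\Delta)+a\,r\partial_t+\sum_j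 b_j\,r\partial_{x_j}+c,\qquad D_t=-i\partial_t,\quad \Delta=-\sum_j\partial_{x_j}^2,$$ with matrix coefficients $a,b_j,c$ that are smooth in $(t,r,\omega)\in\mathbb{R}\times[0,\infty)\times\mathbb{S}^2$. Let $N_{t_0}(\sigma)$ denote the operator on $\mathbb{R}^3\setminus\{0\}$ obtained from $r^2P$ by evaluating $a,b_j,c$ at $t=t_0$, $r=0$ and replacing $\partial_t$ by $-i\sigma$; set $\hat N_{t_0}(\hat\sigma)=r^{-2}N_{t_0}(\hat\sigma)$ for $|\hat\sigma|=1$, and let $N_{\mathrm b,t_0}(\xi)=r^{-\xi}N_{t_0}(0)r^\xi$, regarded as a differential operator on $C^\infty(\mathbb{S}^2;\mathbb{C}^4)$. We say that $P$ is *spectrally admissible with weight $\ell\in\mathbb{R}$ at $t_0$* if $N_{\mathrm b,t_0}(\xi)$ is invertible for all $\xi\in\mathbb{C}$ with $\operatorname{Re}\xi=\ell-\frac32$, and if for all $\hat\sigma\in\mathbb{C}$ with $|\hat\sigma|=1$, $\operatorname{Im}\hat\sigma\ge 0$, every smooth $u\colon\mathbb{R}^3\setminus\{0\}\to\mathbb{C}^4$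 satisfying (1) or (2) vanishes: 1. $\hat N_{t_0}(\hat\sigma)u=0$; for all $j,\alpha$, $|(r\partial_r)^j\partial_\omega^\alpha u|\lesssim r^{\ell-\frac32}$ on $r\le 1$; and on $r\ge 1$, if $\hat\sigma=\pm1$, there is a constant $C$ with $|(r\partial_r)^j\partial_\omega^\alpha(e^{-i\hat\sigma r}u)|\lesssim r^{C}$ for all $j,\alpha$, respectively, if $\operatorname{Im}\hat\sigma>0$, $|\partial_r^j\partial_\omega^\alpha u|\lesssim r^{-N}$ for all $j,\alpha,N$. 2. $\hat N_{t_0}(\hat\sigma)^*u=0$ (formal adjoint with respect to $dx$ and the standard inner product of $\mathbb{C}^4$); for all $j,\alpha$, $|(r\partial_r)^j\partial_\omega^\alpha u|\lesssim r^{\frac12-\ell}$ on $r\le 1$; and on $r\ge 1$ the same conditions as in (1), with $e^{i\hat\sigma r}u$ in place of $e^{-i\hat\sigma r}u$. **Lemma.** Let $t_0\in\mathbb{R}$, and suppose that $\mathsf{Z}(t_0)\in\mathbb{R}$ satisfies $|\mathsf{Z}(t_0)|\ne\sqrt{\kappa^2-\frac14}$ for all $\kappa\in\mathbb{Z}\setminus\{0\}$.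 Let $$\delta=\min_{\kappa\in\mathbb{Z}\setminus\{0\}}\Bigl|\tfrac12-\operatorname{Re}\sqrt{\kappa^2-\mathsf{Z}(t_0)^2}\Bigr|,$$ with the principal square root, so that the real part is $0$ if $\kappa^2<\mathsf{Z}(t_0)^2$. Then $P$ is of the above form, and it is spectrally admissible with weight $\ell$ at $t_0$ for all $\ell\in(1-\delta,1+\delta)$. -/

import Mathlib

open scoped ContDiff Matrix

noncomputable section

namespace EdgeWave

/-- Euclidean space `ℝⁿ`. The spatial manifold is the blow-up `[ℝⁿ; {0}] = [0,∞)_r × S^{n-1}`, whose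
interior is `{x ≠ 0}`, with `r = ‖x‖` and `ω = ‖x‖⁻¹ • x`. -/
abbrev Space (n : ℕ) : Type := EuclideanSpace ℝ (Fin n)

/-- The angular coordinate `ω = x / |x|` of a point `x ≠ 0`. -/
def angle {n : ℕ} (x : Space n) : Space n := ‖x‖⁻¹ • x

/-- Smooth functions on the blow-up `[ℝⁿ; {0}] = [0,∞)_r × S^{n-1}`, regarded as functions of
`x ≠ 0`: they are the restrictions of smooth functions of `(r, ω) ∈ ℝ × ℝⁿ`. -/
def IsSmoothOnBlowup {n : ℕ} (f : Space n → ℂ) : Prop :=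
  ∃ F : ℝ × Space n → ℂ, ContDiff ℝ ∞ F ∧ ∀ x : Space n, x ≠ 0 → f x = F (‖x‖, angle x)

variable {n : ℕ} {ι : Type} [Fintype ι]

/-! ### Derivatives -/

/-- `∂_t` on functions of `(t, x)`. -/
def dt (ψ : ℝ × Space n → ι → ℂ) (p : ℝ × Space n) : ι → ℂ := fderiv ℝ ψ p (1, 0)

/-- `∂_{x_j}` on functions of `(t, x)`. -/
def dx (j : Fin n) (ψ : ℝ × Space n → ι → ℂ) (p : ℝ × Space n) : ι → ℂ :=
  fderiv ℝ ψ p (0, EuclideanSpace.single j 1)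

/-- `∂_{x_j}` on functions of `x`. -/
def partialX (j : Fin n) (u : Space n → ι → ℂ) (x : Space n) : ι → ℂ :=
  fderiv ℝ u x (EuclideanSpace.single j 1)

/-- `r ∂_r`. -/
def rDr (u : Space n → ι → ℂ) (x : Space n) : ι → ℂ := fderiv ℝ u x x

/-- `∂_r`. -/
def dr (u : Space n → ι → ℂ) (x : Space n) : ι → ℂ := fderiv ℝ u x (angle x)

/-- The rotation vector field `x_i ∂_j - x_j ∂_i`. These vector fields are tangent to the spheres
`r = const`, do not depend on `r`, and span the tangent spaces of `S^{n-1}`. -/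
def rot (i j : Fin n) (u : Space n → ι → ℂ) (x : Space n) : ι → ℂ :=
  fderiv ℝ u x (x i • EuclideanSpace.single j 1 - x j • EuclideanSpace.single i 1)

/-- Iterated angular derivatives `∂_ω^α`, realized through rotation vector fields. -/
def angular (α : List (Fin n × Fin n)) (u : Space n → ι → ℂ) : Space n → ι → ℂ :=
  α.foldr (fun ij w => rot ij.1 ij.2 w) u

/-! ### Wave operators of edge type on Minkowski space -/

/-- Principally scalar wave operators `P ∈ r⁻² Diff_e²(M; ℂ^ι)` on `(1+n)`-dimensional Minkowski
space, `M = ℝ_t × [ℝⁿ; {0}]`, presented as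
`r² P = r² (-D_t² + Δ) + a r ∂_t + ∑_j b_j r ∂_{x_j} + c`
with matrix-valued coefficients that are smooth in `(t, r, ω)` down to `r = 0`. (The vector fields
`r ∂_t`, `r ∂_{x_j}` are a frame of the edge tangent bundle.) -/
structure WaveOp (n : ℕ) (ι : Type) where
  a : ℝ × ℝ × Space n → Matrix ι ι ℂ
  b : Fin n → ℝ × ℝ × Space n → Matrix ι ι ℂ
  c : ℝ × ℝ × Space n → Matrix ι ι ℂ
  smooth_a : ∀ k l, ContDiff ℝ ∞ fun y => a y k l
  smooth_b : ∀ j k l, ContDiff ℝ ∞ fun y => b j y k l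
  smooth_c : ∀ k l, ContDiff ℝ ∞ fun y => c y k l

namespace WaveOp

/-- The action of `r² P` on functions of `(t, x)`, `x ≠ 0`. -/
def apply (L : WaveOp n ι) (ψ : ℝ × Space n → ι → ℂ) (p : ℝ × Space n) : ι → ℂ :=
  ‖p.2‖ ^ 2 • (dt (dt ψ) p - ∑ j, dx j (dx j ψ) p)
    + L.a (p.1, ‖p.2‖, angle p.2) *ᵥ (‖p.2‖ • dt ψ p)
    + ∑ j, L.b j (p.1, ‖p.2‖, angle p.2) *ᵥ (‖p.2‖ • dx j ψ p)
    + L.c (p.1, ‖p.2‖, angle p.2) *ᵥ ψ p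

/-- `L` is a presentation of the operator `r² P`. The coefficients of `L` are then determined by `P`
at all `(t, r, ω)` with `r > 0`, `|ω| = 1` (apply `P` to constants and to linear functions), hence by
continuity also at `r = 0`. -/
def Represents (L : WaveOp n ι) (P : (ℝ × Space n → ι → ℂ) → ℝ × Space n → ι → ℂ) : Prop :=
  ∀ ψ : ℝ × Space n → ι → ℂ, ContDiffOn ℝ ∞ ψ {p | p.2 ≠ 0} →
    ∀ p : ℝ × Space n, p.2 ≠ 0 → ‖p.2‖ ^ 2 • P ψ p = L.apply ψ p

/-- The spectral family `N_{e,t₀}(r² P, σ)` of the edge normal operator at `t₀`: the coefficients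
are frozen at `t = t₀`, `r = 0`, and the operator acts on `e^{-iσt} u(x)`. For `|σ| = 1` this is the
reduced normal operator of `r² P`. -/
def normalFamily (L : WaveOp n ι) (t₀ : ℝ) (σ : ℂ) (u : Space n → ι → ℂ) (x : Space n) : ι → ℂ :=
  ‖x‖ ^ 2 • (-(σ ^ 2 • u x) - ∑ j, partialX j (partialX j u) x)
    + L.a (t₀, 0, angle x) *ᵥ (‖x‖ • (-(Complex.I * σ)) • u x)
    + ∑ j, L.b j (t₀, 0, angle x) *ᵥ (‖x‖ • partialX j u x)
    + L.c (t₀, 0, angle x) *ᵥ u x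

/-- The reduced normal operator of `P` itself, `r̂⁻² N_{e,t₀}(r² P, σ̂)`. -/
def reducedNormal (L : WaveOp n ι) (t₀ : ℝ) (σ : ℂ) (u : Space n → ι → ℂ) (x : Space n) : ι → ℂ :=
  (‖x‖ ^ 2)⁻¹ • L.normalFamily t₀ σ u x

end WaveOp

/-- Smooth functions on the unit sphere: the extension that is homogeneous of degree `0` is smooth on
`ℝⁿ ∖ {0}`. Only the values on the sphere matter. -/
def IsSmoothOnSphere (v : Space n → ι → ℂ) : Prop :=
  ContDiffOn ℝ ∞ (fun x => v (angle x)) {0}ᶜ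

namespace WaveOp

/-- The indicial family `N_{b,t₀}(r² P, ξ)`, a differential operator on the unit sphere: the
b-normal operator `N_{b,t₀}(r² P) = N_{e,t₀}(r² P, 0)` conjugated by `r^ξ`, so that `r ∂_r` is
replaced by `ξ`. (At `|y| = 1` the factor `r^{-ξ}` is `1`.) -/
def indicialFamily (L : WaveOp n ι) (t₀ : ℝ) (ξ : ℂ) (v : Space n → ι → ℂ) (y : Space n) : ι → ℂ :=
  L.normalFamily t₀ 0 (fun x => ((‖x‖ : ℂ) ^ ξ) • v (angle x)) y

/-- Invertibility of the (elliptic) operator `N_{b,t₀}(r² P, ξ)` on `C^∞(S^{n-1}; ℂ^ι)`. -/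
def IndicialInvertible (L : WaveOp n ι) (t₀ : ℝ) (ξ : ℂ) : Prop :=
  (∀ v : Space n → ι → ℂ, IsSmoothOnSphere v →
      (∀ y, ‖y‖ = 1 → L.indicialFamily t₀ ξ v y = 0) → ∀ y, ‖y‖ = 1 → v y = 0) ∧
  (∀ f : Space n → ι → ℂ, IsSmoothOnSphere f →
      ∃ v, IsSmoothOnSphere v ∧ ∀ y, ‖y‖ = 1 → L.indicialFamily t₀ ξ v y = f y)

/-- `w` is a non-indicial weight at `t₀`. -/
def IsNonIndicial (L : WaveOp n ι) (t₀ w : ℝ) : Prop :=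
  ∀ ξ : ℂ, ξ.re = w → L.IndicialInvertible t₀ ξ

end WaveOp

/-! ### Bounds at `r̂ = 0` and `r̂ = ∞` -/

/-- `|(r ∂_r)^j ∂_ω^α u| ≲ r^w` on `(0, 1]`, for all `j`, `α`. -/
def ConormalAtZero (w : ℝ) (u : Space n → ι → ℂ) : Prop :=
  ∀ (j : ℕ) (α : List (Fin n × Fin n)), ∃ K : ℝ, ∀ x : Space n, x ≠ 0 → ‖x‖ ≤ 1 →
    ‖rDr^[j] (angular α u) x‖ ≤ K * ‖x‖ ^ w

/-- For some `C`: `|(r ∂_r)^j ∂_ω^α u| ≲ r^C` on `[1, ∞)`, for all `j`, `α`. -/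
def ConormalAtInfinity (u : Space n → ι → ℂ) : Prop :=
  ∃ C : ℝ, ∀ (j : ℕ) (α : List (Fin n × Fin n)), ∃ K : ℝ, ∀ x : Space n, 1 ≤ ‖x‖ →
    ‖rDr^[j] (angular α u) x‖ ≤ K * ‖x‖ ^ C

/-- `|∂_r^j ∂_ω^α u| ≲ r^{-N}` on `[1, ∞)`, for all `j`, `α`, `N`. -/
def RapidlyDecaying (u : Space n → ι → ℂ) : Prop :=
  ∀ (j : ℕ) (α : List (Fin n × Fin n)) (N : ℝ), ∃ K : ℝ, ∀ x : Space n, 1 ≤ ‖x‖ →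
    ‖dr^[j] (angular α u) x‖ ≤ K * ‖x‖ ^ (-N)

/-- `e^{iτ|x|} u(x)`. -/
def phase (τ : ℂ) (u : Space n → ι → ℂ) (x : Space n) : ι → ℂ :=
  Complex.exp (Complex.I * τ * ‖x‖) • u x

namespace WaveOp

/-- Injectivity of the reduced normal operator at frequency `σ`, weight `ℓ`. If `|σ| = 1` and
`Im σ ≥ 0`, then `Im σ = 0` means `σ = ±1`. -/
def DirectInjective (L : WaveOp n ι) (t₀ ℓ : ℝ) (σ : ℂ) : Prop :=
  ∀ u : Space n → ι → ℂ, ContDiffOn ℝ ∞ u {0}ᶜ →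
    (∀ x, x ≠ 0 → L.reducedNormal t₀ σ u x = 0) →
    ConormalAtZero (ℓ - n / 2) u →
    (σ.im = 0 → ConormalAtInfinity (phase (-σ) u)) →
    (0 < σ.im → RapidlyDecaying u) →
    ∀ x, x ≠ 0 → u x = 0

/-- `N̂* u = 0`, for smooth `u` on `ℝⁿ ∖ {0}` and the formal adjoint `N̂*` of the reduced normal
operator `N̂` with respect to the density `r^{n-1} dr dω = dx` and the standard Hermitian inner
product on `ℂ^ι`: `⟨N̂ φ, u⟩ = 0` for all test functions `φ` on `ℝⁿ ∖ {0}`. -/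
def AdjointKernel (L : WaveOp n ι) (t₀ : ℝ) (σ : ℂ) (u : Space n → ι → ℂ) : Prop :=
  ∀ φ : Space n → ι → ℂ, ContDiff ℝ ∞ φ → HasCompactSupport φ → tsupport φ ⊆ {0}ᶜ →
    ∫ x, star (u x) ⬝ᵥ L.reducedNormal t₀ σ φ x = 0

/-- Injectivity of the adjoint of the reduced normal operator at frequency `σ`, weight `ℓ`. -/
def AdjointInjective (L : WaveOp n ι) (t₀ ℓ : ℝ) (σ : ℂ) : Prop :=
  ∀ u : Space n → ι → ℂ, ContDiffOn ℝ ∞ u {0}ᶜ →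
    L.AdjointKernel t₀ σ u →
    ConormalAtZero (-(((n : ℝ) - 4) / 2) - ℓ) u →
    (σ.im = 0 → ConormalAtInfinity (phase σ u)) →
    (0 < σ.im → RapidlyDecaying u) →
    ∀ x, x ≠ 0 → u x = 0

end WaveOp

/-- `P` is a wave operator of edge type and is spectrally admissible with weight `ℓ` at `t₀`. -/
def IsSpectrallyAdmissible (P : (ℝ × Space n → ι → ℂ) → ℝ × Space n → ι → ℂ) (ℓ t₀ : ℝ) : Prop :=
  ∃ L : WaveOp n ι, L.Represents P ∧
    L.IsNonIndicial t₀ (ℓ - n / 2) ∧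
    ∀ σ : ℂ, 0 ≤ σ.im → ‖σ‖ = 1 → L.DirectInjective t₀ ℓ σ ∧ L.AdjointInjective t₀ ℓ σ

/-! ### The Dirac–Coulomb operator -/

/-- Index set of the components of a Dirac spinor in `ℂ⁴ = ℂ² ⊕ ℂ²`. -/
abbrev SpinIdx : Type := Fin 2 ⊕ Fin 2

/-- The Pauli matrices. -/
def pauli : Fin 3 → Matrix (Fin 2) (Fin 2) ℂ :=
  ![!![0, 1; 1, 0], !![0, -Complex.I; Complex.I, 0], !![1, 0; 0, -1]]

/-- `γ⁰`. -/
def gammaZero : Matrix SpinIdx SpinIdx ℂ := Matrix.fromBlocks 1 0 0 (-1)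

/-- `γ¹, γ², γ³`. -/
def gamma (j : Fin 3) : Matrix SpinIdx SpinIdx ℂ := Matrix.fromBlocks 0 (pauli j) (-pauli j) 0

/-- The Dirac operator `γ^μ (∂_μ + i A_μ)` on `ℝ_t × ℝ³` with potential
`A₀ = Z(t)/r + V(x)` and `A₁, A₂, A₃` (functions of `x`). -/
def dirac (Z : ℝ → ℂ) (V : Space 3 → ℂ) (A : Fin 3 → Space 3 → ℂ)
    (ψ : ℝ × Space 3 → SpinIdx → ℂ) (p : ℝ × Space 3) : SpinIdx → ℂ :=
  gammaZero *ᵥ (dt ψ p + (Complex.I * (Z p.1 / ‖p.2‖ + V p.2)) • ψ p)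
    + ∑ j, gamma j *ᵥ (dx j ψ p + (Complex.I * A j p.2) • ψ p)

/-- `i γ^μ (∂_μ + i A_μ) + s`. -/
def massiveDirac (s : ℂ) (Z : ℝ → ℂ) (V : Space 3 → ℂ) (A : Fin 3 → Space 3 → ℂ)
    (ψ : ℝ × Space 3 → SpinIdx → ℂ) (p : ℝ × Space 3) : SpinIdx → ℂ :=
  Complex.I • dirac Z V A ψ p + s • ψ p

/-- The squared Dirac–Coulomb operator `P = -(i γ^μ(∂_μ + iA_μ) + m)(i γ^μ(∂_μ + iA_μ) - m)`. -/
def diracCoulombWave (m : ℝ) (Z : ℝ → ℂ) (V : Space 3 → ℂ) (A : Fin 3 → Space 3 → ℂ)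
    (ψ : ℝ × Space 3 → SpinIdx → ℂ) (p : ℝ × Space 3) : SpinIdx → ℂ :=
  -massiveDirac m Z V A (massiveDirac (-m) Z V A ψ) p

end EdgeWave

end

/-! ### Algebra of differential operators on spinors over the punctured space -/

noncomputable section

namespace EdgeWave

/-! Since `m` is constant, `P = D² + m²` for the Dirac operator `D` with potential. The Lichnerowicz
formula `diracB_sq` expands `D²`. After multiplication by `r²` all coefficients are smooth down to
`r = 0`, because a derivative of a function on the blow-up is `r⁻²` times a smooth function
(`fderiv_blowup`, `diracWaveOp_represents`). At `r = 0` the mass, `V` and `A` drop out and only `z =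
Z t₀` survives.

The resulting model operator has the polar form `coulombOp`, that is `T² - T - (r∂_r)² - r∂_r - σ²r²
+ 2zσr` with `T = K - izα`. Here `K` is the spherical Dirac operator and `α = γ⁰γʲω_j`. As `α² = 1`
and `α` anticommutes with `K`, `T² = K² - z²` (`T_sq`), and the spectral theory of `T` reduces to
that of `K`.

`K - n` is invertible on the sphere unless `n` is a nonzero integer. Up to Clifford multiplication
by `x` and powers of `r`, it is the flat Dirac operator from spinors homogeneous of degree `n - 1`
to those of degree `n - 2` (`sphereInj_iff`, `sphereSurj_of_diracSurj`). For degrees with real part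
in `(-2, 0)` this is settled by convolution with the fundamental solution `γʲ y_j |y|⁻³`
(`dirac_injective_base`, `dirac_surjective_base`). Larger degrees follow by differentiation and
Euler's identity (`diracInj_step`, `diracSurj_step`), and negative `n` by the symmetry `K ↦ -K`.
Hence `T - ν` is invertible unless `ν² + z² = κ²` for a nonzero integer `κ` (`sphere_T`).

The indicial family is `(T + ξ)(T - ξ - 1)`. For `Re ξ = ℓ - 3/2`, the real parts of both `-ξ` and
`ξ + 1` have distance `|ℓ - 1| < δ` from `1/2`, while exceptional values have distance at least `δ`
(`le_abs_re_sub_half`). This gives invertibility.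

For the kernels, a solution `u` is paired over spheres with a spinor `Y`. The adjoint of `T z` is `T
(-z)`, so an eigenvector `Y` of the latter produces a scalar radial equation for the pairing `φ`.
The gap `δ` permits an exponent `ρ` for which `r^ρ φ` tends to zero at the origin. The Laplace
transform of `r^ρ φ` then solves a first order equation with singular points `±iσ`. Its nonzero
solutions are unbounded on approach to `-iσ`, whereas the outgoing condition forces boundedness
there, so `φ = 0` (`IsRadialSolution.eq_zero`). Since `T` is not symmetric, generalized eigenvectors
are needed. They are handled by induction (`pair_eq_zero_of_genEigenvector`) and span
finite-dimensional invariant spaces of polynomial spinors on the sphere, which are dense by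
Stone–Weierstrass; thus `u = 0` (`eq_zero_of_coulombOp_eq_zero`).

The formal adjoint of the model operator is the same operator with `(z, σ)` replaced by `(-z, -σ̄)`
(`ip_reducedNormal`), so the dual condition is another instance of the same result. The two ends of
the interval for `ℓ` serve the direct and the adjoint problem respectively. -/

/-- Smooth spinors on `ℝ³ ∖ {0}`, normalized to vanish at the origin. -/
def Sm : Submodule ℂ (Space 3 → SpinIdx → ℂ) where
  carrier := {u | ContDiffOn ℝ ∞ u {0}ᶜ ∧ u 0 = 0}
  zero_mem' := ⟨contDiffOn_const, rfl⟩
  add_mem' := fun ha hb => ⟨ha.1.add hb.1, by simp [ha.2, hb.2]⟩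
  smul_mem' := fun c _ ha => ⟨ha.1.const_smul c, by simp [ha.2]⟩

/-- Restriction of a smooth spinor on `ℝ³ ∖ {0}`, with the value at `0` reset. -/
def cut (u : Space 3 → SpinIdx → ℂ) (hu : ContDiffOn ℝ ∞ u {0}ᶜ) : Sm :=
  ⟨fun x => if x = 0 then 0 else u x,
    hu.congr fun x hx => by simp [Set.mem_compl_singleton_iff.1 hx], by simp⟩

lemma cut_apply {u : Space 3 → SpinIdx → ℂ} (hu : ContDiffOn ℝ ∞ u {0}ᶜ) {x : Space 3}
    (hx : x ≠ 0) : (cut u hu).1 x = u x := by simp [cut, hx]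

lemma isOpen_compl_zero : IsOpen ({0}ᶜ : Set (Space 3)) := isOpen_compl_singleton

lemma compl_zero_mem_nhds {x : Space 3} (hx : x ≠ 0) : ({0}ᶜ : Set (Space 3)) ∈ nhds x :=
  isOpen_compl_zero.mem_nhds hx

lemma eventually_ne_zero {x : Space 3} (hx : x ≠ 0) : ∀ᶠ y in nhds x, y ≠ 0 :=
  compl_zero_mem_nhds hx

lemma cut_eventuallyEq {u : Space 3 → SpinIdx → ℂ} (hu : ContDiffOn ℝ ∞ u {0}ᶜ) {x : Space 3}
    (hx : x ≠ 0) : (cut u hu).1 =ᶠ[nhds x] u :=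
  (eventually_ne_zero hx).mono fun _ hy => cut_apply hu hy

lemma Sm_ext {u v : Sm} (h : ∀ x, x ≠ 0 → u.1 x = v.1 x) : u = v := by
  apply Subtype.ext; funext x
  by_cases hx : x = 0
  · rw [hx, u.2.2, v.2.2]
  · exact h x hx

lemma contDiffAt_sm (u : Sm) {x : Space 3} (hx : x ≠ 0) : ContDiffAt ℝ ∞ u.1 x :=
  u.2.1.contDiffAt (compl_zero_mem_nhds hx)

lemma differentiableAt_sm (u : Sm) {x : Space 3} (hx : x ≠ 0) : DifferentiableAt ℝ u.1 x :=
  (contDiffAt_sm u hx).differentiableAt (by simp)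

lemma contDiffOn_fderiv_apply {F : Type*} [NormedAddCommGroup F] [NormedSpace ℝ F]
    {u : Space 3 → F} (hu : ContDiffOn ℝ ∞ u {0}ᶜ)
    {v : Space 3 → Space 3} (hv : ContDiffOn ℝ ∞ v {0}ᶜ) :
    ContDiffOn ℝ ∞ (fun x => fderiv ℝ u x (v x)) {0}ᶜ :=
  (hu.fderiv_of_isOpen isOpen_compl_zero (m := ∞) (by simp)).clm_apply hv

/-- Linear operators on smooth spinors. -/
def Op : Type := Module.End ℂ Sm

namespace Op

instance : Ring Op := inferInstanceAs (Ring (Module.End ℂ Sm))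
instance : Algebra ℂ Op := inferInstanceAs (Algebra ℂ (Module.End ℂ Sm))
instance : FunLike Op Sm Sm := inferInstanceAs (FunLike (Module.End ℂ Sm) Sm Sm)
instance : LinearMapClass Op ℂ Sm Sm :=
  inferInstanceAs (LinearMapClass (Module.End ℂ Sm) ℂ Sm Sm)

/-- Reinterpretation of a linear map as an operator. -/
def of (f : Sm →ₗ[ℂ] Sm) : Op := f

@[ext] lemma ext {a b : Op} (h : ∀ u, a u = b u) : a = b := DFunLike.ext a b h
@[simp] lemma mul_apply (a b : Op) (u : Sm) : (a * b) u = a (b u) := rfl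
@[simp] lemma add_apply (a b : Op) (u : Sm) : (a + b) u = a u + b u := rfl
@[simp] lemma sub_apply (a b : Op) (u : Sm) : (a - b) u = a u - b u := rfl
@[simp] lemma neg_apply (a : Op) (u : Sm) : (-a) u = -a u := rfl
@[simp] lemma smul_apply (c : ℂ) (a : Op) (u : Sm) : (c • a) u = c • a u := rfl
@[simp] lemma one_apply (u : Sm) : (1 : Op) u = u := rfl
@[simp] lemma zero_apply (u : Sm) : (0 : Op) u = 0 := rfl
lemma sum_apply (a : Fin 3 → Op) (u : Sm) : (∑ i, a i) u = ∑ i, a i u := by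
  simp [Fin.sum_univ_three, add_apply]

end Op

/-- The `j`-th coordinate vector. -/
abbrev ee (j : Fin 3) : Space 3 := EuclideanSpace.single j 1

/-- `∂_j` as an endomorphism of the space of smooth spinors. -/
def pd (j : Fin 3) : Op := Op.of
 { toFun u := cut (fun x => fderiv ℝ u.1 x (ee j)) (contDiffOn_fderiv_apply u.2.1 contDiffOn_const)
   map_add' u v := Sm_ext fun x hx => by
    simp [cut_apply, hx]
    rw [fderiv_add (differentiableAt_sm u hx) (differentiableAt_sm v hx)]; rfl
   map_smul' c u := Sm_ext fun x hx => by
    simp [cut_apply, hx]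
    rw [fderiv_const_smul (differentiableAt_sm u hx)]; rfl }

lemma pd_apply (j : Fin 3) (u : Sm) {x : Space 3} (hx : x ≠ 0) :
    (pd j u).1 x = fderiv ℝ u.1 x (ee j) :=
  cut_apply (contDiffOn_fderiv_apply u.2.1 contDiffOn_const) hx

/-- Multiplication by a scalar function that is smooth on `ℝ³ ∖ {0}`. -/
def mulF (f : Space 3 → ℂ) (hf : ContDiffOn ℝ ∞ f {0}ᶜ) : Op := Op.of
 { toFun u := ⟨fun x => f x • u.1 x, hf.smul u.2.1, by
    change f 0 • u.1 0 = 0; rw [u.2.2, smul_zero]⟩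
   map_add' u v := Sm_ext fun x hx => by simp
   map_smul' c u := Sm_ext fun x _ => smul_comm (f x) c (u.1 x) }

lemma mulF_apply {f : Space 3 → ℂ} (hf : ContDiffOn ℝ ∞ f {0}ᶜ) (u : Sm) (x : Space 3) :
    (mulF f hf u).1 x = f x • u.1 x := rfl

lemma contDiff_mulVec {E : Type*} [NormedAddCommGroup E] [NormedSpace ℝ E]
    (M : Matrix SpinIdx SpinIdx ℂ) {u : E → SpinIdx → ℂ} {s : Set E}
    (hu : ContDiffOn ℝ ∞ u s) : ContDiffOn ℝ ∞ (fun x => M *ᵥ u x) s := by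
  rw [contDiffOn_pi] at hu ⊢
  intro i
  simp only [Matrix.mulVec, dotProduct]
  exact ContDiffOn.sum fun j _ => contDiffOn_const.mul (hu j)

/-- Constant matrices acting on spinors. -/
def mat (M : Matrix SpinIdx SpinIdx ℂ) : Op := Op.of
 { toFun u := ⟨fun x => M *ᵥ u.1 x, contDiff_mulVec M u.2.1, by simp [u.2.2]⟩
   map_add' u v := Sm_ext fun x hx => by simp [Matrix.mulVec_add]
   map_smul' c u := Sm_ext fun x hx => by simp [Matrix.mulVec_smul] }

lemma mat_apply (M : Matrix SpinIdx SpinIdx ℂ) (u : Sm) (x : Space 3) :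
    (mat M u).1 x = M *ᵥ u.1 x := rfl

lemma mat_mul (M N : Matrix SpinIdx SpinIdx ℂ) : mat M * mat N = mat (M * N) := by
  ext u : 1; exact Sm_ext fun x hx => by simp [mat_apply]

lemma mat_add (M N : Matrix SpinIdx SpinIdx ℂ) : mat M + mat N = mat (M + N) := by
  ext u : 1; exact Sm_ext fun x hx => by simp [mat_apply, Matrix.add_mulVec]

lemma mat_smul_one (c : ℂ) : mat (c • 1) = c • 1 := by
  ext u : 1; exact Sm_ext fun x hx => by simp [mat_apply, Matrix.smul_mulVec]

/-- `u ↦ M u` as a continuous real-linear map. -/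
def mulVecCLM (M : Matrix SpinIdx SpinIdx ℂ) : (SpinIdx → ℂ) →L[ℝ] (SpinIdx → ℂ) :=
  (LinearMap.toContinuousLinearMap (Matrix.mulVecLin M)).restrictScalars ℝ

lemma mulVecCLM_apply (M : Matrix SpinIdx SpinIdx ℂ) (v : SpinIdx → ℂ) :
    mulVecCLM M v = M *ᵥ v := rfl

lemma fderiv_mulVec {E : Type*} [NormedAddCommGroup E] [NormedSpace ℝ E]
    (M : Matrix SpinIdx SpinIdx ℂ) {u : E → SpinIdx → ℂ} {x : E}
    (hu : DifferentiableAt ℝ u x) (v : E) :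
    fderiv ℝ (fun y => M *ᵥ u y) x v = M *ᵥ fderiv ℝ u x v := by
  have h := ((mulVecCLM M).hasFDerivAt.comp x hu.hasFDerivAt).fderiv
  have h2 : (fun y => M *ᵥ u y) = (mulVecCLM M) ∘ u := rfl
  rw [h2, h]; rfl

lemma mat_pd (M : Matrix SpinIdx SpinIdx ℂ) (j : Fin 3) : pd j * mat M = mat M * pd j := by
  ext u : 1; refine Sm_ext fun x hx => ?_
  simp only [Op.mul_apply, mat_apply, pd_apply _ _ hx]
  exact fderiv_mulVec M (differentiableAt_sm u hx) _

lemma mat_mulF (M : Matrix SpinIdx SpinIdx ℂ) {f : Space 3 → ℂ} (hf : ContDiffOn ℝ ∞ f {0}ᶜ) :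
    mulF f hf * mat M = mat M * mulF f hf := by
  ext u : 1; exact Sm_ext fun x hx => by simp [mat_apply, mulF_apply, Matrix.mulVec_smul]

/-- Symmetry of the second derivative; `key` identifies each composition with a value of the
iterated Fréchet derivative. -/
lemma pd_comm (i j : Fin 3) : pd i * pd j = pd j * pd i := by
  ext u : 1; refine Sm_ext fun x hx => ?_
  have key : ∀ i j : Fin 3, (pd i (pd j u)).1 x = fderiv ℝ (fderiv ℝ u.1) x (ee i) (ee j) := by
    intro i j
    rw [pd_apply _ _ hx]
    have h1 : (pd j u).1 =ᶠ[nhds x] fun y => fderiv ℝ u.1 y (ee j) :=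
      cut_eventuallyEq (contDiffOn_fderiv_apply u.2.1 contDiffOn_const) hx
    have h2 : DifferentiableAt ℝ (fderiv ℝ u.1) x :=
      ((contDiffAt_sm u hx).fderiv_right (m := ∞) (by simp)).differentiableAt (by simp)
    rw [h1.fderiv_eq, fderiv_clm_apply h2 (differentiableAt_const _)]
    simp
  simp only [Op.mul_apply, key]
  exact (((contDiffAt_sm u hx).isSymmSndFDerivAt (by
    rw [minSmoothness_of_isRCLikeNormedField]; exact WithTop.coe_le_coe.2 (le_top : (2 : ℕ∞) ≤ ⊤))) _ _)

/-- The Leibniz rule as an identity of operators. The derivative of `f` is requested only along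
coordinate lines, so that applications reduce to one-variable calculus. -/
lemma pd_mulF {f : Space 3 → ℂ} (hf : ContDiffOn ℝ ∞ f {0}ᶜ) (j : Fin 3)
    {g : Space 3 → ℂ} (hg : ContDiffOn ℝ ∞ g {0}ᶜ)
    (h : ∀ x, x ≠ 0 → HasDerivAt (fun t : ℝ => f (x + t • ee j)) (g x) 0) :
    pd j * mulF f hf = mulF f hf * pd j + mulF g hg := by
  ext u : 1; refine Sm_ext fun x hx => ?_
  simp only [Op.mul_apply, Op.add_apply, Submodule.coe_add, Pi.add_apply,
    mulF_apply, pd_apply _ _ hx]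
  have hfd : DifferentiableAt ℝ f x :=
    (hf.contDiffAt (compl_zero_mem_nhds hx)).differentiableAt (by simp)
  have h1 : (mulF f hf u).1 = fun y => f y • u.1 y := rfl
  have h2 : fderiv ℝ f x (ee j) = g x := by
    rw [← hfd.lineDeriv_eq_fderiv]; exact (h x hx).deriv
  rw [h1, fderiv_fun_smul hfd (differentiableAt_sm u hx)]
  simp [h2]

lemma mulF_mul {f g : Space 3 → ℂ} (hf : ContDiffOn ℝ ∞ f {0}ᶜ) (hg : ContDiffOn ℝ ∞ g {0}ᶜ) :
    mulF f hf * mulF g hg = mulF (fun x => f x * g x) (hf.mul hg) := by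
  ext u : 1; exact Sm_ext fun x hx => by simp [mulF_apply, mul_smul]

lemma mulF_comm {f g : Space 3 → ℂ} (hf : ContDiffOn ℝ ∞ f {0}ᶜ) (hg : ContDiffOn ℝ ∞ g {0}ᶜ) :
    mulF f hf * mulF g hg = mulF g hg * mulF f hf := by
  ext u : 1; exact Sm_ext fun x hx => by simp [mulF_apply, smul_smul, mul_comm]

lemma mulF_congr {f g : Space 3 → ℂ} (hf : ContDiffOn ℝ ∞ f {0}ᶜ) (hg : ContDiffOn ℝ ∞ g {0}ᶜ)
    (h : ∀ x, x ≠ 0 → f x = g x) : mulF f hf = mulF g hg := by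
  ext u : 1; exact Sm_ext fun x hx => by simp [mulF_apply, h x hx]

lemma contDiff_coord (j : Fin 3) : ContDiff ℝ ∞ (fun x : Space 3 => ((x j : ℝ) : ℂ)) :=
  Complex.ofRealCLM.contDiff.comp (EuclideanSpace.proj (𝕜 := ℝ) j).contDiff

lemma contDiffOn_norm {s : Set (Space 3)} (hs : s ⊆ {0}ᶜ) :
    ContDiffOn ℝ ∞ (fun x : Space 3 => ‖x‖) s :=
  fun x hx => (contDiffAt_norm ℝ (hs hx)).contDiffWithinAt

lemma ofReal_norm_mem_slitPlane {x : Space 3} (hx : x ≠ 0) : ((‖x‖ : ℝ) : ℂ) ∈ Complex.slitPlane :=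
  Complex.ofReal_mem_slitPlane.2 (norm_pos_iff.2 hx)

lemma contDiffOn_norm_cpow (ξ : ℂ) :
    ContDiffOn ℝ ∞ (fun x : Space 3 => ((‖x‖ : ℝ) : ℂ) ^ ξ) {0}ᶜ := by
  have h1 : ContDiffOn ℝ ∞ (fun x : Space 3 => Complex.exp (((Real.log ‖x‖ : ℝ) : ℂ) * ξ)) {0}ᶜ := by
    refine (Complex.contDiff_exp (𝕜 := ℝ) (n := ∞)).comp_contDiffOn (ContDiffOn.mul ?_ contDiffOn_const)
    exact Complex.ofRealCLM.contDiff.comp_contDiffOn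
      ((contDiffOn_norm le_rfl).log fun x hx => norm_ne_zero_iff.2 hx)
  refine h1.congr fun x hx => ?_
  have hx' : ((‖x‖ : ℝ) : ℂ) ≠ 0 := by simpa using hx
  rw [Complex.cpow_def_of_ne_zero hx', Complex.ofReal_log (norm_nonneg _)]

/-- Multiplication by the coordinate `x_j`. -/
def X (j : Fin 3) : Op := mulF _ (contDiff_coord j).contDiffOn

/-- Multiplication by `|x|^ξ`. -/
def rp (ξ : ℂ) : Op := mulF _ (contDiffOn_norm_cpow ξ)

lemma X_apply (j : Fin 3) (u : Sm) (x : Space 3) : (X j u).1 x = ((x j : ℝ) : ℂ) • u.1 x := rfl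

lemma rp_apply (ξ : ℂ) (u : Sm) (x : Space 3) : (rp ξ u).1 x = ((‖x‖ : ℝ) : ℂ) ^ ξ • u.1 x := rfl

lemma pd_X (i j : Fin 3) : pd i * X j = X j * pd i + if i = j then 1 else 0 := by
  rw [X, pd_mulF _ i (g := fun _ => if i = j then 1 else 0) contDiffOn_const]
  · congr 1
    ext u : 1; refine Sm_ext fun x hx => ?_
    rw [mulF_apply]; split_ifs <;> simp
  · intro x _
    have : ∀ t : ℝ, (x + t • ee i) j = x j + t * (if i = j then 1 else 0) := by
      intro t; simp [ee, eq_comm]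
    simp only [this]
    have h := (((hasDerivAt_id (0:ℝ)).mul_const (if i = j then (1:ℝ) else 0)).const_add (x j)).ofReal_comp
    refine h.congr_deriv ?_
    by_cases hij : i = j <;> simp [hij]

lemma X_comm (i j : Fin 3) : X i * X j = X j * X i := mulF_comm _ _
lemma rp_X (ξ : ℂ) (j : Fin 3) : rp ξ * X j = X j * rp ξ := mulF_comm _ _
lemma rp_mul (ξ η : ℂ) : rp ξ * rp η = rp (ξ + η) := by
  rw [rp, rp, rp, mulF_mul]
  exact mulF_congr _ _ fun x hx => (Complex.cpow_add _ _ (by simpa using hx)).symm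
lemma rp_zero : rp 0 = 1 := by
  ext u : 1; exact Sm_ext fun x hx => by simp [rp_apply]

lemma hasDerivAt_norm_line (j : Fin 3) {x : Space 3} (hx : x ≠ 0) :
    HasDerivAt (fun t : ℝ => ‖x + t • ee j‖) (x j / ‖x‖) 0 := by
  have h0 : HasDerivAt (fun t : ℝ => x + t • ee j) (ee j) 0 := by
    simpa using ((hasDerivAt_id (0:ℝ)).smul_const (ee j)).const_add x
  have h1 := h0.norm_sq
  have h2 : HasDerivAt (fun t : ℝ => Real.sqrt (‖x + t • ee j‖ ^ 2)) _ 0 :=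
    h1.sqrt (by simpa using hx)
  have h3 : (fun t : ℝ => Real.sqrt (‖x + t • ee j‖ ^ 2)) = fun t => ‖x + t • ee j‖ := by
    funext t; exact Real.sqrt_sq (norm_nonneg _)
  rw [h3] at h2
  convert h2 using 1
  have h4 : inner ℝ x (ee j) = x j := by
    rw [real_inner_comm]; simpa using EuclideanSpace.inner_single_left (𝕜 := ℝ) j 1 x
  rw [zero_smul, add_zero, h4, Real.sqrt_sq (norm_nonneg _)]
  field_simp

lemma pd_rp (j : Fin 3) (ξ : ℂ) : pd j * rp ξ = rp ξ * pd j + ξ • (rp (ξ - 2) * X j) := by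
  have hg : ContDiffOn ℝ ∞ (fun x : Space 3 => ξ * (((‖x‖ : ℝ) : ℂ) ^ (ξ - 2) * ((x j : ℝ) : ℂ))) {0}ᶜ :=
    contDiffOn_const.mul ((contDiffOn_norm_cpow _).mul (contDiff_coord j).contDiffOn)
  rw [rp, pd_mulF _ j hg]
  · congr 1
    ext u : 1; exact Sm_ext fun x hx => by simp [mulF_apply, rp_apply, X_apply, mul_smul]
  · intro x hx
    have h1 := (hasDerivAt_norm_line j hx).ofReal_comp
    have hx' : ((‖x‖ : ℝ) : ℂ) ≠ 0 := by simpa using hx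
    have h3 : HasDerivAt (fun w : ℂ => w ^ ξ) (ξ * ((‖x‖ : ℝ) : ℂ) ^ (ξ - 1) * 1) ((‖x‖ : ℝ) : ℂ) :=
      (hasDerivAt_id _).cpow_const (ofReal_norm_mem_slitPlane hx)
    have h2 : HasDerivAt (fun t : ℝ => ((‖x + t • ee j‖ : ℝ) : ℂ) ^ ξ) _ 0 :=
      HasDerivAt.comp (h₂ := fun w : ℂ => w ^ ξ) (0 : ℝ) (by simpa using h3) h1
    convert h2 using 1
    simp
    rw [Complex.cpow_sub _ _ hx', Complex.cpow_sub _ _ hx']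
    simp
    field_simp

lemma mat_X (M : Matrix SpinIdx SpinIdx ℂ) (j : Fin 3) : X j * mat M = mat M * X j := mat_mulF _ _
lemma mat_rp (M : Matrix SpinIdx SpinIdx ℂ) (ξ : ℂ) : rp ξ * mat M = mat M * rp ξ := mat_mulF _ _

lemma sum_X_sq : ∑ j, X j * X j = rp 2 := by
  ext u : 1; refine Sm_ext fun x hx => ?_
  have h : ((‖x‖ : ℝ) : ℂ) ^ (2 : ℂ) = ∑ j, ((x j : ℝ) : ℂ) * ((x j : ℝ) : ℂ) := by
    rw [show (2 : ℂ) = ((2 : ℕ) : ℂ) by norm_num, Complex.cpow_natCast, ← Complex.ofReal_pow,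
      EuclideanSpace.norm_sq_eq]
    push_cast
    refine Finset.sum_congr rfl fun j _ => ?_
    rw [← Complex.ofReal_pow]; simp [sq]
  rw [rp_apply, h, Finset.sum_smul, Op.sum_apply]
  simp only [Submodule.coe_sum, Finset.sum_apply, Op.mul_apply, X_apply, mul_smul]

end EdgeWave

end

noncomputable section

namespace EdgeWave

/-! ### Clifford algebra -/

lemma pauli_mul_pauli (i j : Fin 3) :
    pauli i * pauli j + pauli j * pauli i = if i = j then (2 : ℂ) • 1 else 0 := by
  fin_cases i <;> fin_cases j <;>
  · ext a b; fin_cases a <;> fin_cases b <;> simp [pauli] <;> norm_num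

lemma gamma_mul_gamma (i j : Fin 3) :
    gamma i * gamma j + gamma j * gamma i = if i = j then (-2 : ℂ) • 1 else 0 := by
  have h := pauli_mul_pauli i j
  have h2 : gamma i * gamma j + gamma j * gamma i = Matrix.fromBlocks
      (-(pauli i * pauli j + pauli j * pauli i)) 0 0 (-(pauli i * pauli j + pauli j * pauli i)) := by
    simp [gamma, Matrix.fromBlocks_multiply, Matrix.fromBlocks_add, add_comm]
  rw [h2, h, ← Matrix.fromBlocks_one, Matrix.fromBlocks_smul]
  split_ifs <;> simp

lemma gammaZero_mul_gamma (j : Fin 3) : gammaZero * gamma j = -(gamma j * gammaZero) := by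
  fin_cases j <;>
  · ext (a | a) (b | b) <;> fin_cases a <;> fin_cases b <;>
      simp [gamma, gammaZero, pauli, Matrix.fromBlocks_multiply]

lemma gammaZero_sq : gammaZero * gammaZero = 1 := by
  simp [gammaZero, Matrix.fromBlocks_multiply]

lemma gamma_conjTranspose (j : Fin 3) : (gamma j)ᴴ = -gamma j := by
  fin_cases j <;>
  · ext (a | a) (b | b) <;> fin_cases a <;> fin_cases b <;> simp [gamma, pauli]

lemma gammaZero_conjTranspose : gammaZeroᴴ = gammaZero := by
  simp [gammaZero, Matrix.fromBlocks_conjTranspose]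

/-- `γ^j` acting on spinors. -/
def G (j : Fin 3) : Op := mat (gamma j)

/-- `γ⁰` acting on spinors. -/
def G0 : Op := mat gammaZero

lemma G_anticomm (i j : Fin 3) : G i * G j + G j * G i = if i = j then (-2 : ℂ) • 1 else 0 := by
  rw [G, G, mat_mul, mat_mul, mat_add, gamma_mul_gamma]
  split_ifs
  · exact mat_smul_one _
  · rw [← zero_smul ℂ (1 : Matrix SpinIdx SpinIdx ℂ), mat_smul_one, zero_smul]

lemma G_sq (i : Fin 3) : G i * G i = -1 := by
  have h := G_anticomm i i
  rw [if_pos rfl, ← two_smul ℂ] at h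
  have h2 : (2 : ℂ) • (G i * G i) = (2 : ℂ) • (-1 : Op) := by rw [h]; module
  exact smul_right_injective _ (two_ne_zero' ℂ) h2

lemma G0_G (j : Fin 3) : G0 * G j = -(G j * G0) := by
  rw [G, G0, mat_mul, mat_mul, gammaZero_mul_gamma, eq_neg_iff_add_eq_zero, mat_add, neg_add_cancel,
    ← zero_smul ℂ (1 : Matrix SpinIdx SpinIdx ℂ), mat_smul_one, zero_smul]

lemma G0_sq : G0 * G0 = 1 := by
  rw [G0, mat_mul, gammaZero_sq, ← one_smul ℂ (1 : Matrix SpinIdx SpinIdx ℂ), mat_smul_one, one_smul]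

lemma pd_G (i j : Fin 3) : pd i * G j = G j * pd i := mat_pd _ _
lemma X_G (i j : Fin 3) : X i * G j = G j * X i := mat_X _ _
lemma rp_G (ξ : ℂ) (j : Fin 3) : rp ξ * G j = G j * rp ξ := mat_rp _ _
lemma pd_G0 (i : Fin 3) : pd i * G0 = G0 * pd i := mat_pd _ _
lemma X_G0 (i : Fin 3) : X i * G0 = G0 * X i := mat_X _ _
lemma rp_G0 (ξ : ℂ) : rp ξ * G0 = G0 * rp ξ := mat_rp _ _

/-! ### The spherical Dirac operator and the Coulomb matrix -/

/-- The radial field `r ∂_r`. -/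
def R : Op := ∑ j, X j * pd j
/-- The Dirac operator `γ^j ∂_j`. -/
def GD : Op := ∑ j, G j * pd j
/-- Clifford multiplication by `x`. -/
def GX : Op := ∑ j, G j * X j
/-- The spherical Dirac operator. -/
def K : Op := GX * GD + R + 1
/-- Clifford multiplication by `γ⁰ γ^j ω_j`. -/
def Al : Op := rp (-1) * (G0 * GX)
/-- The rotation field `x_i ∂_j - x_j ∂_i`. -/
def rotE (i j : Fin 3) : Op := X i * pd j - X j * pd i

/-- Signs in sums of anticommuting products. -/
lemma sum_clifford (a : Fin 3 → Fin 3 → Op) :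
    (∑ i, ∑ j, G i * G j * a i j) + (∑ i, ∑ j, G j * G i * a i j) = (-2 : ℂ) • ∑ i, a i i := by
  simp only [← Finset.sum_add_distrib, ← add_mul, G_anticomm]
  simp only [ite_mul, zero_mul, Finset.sum_ite_eq, Finset.mem_univ, if_true, Finset.smul_sum,
    smul_mul_assoc, one_mul]

/-- The coordinates commute, so the square is unchanged when the two Clifford factors are exchanged.
Adding the two versions leaves only the diagonal, by `sum_clifford`. `GD_sq` is the same argument
with commuting derivatives. -/
lemma GX_sq : GX * GX = -rp 2 := by
  have h : GX * GX = ∑ i, ∑ j, G i * G j * (X i * X j) := by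
    simp only [GX, Finset.sum_mul, Finset.mul_sum]
    rw [Finset.sum_comm]
    refine Finset.sum_congr rfl fun i _ => Finset.sum_congr rfl fun j _ => ?_
    rw [mul_assoc, ← mul_assoc (X i), X_G]; noncomm_ring
  have h' : GX * GX = ∑ i, ∑ j, G j * G i * (X i * X j) := by
    rw [h, Finset.sum_comm]
    refine Finset.sum_congr rfl fun i _ => Finset.sum_congr rfl fun j _ => ?_
    rw [X_comm]
  have h2 := sum_clifford (fun i j => X i * X j)
  rw [← h, ← h', sum_X_sq, ← two_smul ℂ] at h2
  have h3 : (2 : ℂ) • (GX * GX) = (2 : ℂ) • (-rp 2) := by rw [h2]; module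
  exact smul_right_injective _ (two_ne_zero' ℂ) h3

lemma GD_sq : GD * GD = -∑ j, pd j * pd j := by
  have h : GD * GD = ∑ i, ∑ j, G i * G j * (pd i * pd j) := by
    simp only [GD, Finset.sum_mul, Finset.mul_sum]
    rw [Finset.sum_comm]
    refine Finset.sum_congr rfl fun i _ => Finset.sum_congr rfl fun j _ => ?_
    rw [mul_assoc, ← mul_assoc (pd i), pd_G]; noncomm_ring
  have h' : GD * GD = ∑ i, ∑ j, G j * G i * (pd i * pd j) := by
    rw [h, Finset.sum_comm]
    refine Finset.sum_congr rfl fun i _ => Finset.sum_congr rfl fun j _ => ?_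
    rw [pd_comm]
  have h2 := sum_clifford (fun i j => pd i * pd j)
  rw [← h, ← h', ← two_smul ℂ] at h2
  have h3 : (2 : ℂ) • (GD * GD) = (2 : ℂ) • (-∑ j, pd j * pd j) := by rw [h2]; module
  exact smul_right_injective _ (two_ne_zero' ℂ) h3

/-- The off-diagonal part of the anticommutator cancels by the Clifford relation and the diagonal
part gives `-2 * R`. The constant is the sum of the squares of the `G i`, produced where `pd i`
differentiates the coordinate. -/
lemma GD_GX : GD * GX = -3 - 2 * R - GX * GD := by
  have h1 : GD * GX = (∑ i, ∑ j, G i * G j * (X j * pd i)) + ∑ i, G i * G i := by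
    simp only [GD, GX, Finset.sum_mul, Finset.mul_sum]
    rw [Finset.sum_comm, ← Finset.sum_add_distrib]
    refine Finset.sum_congr rfl fun i _ => ?_
    have : G i * G i = ∑ j, G i * G j * (if i = j then 1 else 0) := by simp
    rw [this, ← Finset.sum_add_distrib]
    refine Finset.sum_congr rfl fun j _ => ?_
    rw [mul_assoc, ← mul_assoc (pd i), pd_G, mul_assoc (G j), pd_X]; noncomm_ring
  have h2 : GX * GD = ∑ i, ∑ j, G j * G i * (X j * pd i) := by
    simp only [GD, GX, Finset.sum_mul, Finset.mul_sum]
    refine Finset.sum_congr rfl fun i _ => Finset.sum_congr rfl fun j _ => ?_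
    rw [mul_assoc, ← mul_assoc (X j), X_G]; noncomm_ring
  have h3 := sum_clifford (fun i j => X j * pd i)
  have h4 : ∑ i, G i * G i = -3 := by
    simp only [G_sq, Fin.sum_univ_three]; norm_num
  rw [h4] at h1
  rw [← h2, ← sub_eq_iff_eq_add.2 h1] at h3
  have h5 : GD * GX + GX * GD = -3 - 2 * R := by
    have : (2 : Op) * R = (2 : ℂ) • R := by
      rw [two_mul, two_smul]
    rw [this]
    have h6 : (-2 : ℂ) • ∑ i, X i * pd i = -((2 : ℂ) • R) := by rw [R]; module
    rw [h6] at h3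
    have h7 : GD * GX + GX * GD = (GD * GX - -3 + GX * GD) - 3 := by abel
    rw [h7, h3]; abel
  rw [← h5]; abel

lemma pd_R (i : Fin 3) : pd i * R = R * pd i + pd i := by
  have h : ∀ j, pd i * (X j * pd j) = X j * pd j * pd i + (if i = j then 1 else 0) * pd j := by
    intro j
    rw [← mul_assoc, pd_X, add_mul, mul_assoc, pd_comm, mul_assoc]
  simp only [R, Finset.mul_sum, h, Finset.sum_add_distrib, Finset.sum_mul]
  simp

lemma R_X (i : Fin 3) : R * X i = X i * R + X i := by
  have h : ∀ j, X j * pd j * X i = X i * (X j * pd j) + X j * (if j = i then 1 else 0) := by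
    intro j
    rw [mul_assoc, pd_X, mul_add, ← mul_assoc, X_comm, mul_assoc]
  simp only [R, Finset.sum_mul, h, Finset.sum_add_distrib, Finset.mul_sum]
  simp

lemma R_G (i : Fin 3) : R * G i = G i * R := by
  simp only [R, Finset.sum_mul, Finset.mul_sum]
  refine Finset.sum_congr rfl fun j _ => ?_
  rw [mul_assoc, pd_G, ← mul_assoc, X_G, mul_assoc]

lemma R_G0 : R * G0 = G0 * R := by
  simp only [R, Finset.sum_mul, Finset.mul_sum]
  refine Finset.sum_congr rfl fun j _ => ?_
  rw [mul_assoc, pd_G0, ← mul_assoc, X_G0, mul_assoc]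

lemma R_rp (ξ : ℂ) : R * rp ξ = rp ξ * R + ξ • rp ξ := by
  have h : ∀ j, X j * pd j * rp ξ = rp ξ * (X j * pd j) + ξ • (rp (ξ - 2) * (X j * X j)) := by
    intro j
    rw [mul_assoc, pd_rp, mul_add, ← mul_assoc, ← rp_X, mul_assoc, mul_smul_comm,
      ← mul_assoc (X j) (rp (ξ - 2)), ← rp_X, mul_assoc (rp (ξ - 2))]
  have h2 : ∑ j, ξ • (rp (ξ - 2) * (X j * X j)) = ξ • rp ξ := by
    rw [← Finset.smul_sum, ← Finset.mul_sum, sum_X_sq, rp_mul, sub_add_cancel]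
  simp only [R, Finset.sum_mul, h, Finset.sum_add_distrib, Finset.mul_sum, h2]

lemma R_GX : R * GX = GX * R + GX := by
  simp only [GX, Finset.sum_mul, Finset.mul_sum]
  rw [← Finset.sum_add_distrib]
  refine Finset.sum_congr rfl fun j _ => ?_
  rw [← mul_assoc, R_G, mul_assoc, R_X]; noncomm_ring

lemma R_GD : R * GD = GD * R - GD := by
  simp only [GD, Finset.sum_mul, Finset.mul_sum]
  rw [← Finset.sum_sub_distrib]
  refine Finset.sum_congr rfl fun j _ => ?_
  rw [← mul_assoc, R_G, mul_assoc, mul_assoc, pd_R]; noncomm_ring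

lemma GD_rp (ξ : ℂ) : GD * rp ξ = rp ξ * GD + ξ • (rp (ξ - 2) * GX) := by
  simp only [GD, GX, Finset.sum_mul, Finset.mul_sum, Finset.smul_sum]
  rw [← Finset.sum_add_distrib]
  refine Finset.sum_congr rfl fun j _ => ?_
  rw [mul_assoc, pd_rp, mul_add, ← mul_assoc, ← rp_G, mul_assoc, mul_smul_comm,
    ← mul_assoc (G j) (rp (ξ - 2)), ← rp_G, mul_assoc (rp (ξ - 2))]

lemma rp_GX (ξ : ℂ) : rp ξ * GX = GX * rp ξ := by
  simp only [GX, Finset.sum_mul, Finset.mul_sum]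
  refine Finset.sum_congr rfl fun j _ => ?_
  rw [← mul_assoc, rp_G, mul_assoc, rp_X, mul_assoc]

lemma G0_GX : G0 * GX = -(GX * G0) := by
  simp only [GX, Finset.sum_mul, Finset.mul_sum, ← Finset.sum_neg_distrib]
  refine Finset.sum_congr rfl fun j _ => ?_
  rw [← mul_assoc, G0_G, mul_assoc, X_G0]; noncomm_ring

lemma G0_GD : G0 * GD = -(GD * G0) := by
  simp only [GD, Finset.sum_mul, Finset.mul_sum, ← Finset.sum_neg_distrib]
  refine Finset.sum_congr rfl fun j _ => ?_
  rw [← mul_assoc, G0_G, mul_assoc, pd_G0]; noncomm_ring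

/-- The summand `1` in `K` is exactly what absorbs the constants coming from `GD_GX` and `R_GX`. -/
lemma K_GX : K * GX = -(GX * K) := by
  have h : K * GX = GX * (GD * GX) + R * GX + GX := by rw [K]; noncomm_ring
  have h3 : (3 : Op) = 1 + 1 + 1 := by norm_num
  rw [h, GD_GX, R_GX, K, h3]; noncomm_ring

lemma R_K : R * K = K * R := by
  have h : R * K = (R * GX) * GD + R * R + R := by rw [K]; noncomm_ring
  have h2 : GX * (R * GD) = GX * (GD * R - GD) := by rw [R_GD]
  have h3 : (GX * R + GX) * GD = GX * (R * GD) + GX * GD := by noncomm_ring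
  rw [h, R_GX, h3, h2, K]; noncomm_ring

/-- `K` contains no radial derivative: the multiple of `ξ` produced by `R` cancels the one produced
by `GX * GD`, because `GX * GX = -rp 2`. -/
lemma K_rp (ξ : ℂ) : K * rp ξ = rp ξ * K := by
  have h : K * rp ξ = GX * (GD * rp ξ) + R * rp ξ + rp ξ := by rw [K]; noncomm_ring
  have h2 : GX * (rp (ξ - 2) * GX) = -rp ξ := by
    rw [rp_GX, ← mul_assoc, GX_sq, neg_mul, rp_mul]; ring_nf
  rw [h, GD_rp, R_rp, mul_add, mul_smul_comm, h2, ← mul_assoc, ← rp_GX, K, smul_neg, mul_add,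
    mul_add, mul_one, mul_assoc]
  abel

lemma K_G0 : K * G0 = G0 * K := by
  have h : G0 * K = (G0 * GX) * GD + G0 * R + G0 := by rw [K]; noncomm_ring
  have h2 : -(GX * G0) * GD = GX * GD * G0 := by
    rw [neg_mul, mul_assoc, G0_GD]; noncomm_ring
  rw [h, G0_GX, h2, K, ← R_G0]; noncomm_ring

/-- Polar decomposition of the Laplacian. -/
lemma rp_two_laplacian : rp 2 * (-∑ j, pd j * pd j) = K * K - K - R * R - R := by
  have hm : GX * GD = K - R - 1 := by rw [K]; abel
  have h1 : (GX * GD) * (GX * GD) = GX * (GD * GX) * GD := by noncomm_ring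
  have h2 : GX * (R * GD) = R * (GX * GD) - GX * GD := by
    rw [← mul_assoc, ← mul_assoc, R_GX]; noncomm_ring
  have h3 : GX * (GD * GX) * GD = -(GX * GD + GX * GD + GX * GD)
      - (GX * (R * GD) + GX * (R * GD)) - GX * GX * (GD * GD) := by
    have e : (3 : Op) = 1 + 1 + 1 := by norm_num
    rw [GD_GX, e]; noncomm_ring
  rw [← GD_sq]
  have h4 : rp 2 * (GD * GD) = -(GX * GX * (GD * GD)) := by rw [GX_sq, neg_mul, neg_neg]
  -- Expanding `(GX * GD)²` with `GD_GX` isolates `rp 2 * (GD * GD)`; everything else is a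
  -- polynomial in `R` and `GX * GD = K - R - 1`.
  have h5 : rp 2 * (GD * GD) = (GX * GD) * (GX * GD) + (GX * GD + GX * GD + GX * GD)
      + (GX * (R * GD) + GX * (R * GD)) := by
    rw [h4, h1, h3]; abel
  rw [h5, h2, hm]
  simp only [sub_mul, mul_sub, R_K]
  noncomm_ring

lemma R_Al : R * Al = Al * R := by
  have h : R * Al = (R * rp (-1)) * (G0 * GX) := by rw [Al]; noncomm_ring
  have h2 : rp (-1) * R * (G0 * GX) = rp (-1) * ((R * G0) * GX) := by noncomm_ring
  rw [h, R_rp, add_mul, h2, R_G0, mul_assoc G0, R_GX, Al, neg_smul, one_smul]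
  noncomm_ring

lemma rp_Al (ξ : ℂ) : rp ξ * Al = Al * rp ξ := by
  have h : Al * rp ξ = rp (-1) * (G0 * (GX * rp ξ)) := by rw [Al]; noncomm_ring
  rw [h, ← rp_GX, ← mul_assoc G0, ← rp_G0, Al, ← mul_assoc, ← mul_assoc, ← mul_assoc, ← mul_assoc,
    rp_mul, rp_mul, add_comm]

/-- Of the three factors of `Al`, the power of `r` and `γ⁰` commute with `K`, and `GX` anticommutes.
This sign removes the cross terms in `T_sq`. -/
lemma K_Al : K * Al = -(Al * K) := by
  have h : K * Al = (K * rp (-1)) * (G0 * GX) := by rw [Al]; noncomm_ring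
  have h2 : rp (-1) * K * (G0 * GX) = rp (-1) * ((K * G0) * GX) := by noncomm_ring
  rw [h, K_rp, h2, K_G0, mul_assoc G0, K_GX, Al, mul_neg, mul_neg, mul_assoc, mul_assoc]

lemma Al_sq : Al * Al = 1 := by
  have h : Al * Al = rp (-1) * G0 * (GX * rp (-1)) * (G0 * GX) := by rw [Al]; noncomm_ring
  have h2 : rp (-1) * G0 * (rp (-1) * GX) * (G0 * GX) = rp (-1) * (G0 * rp (-1)) * (GX * G0) * GX := by
    noncomm_ring
  have h3 : GX * G0 = -(G0 * GX) := by rw [G0_GX, neg_neg]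
  have h4 : rp (-1) * (rp (-1) * G0) * (-(G0 * GX)) * GX
    = -(rp (-1) * rp (-1) * (G0 * G0) * (GX * GX)) := by
    simp only [mul_neg, neg_mul, mul_assoc]
  rw [h, ← rp_GX, h2, h3, ← rp_G0, h4, G0_sq, GX_sq, rp_mul, mul_one, mul_neg, neg_neg, rp_mul]
  norm_num [rp_zero]

/-- The Dirac–Coulomb angular operator `K - i z α_ω`. -/
def T (z : ℝ) : Op := K - (Complex.I * z) • Al

/-- By anticommutation and `Al * Al = 1`, the Coulomb term only shifts the square of `K`. An
eigenvalue `κ` of `K` thus corresponds to the square roots of `κ² - z²` for `T z`. -/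
lemma T_sq (z : ℝ) : T z * T z = K * K - ((z : ℂ) ^ 2) • 1 := by
  have h : T z * T z = K * K - (Complex.I * z) • (K * Al + Al * K)
      + ((Complex.I * z) * (Complex.I * z)) • (Al * Al) := by
    simp only [T, sub_mul, mul_sub, smul_mul_assoc, mul_smul_comm, smul_add, smul_smul, smul_sub]
    abel
  have h2 : (Complex.I * (z : ℂ)) * (Complex.I * z) = -(z : ℂ) ^ 2 := by
    linear_combination (z : ℂ) ^ 2 * Complex.I_mul_I
  rw [h, K_Al, Al_sq, h2, neg_add_cancel, smul_zero, neg_smul]; abel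

lemma R_T (z : ℝ) : R * T z = T z * R := by
  rw [T, mul_sub, sub_mul, R_K, mul_smul_comm, R_Al, smul_mul_assoc]

lemma T_rp (z : ℝ) (ξ : ℂ) : T z * rp ξ = rp ξ * T z := by
  rw [T, mul_sub, sub_mul, K_rp, mul_smul_comm, rp_Al, smul_mul_assoc]

/-- `K` in terms of rotation fields. -/
lemma K_eq_rot : K = 1 + (G 0 * G 1 * rotE 0 1 + G 0 * G 2 * rotE 0 2 + G 1 * G 2 * rotE 1 2) := by
  have h : GX * GD = ∑ i, ∑ j, G i * G j * (X i * pd j) := by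
    simp only [GD, GX, Finset.sum_mul, Finset.mul_sum]
    rw [Finset.sum_comm]
    refine Finset.sum_congr rfl fun i _ => Finset.sum_congr rfl fun j _ => ?_
    rw [mul_assoc, ← mul_assoc (X i), X_G]; noncomm_ring
  have h1 : ∀ i j : Fin 3, i ≠ j → G j * G i = -(G i * G j) := fun i j hij => by
    have := G_anticomm j i
    rw [if_neg hij.symm] at this
    exact eq_neg_of_add_eq_zero_left this
  -- The diagonal terms of `GX * GD` add up to `-R` and cancel the radial field in `K`.
  rw [K, h, R]
  simp only [Fin.sum_univ_three, G_sq, h1 0 1 (by decide), h1 0 2 (by decide), h1 1 2 (by decide), rotE]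
  simp only [mul_sub, neg_mul, one_mul]
  abel

end EdgeWave

end

noncomputable section

namespace EdgeWave
open MeasureTheory

/-! ### Integrals depending on parameters -/

section Param

variable {X Y : Type} [NormedAddCommGroup X] [NormedSpace ℝ X] [ProperSpace X]
  [NormedAddCommGroup Y] [NormedSpace ℝ Y] [MeasurableSpace Y] [BorelSpace Y]
  [SecondCountableTopology Y]

/-- The tube lemma provides a ball around `x₀` over which `g` is still defined on all of `k`, and
compactness bounds its derivative there, so dominated differentiation applies. The weight `f` need
only be integrable: later it is a power of the variable that may be singular at `0`. -/
lemma hasFDerivAt_integral_compact {F : Type} [NormedAddCommGroup F] [NormedSpace ℝ F]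
    [NormedSpace ℂ F] [IsScalarTower ℝ ℂ F] [CompleteSpace F] {μ : Measure Y}
    {g : X × Y → F} {Ω : Set (X × Y)}
    (hΩ : IsOpen Ω) (hg : ContDiffOn ℝ 1 g Ω) {k : Set Y} (hk : IsCompact k) {f : Y → ℂ}
    (hf : IntegrableOn f k μ) {x₀ : X} (hx₀ : {x₀} ×ˢ k ⊆ Ω) :
    HasFDerivAt (fun x => ∫ y in k, f y • g (x, y) ∂μ)
      (∫ y in k, f y • (fderiv ℝ g (x₀, y)).comp (ContinuousLinearMap.inl ℝ X Y) ∂μ) x₀ := by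
  obtain ⟨U, V, hU, -, hxU, hkV, hUV⟩ := generalized_tube_lemma isCompact_singleton hk hΩ hx₀
  obtain ⟨ε, hε, hεU⟩ := Metric.nhds_basis_closedBall.mem_iff.1
    (hU.mem_nhds (hxU (Set.mem_singleton x₀)))
  have hsub : ∀ x ∈ Metric.closedBall x₀ ε, ∀ y ∈ k, (x, y) ∈ Ω :=
    fun x hx y hy => hUV ⟨hεU hx, hkV hy⟩
  have hcf : ContinuousOn (fun p => (fderiv ℝ g p).comp (ContinuousLinearMap.inl ℝ X Y)) Ω :=
    (hg.continuousOn_fderiv_of_isOpen hΩ le_rfl).clm_comp continuousOn_const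
  obtain ⟨C, hC⟩ := ((isCompact_closedBall x₀ ε).prod hk).exists_bound_of_continuousOn
    (hcf.mono fun p hp => hsub p.1 hp.1 p.2 hp.2)
  have hslice : ∀ {F' : Type} [NormedAddCommGroup F'] {h : X × Y → F'}, ContinuousOn h Ω →
      ∀ x ∈ Metric.closedBall x₀ ε, ContinuousOn (fun y => h (x, y)) k := by
    intro F' _ h hh x hx
    exact hh.comp (by fun_prop) fun y hy => hsub x hx y hy
  have hx₀m : x₀ ∈ Metric.closedBall x₀ ε := Metric.mem_closedBall_self hε.le
  refine hasFDerivAt_integral_of_dominated_of_fderiv_le (𝕜 := ℝ)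
    (s := Metric.closedBall x₀ ε) (bound := fun y => ‖f y‖ * C)
    (F' := fun x y => f y • (fderiv ℝ g (x, y)).comp (ContinuousLinearMap.inl ℝ X Y))
    (Metric.closedBall_mem_nhds x₀ hε) ?_ ?_ ?_ ?_ ?_ ?_
  · filter_upwards [Metric.closedBall_mem_nhds x₀ hε] with x hx
    exact hf.aestronglyMeasurable.smul
      ((hslice hg.continuousOn x hx).aestronglyMeasurable hk.measurableSet)
  · obtain ⟨C', hC'⟩ := hk.exists_bound_of_continuousOn (hslice hg.continuousOn x₀ hx₀m)
    refine (hf.norm.mul_const C').mono' (hf.aestronglyMeasurable.smul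
      ((hslice hg.continuousOn x₀ hx₀m).aestronglyMeasurable hk.measurableSet)) ?_
    refine (ae_restrict_iff' hk.measurableSet).2 (ae_of_all _ fun y hy => ?_)
    rw [norm_smul]
    exact mul_le_mul_of_nonneg_left (hC' y hy) (norm_nonneg _)
  · exact hf.aestronglyMeasurable.smul
      ((hslice hcf x₀ hx₀m).aestronglyMeasurable hk.measurableSet)
  · refine (ae_restrict_iff' hk.measurableSet).2 (ae_of_all _ fun y hy x hx => ?_)
    rw [norm_smul]
    exact mul_le_mul_of_nonneg_left (hC (x, y) ⟨hx, hy⟩) (norm_nonneg _)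
  · exact hf.norm.mul_const C
  · refine (ae_restrict_iff' hk.measurableSet).2 (ae_of_all _ fun y hy x hx => ?_)
    have h1 : DifferentiableAt ℝ g (x, y) :=
      (hg.contDiffAt (hΩ.mem_nhds (hsub x hx y hy))).differentiableAt one_ne_zero
    have h2 : HasFDerivAt (fun x' : X => (x', y)) (ContinuousLinearMap.inl ℝ X Y) x :=
      hasFDerivAt_prodMk_left x y
    exact (h1.hasFDerivAt.comp x h2).const_smul (f y)

/-- The derivative is an integral of the same shape with values in a space of linear maps. The
induction therefore has to range over all target spaces at once. -/
lemma contDiffOn_integral_compact_nat {μ : Measure Y} {Ω : Set (X × Y)}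
    (hΩ : IsOpen Ω) {k : Set Y} (hk : IsCompact k) {f : Y → ℂ}
    (hf : IntegrableOn f k μ) {A : Set X} (hA : IsOpen A) (hAΩ : A ×ˢ k ⊆ Ω) (n : ℕ) :
    ∀ {F : Type} [NormedAddCommGroup F] [NormedSpace ℝ F]
    [NormedSpace ℂ F] [IsScalarTower ℝ ℂ F] [CompleteSpace F] {g : X × Y → F},
    ContDiffOn ℝ ∞ g Ω → ContDiffOn ℝ n (fun x => ∫ y in k, f y • g (x, y) ∂μ) A := by
  induction n with
  | zero =>
    intro F _ _ _ _ _ g hg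
    refine contDiffOn_zero.2 fun x hx => ContinuousAt.continuousWithinAt ?_
    exact (hasFDerivAt_integral_compact hΩ (hg.of_le (by simp)) hk hf
      ((Set.prod_mono (Set.singleton_subset_iff.2 hx) le_rfl).trans hAΩ)).continuousAt
  | succ n ih =>
    intro F _ _ _ _ _ g hg
    have hd : ∀ x ∈ A, HasFDerivAt (fun x => ∫ y in k, f y • g (x, y) ∂μ)
        (∫ y in k, f y • (fderiv ℝ g (x, y)).comp (ContinuousLinearMap.inl ℝ X Y) ∂μ) x :=
      fun x hx => hasFDerivAt_integral_compact hΩ (hg.of_le (by simp)) hk hf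
        ((Set.prod_mono (Set.singleton_subset_iff.2 hx) le_rfl).trans hAΩ)
    have hg' : ContDiffOn ℝ ∞ (fun p => (fderiv ℝ g p).comp (ContinuousLinearMap.inl ℝ X Y)) Ω :=
      (hg.fderiv_of_isOpen hΩ (m := ∞) (by simp)).clm_comp contDiffOn_const
    rw [show ((n + 1 : ℕ) : WithTop ℕ∞) = (n : WithTop ℕ∞) + 1 by norm_cast,
      contDiffOn_succ_iff_fderiv_of_isOpen hA]
    refine ⟨fun x hx => (hd x hx).differentiableAt.differentiableWithinAt, by simp, ?_⟩
    exact (ih hg').congr fun x hx => (hd x hx).fderiv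

lemma contDiffOn_integral_compact {F : Type} [NormedAddCommGroup F] [NormedSpace ℝ F]
    [NormedSpace ℂ F] [IsScalarTower ℝ ℂ F] [CompleteSpace F] {μ : Measure Y} {Ω : Set (X × Y)}
    (hΩ : IsOpen Ω) {k : Set Y} (hk : IsCompact k) {f : Y → ℂ}
    (hf : IntegrableOn f k μ) {A : Set X} (hA : IsOpen A) (hAΩ : A ×ˢ k ⊆ Ω) {g : X × Y → F}
    (hg : ContDiffOn ℝ ∞ g Ω) : ContDiffOn ℝ ∞ (fun x => ∫ y in k, f y • g (x, y) ∂μ) A :=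
  contDiffOn_infty.2 fun n => contDiffOn_integral_compact_nat hΩ hk hf hA hAΩ n hg

lemma fderiv_integral_compact {F : Type} [NormedAddCommGroup F] [NormedSpace ℝ F]
    [NormedSpace ℂ F] [IsScalarTower ℝ ℂ F] [CompleteSpace F] {μ : Measure Y}
    {g : X × Y → F} {Ω : Set (X × Y)}
    (hΩ : IsOpen Ω) (hg : ContDiffOn ℝ 1 g Ω) {k : Set Y} (hk : IsCompact k) {f : Y → ℂ}
    (hf : IntegrableOn f k μ) {x₀ : X} (hx₀ : {x₀} ×ˢ k ⊆ Ω) (v : X) :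
    fderiv ℝ (fun x => ∫ y in k, f y • g (x, y) ∂μ) x₀ v =
      ∫ y in k, f y • fderiv ℝ (fun x => g (x, y)) x₀ v ∂μ := by
  have hcf : ContinuousOn (fun y => (fderiv ℝ g (x₀, y)).comp (ContinuousLinearMap.inl ℝ X Y)) k :=
    ((hg.continuousOn_fderiv_of_isOpen hΩ le_rfl).clm_comp continuousOn_const).comp
      (f := fun y => (x₀, y)) (by fun_prop) fun y hy => hx₀ ⟨rfl, hy⟩
  obtain ⟨C', hC'⟩ := hk.exists_bound_of_continuousOn hcf
  have hint : IntegrableOn (fun y => f y • (fderiv ℝ g (x₀, y)).comp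
      (ContinuousLinearMap.inl ℝ X Y)) k μ := by
    refine (hf.norm.mul_const C').mono' (hf.aestronglyMeasurable.smul
      (hcf.aestronglyMeasurable hk.measurableSet)) ?_
    refine (ae_restrict_iff' hk.measurableSet).2 (ae_of_all _ fun y hy => ?_)
    rw [norm_smul]
    exact mul_le_mul_of_nonneg_left (hC' y hy) (norm_nonneg _)
  rw [(hasFDerivAt_integral_compact hΩ hg hk hf hx₀).fderiv, ContinuousLinearMap.integral_apply hint]
  refine setIntegral_congr_fun hk.measurableSet fun y hy => ?_
  have h1 : DifferentiableAt ℝ g (x₀, y) :=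
    (hg.contDiffAt (hΩ.mem_nhds (hx₀ ⟨Set.mem_singleton _, hy⟩))).differentiableAt one_ne_zero
  have h2 : HasFDerivAt (fun x' : X => (x', y)) (ContinuousLinearMap.inl ℝ X Y) x₀ :=
    hasFDerivAt_prodMk_left x₀ y
  have h3 : fderiv ℝ (fun x => g (x, y)) x₀ = _ := (h1.hasFDerivAt.comp x₀ h2).fderiv
  rw [h3]; rfl

end Param

end EdgeWave

end

noncomputable section

namespace EdgeWave
open MeasureTheory

/-! ### The fundamental solution of the Dirac operator -/

/-- The kernel `y_j (|y|² + ε²)^{-3/2}`, a regularization of `y_j |y|⁻³`. -/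
def ker (ε : ℝ) (j : Fin 3) (y : Space 3) : ℝ := y j * (‖y‖ ^ 2 + ε ^ 2) ^ (-(3 / 2) : ℝ)

/-- The derivative `∂_i` of the regularized kernel. -/
def dker (ε : ℝ) (i j : Fin 3) (y : Space 3) : ℝ :=
  (if i = j then 1 else 0) * (‖y‖ ^ 2 + ε ^ 2) ^ (-(3 / 2) : ℝ)
    - 3 * y i * y j * (‖y‖ ^ 2 + ε ^ 2) ^ (-(5 / 2) : ℝ)

lemma dker_symm (ε : ℝ) (i j : Fin 3) (y : Space 3) : dker ε i j y = dker ε j i y := by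
  simp only [dker, eq_comm (a := i)]; ring

/-- With the power `-3/2` written as `|y|² + ε²` times the power `-5/2`, the terms in `|y|²` cancel
because the dimension is three. What remains is an approximate identity as `ε → 0`. -/
lemma sum_dker {ε : ℝ} (hε : 0 < ε) (y : Space 3) :
    ∑ j, dker ε j j y = 3 * ε ^ 2 * (‖y‖ ^ 2 + ε ^ 2) ^ (-(5 / 2) : ℝ) := by
  have hq : 0 < ‖y‖ ^ 2 + ε ^ 2 := by positivity
  have h1 : (‖y‖ ^ 2 + ε ^ 2) ^ (-(3 / 2) : ℝ)
      = (‖y‖ ^ 2 + ε ^ 2) * (‖y‖ ^ 2 + ε ^ 2) ^ (-(5 / 2) : ℝ) := by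
    conv_rhs => rw [← Real.rpow_one_add' hq.le (by norm_num)]
    norm_num
  have h2 : ‖y‖ ^ 2 = ∑ j, y j ^ 2 := EuclideanSpace.real_norm_sq_eq y
  simp only [dker, if_true, one_mul, Fin.sum_univ_three]
  rw [h1]
  have h3 : ‖y‖ ^ 2 = y 0 ^ 2 + y 1 ^ 2 + y 2 ^ 2 := by rw [h2, Fin.sum_univ_three]
  generalize (‖y‖ ^ 2 + ε ^ 2) ^ (-(5 / 2) : ℝ) = w
  rw [h3]; ring

lemma contDiffAt_ker {ε : ℝ} (j : Fin 3) {y : Space 3} (h : 0 < ‖y‖ ^ 2 + ε ^ 2) :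
    ContDiffAt ℝ ∞ (ker ε j) y := by
  unfold ker
  refine ContDiffAt.mul (EuclideanSpace.proj (𝕜 := ℝ) j).contDiff.contDiffAt ?_
  exact ((contDiff_norm_sq ℝ).contDiffAt.add contDiffAt_const).rpow_const_of_ne h.ne'

lemma fderiv_ker {ε : ℝ} (hε : 0 < ε) (i j : Fin 3) (y : Space 3) :
    fderiv ℝ (ker ε j) y (ee i) = dker ε i j y := by
  have hq : 0 < ‖y‖ ^ 2 + ε ^ 2 := by positivity
  have h1 : HasFDerivAt (fun y : Space 3 => y j) (EuclideanSpace.proj (𝕜 := ℝ) j) y :=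
    (EuclideanSpace.proj (𝕜 := ℝ) j).hasFDerivAt
  have h2 : HasFDerivAt (fun y : Space 3 => ‖y‖ ^ 2 + ε ^ 2) (2 • innerSL ℝ y) y :=
    (hasStrictFDerivAt_norm_sq y).hasFDerivAt.add_const _
  have h3 := h1.mul (h2.rpow_const (p := (-(3 / 2) : ℝ)) (Or.inl hq.ne'))
  have h4 : fderiv ℝ (ker ε j) y = _ := h3.fderiv
  have h5 : inner ℝ y (ee i) = y i := by
    rw [real_inner_comm]; simpa using EuclideanSpace.inner_single_left (𝕜 := ℝ) i 1 y
  rw [h4, dker]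
  simp only [add_apply, smul_apply, innerSL_apply_apply, h5]
  have h6 : (-(3 / 2) : ℝ) - 1 = -(5 / 2) := by norm_num
  rw [h6]
  simp [ee]
  by_cases hij : i = j
  · subst hij; simp; ring
  · simp [hij, Ne.symm hij]; ring

/-- The majorant does not depend on `ε` and is locally integrable in dimension three, which
justifies letting `ε → 0` under the integral. -/
lemma abs_ker_le (ε : ℝ) (j : Fin 3) (y : Space 3) : |ker ε j y| ≤ (‖y‖ ^ 2)⁻¹ := by
  by_cases hy : y = 0
  · simp [ker, hy]
  have hn : 0 < ‖y‖ := norm_pos_iff.2 hy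
  rw [ker, abs_mul, abs_of_nonneg (Real.rpow_nonneg (by positivity) _)]
  have h1 : |y j| ≤ ‖y‖ := by simpa using PiLp.norm_apply_le y j
  have h2 : (‖y‖ ^ 2 + ε ^ 2) ^ (-(3 / 2) : ℝ) ≤ (‖y‖ ^ 2) ^ (-(3 / 2) : ℝ) :=
    Real.rpow_le_rpow_of_nonpos (by positivity) (by nlinarith [sq_nonneg ε]) (by norm_num)
  have h3 : (‖y‖ ^ 2) ^ (-(3 / 2) : ℝ) = (‖y‖ ^ 3)⁻¹ := by
    rw [← Real.rpow_natCast, ← Real.rpow_mul hn.le, ← Real.rpow_natCast, ← Real.rpow_neg hn.le]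
    norm_num
  calc |y j| * (‖y‖ ^ 2 + ε ^ 2) ^ (-(3 / 2) : ℝ) ≤ ‖y‖ * (‖y‖ ^ 3)⁻¹ := by
        rw [← h3]; gcongr
    _ = (‖y‖ ^ 2)⁻¹ := by field_simp

lemma measurable_ker (ε : ℝ) (j : Fin 3) : Measurable (ker ε j) := by
  unfold ker
  exact (EuclideanSpace.proj (𝕜 := ℝ) j).continuous.measurable.mul
    (((continuous_norm.pow 2).add continuous_const).measurable.pow_const _)

/-- In polar coordinates the Jacobian `t²` cancels the singularity. -/
lemma integrableOn_inv_norm_sq (r : ℝ) :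
    IntegrableOn (fun y : Space 3 => (‖y‖ ^ 2)⁻¹) (Metric.ball 0 r) := by
  have h := (integrableOn_fun_norm_addHaar (volume : Measure (Space 3))
    (f := fun t : ℝ => (t ^ 2)⁻¹) (r := r)).2
  refine h ?_
  have h2 : IntegrableOn (fun _ : ℝ => (1 : ℝ)) (Set.Ioo 0 r) :=
    integrableOn_const (by simp)
  refine h2.congr_fun (fun t ht => ?_) measurableSet_Ioo
  have : t ≠ 0 := ht.1.ne'
  simp [this]

lemma locallyIntegrable_inv_norm_sq : LocallyIntegrable (fun y : Space 3 => (‖y‖ ^ 2)⁻¹) := by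
  rw [locallyIntegrable_iff]
  intro k hk
  obtain ⟨r, hr⟩ := hk.isBounded.subset_ball 0
  exact (integrableOn_inv_norm_sq r).mono_set hr

lemma locallyIntegrable_ker (ε : ℝ) (j : Fin 3) : LocallyIntegrable (ker ε j) :=
  locallyIntegrable_inv_norm_sq.mono (measurable_ker ε j).aestronglyMeasurable
    (ae_of_all _ fun y => by
      rw [Real.norm_eq_abs, Real.norm_eq_abs, abs_of_nonneg (by positivity : (0:ℝ) ≤ (‖y‖ ^ 2)⁻¹)]
      exact abs_ker_le ε j y)

section Kernel

variable {F : Type} [NormedAddCommGroup F] [NormedSpace ℝ F]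

lemma hasCompactSupport_sub_left {F : Type} [NormedAddCommGroup F] {φ : Space 3 → F} (hc : HasCompactSupport φ) (x : Space 3) :
    HasCompactSupport (fun y => φ (x - y)) :=
  hc.comp_homeomorph (Homeomorph.subLeft x)

lemma integrable_inv_norm_sq_smul {φ : Space 3 → F} (hφ : Continuous φ) (hc : HasCompactSupport φ) :
    Integrable (fun y => (‖y‖ ^ 2)⁻¹ • φ y) :=
  locallyIntegrable_inv_norm_sq.integrable_smul_right_of_hasCompactSupport hφ hc

lemma integrable_ker_smul {φ : Space 3 → F} (hφ : Continuous φ) (hc : HasCompactSupport φ)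
    (ε : ℝ) (j : Fin 3) (x : Space 3) : Integrable (fun y => ker ε j y • φ (x - y)) :=
  (locallyIntegrable_ker ε j).integrable_smul_right_of_hasCompactSupport (by fun_prop)
    (hasCompactSupport_sub_left hc x)

lemma fderiv_sub_left {φ : Space 3 → F} (hφ : ContDiff ℝ ∞ φ) (x y v : Space 3) :
    fderiv ℝ (fun y => φ (x - y)) y v = -fderiv ℝ φ (x - y) v := by
  have h1 : HasFDerivAt (fun y => x - y) (-ContinuousLinearMap.id ℝ (Space 3)) y :=
    (hasFDerivAt_id y).const_sub x
  have h2 := ((hφ.differentiable (by simp) (x - y)).hasFDerivAt.comp y h1).fderiv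
  have h3 : (fun y => φ (x - y)) = φ ∘ fun y => x - y := rfl
  rw [h3, h2]; simp

lemma hasCompactSupport_fderiv_apply {φ : Space 3 → F} (hc : HasCompactSupport φ) (v : Space 3) :
    HasCompactSupport (fun y => fderiv ℝ φ y v) := by
  refine (hc.fderiv ℝ).mono fun y hy => ?_
  rw [Function.mem_support] at hy ⊢
  intro h; rw [h] at hy; exact hy rfl

lemma continuous_fderiv_apply {φ : Space 3 → F} (hφ : ContDiff ℝ ∞ φ) (v : Space 3) :
    Continuous (fun y => fderiv ℝ φ y v) :=
  (hφ.continuous_fderiv (by simp)).clm_apply continuous_const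

/-- Integration by parts, which needs `ε > 0` so that the kernel is smooth at the origin. The
reflection in `φ (x - y)` supplies the second sign. -/
lemma integral_ker_fderiv {φ : Space 3 → F} (hφ : ContDiff ℝ ∞ φ)
    (hc : HasCompactSupport φ) {ε : ℝ} (hε : 0 < ε) (i j : Fin 3) (x : Space 3) :
    ∫ y, ker ε j y • fderiv ℝ φ (x - y) (ee i) = ∫ y, dker ε i j y • φ (x - y) := by
  have hs : ContDiff ℝ ∞ (fun y => φ (x - y)) := hφ.comp (contDiff_const.sub contDiff_id)
  have hk : ContDiff ℝ ∞ (ker ε j) :=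
    contDiff_iff_contDiffAt.2 fun y => contDiffAt_ker j (by positivity)
  have hcs := hasCompactSupport_sub_left hc x
  have h := integral_smul_fderiv_eq_neg_fderiv_smul_of_integrable (μ := volume)
    (f := ker ε j) (g := fun y => φ (x - y)) (v := ee i) (𝕜 := ℝ)
    ?_ ?_ ?_ (fun y _ => hk.differentiable (by simp) y) (fun y _ => hs.differentiable (by simp) y)
  · simp only [fderiv_sub_left hφ, smul_neg, integral_neg, neg_inj, fderiv_ker hε] at h
    exact h
  · exact ((continuous_fderiv_apply hk _).smul hs.continuous).integrable_of_hasCompactSupport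
      hcs.smul_left
  · exact (hk.continuous.smul (continuous_fderiv_apply hs _)).integrable_of_hasCompactSupport
      (hasCompactSupport_fderiv_apply hcs _).smul_left
  · exact (hk.continuous.smul hs.continuous).integrable_of_hasCompactSupport hcs.smul_left

lemma tendsto_integral_ker {φ : Space 3 → F} (hφ : Continuous φ)
    (hc : HasCompactSupport φ) (j : Fin 3) (x : Space 3) :
    Filter.Tendsto (fun ε => ∫ y, ker ε j y • φ (x - y)) (nhdsWithin 0 (Set.Ioi 0))
      (nhds (∫ y, ker 0 j y • φ (x - y))) := by
  refine tendsto_integral_filter_of_dominated_convergence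
    (fun y => ‖(‖y‖ ^ 2)⁻¹ • φ (x - y)‖) ?_ ?_ ?_ ?_
  · exact Filter.Eventually.of_forall fun ε => (integrable_ker_smul hφ hc ε j x).aestronglyMeasurable
  · refine Filter.Eventually.of_forall fun ε => ae_of_all _ fun y => ?_
    rw [norm_smul, norm_smul]
    gcongr
    rw [Real.norm_eq_abs, Real.norm_eq_abs, abs_of_nonneg (by positivity : (0:ℝ) ≤ (‖y‖ ^ 2)⁻¹)]
    exact abs_ker_le ε j y
  · exact (integrable_inv_norm_sq_smul (by fun_prop : Continuous fun y => φ (x - y))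
      (hasCompactSupport_sub_left hc x)).norm
  · filter_upwards [compl_mem_ae_iff.2 (measure_singleton (0 : Space 3))] with y hy
    refine Filter.Tendsto.smul_const ?_ _
    have hn : 0 < ‖y‖ := norm_pos_iff.2 hy
    have : ContinuousAt (fun ε : ℝ => ker ε j y) 0 := by
      unfold ker
      exact continuousAt_const.mul (ContinuousAt.rpow_const (by fun_prop) (Or.inl (by positivity)))
    exact this.tendsto.mono_left nhdsWithin_le_nhds

/-- The total mass of the approximate identity `3 ε² (|y|² + ε²)^{-5/2}`. -/
def massConst : ℝ := ∫ y : Space 3, 3 * (1 + ‖y‖ ^ 2) ^ (-(5 / 2) : ℝ)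

lemma integrable_massKernel :
    Integrable (fun y : Space 3 => 3 * (1 + ‖y‖ ^ 2) ^ (-(5 / 2) : ℝ)) := by
  have h := integrable_rpow_neg_one_add_norm_sq (E := Space 3) (μ := volume) (r := 5) (by norm_num)
  have h2 : (-5 / 2 : ℝ) = -(5 / 2) := by norm_num
  rw [h2] at h
  exact h.const_mul 3

lemma massConst_pos : 0 < massConst := by
  rw [massConst, integral_pos_iff_support_of_nonneg (fun y => by positivity) integrable_massKernel]
  have : Function.support (fun y : Space 3 => 3 * (1 + ‖y‖ ^ 2) ^ (-(5 / 2) : ℝ)) = Set.univ := by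
    refine Set.eq_univ_of_forall fun y => ?_
    have : 0 < 3 * (1 + ‖y‖ ^ 2) ^ (-(5 / 2) : ℝ) := by positivity
    exact this.ne'
  rw [this]; simp

/-- The regularized kernel is a gradient, so its Jacobian is symmetric. Integration by parts for `ε
> 0` and the limit `ε → 0` transfer this to the singular kernel. -/
lemma ker_curl_free {φ : Space 3 → F} (hφ : ContDiff ℝ ∞ φ) (hc : HasCompactSupport φ)
    (i j : Fin 3) (x : Space 3) :
    ∫ y, ker 0 j y • fderiv ℝ φ (x - y) (ee i) = ∫ y, ker 0 i y • fderiv ℝ φ (x - y) (ee j) := by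
  have h1 := tendsto_integral_ker (continuous_fderiv_apply hφ (ee i))
    (hasCompactSupport_fderiv_apply hc (ee i)) j x
  have h2 := tendsto_integral_ker (continuous_fderiv_apply hφ (ee j))
    (hasCompactSupport_fderiv_apply hc (ee j)) i x
  refine tendsto_nhds_unique h1 (h2.congr' ?_)
  filter_upwards [self_mem_nhdsWithin] with ε hε
  rw [integral_ker_fderiv hφ hc hε, integral_ker_fderiv hφ hc hε]
  simp only [dker_symm ε i j]

variable [CompleteSpace F]

/-- The substitution `y ↦ ε y` moves all dependence on `ε` into the argument of `φ`, and dominated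
convergence applies with the integrable profile times a bound for `φ`. -/
lemma tendsto_approx_identity {φ : Space 3 → F} (hφ : Continuous φ)
    (hc : HasCompactSupport φ) (x : Space 3) :
    Filter.Tendsto (fun ε : ℝ => ∫ y : Space 3,
        (3 * ε ^ 2 * (‖y‖ ^ 2 + ε ^ 2) ^ (-(5 / 2) : ℝ)) • φ (x - y)) (nhdsWithin 0 (Set.Ioi 0))
      (nhds (massConst • φ x)) := by
  have h1 : ∀ ε : ℝ, 0 < ε → ∫ y : Space 3, (3 * (1 + ‖y‖ ^ 2) ^ (-(5 / 2) : ℝ)) • φ (x - ε • y)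
      = ∫ y : Space 3, (3 * ε ^ 2 * (‖y‖ ^ 2 + ε ^ 2) ^ (-(5 / 2) : ℝ)) • φ (x - y) := by
    intro ε hε
    have h := Measure.integral_comp_smul (volume : Measure (Space 3))
      (fun y => (3 * ε ^ 2 * (‖y‖ ^ 2 + ε ^ 2) ^ (-(5 / 2) : ℝ)) • φ (x - y)) ε
    have h5 : |(ε ^ Module.finrank ℝ (Space 3))⁻¹| = (ε ^ 3)⁻¹ := by
      rw [finrank_euclideanSpace_fin, abs_of_pos (by positivity)]
    rw [h5] at h
    have h6 := congrArg (fun w => ε ^ 3 • w) h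
    simp only [smul_inv_smul₀ (by positivity : ε ^ 3 ≠ 0)] at h6
    rw [← h6, ← integral_smul]
    refine integral_congr_ae (ae_of_all _ fun y => ?_)
    simp only
    rw [smul_smul]
    congr 1
    have h2 : ‖ε • y‖ ^ 2 + ε ^ 2 = ε ^ 2 * (1 + ‖y‖ ^ 2) := by
      rw [norm_smul, Real.norm_eq_abs, mul_pow, sq_abs]; ring
    have h4 : (ε ^ 2) ^ (-(5 / 2) : ℝ) = (ε ^ 5)⁻¹ := by
      rw [← Real.rpow_natCast, ← Real.rpow_mul hε.le, ← Real.rpow_natCast, ← Real.rpow_neg hε.le]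
      norm_num
    rw [h2, Real.mul_rpow (by positivity) (by positivity), h4]
    have h3 : ε ^ 3 * ε ^ 2 * (ε ^ 5)⁻¹ = 1 := by field_simp
    linear_combination (-(3 * (1 + ‖y‖ ^ 2) ^ (-(5 / 2) : ℝ))) * h3
  have h2 : Filter.Tendsto (fun ε : ℝ => ∫ y : Space 3,
      (3 * (1 + ‖y‖ ^ 2) ^ (-(5 / 2) : ℝ)) • φ (x - ε • y)) (nhdsWithin 0 (Set.Ioi 0))
      (nhds (∫ y : Space 3, (3 * (1 + ‖y‖ ^ 2) ^ (-(5 / 2) : ℝ)) • φ x)) := by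
    obtain ⟨C, hC⟩ := hφ.bounded_above_of_compact_support hc
    refine tendsto_integral_filter_of_dominated_convergence
      (fun y => (3 * (1 + ‖y‖ ^ 2) ^ (-(5 / 2) : ℝ)) * C) ?_ ?_ ?_ ?_
    · refine Filter.Eventually.of_forall fun ε => ?_
      exact integrable_massKernel.aestronglyMeasurable.smul
        (by fun_prop : Continuous fun y => φ (x - ε • y)).aestronglyMeasurable
    · refine Filter.Eventually.of_forall fun ε => ae_of_all _ fun y => ?_
      rw [norm_smul, Real.norm_of_nonneg (by positivity)]
      gcongr
      exact hC _
    · exact integrable_massKernel.mul_const C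
    · refine ae_of_all _ fun y => Filter.Tendsto.const_smul ?_ _
      have : Continuous fun ε : ℝ => φ (x - ε • y) := by fun_prop
      have h := this.tendsto 0
      simp only [zero_smul, sub_zero] at h
      exact h.mono_left nhdsWithin_le_nhds
  rw [integral_smul_const] at h2
  refine h2.congr' ?_
  filter_upwards [self_mem_nhdsWithin] with ε hε using h1 ε hε

/-- For `ε > 0` integration by parts produces the trace `sum_dker`, an approximate identity of mass
`massConst`; then `ε → 0`. -/
lemma ker_divergence {φ : Space 3 → F} (hφ : ContDiff ℝ ∞ φ) (hc : HasCompactSupport φ)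
    (x : Space 3) :
    ∑ j, ∫ y, ker 0 j y • fderiv ℝ φ (x - y) (ee j) = massConst • φ x := by
  have h1 : Filter.Tendsto (fun ε => ∑ j, ∫ y, ker ε j y • fderiv ℝ φ (x - y) (ee j))
      (nhdsWithin 0 (Set.Ioi 0)) (nhds (∑ j, ∫ y, ker 0 j y • fderiv ℝ φ (x - y) (ee j))) :=
    tendsto_finsetSum _ fun j _ => tendsto_integral_ker (continuous_fderiv_apply hφ (ee j))
      (hasCompactSupport_fderiv_apply hc (ee j)) j x
  refine tendsto_nhds_unique h1 ((tendsto_approx_identity hφ.continuous hc x).congr' ?_)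
  filter_upwards [self_mem_nhdsWithin] with ε hε
  have hε' : 0 < ε := hε
  simp only [integral_ker_fderiv hφ hc hε']
  rw [← integral_finsetSum]
  · simp only [← Finset.sum_smul, sum_dker hε']
  · intro j _
    have hk : ContDiff ℝ ∞ (ker ε j) :=
      contDiff_iff_contDiffAt.2 fun y => contDiffAt_ker j (by positivity)
    simp only [← fderiv_ker hε']
    have hs : Continuous (fun y => φ (x - y)) := hφ.continuous.comp (by fun_prop)
    exact ((continuous_fderiv_apply hk _).smul hs).integrable_of_hasCompactSupport
      (hasCompactSupport_sub_left hc x).smul_left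

end Kernel

end EdgeWave

end

/-! ### Inverting the Dirac operator on test spinors -/

noncomputable section

namespace EdgeWave
open MeasureTheory

/-- The Dirac operator `γ^j ∂_j` on spinor-valued functions on `ℝ³`. -/
def diracF (φ : Space 3 → SpinIdx → ℂ) (x : Space 3) : SpinIdx → ℂ :=
  ∑ j, gamma j *ᵥ fderiv ℝ φ x (ee j)

/-- Convolution with the kernel `γ^j y_j |y|⁻³`. -/
def newton (φ : Space 3 → SpinIdx → ℂ) (x : Space 3) : SpinIdx → ℂ :=
  ∑ j, gamma j *ᵥ ∫ y, ker 0 j y • φ (x - y)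

lemma mulVec_integral (M : Matrix SpinIdx SpinIdx ℂ) {Y : Type} [MeasurableSpace Y] {μ : Measure Y}
    {f : Y → SpinIdx → ℂ} (hf : Integrable f μ) : M *ᵥ ∫ y, f y ∂μ = ∫ y, M *ᵥ f y ∂μ :=
  ((mulVecCLM M).integral_comp_comm hf).symm

lemma clifford_sum_symm {a : Fin 3 → Fin 3 → SpinIdx → ℂ} (h : ∀ i j, a i j = a j i) :
    ∑ j, ∑ i, (gamma j * gamma i) *ᵥ a i j = -∑ j, a j j := by
  have h1 : ∑ j, ∑ i, (gamma j * gamma i) *ᵥ a i j = ∑ j, ∑ i, (gamma i * gamma j) *ᵥ a i j := by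
    rw [Finset.sum_comm]
    refine Finset.sum_congr rfl fun i _ => Finset.sum_congr rfl fun j _ => ?_
    rw [h]
  have h2 : (∑ j, ∑ i, (gamma j * gamma i) *ᵥ a i j) + ∑ j, ∑ i, (gamma i * gamma j) *ᵥ a i j
      = (-2 : ℂ) • ∑ j, a j j := by
    simp only [← Finset.sum_add_distrib, ← Matrix.add_mulVec, gamma_mul_gamma]
    rw [Finset.smul_sum]
    refine Finset.sum_congr rfl fun j _ => ?_
    rw [Finset.sum_eq_single j]
    · simp [Matrix.smul_mulVec, Matrix.neg_mulVec]
    · intro i _ hij; simp [Ne.symm hij]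
    · simp
  rw [← h1, ← two_smul ℂ] at h2
  have h3 : (2 : ℂ) • ∑ j, ∑ i, (gamma j * gamma i) *ᵥ a i j = (2 : ℂ) • -∑ j, a j j := by
    rw [h2]; module
  exact smul_right_injective _ (two_ne_zero' ℂ) h3

/-- Curl-freeness makes the double sum symmetric, so the Clifford relation retains only its
diagonal, which is the divergence. `diracF_newton` repeats this after moving the derivative onto `φ`
inside the convolution. -/
lemma newton_diracF {φ : Space 3 → SpinIdx → ℂ} (hφ : ContDiff ℝ ∞ φ) (hc : HasCompactSupport φ)
    (x : Space 3) : newton (diracF φ) x = -(massConst • φ x) := by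
  have hi : ∀ i j, Integrable (fun y => ker 0 j y • fderiv ℝ φ (x - y) (ee i)) := fun i j =>
    integrable_ker_smul (continuous_fderiv_apply hφ _) (hasCompactSupport_fderiv_apply hc _) 0 j x
  have h1 : newton (diracF φ) x = ∑ j, ∑ i, (gamma j * gamma i) *ᵥ
      ∫ y, ker 0 j y • fderiv ℝ φ (x - y) (ee i) := by
    unfold newton diracF
    refine Finset.sum_congr rfl fun j _ => ?_
    have : ∀ y, ker 0 j y • ∑ i, gamma i *ᵥ fderiv ℝ φ (x - y) (ee i)
        = ∑ i, gamma i *ᵥ (ker 0 j y • fderiv ℝ φ (x - y) (ee i)) := by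
      intro y; simp only [Finset.smul_sum, Matrix.mulVec_smul]
    simp only [this]
    have hi' : ∀ i ∈ Finset.univ, Integrable fun y =>
        gamma i *ᵥ (ker 0 j y • fderiv ℝ φ (x - y) (ee i)) := fun i _ =>
      (mulVecCLM (gamma i)).integrable_comp (hi i j)
    rw [integral_finsetSum _ hi', Matrix.mulVec_sum]
    refine Finset.sum_congr rfl fun i _ => ?_
    rw [← mulVec_integral _ (hi i j), Matrix.mulVec_mulVec]
  rw [h1, clifford_sum_symm (fun i j => ker_curl_free hφ hc i j x), ker_divergence hφ hc]

lemma hasFDerivAt_ker_conv {φ : Space 3 → SpinIdx → ℂ} (hφ : ContDiff ℝ ∞ φ)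
    (hc : HasCompactSupport φ) (j : Fin 3) :
    ContDiff ℝ ∞ (fun x => ∫ y, ker 0 j y • φ (x - y)) ∧ ∀ x v,
      fderiv ℝ (fun x => ∫ y, ker 0 j y • φ (x - y)) x v = ∫ y, ker 0 j y • fderiv ℝ φ (x - y) v := by
  have hf : LocallyIntegrable (ker 0 j) := locallyIntegrable_ker 0 j
  refine ⟨hc.contDiff_convolution_right (n := ⊤) (ContinuousLinearMap.lsmul ℝ ℝ) hf hφ, ?_⟩
  intro x v
  have h := hc.hasFDerivAt_convolution_right (ContinuousLinearMap.lsmul ℝ ℝ) hf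
    (hφ.of_le (by simp)) x (μ := volume)
  have h2 : fderiv ℝ (fun x => ∫ y, ker 0 j y • φ (x - y)) x = _ := h.fderiv
  rw [h2, convolution_precompR_apply _ hf (hc.fderiv ℝ) (hφ.continuous_fderiv (by simp))]
  rfl

lemma contDiff_newton {φ : Space 3 → SpinIdx → ℂ} (hφ : ContDiff ℝ ∞ φ)
    (hc : HasCompactSupport φ) : ContDiff ℝ ∞ (newton φ) := by
  unfold newton
  refine ContDiff.sum fun j _ => ?_
  exact contDiffOn_univ.1 (contDiff_mulVec _ (hasFDerivAt_ker_conv hφ hc j).1.contDiffOn)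

lemma diracF_newton {φ : Space 3 → SpinIdx → ℂ} (hφ : ContDiff ℝ ∞ φ) (hc : HasCompactSupport φ)
    (x : Space 3) : diracF (newton φ) x = -(massConst • φ x) := by
  have h1 : ∀ i, fderiv ℝ (newton φ) x (ee i)
      = ∑ j, gamma j *ᵥ ∫ y, ker 0 j y • fderiv ℝ φ (x - y) (ee i) := by
    intro i
    have hd : ∀ j, DifferentiableAt ℝ (fun x => ∫ y, ker 0 j y • φ (x - y)) x := fun j =>
      (hasFDerivAt_ker_conv hφ hc j).1.differentiable (by simp) x
    have h2 : newton φ = fun x => ∑ j, gamma j *ᵥ ∫ y, ker 0 j y • φ (x - y) := rfl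
    have hd' : ∀ j ∈ Finset.univ, DifferentiableAt ℝ
        (fun x => gamma j *ᵥ ∫ y, ker 0 j y • φ (x - y)) x := fun j _ =>
      (mulVecCLM (gamma j)).differentiableAt.comp x (hd j)
    rw [h2, fderiv_fun_sum hd', sum_apply]
    refine Finset.sum_congr rfl fun j _ => ?_
    rw [fderiv_mulVec _ (hd j), (hasFDerivAt_ker_conv hφ hc j).2]
  have h2 : diracF (newton φ) x = ∑ j, ∑ i, (gamma j * gamma i) *ᵥ
      ∫ y, ker 0 i y • fderiv ℝ φ (x - y) (ee j) := by
    unfold diracF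
    refine Finset.sum_congr rfl fun j _ => ?_
    rw [h1, Matrix.mulVec_sum]
    simp only [Matrix.mulVec_mulVec]
  rw [h2, clifford_sum_symm (fun i j => ker_curl_free hφ hc j i x), ker_divergence hφ hc]

/-- The Dirac kernel decays quadratically away from the support. -/
lemma exists_newton_bound {φ : Space 3 → SpinIdx → ℂ} (hφ : Continuous φ)
    (hc : HasCompactSupport φ) :
    ∃ C M : ℝ, 0 < M ∧ ∀ x, M ≤ ‖x‖ → ‖newton φ x‖ ≤ C * (‖x‖ ^ 2)⁻¹ := by
  obtain ⟨M, hM, hsupp⟩ := hc.isCompact.isBounded.subset_closedBall_lt 0 0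
  have hI : Integrable (fun y => ‖φ y‖) := (hφ.integrable_of_hasCompactSupport hc).norm
  -- On the support `|x - y| ≤ M ≤ |x| / 2`, so `|y| ≥ |x| / 2`; this is the factor `4`.
  have hb : ∀ j x, 2 * M ≤ ‖x‖ → ‖∫ y, ker 0 j y • φ (x - y)‖ ≤ (4 * (‖x‖ ^ 2)⁻¹) * ∫ y, ‖φ y‖ := by
    intro j x hx
    rw [← integral_sub_left_eq_self (fun y => ‖φ y‖) volume x, ← integral_const_mul]
    refine norm_integral_le_of_norm_le ((hI.comp_sub_left x).const_mul _) (ae_of_all _ fun y => ?_)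
    rw [norm_smul]
    by_cases hy : φ (x - y) = 0
    · simp [hy]
    have h1 : ‖x - y‖ ≤ M := by simpa using hsupp (subset_tsupport _ hy)
    have h2 : ‖x‖ / 2 ≤ ‖y‖ := by
      have := norm_sub_norm_le x y; linarith
    have hx0 : 0 < ‖x‖ := by linarith
    gcongr
    rw [Real.norm_eq_abs]
    refine (abs_ker_le 0 j y).trans ?_
    have h3 : (‖x‖ / 2) ^ 2 ≤ ‖y‖ ^ 2 := by gcongr
    calc (‖y‖ ^ 2)⁻¹ ≤ ((‖x‖ / 2) ^ 2)⁻¹ := by gcongr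
      _ = 4 * (‖x‖ ^ 2)⁻¹ := by field_simp; norm_num
  refine ⟨∑ j : Fin 3, ‖mulVecCLM (gamma j)‖ * (4 * ∫ y, ‖φ y‖), 2 * M, by linarith, fun x hx => ?_⟩
  unfold newton
  rw [Finset.sum_mul]
  refine norm_sum_le_of_le _ fun j _ => ?_
  rw [← mulVecCLM_apply]
  refine ((mulVecCLM (gamma j)).le_opNorm _).trans ?_
  rw [mul_assoc]
  gcongr
  refine (hb j x hx).trans_eq (by ring)

/-! ### Homogeneous spinors -/

lemma sum_coord (x : Space 3) : ∑ j, x j • ee j = x := by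
  ext i
  simp [ee, Finset.sum_apply, Pi.single_apply]

lemma sum_coord_fderiv {F : Type} [NormedAddCommGroup F] [NormedSpace ℝ F]
    (L : Space 3 →L[ℝ] F) (x : Space 3) : ∑ j, x j • L (ee j) = L x := by
  conv_rhs => rw [← sum_coord x, map_sum]
  simp only [map_smul]

lemma R_apply (u : Sm) {x : Space 3} (hx : x ≠ 0) : (R u).1 x = fderiv ℝ u.1 x x := by
  rw [← sum_coord_fderiv, R, Op.sum_apply, Submodule.coe_sum, Finset.sum_apply]
  refine Finset.sum_congr rfl fun j _ => ?_
  rw [Op.mul_apply, X_apply, pd_apply _ _ hx, Complex.coe_smul]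

lemma GD_apply (u : Sm) {x : Space 3} (hx : x ≠ 0) : (GD u).1 x = diracF u.1 x := by
  rw [GD, Op.sum_apply, Submodule.coe_sum, Finset.sum_apply]
  refine Finset.sum_congr rfl fun j _ => ?_
  rw [Op.mul_apply, G, mat_apply, pd_apply _ _ hx]

/-- Euler's identity integrated along a ray: `exp (-λ s) w (exp s • x)` has vanishing derivative in
`s`. -/
lemma homogeneous_of_R {w : Sm} {lam : ℂ} (hw : R w = lam • w) {x : Space 3} (hx : x ≠ 0)
    {t : ℝ} (ht : 0 < t) : w.1 (t • x) = (t : ℂ) ^ lam • w.1 x := by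
  have hd : ∀ s : ℝ, HasDerivAt (fun s : ℝ => Complex.exp (-(lam * s)) • w.1 (Real.exp s • x)) 0 s := by
    intro s
    have hx' : Real.exp s • x ≠ 0 := smul_ne_zero (Real.exp_pos s).ne' hx
    have h1 : HasDerivAt (fun s : ℝ => Real.exp s • x) (Real.exp s • x) s :=
      (Real.hasDerivAt_exp s).smul_const x
    have h2 := (differentiableAt_sm w hx').hasFDerivAt.comp_hasDerivAt s h1
    rw [← R_apply w hx', hw] at h2
    have h3 : HasDerivAt (fun s : ℝ => Complex.exp (-(lam * s)))
        (Complex.exp (-(lam * s)) * -(lam * 1)) s := by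
      have : HasDerivAt (fun s : ℝ => -(lam * (s : ℂ))) (-(lam * 1)) s :=
        ((Complex.ofRealCLM.hasDerivAt (x := s)).const_mul lam).neg
      exact this.cexp
    refine (h3.smul h2).congr_deriv ?_
    simp only [Submodule.coe_smul, Pi.smul_apply, smul_smul, ← add_smul, Function.comp]
    rw [show Complex.exp (-(lam * s)) * lam + Complex.exp (-(lam * s)) * -(lam * 1) = 0 by ring,
      zero_smul]
  have hc := is_const_of_deriv_eq_zero (fun s => (hd s).differentiableAt) (fun s => (hd s).deriv)
    (Real.log t) 0
  simp only [Real.exp_log ht, Complex.ofReal_zero, mul_zero, neg_zero, Complex.exp_zero, one_smul,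
    Real.exp_zero] at hc
  have ht' : (t : ℂ) ≠ 0 := by exact_mod_cast ht.ne'
  rw [Complex.cpow_def_of_ne_zero ht', ← Complex.ofReal_log ht.le, mul_comm, ← hc, smul_smul,
    ← Complex.exp_add, add_neg_cancel, Complex.exp_zero, one_smul]

lemma R_of_homogeneous {w : Sm} {lam : ℂ}
    (h : ∀ x, x ≠ 0 → ∀ t : ℝ, 0 < t → w.1 (t • x) = (t : ℂ) ^ lam • w.1 x) : R w = lam • w := by
  refine Sm_ext fun x hx => ?_
  rw [R_apply w hx, Submodule.coe_smul, Pi.smul_apply]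
  have h1 : HasDerivAt (fun t : ℝ => w.1 (t • x)) (fderiv ℝ w.1 x x) 1 := by
    have h0 : HasDerivAt (fun t : ℝ => t • x) x 1 := by
      simpa using (hasDerivAt_id (1 : ℝ)).smul_const x
    have h2 : HasFDerivAt w.1 (fderiv ℝ w.1 x) ((1 : ℝ) • x) := by
      rw [one_smul]; exact (differentiableAt_sm w hx).hasFDerivAt
    exact h2.comp_hasDerivAt 1 h0
  have h3 : HasDerivAt (fun t : ℝ => (t : ℂ) ^ lam • w.1 x) (lam • w.1 x) 1 := by
    have h4 : HasDerivAt (fun z : ℂ => z ^ lam) (lam * (1 : ℂ) ^ (lam - 1) * 1) ((1 : ℝ) : ℂ) := by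
      simpa using (hasDerivAt_id (1 : ℂ)).cpow_const (c := lam) (by simp)
    have h5 := (h4.comp_ofReal).smul_const (w.1 x)
    simpa using h5
  refine h1.unique (h3.congr_of_eventuallyEq ?_)
  filter_upwards [lt_mem_nhds (zero_lt_one (α := ℝ))] with t ht using h x hx t ht

end EdgeWave

end

noncomputable section

namespace EdgeWave
open MeasureTheory

/-! ### Cutoff functions -/

/-- A smooth cutoff, equal to `1` for `|x| ≤ 1` and to `0` for `|x|² ≥ 2`. -/
def eta (x : Space 3) : ℝ := 1 - Real.smoothTransition (‖x‖ ^ 2 - 1)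

lemma contDiff_eta : ContDiff ℝ ∞ eta :=
  contDiff_const.sub (Real.smoothTransition.contDiff.comp ((contDiff_norm_sq ℝ).sub contDiff_const))

lemma eta_eq_one {x : Space 3} (h : ‖x‖ ≤ 1) : eta x = 1 := by
  rw [eta, Real.smoothTransition.zero_of_nonpos (by nlinarith [norm_nonneg x]), sub_zero]

lemma eta_eq_zero {x : Space 3} (h : 2 ≤ ‖x‖) : eta x = 0 := by
  rw [eta, Real.smoothTransition.one_of_one_le (by nlinarith), sub_self]

lemma hasCompactSupport_eta : HasCompactSupport eta :=
  HasCompactSupport.intro (isCompact_closedBall 0 2) fun x hx => eta_eq_zero (by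
    simp at hx; exact hx.le)

lemma eta_antitone {x y : Space 3} (h : ‖x‖ ≤ ‖y‖) : eta y ≤ eta x := by
  unfold eta
  have : Real.smoothTransition (‖x‖ ^ 2 - 1) ≤ Real.smoothTransition (‖y‖ ^ 2 - 1) :=
    Real.smoothTransition.monotone (by gcongr)
  linarith

lemma fderiv_eta_eq_zero {x : Space 3} (h : ‖x‖ < 1) : fderiv ℝ eta x = 0 := by
  have : eta =ᶠ[nhds x] fun _ => (1 : ℝ) := by
    filter_upwards [(isOpen_lt continuous_norm continuous_const).mem_nhds h] with y hy
    exact eta_eq_one (le_of_lt hy)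
  rw [this.fderiv_eq]; simp

/-- A function that is smooth away from the origin and vanishes near the origin is smooth. -/
lemma contDiff_of_zero_near {F : Type*} [NormedAddCommGroup F] [NormedSpace ℝ F]
    {f : Space 3 → F} (hf : ContDiffOn ℝ ∞ f {0}ᶜ) {r : ℝ} (hr : 0 < r)
    (h : ∀ x, ‖x‖ < r → f x = 0) : ContDiff ℝ ∞ f := by
  rw [contDiff_iff_contDiffAt]
  intro x
  by_cases hx : x = 0
  · have : f =ᶠ[nhds x] fun _ => 0 := by
      filter_upwards [(isOpen_lt continuous_norm continuous_const).mem_nhds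
        (by simpa [hx] using hr : ‖x‖ < r)] with y hy using h y hy
    exact contDiffAt_const.congr_of_eventuallyEq this
  · exact hf.contDiffAt (compl_zero_mem_nhds hx)

/-! ### Dilations and the kernel of the Dirac operator on homogeneous spinors -/

lemma ker_smul {t : ℝ} (ht : 0 < t) (j : Fin 3) (y : Space 3) :
    ker 0 j (t • y) = (t ^ 2)⁻¹ * ker 0 j y := by
  unfold ker
  have h1 : ‖t • y‖ ^ 2 + 0 ^ 2 = t ^ 2 * (‖y‖ ^ 2 + 0 ^ 2) := by
    rw [norm_smul, Real.norm_of_nonneg ht.le]; ring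
  have h2 : (t ^ 2) ^ (-(3 / 2) : ℝ) = (t ^ 3)⁻¹ := by
    rw [← Real.rpow_natCast, ← Real.rpow_mul ht.le, ← Real.rpow_natCast, ← Real.rpow_neg ht.le]
    norm_num
  rw [h1, Real.mul_rpow (by positivity) (by positivity), h2]
  simp only [PiLp.smul_apply, smul_eq_mul]
  field_simp

/-- The kernel has degree `-2` and the volume degree `3`, so the convolution gains one power of `t`.
-/
lemma newton_scale {a b : Space 3 → SpinIdx → ℂ} {t : ℝ} (ht : 0 < t) {c : ℂ}
    (h : ∀ y, a (t • y) = c • b y) (x : Space 3) :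
    newton a x = (t * c) • newton b (t⁻¹ • x) := by
  unfold newton
  rw [Finset.smul_sum]
  refine Finset.sum_congr rfl fun j _ => ?_
  rw [← Matrix.mulVec_smul]
  congr 1
  have h1 := Measure.integral_comp_smul (volume : Measure (Space 3))
    (fun y => ker 0 j y • a (x - y)) t
  have h5 : |(t ^ Module.finrank ℝ (Space 3))⁻¹| = (t ^ 3)⁻¹ := by
    rw [finrank_euclideanSpace_fin, abs_of_pos (by positivity)]
  rw [h5] at h1
  have h6 := congrArg (fun w => t ^ 3 • w) h1
  simp only [smul_inv_smul₀ (by positivity : t ^ 3 ≠ 0)] at h6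
  rw [← h6, ← integral_smul, ← integral_smul]
  refine integral_congr_ae (ae_of_all _ fun y => ?_)
  have h7 : x - t • y = t • (t⁻¹ • x - y) := by
    rw [smul_sub, smul_inv_smul₀ ht.ne']
  simp only
  rw [h7, h, ker_smul ht]
  ext i
  simp only [Pi.smul_apply, Complex.real_smul, smul_eq_mul]
  push_cast
  have : (t : ℂ) ≠ 0 := by exact_mod_cast ht.ne'
  field_simp

/-- Injectivity of the Dirac operator on homogeneous spinors of degree in `(-2, 0)`. -/
lemma dirac_injective_base {w : Sm} {lam : ℂ} (hw : R w = lam • w) (hD : GD w = 0)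
    (h1 : -2 < lam.re) (h2 : lam.re < 0) : w = 0 := by
  refine Sm_ext fun x hx => ?_
  -- The commutator of the Dirac operator with the cutoff, applied to `w`. Because `w` is in the
  -- kernel, this is all that remains of the Dirac operator on `eta • w`. Other scales of the cutoff
  -- are reached by homogeneity.
  set a : Space 3 → SpinIdx → ℂ := fun y => ∑ j, gamma j *ᵥ (fderiv ℝ eta y (ee j) • w.1 y) with ha
  have haz : ∀ y, ‖y‖ < 1 → a y = 0 := fun y hy => by simp [ha, fderiv_eta_eq_zero hy]
  have has : ContDiff ℝ ∞ a := by
    refine contDiff_of_zero_near ?_ one_pos haz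
    refine ContDiffOn.sum fun j _ => contDiff_mulVec _ ?_
    exact ((contDiff_eta.fderiv_right (m := ∞) (by simp)).clm_apply contDiff_const).contDiffOn.smul
      w.2.1
  have hac : HasCompactSupport a := by
    refine HasCompactSupport.mono' (hasCompactSupport_eta.fderiv ℝ) fun y hy => ?_
    rw [Function.mem_support] at hy
    by_contra hn
    have : fderiv ℝ eta y = 0 := by
      by_contra h'; exact hn (subset_tsupport _ h')
    exact hy (by simp [ha, this])
  have hN := contDiff_newton has hac
  -- the identity obtained from a cutoff at the scales `s` and `t`
  have key : ∀ s t : ℝ, 0 < s → s ≤ t → 2 * s ≤ ‖x‖ → ‖x‖ ≤ t →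
      (t : ℂ) ^ lam • newton a (t⁻¹ • x) - (s : ℂ) ^ lam • newton a (s⁻¹ • x)
        = -(massConst • w.1 x) := by
    intro s t hs hst hsx hxt
    have ht : 0 < t := hs.trans_le hst
    set chi : Space 3 → ℝ := fun y => eta (t⁻¹ • y) - eta (s⁻¹ • y) with hchi
    have hchis : ContDiff ℝ ∞ chi :=
      (contDiff_eta.comp (contDiff_const_smul _)).sub (contDiff_eta.comp (contDiff_const_smul _))
    have hnr : ∀ (ρ : ℝ), 0 < ρ → ∀ y : Space 3, ‖ρ⁻¹ • y‖ = ρ⁻¹ * ‖y‖ := fun ρ hρ y => by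
      rw [norm_smul, Real.norm_of_nonneg (by positivity)]
    set φ : Space 3 → SpinIdx → ℂ := fun y => chi y • w.1 y with hφ
    have hφs : ContDiff ℝ ∞ φ := by
      refine contDiff_of_zero_near (hchis.contDiffOn.smul w.2.1) hs fun y hy => ?_
      have e1 : eta (t⁻¹ • y) = 1 := eta_eq_one (by
        rw [hnr t ht, inv_mul_le_iff₀ ht]; linarith)
      have e2 : eta (s⁻¹ • y) = 1 := eta_eq_one (by
        rw [hnr s hs, inv_mul_le_iff₀ hs]; linarith)
      simp [hφ, hchi, e1, e2]
    have hφc : HasCompactSupport φ := by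
      refine HasCompactSupport.intro (isCompact_closedBall 0 (2 * t)) fun y hy => ?_
      have hy' : 2 * t < ‖y‖ := by simpa using hy
      have e1 : eta (t⁻¹ • y) = 0 := eta_eq_zero (by
        rw [hnr t ht, le_inv_mul_iff₀ ht]; linarith)
      have e2 : eta (s⁻¹ • y) = 0 := eta_eq_zero (by
        rw [hnr s hs, le_inv_mul_iff₀ hs]; nlinarith)
      simp [hφ, hchi, e1, e2]
    have hφx : φ x = w.1 x := by
      have e1 : eta (t⁻¹ • x) = 1 := eta_eq_one (by
        rw [hnr t ht, inv_mul_le_iff₀ ht]; linarith)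
      have e2 : eta (s⁻¹ • x) = 0 := eta_eq_zero (by
        rw [hnr s hs, le_inv_mul_iff₀ hs]; linarith)
      simp [hφ, hchi, e1, e2]
    -- the Dirac operator applied to the cut off spinor
    set b : ℝ → Space 3 → SpinIdx → ℂ := fun ρ y =>
      ∑ j, gamma j *ᵥ (fderiv ℝ (fun y => eta (ρ⁻¹ • y)) y (ee j) • w.1 y) with hb
    have hbs : ∀ ρ : ℝ, 0 < ρ → ∀ y, b ρ (ρ • y) = ((ρ : ℂ)⁻¹ * (ρ : ℂ) ^ lam) • a y := by
      intro ρ hρ y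
      by_cases hy : y = 0
      · simp [hb, ha, hy, w.2.2]
      rw [hb, ha]
      simp only [Finset.smul_sum]
      refine Finset.sum_congr rfl fun j _ => ?_
      have e1 : fderiv ℝ (fun y => eta (ρ⁻¹ • y)) (ρ • y) (ee j) = ρ⁻¹ * fderiv ℝ eta y (ee j) := by
        rw [fderiv_comp_smul, inv_smul_smul₀ hρ.ne']; simp
      rw [e1, homogeneous_of_R hw hy hρ, ← Matrix.mulVec_smul]
      congr 1
      ext i
      simp only [Pi.smul_apply, Complex.real_smul, smul_eq_mul]
      push_cast; ring
    have hbN : ∀ ρ : ℝ, 0 < ρ → newton (b ρ) x = (ρ : ℂ) ^ lam • newton a (ρ⁻¹ • x) := by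
      intro ρ hρ
      rw [newton_scale hρ (hbs ρ hρ)]
      congr 1
      have : (ρ : ℂ) ≠ 0 := by exact_mod_cast hρ.ne'
      field_simp
    have hde : ∀ ρ y, DifferentiableAt ℝ (fun y => eta (ρ⁻¹ • y)) y := fun ρ y =>
      (contDiff_eta.comp (contDiff_const_smul (ρ⁻¹ : ℝ))).differentiable (by simp) y
    have hdb : diracF φ = fun y => b t y - b s y := by
      funext y
      by_cases hy : y = 0
      · have e : φ =ᶠ[nhds y] fun _ => 0 := by
          filter_upwards [(isOpen_lt continuous_norm continuous_const).mem_nhds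
            (by simpa [hy] using hs : ‖y‖ < s)] with y' hy'
          have e1 : eta (t⁻¹ • y') = 1 := eta_eq_one (by
            rw [hnr t ht, inv_mul_le_iff₀ ht]; linarith [show ‖y'‖ < s from hy'])
          have e2 : eta (s⁻¹ • y') = 1 := eta_eq_one (by
            rw [hnr s hs, inv_mul_le_iff₀ hs]; linarith [show ‖y'‖ < s from hy'])
          simp [hφ, hchi, e1, e2]
        rw [hy] at e
        simp [diracF, e.fderiv_eq, hb, hy, w.2.2]
      · have hGD : ∑ j, gamma j *ᵥ fderiv ℝ w.1 y (ee j) = 0 := by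
          have := GD_apply w hy
          rw [hD] at this; exact this.symm
        have e1 : ∀ j, fderiv ℝ φ y (ee j) = chi y • fderiv ℝ w.1 y (ee j)
            + (fderiv ℝ (fun y => eta (t⁻¹ • y)) y (ee j) • w.1 y
              - fderiv ℝ (fun y => eta (s⁻¹ • y)) y (ee j) • w.1 y) := by
          intro j
          rw [hφ, fderiv_fun_smul (hchis.differentiable (by simp) y) (differentiableAt_sm w hy), hchi,
            fderiv_fun_sub (hde t y) (hde s y)]
          simp [sub_smul]
        simp only [diracF, e1, hb, Matrix.mulVec_add, Matrix.mulVec_sub, Finset.sum_add_distrib,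
          Finset.sum_sub_distrib]
        have e2 : ∑ j, gamma j *ᵥ (chi y • fderiv ℝ w.1 y (ee j)) = 0 := by
          simp only [Matrix.mulVec_smul]
          rw [← Finset.smul_sum, hGD, smul_zero]
        rw [e2, zero_add]
    have hcont : ∀ ρ : ℝ, 0 < ρ → Continuous (b ρ) ∧ HasCompactSupport (b ρ) := by
      intro ρ hρ
      have e : b ρ = fun y => ((ρ : ℂ)⁻¹ * (ρ : ℂ) ^ lam) • a (ρ⁻¹ • y) := by
        funext y
        rw [← hbs ρ hρ, smul_inv_smul₀ hρ.ne']
      rw [e]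
      have hac2 : HasCompactSupport fun y => a (ρ⁻¹ • y) :=
        hac.comp_smul (by positivity)
      have hcn := has.continuous
      exact ⟨by fun_prop,
        hac2.smul_left (f := fun _ => ((ρ : ℂ)⁻¹ * (ρ : ℂ) ^ lam))⟩
    rw [← hbN t ht, ← hbN s hs, ← hφx, ← newton_diracF hφs hφc, hdb]
    unfold newton
    rw [← Finset.sum_sub_distrib]
    refine Finset.sum_congr rfl fun j _ => ?_
    rw [← Matrix.mulVec_sub, ← integral_sub]
    · simp only [smul_sub]
    · exact integrable_ker_smul (hcont t ht).1 (hcont t ht).2 0 j x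
    · exact integrable_ker_smul (hcont s hs).1 (hcont s hs).2 0 j x
  have hxn : 0 < ‖x‖ := norm_pos_iff.2 hx
  -- Outer scale: the convolution converges to its value at the origin, and `t ^ lam → 0` because
  -- `Re lam < 0`.
  have hlim1 : Filter.Tendsto (fun t : ℝ => (t : ℂ) ^ lam • newton a (t⁻¹ • x)) Filter.atTop
      (nhds 0) := by
    have e1 : Filter.Tendsto (fun t : ℝ => newton a (t⁻¹ • x)) Filter.atTop (nhds (newton a 0)) := by
      refine hN.continuous.tendsto' 0 _ rfl |>.comp ?_
      have := (tendsto_inv_atTop_zero (𝕜 := ℝ)).smul_const x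
      rwa [zero_smul] at this
    have e2 : Filter.Tendsto (fun t : ℝ => (t : ℂ) ^ lam) Filter.atTop (nhds 0) := by
      rw [tendsto_zero_iff_norm_tendsto_zero]
      have := tendsto_rpow_neg_atTop (neg_pos.2 h2)
      rw [neg_neg] at this
      refine this.congr' ?_
      filter_upwards [Filter.eventually_gt_atTop 0] with t ht
      rw [Complex.norm_cpow_eq_rpow_re_of_pos ht]
    simpa using e2.smul e1
  -- Inner scale: the quadratic decay of the convolution beats the power because `Re lam > -2`.
  have hlim2 : Filter.Tendsto (fun t : ℝ => ((t⁻¹ : ℝ) : ℂ) ^ lam • newton a ((t⁻¹)⁻¹ • x)) Filter.atTop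
      (nhds 0) := by
    obtain ⟨C, M, hM, hC⟩ := exists_newton_bound has.continuous hac
    have e2 : Filter.Tendsto (fun t : ℝ => t ^ (-(lam.re + 2)) * (C * (‖x‖ ^ 2)⁻¹)) Filter.atTop
        (nhds 0) := by
      have := (tendsto_rpow_neg_atTop (by linarith : 0 < lam.re + 2)).mul_const (C * (‖x‖ ^ 2)⁻¹)
      rwa [zero_mul] at this
    refine squeeze_zero_norm' ?_ e2
    filter_upwards [Filter.eventually_gt_atTop 0, Filter.eventually_ge_atTop (M / ‖x‖)] with t ht htM
    rw [norm_smul, Complex.norm_cpow_eq_rpow_re_of_pos (by positivity), inv_inv]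
    have e3 : ‖t • x‖ = t * ‖x‖ := by rw [norm_smul, Real.norm_of_nonneg ht.le]
    have e4 := hC (t • x) (by rw [e3]; exact (div_le_iff₀ hxn).1 htM)
    calc t⁻¹ ^ lam.re * ‖newton a (t • x)‖ ≤ t⁻¹ ^ lam.re * (C * (‖t • x‖ ^ 2)⁻¹) := by gcongr
      _ = t ^ (-(lam.re + 2)) * (C * (‖x‖ ^ 2)⁻¹) := by
        rw [e3, mul_pow, mul_inv, Real.inv_rpow ht.le, neg_add, Real.rpow_add ht, Real.rpow_neg ht.le,
          Real.rpow_neg ht.le, Real.rpow_two]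
        ring
  have hlim := hlim1.sub hlim2
  rw [sub_zero] at hlim
  have hfin : -(massConst • w.1 x) = 0 := by
    refine tendsto_nhds_unique (tendsto_const_nhds.congr' ?_) hlim
    filter_upwards [Filter.eventually_ge_atTop 1, Filter.eventually_ge_atTop ‖x‖,
      Filter.eventually_ge_atTop (2 / ‖x‖)] with t ht1 ht2 ht3
    refine (key t⁻¹ t (by positivity) ?_ ?_ ht2).symm
    · exact (inv_le_one_of_one_le₀ ht1).trans ht1
    · have := (div_le_iff₀ hxn).1 ht3
      rw [← div_eq_mul_inv, div_le_iff₀ (by linarith)]; linarith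
  have := neg_eq_zero.1 hfin
  exact (smul_eq_zero.1 this).resolve_left massConst_pos.ne'

end EdgeWave

end

/-! ### Solving the Dirac equation with homogeneous right-hand side by averaging over dilations -/

noncomputable section

namespace EdgeWave
open MeasureTheory

/-- Inversion `s = 1/t` turns the tail into an integral over a compact interval, where the results
on parameter integrals are available. -/
lemma integral_Ioi_split_inv {F : Type} [NormedAddCommGroup F] [NormedSpace ℝ F] {f g : ℝ → F}
    {a : ℝ} (ha : 0 < a) (hf : IntegrableOn f (Set.Icc 0 a)) (hg : IntegrableOn g (Set.Icc 0 a⁻¹))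
    (hfg : ∀ t, 0 < t → t ≤ a⁻¹ → g t = (t ^ 2)⁻¹ • f t⁻¹) :
    IntegrableOn f (Set.Ioi 0) ∧
      ∫ s in Set.Ioi 0, f s = (∫ s in Set.Icc 0 a, f s) + ∫ t in Set.Icc 0 a⁻¹, g t := by
  have e0 : Set.EqOn (fun x : ℝ => (|(-1 : ℝ)| * x ^ ((-1 : ℝ) - 1)) • (Set.Ioi a).indicator f (x ^ (-1 : ℝ)))
      ((Set.Iio a⁻¹).indicator g) (Set.Ioi 0) := by
    intro x hx
    have hx' : 0 < x := hx
    have e1 : x ^ (-1 : ℝ) = x⁻¹ := Real.rpow_neg_one x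
    have e2 : x ^ ((-1 : ℝ) - 1) = (x ^ 2)⁻¹ := by
      rw [show (-1 : ℝ) - 1 = -((2 : ℕ) : ℝ) by norm_num, Real.rpow_neg hx'.le, Real.rpow_natCast]
    simp only [e1, e2, abs_neg, abs_one, one_mul]
    by_cases h : x < a⁻¹
    · have h' : a < x⁻¹ := (lt_inv_comm₀ ha hx').2 h
      rw [Set.indicator_of_mem (show x⁻¹ ∈ Set.Ioi a from h'),
        Set.indicator_of_mem (show x ∈ Set.Iio a⁻¹ from h), hfg x hx' h.le]
    · have h' : ¬ a < x⁻¹ := fun h' => h ((lt_inv_comm₀ ha hx').1 h')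
      rw [Set.indicator_of_notMem (show x⁻¹ ∉ Set.Ioi a from h'),
        Set.indicator_of_notMem (show x ∉ Set.Iio a⁻¹ from h), smul_zero]
  have e3 : Set.Ioi (0 : ℝ) ∩ Set.Iio a⁻¹ = Set.Ioo 0 a⁻¹ := rfl
  have e4 : Set.Ioi (0 : ℝ) ∩ Set.Ioi a = Set.Ioi a := by
    ext x; simp only [Set.mem_inter_iff, Set.mem_Ioi]; constructor
    · exact fun h => h.2
    · exact fun h => ⟨ha.trans h, h⟩
  have hI : IntegrableOn ((Set.Ioi a).indicator f) (Set.Ioi 0) := by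
    rw [← integrableOn_Ioi_comp_rpow_iff _ (by norm_num : (-1 : ℝ) ≠ 0),
      integrableOn_congr_fun e0 measurableSet_Ioi, IntegrableOn,
      integrable_indicator_iff measurableSet_Iio, IntegrableOn, Measure.restrict_restrict measurableSet_Iio,
      Set.inter_comm, e3]
    exact hg.mono_set Set.Ioo_subset_Icc_self
  have hfa : IntegrableOn f (Set.Ioi a) := by
    rw [IntegrableOn, integrable_indicator_iff measurableSet_Ioi, IntegrableOn,
      Measure.restrict_restrict measurableSet_Ioi, Set.inter_comm, e4] at hI
    exact hI
  have hfa0 : IntegrableOn f (Set.Ioc 0 a) := hf.mono_set Set.Ioc_subset_Icc_self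
  have hu : Set.Ioi (0 : ℝ) = Set.Ioc 0 a ∪ Set.Ioi a := (Set.Ioc_union_Ioi_eq_Ioi ha.le).symm
  refine ⟨hu ▸ hfa0.union hfa, ?_⟩
  have h1 := integral_comp_rpow_Ioi ((Set.Ioi a).indicator f) (by norm_num : (-1 : ℝ) ≠ 0)
  rw [setIntegral_congr_fun measurableSet_Ioi e0, setIntegral_indicator measurableSet_Iio, e3,
    setIntegral_indicator measurableSet_Ioi, e4] at h1
  have hdis : Disjoint (Set.Ioc 0 a) (Set.Ioi a) := Set.Ioc_disjoint_Ioi le_rfl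
  rw [hu, setIntegral_union hdis measurableSet_Ioi hfa0 hfa,
    ← h1, integral_Icc_eq_integral_Ioc, integral_Icc_eq_integral_Ioo (x := 0) (y := a⁻¹)]

lemma integrableOn_cpow_Icc {r : ℂ} (h : -1 < r.re) (a : ℝ) :
    IntegrableOn (fun x : ℝ => (x : ℂ) ^ r) (Set.Icc 0 a) := by
  rcases le_or_gt 0 a with ha | ha
  · rw [integrableOn_Icc_iff_integrableOn_Ioc, ← intervalIntegrable_iff_integrableOn_Ioc_of_le ha]
    exact intervalIntegral.intervalIntegrable_cpow' h
  · rw [Set.Icc_eq_empty (not_le.2 ha)]; exact integrableOn_empty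

/-- A radial bump function, supported in `1 ≤ |x| ≤ 4`. -/
def bump (x : Space 3) : ℝ := eta ((2 : ℝ)⁻¹ • x) - eta x

lemma contDiff_bump : ContDiff ℝ ∞ bump :=
  (contDiff_eta.comp (contDiff_const_smul _)).sub contDiff_eta

lemma bump_nonneg (x : Space 3) : 0 ≤ bump x := by
  refine sub_nonneg.2 (eta_antitone ?_)
  rw [norm_smul, Real.norm_of_nonneg (by norm_num)]
  linarith [norm_nonneg x]

lemma bump_eq_zero_of_le {x : Space 3} (h : ‖x‖ ≤ 1) : bump x = 0 := by
  rw [bump, eta_eq_one h, eta_eq_one, sub_self]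
  rw [norm_smul, Real.norm_of_nonneg (by norm_num)]
  linarith [norm_nonneg x]

lemma bump_eq_zero_of_ge {x : Space 3} (h : 4 ≤ ‖x‖) : bump x = 0 := by
  have h2 : ‖(2 : ℝ)⁻¹ • x‖ = 2⁻¹ * ‖x‖ := by rw [norm_smul, Real.norm_of_nonneg (by norm_num)]
  rw [bump, eta_eq_zero (x := x) (by linarith), eta_eq_zero (by rw [h2]; linarith), sub_self]

lemma bump_eq_one {x : Space 3} (h : ‖x‖ = 2) : bump x = 1 := by
  rw [bump, eta_eq_zero h.ge, eta_eq_one, sub_zero]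
  rw [norm_smul, Real.norm_of_nonneg (by norm_num)]
  linarith

lemma bump_congr {x y : Space 3} (h : ‖x‖ = ‖y‖) : bump x = bump y := by
  simp only [bump, eta, norm_smul, h]

lemma hasCompactSupport_bump : HasCompactSupport bump :=
  HasCompactSupport.intro (isCompact_closedBall 0 4) fun x hx => bump_eq_zero_of_ge (by
    simp at hx; exact hx.le)

/-- The Mellin mass of the radial bump function. -/
def bumpMass (x : Space 3) : ℝ := ∫ s in Set.Ioi 0, s⁻¹ * bump (s • x)

lemma continuous_inv_mul_bump (x : Space 3) : Continuous fun s : ℝ => s⁻¹ * bump (s • x) := by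
  rw [continuous_iff_continuousAt]
  intro s
  by_cases hs : s = 0
  · have : (fun s : ℝ => s⁻¹ * bump (s • x)) =ᶠ[nhds s] fun _ => 0 := by
      have h1 : Continuous fun s : ℝ => ‖s • x‖ := by fun_prop
      filter_upwards [(isOpen_lt h1 continuous_const).mem_nhds
        (by simp [hs] : ‖s • x‖ < 1)] with t ht
      rw [bump_eq_zero_of_le (le_of_lt ht), mul_zero]
    exact continuousAt_const.congr this.symm
  · refine ContinuousAt.mul (continuousAt_inv₀ hs) ?_
    have := contDiff_bump.continuous
    fun_prop

lemma integrable_inv_mul_bump {x : Space 3} (hx : x ≠ 0) :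
    Integrable fun s : ℝ => s⁻¹ * bump (s • x) := by
  refine (continuous_inv_mul_bump x).integrable_of_hasCompactSupport ?_
  refine HasCompactSupport.intro (isCompact_closedBall 0 (4 / ‖x‖)) fun s hs => ?_
  have hs' : 4 / ‖x‖ < |s| := by simpa using hs
  rw [div_lt_iff₀ (norm_pos_iff.2 hx)] at hs'
  rw [bump_eq_zero_of_ge (by rw [norm_smul]; exact hs'.le), mul_zero]

lemma bumpMass_pos {x : Space 3} (hx : x ≠ 0) : 0 < bumpMass x := by
  have hxn : 0 < ‖x‖ := norm_pos_iff.2 hx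
  unfold bumpMass
  rw [setIntegral_pos_iff_support_of_nonneg_ae _ (integrable_inv_mul_bump hx).integrableOn]
  · refine IsOpen.measure_pos _ ?_ ⟨2 / ‖x‖, ?_⟩
    · exact ((continuous_inv_mul_bump x).isOpen_support).inter isOpen_Ioi
    · refine ⟨?_, by simp; positivity⟩
      rw [Function.mem_support, bump_eq_one]
      · positivity
      · rw [norm_smul, Real.norm_of_nonneg (by positivity)]; field_simp
  · refine (ae_restrict_iff' measurableSet_Ioi).2 (ae_of_all _ fun s hs => ?_)
    have hs' : 0 < s := hs
    exact mul_nonneg (by positivity) (bump_nonneg _)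

/-- The measure `ds / s` is invariant under dilations and `bump` is radial. -/
lemma bumpMass_eq {x y : Space 3} (hx : x ≠ 0) (hy : y ≠ 0) : bumpMass x = bumpMass y := by
  have hxn : 0 < ‖x‖ := norm_pos_iff.2 hx
  have hyn : 0 < ‖y‖ := norm_pos_iff.2 hy
  have h := integral_comp_mul_left_Ioi (fun s => s⁻¹ * bump (s • y)) 0 (b := ‖x‖ / ‖y‖) (by positivity)
  rw [mul_zero] at h
  have h2 : bumpMass y = (‖x‖ / ‖y‖) • ∫ s in Set.Ioi 0, (‖x‖ / ‖y‖ * s)⁻¹ * bump ((‖x‖ / ‖y‖ * s) • y) := by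
    rw [h, smul_inv_smul₀ (by positivity)]; rfl
  rw [h2, ← integral_smul]
  refine setIntegral_congr_fun measurableSet_Ioi fun s hs => ?_
  have hs' : 0 < s := hs
  have h3 : bump ((‖x‖ / ‖y‖ * s) • y) = bump (s • x) := bump_congr (by
    rw [norm_smul, norm_smul, Real.norm_of_nonneg (by positivity), Real.norm_of_nonneg hs'.le]
    field_simp)
  simp only [h3, smul_eq_mul]
  field_simp

lemma diracF_fderiv_smul {u : Space 3 → SpinIdx → ℂ} (s : ℝ) (x : Space 3) :
    diracF (fun y => u (s • y)) x = s • diracF u (s • x) := by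
  simp only [diracF, fderiv_comp_smul, Finset.smul_sum, smul_apply, Matrix.mulVec_smul]

lemma diracF_const_smul (c : ℂ) {f : Space 3 → SpinIdx → ℂ} {x : Space 3}
    (hf : DifferentiableAt ℝ f x) : diracF (fun y => c • f y) x = c • diracF f x := by
  simp only [diracF, fderiv_fun_const_smul hf, Finset.smul_sum]
  refine Finset.sum_congr rfl fun j _ => ?_
  rw [← Matrix.mulVec_smul]; rfl

lemma diracF_integral_compact {Ω : Set (Space 3 × ℝ)} {g : Space 3 × ℝ → SpinIdx → ℂ}
    (hΩ : IsOpen Ω) (hg : ContDiffOn ℝ ∞ g Ω) {a : ℝ} {f : ℝ → ℂ}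
    (hf : IntegrableOn f (Set.Icc 0 a)) {x₀ : Space 3} (hsub : {x₀} ×ˢ Set.Icc 0 a ⊆ Ω) :
    diracF (fun x => ∫ t in Set.Icc 0 a, f t • g (x, t)) x₀ =
      ∫ t in Set.Icc 0 a, f t • diracF (fun x => g (x, t)) x₀ := by
  have e1 : ∀ v, fderiv ℝ (fun x => ∫ t in Set.Icc 0 a, f t • g (x, t)) x₀ v =
      ∫ t in Set.Icc 0 a, f t • fderiv ℝ (fun x => g (x, t)) x₀ v := fun v =>
    fderiv_integral_compact hΩ (hg.of_le (by simp)) isCompact_Icc hf hsub v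
  have hdiff : ∀ t ∈ Set.Icc 0 a, ∀ v, fderiv ℝ (fun x => g (x, t)) x₀ v
      = fderiv ℝ g (x₀, t) (v, 0) := by
    intro t ht v
    have h3 : DifferentiableAt ℝ g (x₀, t) :=
      (hg.contDiffAt (hΩ.mem_nhds (hsub ⟨Set.mem_singleton _, ht⟩))).differentiableAt (by simp)
    have h4 : HasFDerivAt (fun x : Space 3 => (x, t)) (ContinuousLinearMap.inl ℝ (Space 3) ℝ) x₀ :=
      hasFDerivAt_prodMk_left x₀ t
    have h5 : HasFDerivAt (fun x => g (x, t))
        ((fderiv ℝ g (x₀, t)).comp (ContinuousLinearMap.inl ℝ (Space 3) ℝ)) x₀ :=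
      HasFDerivAt.comp (g := g) x₀ h3.hasFDerivAt h4
    rw [h5.fderiv]; rfl
  have hcd : ∀ v, ContinuousOn (fun t : ℝ => fderiv ℝ (fun x => g (x, t)) x₀ v)
      (Set.Icc 0 a) := by
    intro v
    have h3 : ContinuousOn (fun t : ℝ => fderiv ℝ g (x₀, t) (v, 0)) (Set.Icc 0 a) :=
      (((hg.continuousOn_fderiv_of_isOpen hΩ (by simp)).comp (f := fun t : ℝ => (x₀, t))
        (by fun_prop) fun t ht => hsub ⟨Set.mem_singleton _, ht⟩)).clm_apply continuousOn_const
    exact h3.congr fun t ht => hdiff t ht v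
  have hi : ∀ j, IntegrableOn (fun t : ℝ => f t •
      fderiv ℝ (fun x => g (x, t)) x₀ (ee j)) (Set.Icc 0 a) := fun j =>
    hf.smul_continuousOn (hcd _) isCompact_Icc
  have hi' : ∀ j ∈ Finset.univ, IntegrableOn (fun t : ℝ => gamma j *ᵥ (f t •
      fderiv ℝ (fun x => g (x, t)) x₀ (ee j))) (Set.Icc 0 a) := fun j _ =>
    (mulVecCLM (gamma j)).integrable_comp (hi j)
  unfold diracF
  simp only [Finset.smul_sum, ← Matrix.mulVec_smul]
  rw [integral_finsetSum _ hi']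
  refine Finset.sum_congr rfl fun j _ => ?_
  rw [e1, mulVec_integral _ (hi j)]

/-- By homogeneity the kernel at `x/t - y` is `t²` times the kernel at `x - t y`. The latter point
stays away from the origin for `|y| ≤ 4` as long as `4|t| < |x|`, so the formula extends smoothly
across `t = 0`, that is, to infinity. -/
lemma newton_at_infinity {g0 : Space 3 → SpinIdx → ℂ} (hg0s : ContDiff ℝ ∞ g0)
    (hg0z : ∀ y, 4 ≤ ‖y‖ → g0 y = 0) :
    ∃ U : Space 3 × ℝ → SpinIdx → ℂ, ContDiffOn ℝ ∞ U {p | 4 * |p.2| < ‖p.1‖} ∧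
      ∀ x : Space 3, ∀ t : ℝ, 0 < t → newton g0 (t⁻¹ • x) = (t ^ 2) • U (x, t) := by
  refine ⟨fun p => ∑ j, gamma j *ᵥ
    ∫ y in Metric.closedBall 0 4, (1 : ℂ) • (ker 0 j (p.1 - p.2 • y) • g0 y), ?_, ?_⟩
  · refine ContDiffOn.sum fun j _ => contDiff_mulVec _ ?_
    refine contDiffOn_integral_compact (X := Space 3 × ℝ) (Y := Space 3)
      (Ω := {q | q.1.1 - q.1.2 • q.2 ≠ 0})
      (g := fun q : (Space 3 × ℝ) × Space 3 => ker 0 j (q.1.1 - q.1.2 • q.2) • g0 q.2) ?_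
      (isCompact_closedBall 0 4) (integrableOn_const (isCompact_closedBall _ _).measure_lt_top.ne)
      (isOpen_lt (by fun_prop) (by fun_prop)) ?_ ?_
    · exact isOpen_ne_fun (by fun_prop) (by fun_prop)
    · rintro ⟨p, y⟩ ⟨hp, hy⟩
      have hp' : 4 * |p.2| < ‖p.1‖ := hp
      have hy' : ‖y‖ ≤ 4 := by simpa using hy
      intro h0
      have h3 : p.1 = p.2 • y := sub_eq_zero.1 h0
      rw [h3, norm_smul, Real.norm_eq_abs] at hp'
      nlinarith [abs_nonneg p.2]
    · have h6 : ContDiff ℝ ∞ fun q : (Space 3 × ℝ) × Space 3 => g0 q.2 := hg0s.comp contDiff_snd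
      have hk6 : ContDiffOn ℝ ∞ (fun q : (Space 3 × ℝ) × Space 3 => ker 0 j (q.1.1 - q.1.2 • q.2))
          {q | q.1.1 - q.1.2 • q.2 ≠ 0} := by
        intro q hq
        have h3 : 0 < ‖q.1.1 - q.1.2 • q.2‖ := norm_pos_iff.2 hq
        have h4 : ContDiffAt ℝ ∞ (ker 0 j) (q.1.1 - q.1.2 • q.2) := contDiffAt_ker j (by positivity)
        have h5 : ContDiff ℝ ∞ fun q : (Space 3 × ℝ) × Space 3 => q.1.1 - q.1.2 • q.2 := by fun_prop
        exact (h4.comp q h5.contDiffAt).contDiffWithinAt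
      exact hk6.smul h6.contDiffOn
  · intro x t ht
    simp only [newton, Finset.smul_sum]
    refine Finset.sum_congr rfl fun j _ => ?_
    rw [← Matrix.mulVec_smul, ← integral_smul]
    congr 1
    rw [setIntegral_eq_integral_of_forall_compl_eq_zero]
    · have e := integral_sub_left_eq_self (fun y => ker 0 j y • g0 (t⁻¹ • x - y)) volume (t⁻¹ • x)
      rw [← e]
      refine integral_congr_ae (ae_of_all _ fun y => ?_)
      have h3 : t⁻¹ • x - y = t⁻¹ • (x - t • y) := by rw [smul_sub, inv_smul_smul₀ ht.ne']
      simp only [sub_sub_cancel]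
      rw [h3, ker_smul (by positivity), one_smul, inv_pow, inv_inv, mul_smul]
    · intro y hy
      have hy' : 4 < ‖y‖ := by simpa using hy
      simp [hg0z y hy'.le]

set_option maxHeartbeats 400000 in
/-- Surjectivity of the Dirac operator onto homogeneous spinors of degree in `(-3, -1)`. -/
lemma dirac_surjective_base {g : Sm} {lam : ℂ} (hg : R g = (lam - 1) • g)
    (h1 : -2 < lam.re) (h2 : lam.re < 0) : ∃ w : Sm, R w = lam • w ∧ GD w = g := by
  -- Up to a constant, `g` is the average over dilations of this cut-off version. The average of the
  -- dilates of a solution for `g0`, with the weight dictated by the degree, is then a homogeneous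
  -- solution for a multiple of `g`.
  set g0 : Space 3 → SpinIdx → ℂ := fun y => bump y • g.1 y with hg0
  have hg0s : ContDiff ℝ ∞ g0 := contDiff_of_zero_near (contDiff_bump.contDiffOn.smul g.2.1) one_pos
    fun y hy => by simp [hg0, bump_eq_zero_of_le hy.le]
  have hg0z : ∀ y, 4 ≤ ‖y‖ → g0 y = 0 := fun y hy => by simp [hg0, bump_eq_zero_of_ge hy]
  have hg0c : HasCompactSupport g0 := hasCompactSupport_bump.smul_right
  obtain ⟨u, hu⟩ : ∃ u, u = newton g0 := ⟨_, rfl⟩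
  have hus : ContDiff ℝ ∞ u := hu ▸ contDiff_newton hg0s hg0c
  -- the behavior of `u` at infinity
  set B : Set (Space 3 × ℝ) := {p | 4 * |p.2| < ‖p.1‖} with hB
  have hBo : IsOpen B := isOpen_lt (by fun_prop) (by fun_prop)
  obtain ⟨U, hUs, hUu⟩ := newton_at_infinity hg0s hg0z
  rw [← hu] at hUu
  -- the homogeneous solution
  set w0 : Space 3 → SpinIdx → ℂ := fun x => ∫ s in Set.Ioi (0 : ℝ), (s : ℂ) ^ (-lam - 1) • u (s • x)
    with hw0
  have hhom : ∀ x, ∀ t : ℝ, 0 < t → w0 (t • x) = (t : ℂ) ^ lam • w0 x := by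
    intro x t ht
    have htc : (t : ℂ) ≠ 0 := by exact_mod_cast ht.ne'
    have h := integral_comp_mul_left_Ioi (fun s : ℝ => (s : ℂ) ^ (-lam - 1) • u (s • x)) 0 ht
    rw [mul_zero] at h
    have h3 : ∫ s in Set.Ioi (0 : ℝ), ((t * s : ℝ) : ℂ) ^ (-lam - 1) • u ((t * s) • x)
        = (t : ℂ) ^ (-lam - 1) • w0 (t • x) := by
      rw [hw0, ← integral_smul]
      refine setIntegral_congr_fun measurableSet_Ioi fun s hs => ?_
      have hs' : 0 < s := hs
      rw [Complex.ofReal_mul, Complex.mul_cpow_ofReal_nonneg ht.le hs'.le, mul_smul, smul_smul s t x,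
        mul_comm s t]
    rw [h3] at h
    have h4 : (t : ℂ) ^ (-lam - 1) = ((t : ℂ) ^ lam)⁻¹ * (t : ℂ)⁻¹ := by
      rw [Complex.cpow_sub _ _ htc, Complex.cpow_neg, Complex.cpow_one, div_eq_mul_inv]
    have h5 : (t : ℂ) ^ lam ≠ 0 := by simp [Complex.cpow_eq_zero_iff, htc]
    have h6 := congrArg (fun v => ((t : ℂ) ^ lam * t) • v) h
    simp only [smul_smul, h4] at h6
    have h7 : (t : ℂ) ^ lam * t * (((t : ℂ) ^ lam)⁻¹ * (t : ℂ)⁻¹) = 1 := by field_simp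
    rw [h7, one_smul] at h6
    rw [h6, hw0]
    ext i
    simp only [Pi.smul_apply, Complex.real_smul, smul_eq_mul]
    push_cast
    field_simp
  have hg0h : ∀ x, x ≠ 0 → ∀ s : ℝ, 0 < s →
      (s : ℂ) ^ (-lam - 1) • (s • g0 (s • x)) = (s⁻¹ * bump (s • x)) • g.1 x := by
    intro x hx s hs
    have hsc : (s : ℂ) ≠ 0 := by exact_mod_cast hs.ne'
    rw [hg0]
    simp only
    rw [homogeneous_of_R hg hx hs]
    have h4 : (s : ℂ) ^ (-lam - 1) = ((s : ℂ) ^ lam)⁻¹ * (s : ℂ)⁻¹ := by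
      rw [Complex.cpow_sub _ _ hsc, Complex.cpow_neg, Complex.cpow_one, div_eq_mul_inv]
    have h5 : (s : ℂ) ^ lam ≠ 0 := by simp [Complex.cpow_eq_zero_iff, hsc]
    rw [h4, Complex.cpow_sub _ _ hsc, Complex.cpow_one]
    ext i
    simp only [Pi.smul_apply, Complex.real_smul, smul_eq_mul]
    push_cast
    field_simp
  -- the local analysis near a point
  have hloc : ∀ x₀ : Space 3, x₀ ≠ 0 → ContDiffAt ℝ ∞ w0 x₀ ∧
      diracF w0 x₀ = (-(massConst * bumpMass x₀)) • g.1 x₀ := by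
    intro x₀ hx₀
    set d : ℝ := ‖x₀‖ / 2 with hd
    have hdp : 0 < d := by have := norm_pos_iff.2 hx₀; positivity
    -- Here `|x₀| = 2d`, so `bump (s • x₀)` is nonzero only for `s < 2/d`, well inside `[0, a]`; and
    -- `t ≤ d/16` keeps `4t < |x|` for all `x` in `A`.
    set a : ℝ := 16 / d with ha
    have hap : 0 < a := by positivity
    set A : Set (Space 3) := {x | d < ‖x‖} with hA
    have hAo : IsOpen A := isOpen_lt (by fun_prop) (by fun_prop)
    have hx₀A : x₀ ∈ A := by
      have : d < ‖x₀‖ := by rw [hd]; linarith [norm_pos_iff.2 hx₀]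
      exact this
    have hAne : ∀ x ∈ A, x ≠ 0 := fun x hx h0 => by
      have : d < ‖x‖ := hx
      rw [h0, norm_zero] at this; linarith
    have hnear : ContDiff ℝ ∞ fun p : Space 3 × ℝ => u (p.2 • p.1) := hus.comp (by fun_prop)
    have hAB : A ×ˢ Set.Icc 0 a⁻¹ ⊆ B := by
      rintro ⟨x, t⟩ ⟨hx, ht⟩
      have hx' : d < ‖x‖ := hx
      have ht' : t ≤ a⁻¹ := ht.2
      have ht0 : 0 ≤ t := ht.1
      change 4 * |t| < ‖x‖
      rw [abs_of_nonneg ht0]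
      have : a⁻¹ = d / 16 := by rw [ha, inv_div]
      linarith
    -- The two bounds on `Re lam` enter here: `Re lam < 0` for convergence at small dilations, `Re
    -- lam > -2` for large ones.
    have hw1 : IntegrableOn (fun s : ℝ => (s : ℂ) ^ (-lam - 1)) (Set.Icc 0 a) :=
      integrableOn_cpow_Icc (by simp; linarith) a
    have hw2 : IntegrableOn (fun t : ℝ => (t : ℂ) ^ (lam + 1)) (Set.Icc 0 a⁻¹) :=
      integrableOn_cpow_Icc (by simp; linarith) _
    set near : Space 3 → SpinIdx → ℂ := fun x => ∫ s in Set.Icc 0 a, (s : ℂ) ^ (-lam - 1) • u (s • x)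
      with hn
    set far : Space 3 → SpinIdx → ℂ := fun x => ∫ t in Set.Icc 0 a⁻¹, (t : ℂ) ^ (lam + 1) • U (x, t)
      with hf
    have hns : ContDiff ℝ ∞ near := contDiffOn_univ.1 (contDiffOn_integral_compact isOpen_univ
      isCompact_Icc hw1 isOpen_univ (Set.subset_univ _) hnear.contDiffOn)
    have hfs : ContDiffOn ℝ ∞ far A := contDiffOn_integral_compact hBo isCompact_Icc hw2 hAo hAB hUs
    have hsum : ∀ x ∈ A, w0 x = near x + far x := by
      intro x hx
      refine (integral_Ioi_split_inv hap ?_ ?_ ?_).2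
      · exact hw1.smul_continuousOn (by
          have := hus.continuous; fun_prop) isCompact_Icc
      · exact hw2.smul_continuousOn (hUs.continuousOn.comp (f := fun t => (x, t)) (by fun_prop)
          fun t ht => hAB ⟨hx, ht⟩) isCompact_Icc
      · intro t ht _
        have htc : (t : ℂ) ≠ 0 := by exact_mod_cast ht.ne'
        rw [hUu x t ht]
        have h4 : ((t⁻¹ : ℝ) : ℂ) ^ (-lam - 1) = (t : ℂ) ^ (lam + 1) := by
          rw [Complex.ofReal_inv, Complex.inv_cpow _ _ (by
            rw [Complex.arg_ofReal_of_nonneg ht.le]; exact Real.pi_pos.ne), ← Complex.cpow_neg]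
          congr 1; ring
        rw [h4]
        ext i
        simp only [Pi.smul_apply, Complex.real_smul, smul_eq_mul]
        push_cast
        field_simp
    have heq : w0 =ᶠ[nhds x₀] fun x => near x + far x :=
      Filter.eventuallyEq_of_mem (hAo.mem_nhds hx₀A) hsum
    have hfx : ContDiffAt ℝ ∞ far x₀ := hfs.contDiffAt (hAo.mem_nhds hx₀A)
    refine ⟨(hns.contDiffAt.add hfx).congr_of_eventuallyEq heq, ?_⟩
    have hdn : diracF near x₀ = (-(massConst * bumpMass x₀)) • g.1 x₀ := by
      have e2 : diracF near x₀ = ∫ s in Set.Icc 0 a, (s : ℂ) ^ (-lam - 1) •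
          diracF (fun x => u (s • x)) x₀ :=
        diracF_integral_compact (g := fun p : Space 3 × ℝ => u (p.2 • p.1)) isOpen_univ
          hnear.contDiffOn hw1 (Set.subset_univ _)
      have e3 : Set.EqOn (fun s : ℝ => (s : ℂ) ^ (-lam - 1) • diracF (fun x => u (s • x)) x₀)
          (fun s => (s⁻¹ * bump (s • x₀)) • (-(massConst • g.1 x₀))) (Set.Ioc 0 a) := by
        intro s hs
        simp only
        rw [diracF_fderiv_smul, hu, diracF_newton hg0s hg0c, smul_neg, smul_neg, smul_neg,
          smul_comm s massConst, smul_comm _ massConst, hg0h x₀ hx₀ s hs.1, smul_comm]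
      rw [e2, integral_Icc_eq_integral_Ioc, setIntegral_congr_fun measurableSet_Ioc e3,
        integral_smul_const]
      have e4 : ∫ s in Set.Ioc 0 a, s⁻¹ * bump (s • x₀) = bumpMass x₀ := by
        unfold bumpMass
        refine (setIntegral_eq_of_subset_of_forall_sdiff_eq_zero measurableSet_Ioi
          Set.Ioc_subset_Ioi_self fun s hs => ?_).symm
        have hs0 : 0 < s := hs.1
        have hsa : a < s := by
          by_contra h
          exact hs.2 ⟨hs0, not_lt.1 h⟩
        rw [bump_eq_zero_of_ge, mul_zero]
        rw [norm_smul, Real.norm_of_nonneg hs0.le]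
        have : 16 / d * d = 16 := by field_simp
        have h5 : ‖x₀‖ = 2 * d := by rw [hd]; ring
        rw [h5]
        nlinarith
      rw [e4, smul_neg, smul_smul, neg_smul, mul_comm]
    -- In the far part `t⁻¹ • x₀` lies outside the support of `g0`.
    have hdf : diracF far x₀ = 0 := by
      have hsub : {x₀} ×ˢ Set.Icc 0 a⁻¹ ⊆ B :=
        (Set.prod_mono (Set.singleton_subset_iff.2 hx₀A) le_rfl).trans hAB
      have e2 : diracF far x₀ = ∫ t in Set.Icc 0 a⁻¹, (t : ℂ) ^ (lam + 1) •
          diracF (fun x => U (x, t)) x₀ := diracF_integral_compact hBo hUs hw2 hsub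
      rw [e2, integral_Icc_eq_integral_Ioc]
      refine setIntegral_eq_zero_of_forall_eq_zero fun t ht => ?_
      have h3 : (fun x => U (x, t)) = fun x => ((t : ℂ) ^ 2)⁻¹ • u (t⁻¹ • x) := by
        funext x
        have htc : (t : ℂ) ≠ 0 := by exact_mod_cast ht.1.ne'
        rw [hUu x t ht.1]
        ext i
        simp only [Pi.smul_apply, Complex.real_smul, smul_eq_mul]
        push_cast
        field_simp
      have h4 : diracF (fun x => u (t⁻¹ • x)) x₀ = 0 := by
        rw [diracF_fderiv_smul, hu, diracF_newton hg0s hg0c, hg0z, smul_zero, neg_zero, smul_zero]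
        rw [norm_smul, Real.norm_of_nonneg (by have := ht.1; positivity)]
        have h5m : (x₀, t) ∈ B := hAB (Set.mk_mem_prod hx₀A (Set.Ioc_subset_Icc_self ht))
        have h5 : 4 * |t| < ‖x₀‖ := h5m
        rw [abs_of_pos ht.1] at h5
        rw [inv_mul_eq_div, le_div_iff₀ ht.1]
        exact h5.le
      have h7 : DifferentiableAt ℝ (fun x : Space 3 => u (t⁻¹ • x)) x₀ :=
        (hus.comp (contDiff_const_smul _)).differentiable (by simp) x₀
      rw [h3, diracF_const_smul _ h7, h4, smul_zero, smul_zero]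
    have hadd : diracF w0 x₀ = diracF near x₀ + diracF far x₀ := by
      simp only [diracF, heq.fderiv_eq]
      rw [← Finset.sum_add_distrib]
      refine Finset.sum_congr rfl fun j _ => ?_
      rw [fderiv_fun_add (hns.differentiable (by simp) x₀) (hfx.differentiableAt (by simp)),
        add_apply, Matrix.mulVec_add]
    rw [hadd, hdn, hdf, add_zero]
  have hw0s : ContDiffOn ℝ ∞ w0 {0}ᶜ := fun x hx => (hloc x hx).1.contDiffWithinAt
  set c : ℝ := -(massConst * bumpMass (ee 0)) with hc
  have he0 : ee 0 ≠ 0 := by simp [ee]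
  have hc0 : (c : ℂ) ≠ 0 := by
    have := mul_pos massConst_pos (bumpMass_pos he0)
    exact_mod_cast (neg_neg_of_pos this).ne
  refine ⟨(c : ℂ)⁻¹ • cut w0 hw0s, ?_, ?_⟩
  · rw [map_smul, R_of_homogeneous (lam := lam), smul_comm]
    intro x hx t ht
    rw [cut_apply _ hx, cut_apply _ (smul_ne_zero ht.ne' hx), hhom x t ht]
  · rw [map_smul, inv_smul_eq_iff₀ hc0]
    refine Sm_ext fun x hx => ?_
    rw [GD_apply _ hx]
    have h3 : diracF (cut w0 hw0s).1 x = diracF w0 x := by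
      simp only [diracF, (cut_eventuallyEq hw0s hx).fderiv_eq]
    rw [h3, (hloc x hx).2, bumpMass_eq hx he0]
    ext i
    simp [hc]

end EdgeWave

end

/-! ### Spectrum of the operators `K` and `T` on the sphere -/

noncomputable section

namespace EdgeWave

/-- A complex number that is not a nonzero integer. -/
def NotNonzeroInt (n : ℂ) : Prop := ∀ κ : ℤ, κ ≠ 0 → n ≠ κ

lemma NotNonzeroInt.neg {n : ℂ} (h : NotNonzeroInt n) : NotNonzeroInt (-n) := fun κ hκ e =>
  h (-κ) (neg_ne_zero.2 hκ) (by push_cast; rw [← e, neg_neg])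

lemma NotNonzeroInt.sub_one {n : ℂ} (h : NotNonzeroInt n) (h0 : n ≠ 0) : NotNonzeroInt (n - 1) := by
  intro κ _ e
  have e' : n = ((κ + 1 : ℤ) : ℂ) := by push_cast; rw [← e]; ring
  by_cases hk : κ + 1 = 0
  · rw [hk] at e'; exact h0 (by simpa using e')
  · exact h _ hk e'

lemma sm_sub_smul (a b : ℂ) (u : Sm) : (a - b) • u = a • u - b • u := sub_smul a b u

lemma sm_neg_smul (a : ℂ) (u : Sm) : (-a) • u = -(a • u) := neg_smul a u

lemma pd_GD (i : Fin 3) : pd i * GD = GD * pd i := by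
  simp only [GD, Finset.mul_sum, Finset.sum_mul]
  refine Finset.sum_congr rfl fun j _ => ?_
  rw [← mul_assoc, pd_G, mul_assoc, pd_comm, mul_assoc]

lemma R_pd_apply (i : Fin 3) {w : Sm} {lam : ℂ} (hw : R w = lam • w) :
    R (pd i w) = (lam - 1) • pd i w := by
  have h := congrArg (fun a : Op => a w) (pd_R i)
  simp only [Op.mul_apply, Op.add_apply, hw, map_smul] at h
  rw [sm_sub_smul, one_smul, h]; abel

lemma R_eq_sum (w : Sm) : R w = ∑ j, X j (pd j w) := by
  simp only [R, Op.sum_apply, Op.mul_apply]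

lemma eq_zero_of_pd_eq_zero {w : Sm} {lam : ℂ} (hw : R w = lam • w) (h0 : lam ≠ 0)
    (h : ∀ j, pd j w = 0) : w = 0 := by
  have h1 : lam • w = 0 := by rw [← hw, R_eq_sum]; simp [h]
  exact (smul_eq_zero.1 h1).resolve_left h0

/-- Injectivity of the Dirac operator on spinors of degree `n - 1`. -/
def DiracInj (n : ℂ) : Prop := ∀ w : Sm, R w = (n - 1) • w → GD w = 0 → w = 0

/-- Surjectivity of the Dirac operator from spinors of degree `n - 1` to degree `n - 2`. -/
def DiracSurj (n : ℂ) : Prop := ∀ g : Sm, R g = (n - 2) • g → ∃ w : Sm, R w = (n - 1) • w ∧ GD w = g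

/-- Injectivity on spinors of degree `0`. -/
def SphereInj (A : Op) : Prop := ∀ s : Sm, R s = 0 → A s = 0 → s = 0

/-- Surjectivity on spinors of degree `0`. -/
def SphereSurj (A : Op) : Prop := ∀ g : Sm, R g = 0 → ∃ s : Sm, R s = 0 ∧ A s = g

/-- Partial derivatives commute with the Dirac operator and lower the degree by one, so those of `w`
vanish by hypothesis. Euler's identity then gives `w = 0`, the degree `n - 1` being nonzero. -/
lemma diracInj_step {n : ℂ} (h : DiracInj (n - 1)) (hn : n - 1 ≠ 0) : DiracInj n := by
  intro w hw hD
  refine eq_zero_of_pd_eq_zero hw hn fun j => h _ (R_pd_apply j hw) ?_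
  have := congrArg (fun a : Op => a w) (pd_GD j)
  simp only [Op.mul_apply, hD, map_zero] at this
  exact this.symm

/-- Solve for each derivative of `g` one degree lower. Injectivity in degree `n - 3` shows that the
solutions `w j` are curl-free, so `∑ j, X j (w j)` is `n - 1` times a common primitive. The Dirac
operator of that primitive differs from `g` by a spinor with vanishing derivatives and nonzero
degree `n - 2`, hence by zero. -/
lemma diracSurj_step {n : ℂ} (hs : DiracSurj (n - 1)) (hi : DiracInj (n - 2)) (h1 : n - 1 ≠ 0)
    (h2 : n - 2 ≠ 0) : DiracSurj n := by
  intro g hg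
  have hw : ∀ j, ∃ w, R w = (n - 1 - 1) • w ∧ GD w = pd j g := fun j => hs _ (by
    rw [R_pd_apply j hg]; congr 1; ring)
  choose w hRw hDw using hw
  have hcurl : ∀ i j, pd i (w j) = pd j (w i) := by
    intro i j
    rw [← sub_eq_zero]
    refine hi _ ?_ ?_
    · rw [map_sub, R_pd_apply i (hRw j), R_pd_apply j (hRw i), smul_sub]
      congr 2 <;> ring
    · have e : ∀ i u, GD (pd i u) = pd i (GD u) := fun i u => by
        rw [← Op.mul_apply, ← pd_GD]; rfl
      rw [map_sub, e, e, hDw, hDw, ← Op.mul_apply, ← Op.mul_apply, pd_comm, sub_self]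
  set v : Sm := ∑ j, X j (w j) with hv
  have hpv : ∀ i, pd i v = (n - 1) • w i := by
    intro i
    have e1 : ∀ j, pd i (X j (w j)) = X j (pd j (w i)) + if i = j then w i else 0 := by
      intro j
      have := congrArg (fun a : Op => a (w j)) (pd_X i j)
      simp only [Op.mul_apply, Op.add_apply] at this
      rw [this, hcurl i j]
      split_ifs with h
      · rw [h]; rfl
      · rfl
    rw [hv, map_sum]
    simp only [e1, Finset.sum_add_distrib, ← R_eq_sum, hRw, Finset.sum_ite_eq, Finset.mem_univ,
      if_true]
    rw [sm_sub_smul (n - 1), one_smul, sub_add_cancel]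
  have hRX : ∀ j, R (X j (w j)) = (n - 1) • X j (w j) := by
    intro j
    have := congrArg (fun a : Op => a (w j)) (R_X j)
    simp only [Op.mul_apply, Op.add_apply, hRw, map_smul] at this
    rw [this, sm_sub_smul (n - 1), one_smul, sub_add_cancel]
  have hRv : R v = (n - 1) • v := by
    rw [hv, map_sum, Finset.smul_sum]
    exact Finset.sum_congr rfl fun j _ => hRX j
  have hDv : GD v = (n - 1) • ∑ j, G j (w j) := by
    simp only [GD, Op.sum_apply, Op.mul_apply, hpv, map_smul, Finset.smul_sum]
  refine ⟨(n - 1)⁻¹ • v, by rw [map_smul, hRv, smul_comm], ?_⟩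
  rw [map_smul, hDv, inv_smul_smul₀ h1, ← sub_eq_zero]
  have hRh : R (∑ j, G j (w j) - g) = (n - 2) • (∑ j, G j (w j) - g) := by
    have e : ∀ j, R (G j (w j)) = (n - 2) • G j (w j) := by
      intro j
      have := congrArg (fun a : Op => a (w j)) (R_G j)
      simp only [Op.mul_apply, hRw, map_smul] at this
      rw [this]; congr 1; ring
    rw [map_sub, map_sum, hg, smul_sub, Finset.smul_sum]
    simp only [e]
  refine eq_zero_of_pd_eq_zero hRh h2 fun i => ?_
  have e : ∀ j, pd i (G j (w j)) = G j (pd j (w i)) := by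
    intro j
    rw [← Op.mul_apply, pd_G, Op.mul_apply, hcurl]
  rw [map_sub, map_sum]
  simp only [e]
  have h3 : ∑ j, G j (pd j (w i)) = GD (w i) := by simp only [GD, Op.sum_apply, Op.mul_apply]
  rw [h3, hDw, sub_self]

/-- The strip `-1 < Re n < 1` corresponds to degrees with real part in `(-2, 0)` and is the base
case. Larger `n` are lowered into it by unit steps; `n ≠ 1` provides the nonzero degree. -/
lemma diracInj_of_re {n : ℂ} (hn : NotNonzeroInt n) (h : -1 < n.re) : DiracInj n := by
  obtain ⟨k, hk⟩ := exists_nat_gt n.re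
  induction k generalizing n with
  | zero =>
    intro w hw hD
    exact dirac_injective_base hw hD (by simp; linarith) (by simp at hk ⊢; linarith)
  | succ k ih =>
    by_cases h1 : n.re < 1
    · intro w hw hD
      exact dirac_injective_base hw hD (by simp; linarith) (by simp; linarith)
    · have h0 : n ≠ 0 := fun h0 => h1 (by simp [h0])
      refine diracInj_step (ih (hn.sub_one h0) (by simp; linarith) (by push_cast at hk; simp; linarith))
        fun e => hn 1 one_ne_zero ?_
      rw [sub_eq_zero.1 e]; simp

/-- On this degree `R + 1` is the scalar `n`. This identity links the flat Dirac operator with the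
spectral problem for `K`. -/
lemma GX_GD_apply {w : Sm} {n : ℂ} (hw : R w = (n - 1) • w) : GX (GD w) = K w - n • w := by
  have : K w = GX (GD w) + R w + w := rfl
  rw [this, hw, sm_sub_smul, one_smul]; abel

lemma GX_GX_apply (w : Sm) : GX (GX w) = -rp 2 w := by
  rw [← Op.mul_apply, GX_sq]; rfl

lemma rp_rp_apply (a b : ℂ) (w : Sm) : rp a (rp b w) = rp (a + b) w := by
  rw [← Op.mul_apply, rp_mul]

lemma rp_zero_apply (w : Sm) : rp 0 w = w := by rw [rp_zero]; rfl

lemma R_rp_apply {w : Sm} {lam : ℂ} (hw : R w = lam • w) (ξ : ℂ) :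
    R (rp ξ w) = (lam + ξ) • rp ξ w := by
  have := congrArg (fun a : Op => a w) (R_rp ξ)
  simp only [Op.mul_apply, Op.add_apply, Op.smul_apply, hw, map_smul] at this
  rw [this, add_smul]

lemma rp_injective (ξ : ℂ) {w : Sm} (h : rp ξ w = 0) : w = 0 := by
  have := rp_rp_apply (-ξ) ξ w
  rw [h, map_zero, neg_add_cancel, rp_zero_apply] at this
  exact this.symm

lemma R_GX_apply {w : Sm} {lam : ℂ} (hw : R w = lam • w) : R (GX w) = (lam + 1) • GX w := by
  have := congrArg (fun a : Op => a w) R_GX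
  simp only [Op.mul_apply, Op.add_apply, hw, map_smul] at this
  rw [this, add_smul, one_smul]

lemma GX_injective {w : Sm} (h : GX w = 0) : w = 0 := by
  have := GX_GX_apply w
  rw [h, map_zero] at this
  exact rp_injective 2 (neg_eq_zero.1 this.symm)

lemma K_rp_apply (ξ : ℂ) (w : Sm) : K (rp ξ w) = rp ξ (K w) := by
  rw [← Op.mul_apply, K_rp]; rfl

/-- Multiplication by `rp (n - 1)` carries degree `0` to degree `n - 1` and commutes with `K`, and
`GX` is injective, so `GX_GD_apply` identifies the kernels. -/
lemma sphereInj_iff {n : ℂ} : SphereInj (K - n • 1) ↔ DiracInj n := by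
  constructor
  · intro h w hw hD
    have h1 := GX_GD_apply hw
    rw [hD, map_zero] at h1
    refine rp_injective (-(n - 1)) (h _ ?_ ?_)
    · rw [R_rp_apply hw, add_neg_cancel, zero_smul]
    · rw [Op.sub_apply, Op.smul_apply, Op.one_apply, K_rp_apply, ← map_smul, ← map_sub, ← h1, map_zero]
  · intro h s hs hK
    have hs' : R s = (0 : ℂ) • s := by rw [hs, zero_smul]
    have h1 : R (rp (n - 1) s) = (n - 1) • rp (n - 1) s := by rw [R_rp_apply hs', zero_add]
    refine rp_injective (n - 1) (h _ h1 (GX_injective ?_))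
    have hK' : K s - n • s = 0 := hK
    rw [GX_GD_apply h1, K_rp_apply, ← map_smul, ← map_sub, hK', map_zero]

lemma sphereSurj_of_diracSurj {n : ℂ} (h : DiracSurj n) : SphereSurj (K - n • 1) := by
  intro g hg
  have hg' : R g = (0 : ℂ) • g := by rw [hg, zero_smul]
  have h1 : R (rp (-2) (GX (rp (n - 1) g))) = (n - 2) • rp (-2) (GX (rp (n - 1) g)) := by
    rw [R_rp_apply (R_GX_apply (R_rp_apply hg' _))]; congr 1; ring
  obtain ⟨w, hw, hD⟩ := h _ h1
  refine ⟨-rp (-(n - 1)) w, ?_, ?_⟩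
  · rw [map_neg, R_rp_apply hw, add_neg_cancel, zero_smul, neg_zero]
  · have h2 := GX_GD_apply hw
    have e : ∀ u, GX (rp (-2) u) = rp (-2) (GX u) := fun u => by
      rw [← Op.mul_apply, ← rp_GX]; rfl
    rw [hD, e, GX_GX_apply, map_neg, rp_rp_apply, neg_add_cancel, rp_zero_apply] at h2
    rw [Op.sub_apply, Op.smul_apply, Op.one_apply, map_neg, K_rp_apply, smul_neg, sub_neg_eq_add,
      ← map_smul, neg_add_eq_sub, ← neg_sub, ← map_sub, ← h2, map_neg, neg_neg, rp_rp_apply,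
      neg_add_cancel, rp_zero_apply]

/-- Clifford multiplication by `x / |x|`. -/
def unitGX : Op := rp (-1) * GX

lemma unitGX_sq (s : Sm) : unitGX (unitGX s) = -s := by
  have e : ∀ u, GX (rp (-1) u) = rp (-1) (GX u) := fun u => by
    rw [← Op.mul_apply, ← rp_GX]; rfl
  simp only [unitGX, Op.mul_apply]
  rw [e, GX_GX_apply, map_neg, map_neg, rp_rp_apply, rp_rp_apply]
  norm_num [rp_zero_apply]

lemma K_unitGX (s : Sm) : K (unitGX s) = -unitGX (K s) := by
  simp only [unitGX, Op.mul_apply]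
  rw [K_rp_apply, ← Op.mul_apply K GX, K_GX]
  simp

lemma R_unitGX {s : Sm} (hs : R s = 0) : R (unitGX s) = 0 := by
  have hs' : R s = (0 : ℂ) • s := by rw [hs, zero_smul]
  simp only [unitGX, Op.mul_apply]
  rw [R_rp_apply (R_GX_apply hs')]
  norm_num

/-- Unit Clifford multiplication is invertible, preserves degree `0` and anticommutes with `K`, so
the spectrum of `K` is symmetric about `0`. -/
lemma sphereInj_neg {n : ℂ} (h : SphereInj (K - n • 1)) : SphereInj (K - (-n) • 1) := by
  intro s hs hK
  have hK' : K s - (-n) • s = 0 := hK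
  have : unitGX s = 0 := h _ (R_unitGX hs) (by
    rw [Op.sub_apply, Op.smul_apply, Op.one_apply, K_unitGX, sub_eq_zero.1 hK', map_smul, sm_neg_smul,
      neg_neg, sub_self])
  have h2 := unitGX_sq s
  rw [this, map_zero] at h2
  exact neg_eq_zero.1 h2.symm

lemma sphereSurj_neg {n : ℂ} (h : SphereSurj (K - n • 1)) : SphereSurj (K - (-n) • 1) := by
  intro g hg
  obtain ⟨s, hs, hK⟩ := h _ (R_unitGX hg)
  have hK' : K s - n • s = unitGX g := hK
  refine ⟨unitGX s, R_unitGX hs, ?_⟩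
  rw [Op.sub_apply, Op.smul_apply, Op.one_apply, K_unitGX, sm_neg_smul, sub_neg_eq_add, ← map_smul,
    neg_add_eq_sub, ← neg_sub, ← map_sub, hK', unitGX_sq, neg_neg]

lemma sphereInj_K {n : ℂ} (hn : NotNonzeroInt n) : SphereInj (K - n • 1) := by
  rcases le_or_gt 0 n.re with h | h
  · exact sphereInj_iff.2 (diracInj_of_re hn (by linarith))
  · rw [← neg_neg n]
    exact sphereInj_neg (sphereInj_iff.2 (diracInj_of_re hn.neg (by simp; linarith)))

/-- The detour through the sphere and its reflection removes the restriction `-1 < Re n`.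
Surjectivity needs this: when `Re n = 1`, `diracSurj_step` invokes injectivity at `n - 2`, of real
part `-1`. -/
lemma diracInj_of_notNonzeroInt {n : ℂ} (hn : NotNonzeroInt n) : DiracInj n :=
  sphereInj_iff.1 (sphereInj_K hn)

lemma diracSurj_of_re {n : ℂ} (hn : NotNonzeroInt n) (h : -1 < n.re) : DiracSurj n := by
  obtain ⟨k, hk⟩ := exists_nat_gt n.re
  have base : ∀ {n : ℂ}, -1 < n.re → n.re < 1 → DiracSurj n := fun {n} h1 h2 g hg =>
    dirac_surjective_base (by rw [hg]; congr 1; ring) (by simp; linarith) (by simp; linarith)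
  induction k generalizing n with
  | zero => exact base h (by simp at hk; linarith)
  | succ k ih =>
    by_cases h1 : n.re < 1
    · exact base h h1
    · have h0 : n ≠ 0 := fun h0 => h1 (by simp [h0])
      have e1 : n ≠ 1 := fun e => hn 1 one_ne_zero (by rw [e]; simp)
      have e2 : n ≠ 2 := fun e => hn 2 two_ne_zero (by rw [e]; simp)
      have h3 := hn.sub_one h0
      have h4 := h3.sub_one (sub_ne_zero.2 e1)
      refine diracSurj_step (ih h3 (by simp; linarith) (by push_cast at hk; simp; linarith))
        ?_ (sub_ne_zero.2 e1) (sub_ne_zero.2 e2)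
      rw [show n - 2 = n - 1 - 1 by ring]
      exact diracInj_of_notNonzeroInt h4

lemma sphereSurj_K {n : ℂ} (hn : NotNonzeroInt n) : SphereSurj (K - n • 1) := by
  rcases le_or_gt 0 n.re with h | h
  · exact sphereSurj_of_diracSurj (diracSurj_of_re hn (by linarith))
  · rw [← neg_neg n]
    exact sphereSurj_neg (sphereSurj_of_diracSurj (diracSurj_of_re hn.neg (by simp; linarith)))

lemma SphereInj.mul {A B : Op} (hA : SphereInj A) (hB : SphereInj B) (hRB : R * B = B * R) :
    SphereInj (A * B) := by
  intro s hs h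
  refine hB s hs (hA _ ?_ h)
  rw [← Op.mul_apply, hRB, Op.mul_apply, hs, map_zero]

lemma SphereSurj.mul {A B : Op} (hA : SphereSurj A) (hB : SphereSurj B) : SphereSurj (A * B) := by
  intro g hg
  obtain ⟨s, hs, rfl⟩ := hA g hg
  obtain ⟨t, ht, rfl⟩ := hB s hs
  exact ⟨t, ht, rfl⟩

lemma SphereInj.of_mul {A B : Op} (h : SphereInj (A * B)) : SphereInj B := by
  intro s hs hB
  exact h s hs (by rw [Op.mul_apply, hB, map_zero])

lemma SphereSurj.of_mul {A B : Op} (h : SphereSurj (A * B)) (hRB : R * B = B * R) : SphereSurj A := by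
  intro g hg
  obtain ⟨s, hs, h⟩ := h g hg
  exact ⟨B s, by rw [← Op.mul_apply, hRB, Op.mul_apply, hs, map_zero], h⟩

lemma R_mul_sub_smul {A : Op} (h : R * A = A * R) (c : ℂ) : R * (A - c • 1) = (A - c • 1) * R := by
  rw [mul_sub, sub_mul, h, mul_smul_comm, smul_mul_assoc, mul_one, one_mul]

lemma sub_smul_mul_add_smul (A : Op) (c : ℂ) : (A - c • 1) * (A - (-c) • 1) = A * A - (c ^ 2) • 1 := by
  simp only [neg_smul, sub_neg_eq_add, sub_mul, mul_add, mul_smul_comm, smul_mul_assoc, mul_one,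
    one_mul, pow_two, smul_sub, mul_smul]
  abel

/-- With `n² = ν² + z²`, `T_sq` gives `(K - n)(K + n) = (T - ν)(T + ν)`, where `n` is not a nonzero
integer and so the left side is invertible. As a right factor `T - ν` inherits injectivity, as a
left factor surjectivity. -/
lemma sphere_T {z : ℝ} {ν : ℂ} (h : ∀ κ : ℤ, κ ≠ 0 → ν ^ 2 + (z : ℂ) ^ 2 ≠ (κ : ℂ) ^ 2) :
    SphereInj (T z - ν • 1) ∧ SphereSurj (T z - ν • 1) := by
  obtain ⟨n, hn⟩ := IsAlgClosed.exists_pow_nat_eq (ν ^ 2 + (z : ℂ) ^ 2) (n := 2) two_pos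
  have hnn : NotNonzeroInt n := fun κ hκ e => h κ hκ (by rw [← hn, e])
  have e1 : (K - n • 1) * (K - (-n) • 1) = (T z - ν • 1) * (T z - (-ν) • 1) := by
    rw [sub_smul_mul_add_smul, sub_smul_mul_add_smul, T_sq, hn, add_smul]; abel
  have e2 : (K - n • 1) * (K - (-n) • 1) = (T z - (-ν) • 1) * (T z - ν • 1) := by
    have := sub_smul_mul_add_smul (T z) (-ν)
    rw [neg_neg] at this
    rw [this, sub_smul_mul_add_smul, T_sq, hn, neg_sq, add_smul]; abel
  have hi := (sphereInj_K hnn).mul (sphereInj_K hnn.neg) (R_mul_sub_smul R_K _)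
  have hs := (sphereSurj_K hnn).mul (sphereSurj_K hnn.neg)
  rw [e2] at hi
  rw [e1] at hs
  exact ⟨hi.of_mul, hs.of_mul (R_mul_sub_smul (R_T z) _)⟩

end EdgeWave

end

/-! ### Laplace transforms and oscillatory integrals of symbols -/

noncomputable section

namespace EdgeWave
open MeasureTheory Filter Topology

/-- Continuous functions on `(0, ∞)` with power bounds at both ends. -/
def PowerBdd (β C : ℝ) (g : ℝ → ℂ) : Prop :=
  ContinuousOn g (Set.Ioi 0) ∧ ∃ K, ∀ r, 0 < r → ‖g r‖ ≤ K * (r ^ β + r ^ C)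

/-- The Laplace transform. -/
def lap (g : ℝ → ℂ) (P : ℂ) : ℂ := ∫ r in Set.Ioi (0 : ℝ), Complex.exp (-P * r) * g r

lemma norm_exp_neg_mul (P : ℂ) (r : ℝ) : ‖Complex.exp (-P * r)‖ = Real.exp (-P.re * r) := by
  rw [Complex.norm_exp]; simp

lemma integrableOn_rpow_exp {β a : ℝ} (hβ : -1 < β) (ha : 0 < a) :
    IntegrableOn (fun r : ℝ => r ^ β * Real.exp (-a * r)) (Set.Ioi 0) := by
  simpa using integrableOn_rpow_mul_exp_neg_mul_rpow (p := 1) hβ one_pos ha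

lemma integrableOn_power_exp {β C a : ℝ} (hβ : -1 < β) (hC : -1 < C) (ha : 0 < a) (K : ℝ) :
    IntegrableOn (fun r : ℝ => Real.exp (-a * r) * (K * (r ^ β + r ^ C))) (Set.Ioi 0) := by
  have h : IntegrableOn (fun r : ℝ => K * (r ^ β * Real.exp (-a * r) + r ^ C * Real.exp (-a * r)))
      (Set.Ioi 0) :=
    ((integrableOn_rpow_exp hβ ha).add (integrableOn_rpow_exp hC ha)).const_mul K
  exact h.congr_fun (fun r _ => by ring) measurableSet_Ioi

lemma PowerBdd.aestronglyMeasurable {β C : ℝ} {g : ℝ → ℂ} (hg : PowerBdd β C g) (P : ℂ) :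
    AEStronglyMeasurable (fun r : ℝ => Complex.exp (-P * r) * g r)
      (volume.restrict (Set.Ioi 0)) := by
  refine ContinuousOn.aestronglyMeasurable (ContinuousOn.mul ?_ hg.1) measurableSet_Ioi
  exact Continuous.continuousOn (by fun_prop)

lemma PowerBdd.integrable {β C : ℝ} {g : ℝ → ℂ} (hg : PowerBdd β C g) (hβ : -1 < β) (hC : -1 < C)
    {P : ℂ} (hP : 0 < P.re) :
    IntegrableOn (fun r : ℝ => Complex.exp (-P * r) * g r) (Set.Ioi 0) := by
  obtain ⟨K, hK⟩ := hg.2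
  refine (integrableOn_power_exp hβ hC hP K).mono' (hg.aestronglyMeasurable P) ?_
  refine (ae_restrict_iff' measurableSet_Ioi).2 (ae_of_all _ fun r hr => ?_)
  rw [norm_mul, norm_exp_neg_mul]
  exact mul_le_mul_of_nonneg_left (hK r hr) (Real.exp_nonneg _)

lemma PowerBdd.mul_id {β C : ℝ} {g : ℝ → ℂ} (hg : PowerBdd β C g) :
    PowerBdd (β + 1) (C + 1) fun r => r * g r := by
  obtain ⟨K, hK⟩ := hg.2
  refine ⟨ContinuousOn.mul (Continuous.continuousOn (by fun_prop)) hg.1, K, fun r hr => ?_⟩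
  rw [norm_mul, Complex.norm_real, Real.norm_of_nonneg hr.le, Real.rpow_add_one hr.ne',
    Real.rpow_add_one hr.ne']
  nlinarith [mul_le_mul_of_nonneg_left (hK r hr) hr.le]

lemma PowerBdd.hasDerivAt_lap {β C : ℝ} {g : ℝ → ℂ} (hg : PowerBdd β C g) (hβ : -1 < β)
    (hC : -1 < C) {P : ℂ} (hP : 0 < P.re) :
    HasDerivAt (lap g) (-lap (fun r => r * g r) P) P := by
  obtain ⟨K, hK⟩ := hg.mul_id.2
  have hs : {Q : ℂ | P.re / 2 < Q.re} ∈ 𝓝 P :=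
    (isOpen_lt continuous_const Complex.continuous_re).mem_nhds (by
      change P.re / 2 < P.re; linarith)
  have h := hasDerivAt_integral_of_dominated_loc_of_deriv_le (μ := volume.restrict (Set.Ioi (0 : ℝ)))
    (F := fun Q r => Complex.exp (-Q * r) * g r)
    (F' := fun Q r => -(Complex.exp (-Q * r) * (r * g r)))
    (bound := fun r => Real.exp (-(P.re / 2) * r) * (K * (r ^ (β + 1) + r ^ (C + 1)))) hs
    (Eventually.of_forall fun Q => hg.aestronglyMeasurable Q) (hg.integrable hβ hC hP)
    (hg.mul_id.aestronglyMeasurable P).neg ?_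
    (integrableOn_power_exp (by linarith) (by linarith) (by linarith) K) ?_
  · have h2 := h.2
    rw [integral_neg] at h2
    exact h2
  · refine (ae_restrict_iff' measurableSet_Ioi).2 (ae_of_all _ fun r hr Q hQ => ?_)
    have hr' : 0 < r := hr
    have hQ' : P.re / 2 < Q.re := hQ
    rw [norm_neg, norm_mul, norm_exp_neg_mul]
    refine mul_le_mul (Real.exp_le_exp.2 ?_) (hK r hr) (norm_nonneg _) (Real.exp_nonneg _)
    nlinarith
  · refine ae_of_all _ fun r Q _ => ?_
    have h1 : HasDerivAt (fun Q : ℂ => -Q * r) (-1 * r) Q := (hasDerivAt_id Q).neg.mul_const _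
    have h2 := (h1.cexp).mul_const (g r)
    refine h2.congr_deriv ?_
    simp only [neg_mul, one_mul, mul_neg]; ring

/-- Injectivity of the Laplace transform. -/
lemma PowerBdd.eq_zero_of_lap_eq_zero {β C : ℝ} {g : ℝ → ℂ} (hg : PowerBdd β C g) (hβ : -1 < β)
    (hC : -1 < C) (h : ∀ P : ℂ, P.re = 1 → lap g P = 0) {r : ℝ} (hr : 0 < r) : g r = 0 := by
  set f : ℝ → ℂ := (Set.Ioi 0).indicator fun r => Complex.exp (-(1 : ℂ) * r) * g r with hf
  have hfi : Integrable f :=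
    (integrable_indicator_iff measurableSet_Ioi).2 (hg.integrable hβ hC (by simp))
  -- On the line `Re P = 1` the Laplace transform is the Fourier transform of `exp (-r) g r`;
  -- Fourier inversion holds at points of continuity.
  have hF : FourierTransform.fourier f = 0 := by
    funext w
    rw [Real.fourier_eq']
    have h1 := h (1 + 2 * Real.pi * w * Complex.I) (by simp)
    rw [lap, ← integral_indicator measurableSet_Ioi] at h1
    rw [Pi.zero_apply, ← h1]
    refine integral_congr_ae (ae_of_all _ fun v => ?_)
    simp only [hf, Set.indicator_apply]
    split_ifs
    · rw [smul_eq_mul, ← mul_assoc, ← Complex.exp_add]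
      congr 2
      simp; ring
    · simp
  have hc : ContinuousAt f r := by
    have h1 : ContinuousAt (fun r : ℝ => Complex.exp (-(1 : ℂ) * r) * g r) r :=
      ContinuousAt.mul (by fun_prop) (hg.1.continuousAt (Ioi_mem_nhds hr))
    refine h1.congr ?_
    filter_upwards [Ioi_mem_nhds hr] with s hs
    rw [hf, Set.indicator_of_mem hs]
  have h2 := hfi.fourierInv_fourier_eq (by rw [hF]; exact integrable_zero _ _ _) hc
  rw [hF, Real.fourierInv_eq] at h2
  simp only [Pi.zero_apply, smul_zero, integral_zero] at h2
  rw [hf, Set.indicator_of_mem (show r ∈ Set.Ioi 0 from hr)] at h2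
  exact (mul_eq_zero.1 h2.symm).resolve_left (Complex.exp_ne_zero _)

/-- Functions that are symbols of some order, with a record of all derivatives along `r d/dr`. -/
def IsRadialSymbol (ψ : ℕ → ℝ → ℂ) (C : ℝ) : Prop :=
  (∀ (j : ℕ) (r : ℝ), 0 < r → HasDerivAt (ψ j) ((r : ℂ)⁻¹ * ψ (j + 1) r) r) ∧
    ∀ j : ℕ, ∃ K : ℝ, ∀ r : ℝ, 1 ≤ r → ‖ψ j r‖ ≤ K * r ^ C

/-- The derivatives of `r ^ ρ ψ`, up to the factors `r ^ (ρ - j)`. -/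
def symbolDeriv (ρ : ℂ) (ψ : ℕ → ℝ → ℂ) : ℕ → ℕ → ℝ → ℂ
  | 0, k, r => ψ k r
  | j + 1, k, r => (ρ - j) * symbolDeriv ρ ψ j k r + symbolDeriv ρ ψ j (k + 1) r

lemma IsRadialSymbol.symbolDeriv {ψ : ℕ → ℝ → ℂ} {C : ℝ} (h : IsRadialSymbol ψ C) (ρ : ℂ) (j : ℕ) :
    IsRadialSymbol (symbolDeriv ρ ψ j) C := by
  induction j with
  | zero => exact h
  | succ j ih =>
    refine ⟨fun k r hr => ?_, fun k => ?_⟩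
    · have := ((ih.1 k r hr).const_mul (ρ - j)).add (ih.1 (k + 1) r hr)
      refine this.congr_deriv ?_
      simp only [EdgeWave.symbolDeriv]; ring
    · obtain ⟨K1, h1⟩ := ih.2 k
      obtain ⟨K2, h2⟩ := ih.2 (k + 1)
      refine ⟨‖ρ - j‖ * K1 + K2, fun r hr => ?_⟩
      simp only [EdgeWave.symbolDeriv]
      refine (norm_add_le _ _).trans ?_
      rw [norm_mul, add_mul, mul_assoc]
      exact add_le_add (mul_le_mul_of_nonneg_left (h1 r hr) (norm_nonneg _)) (h2 r hr)

lemma hasDerivAt_ofReal_cpow {r : ℝ} (hr : 0 < r) (ρ : ℂ) :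
    HasDerivAt (fun y : ℝ => (y : ℂ) ^ ρ) ((r : ℂ)⁻¹ * (ρ * (r : ℂ) ^ ρ)) r := by
  have hrc : (r : ℂ) ≠ 0 := by exact_mod_cast hr.ne'
  have h2 := ((hasDerivAt_id (r : ℂ)).cpow_const (c := ρ) (Or.inl (by simpa using hr))).comp_ofReal
  refine h2.congr_deriv ?_
  simp only [id]
  rw [Complex.cpow_sub _ _ hrc, Complex.cpow_one]; field_simp

lemma norm_ofReal_cpow {r : ℝ} (hr : 0 < r) (ρ : ℂ) : ‖(r : ℂ) ^ ρ‖ = r ^ ρ.re :=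
  Complex.norm_cpow_eq_rpow_re_of_pos hr ρ

/-- Bound for oscillatory integrals of symbols, uniform up to the oscillatory limit. -/
lemma oscillatory_bound {ψ : ℕ → ℝ → ℂ} {C : ℝ} (h : IsRadialSymbol ψ C) (ρ : ℂ) {τ : ℝ}
    (hτ : τ ≠ 0) :
    ∃ M, ∀ ε : ℝ, 0 < ε →
      ‖∫ r in Set.Ioi (1 : ℝ), Complex.exp ((-ε + τ * Complex.I) * r) * ((r : ℂ) ^ ρ * ψ 0 r)‖ ≤ M := by
  set I : ℕ → ℝ → ℂ := fun j ε => ∫ r in Set.Ioi (1 : ℝ), Complex.exp ((-ε + τ * Complex.I) * r) *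
    ((r : ℂ) ^ (ρ - j) * symbolDeriv ρ ψ j 0 r) with hI
  have hnorm : ∀ ε r : ℝ, ‖Complex.exp ((-ε + τ * Complex.I) * r)‖ = Real.exp (-ε * r) := by
    intro ε r; rw [Complex.norm_exp]; simp
  have hd : ∀ (j : ℕ) (r : ℝ), 0 < r → HasDerivAt (fun r : ℝ => (r : ℂ) ^ (ρ - j) * symbolDeriv ρ ψ j 0 r)
      ((r : ℂ) ^ (ρ - (j + 1 : ℕ)) * symbolDeriv ρ ψ (j + 1) 0 r) r := by
    intro j r hr
    have hrc : (r : ℂ) ≠ 0 := by exact_mod_cast hr.ne'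
    have := (hasDerivAt_ofReal_cpow hr (ρ - j)).mul ((h.symbolDeriv ρ j).1 0 r hr)
    refine this.congr_deriv ?_
    simp only [symbolDeriv]
    rw [show ρ - (j + 1 : ℕ) = ρ - j - 1 by push_cast; ring,
      Complex.cpow_sub (ρ - j) _ hrc, Complex.cpow_one]
    field_simp
  have hb : ∀ j : ℕ, ∃ K : ℝ, ∀ r : ℝ, 1 ≤ r → ‖(r : ℂ) ^ (ρ - j) * symbolDeriv ρ ψ j 0 r‖ ≤
      K * r ^ (ρ.re + C - j) := by
    intro j
    obtain ⟨K, hK⟩ := (h.symbolDeriv ρ j).2 0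
    refine ⟨K, fun r hr => ?_⟩
    have hr0 : 0 < r := by linarith
    rw [norm_mul, norm_ofReal_cpow hr0, show ρ.re + C - j = (ρ - j).re + C by simp; ring,
      Real.rpow_add hr0]
    nlinarith [mul_le_mul_of_nonneg_left (hK r hr) (Real.rpow_nonneg hr0.le (ρ - j).re)]
  have hcont : ∀ (j : ℕ) (ε : ℝ), ContinuousOn (fun r : ℝ => Complex.exp ((-ε + τ * Complex.I) * r) *
      ((r : ℂ) ^ (ρ - j) * symbolDeriv ρ ψ j 0 r)) (Set.Ioi 0) := by
    intro j ε
    refine ContinuousOn.mul (Continuous.continuousOn (by fun_prop)) fun r hr =>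
      (hd j r hr).continuousAt.continuousWithinAt
  have hsub : Set.Ioi (1 : ℝ) ⊆ Set.Ioi 0 := Set.Ioi_subset_Ioi zero_le_one
  have hmeas : ∀ (j : ℕ) (ε : ℝ), AEStronglyMeasurable (fun r : ℝ => Complex.exp ((-ε + τ * Complex.I) * r) *
      ((r : ℂ) ^ (ρ - j) * symbolDeriv ρ ψ j 0 r)) (volume.restrict (Set.Ioi 1)) := fun j ε =>
    ((hcont j ε).mono hsub).aestronglyMeasurable measurableSet_Ioi
  have hint : ∀ (j : ℕ) (ε : ℝ), 0 < ε → IntegrableOn (fun r : ℝ => Complex.exp ((-ε + τ * Complex.I) * r) *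
      ((r : ℂ) ^ (ρ - j) * symbolDeriv ρ ψ j 0 r)) (Set.Ioi 1) := by
    intro j ε hε
    obtain ⟨K, hK⟩ := hb j
    have h1 : IntegrableOn (fun r : ℝ => |K| * (r ^ (max 0 (ρ.re + C - j)) * Real.exp (-ε * r)))
        (Set.Ioi 0) := (integrableOn_rpow_exp (β := max 0 (ρ.re + C - j))
      (lt_of_lt_of_le (by norm_num) (le_max_left 0 _)) hε).const_mul |K|
    refine Integrable.mono' (h1.mono_set hsub) (hmeas j ε) ?_
    refine (ae_restrict_iff' measurableSet_Ioi).2 (ae_of_all _ fun r hr => ?_)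
    have hr1 : 1 < r := hr
    rw [norm_mul, hnorm]
    have h2 : K * r ^ (ρ.re + C - j) ≤ |K| * r ^ (max 0 (ρ.re + C - j)) :=
      mul_le_mul (le_abs_self K) (Real.rpow_le_rpow_of_exponent_le hr1.le (le_max_right _ _))
        (Real.rpow_nonneg (by linarith) _) (abs_nonneg _)
    nlinarith [mul_le_mul_of_nonneg_left ((hK r hr1.le).trans h2) (Real.exp_nonneg (-ε * r))]
  -- One integration by parts: it divides by `-ε + iτ`, whose modulus is at least `|τ|` for every
  -- `ε`, and lowers the order of the amplitude by one.
  have hstep : ∀ j : ℕ, (∃ M, ∀ ε : ℝ, 0 < ε → ‖I (j + 1) ε‖ ≤ M) → ∃ M, ∀ ε : ℝ, 0 < ε → ‖I j ε‖ ≤ M := by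
    rintro j ⟨M, hM⟩
    obtain ⟨K, hK⟩ := hb j
    refine ⟨(|K| + M) / |τ|, fun ε hε => ?_⟩
    set q : ℂ := -ε + τ * Complex.I with hq
    have hqn : |τ| ≤ ‖q‖ := by
      have := Complex.abs_im_le_norm q
      simpa [hq] using this
    have hq0 : 0 < ‖q‖ := (abs_pos.2 hτ).trans_le hqn
    have hparts := integral_Ioi_of_hasDerivAt_of_tendsto (a := 1) (m := 0)
      (f := fun r : ℝ => Complex.exp (q * r) * ((r : ℂ) ^ (ρ - j) * symbolDeriv ρ ψ j 0 r))
      (f' := fun r : ℝ => q * (Complex.exp (q * r) * ((r : ℂ) ^ (ρ - j) * symbolDeriv ρ ψ j 0 r)) +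
        Complex.exp (q * r) * ((r : ℂ) ^ (ρ - (j + 1 : ℕ)) * symbolDeriv ρ ψ (j + 1) 0 r))
      (((hcont j ε).continuousAt (Ioi_mem_nhds one_pos)).continuousWithinAt) ?_
      (((hint j ε hε).const_mul q).add (hint (j + 1) ε hε)) ?_
    · rw [integral_add ((hint j ε hε).const_mul q) (hint (j + 1) ε hε), integral_const_mul] at hparts
      have h1 : q * I j ε = -(Complex.exp (q * (1 : ℝ)) * (((1 : ℝ) : ℂ) ^ (ρ - j) *
          symbolDeriv ρ ψ j 0 1)) - I (j + 1) ε := by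
        rw [← sub_eq_zero, ← sub_eq_zero.2 hparts]
        simp only [hI]
        ring
      have h2 : ‖q‖ * ‖I j ε‖ ≤ |K| + M := by
        rw [← norm_mul, h1]
        refine (norm_sub_le _ _).trans (add_le_add ?_ (hM ε hε))
        rw [norm_neg, norm_mul, hnorm]
        have h3 := hK 1 le_rfl
        rw [Real.one_rpow, mul_one] at h3
        calc Real.exp (-ε * 1) * _ ≤ 1 * K := mul_le_mul (Real.exp_le_one_iff.2 (by linarith)) h3
              (norm_nonneg _) zero_le_one
          _ ≤ |K| := by rw [one_mul]; exact le_abs_self K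
      rw [le_div_iff₀ (abs_pos.2 hτ)]
      nlinarith [norm_nonneg (I j ε)]
    · intro r hr
      have hr0 : 0 < r := hsub hr
      have h1 : HasDerivAt (fun r : ℝ => q * (r : ℂ)) (q * 1) r :=
        (Complex.ofRealCLM.hasDerivAt (x := r)).const_mul q
      have := h1.cexp.mul (hd j r hr0)
      refine this.congr_deriv ?_
      ring
    · refine squeeze_zero_norm' ?_ (by
        simpa only [mul_zero] using
          (tendsto_rpow_mul_exp_neg_mul_atTop_nhds_zero (ρ.re + C - j) ε hε).const_mul |K|)
      filter_upwards [eventually_ge_atTop 1] with r hr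
      rw [norm_mul, hnorm]
      have h2 := hK r hr
      have h3 : K * r ^ (ρ.re + C - j) ≤ |K| * r ^ (ρ.re + C - j) :=
        mul_le_mul_of_nonneg_right (le_abs_self K) (Real.rpow_nonneg (by linarith) _)
      nlinarith [mul_le_mul_of_nonneg_left (h2.trans h3) (Real.exp_nonneg (-ε * r))]
  -- After `J` integrations by parts the amplitude decays faster than `1/r`, so the integral
  -- converges absolutely, uniformly in `ε`.
  obtain ⟨J, hJ⟩ := exists_nat_gt (ρ.re + C + 1)
  have hbase : ∃ M, ∀ ε : ℝ, 0 < ε → ‖I J ε‖ ≤ M := by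
    obtain ⟨K, hK⟩ := hb J
    refine ⟨∫ r in Set.Ioi (1 : ℝ), |K| * r ^ (ρ.re + C - J), fun ε hε => ?_⟩
    refine norm_integral_le_of_norm_le
      ((integrableOn_Ioi_rpow_of_lt (by linarith) one_pos).const_mul _) ?_
    refine (ae_restrict_iff' measurableSet_Ioi).2 (ae_of_all _ fun r hr => ?_)
    have hr1 : 1 < r := hr
    rw [norm_mul, hnorm]
    have h3 : K * r ^ (ρ.re + C - J) ≤ |K| * r ^ (ρ.re + C - J) :=
      mul_le_mul_of_nonneg_right (le_abs_self K) (Real.rpow_nonneg (by linarith) _)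
    have h4 : Real.exp (-ε * r) ≤ 1 := Real.exp_le_one_iff.2 (by nlinarith)
    calc _ ≤ 1 * (|K| * r ^ (ρ.re + C - J)) :=
          mul_le_mul h4 ((hK r hr1.le).trans h3) (norm_nonneg _) zero_le_one
      _ = _ := one_mul _
  have hall : ∀ k : ℕ, k ≤ J → ∃ M, ∀ ε : ℝ, 0 < ε → ‖I (J - k) ε‖ ≤ M := by
    intro k
    induction k with
    | zero => exact fun _ => hbase
    | succ k ih =>
      intro hk
      refine hstep _ ?_
      rw [show J - (k + 1) + 1 = J - k by omega]
      exact ih (by omega)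
  have h0 := hall J le_rfl
  rw [Nat.sub_self] at h0
  obtain ⟨M, hM⟩ := h0
  refine ⟨M, fun ε hε => ?_⟩
  have := hM ε hε
  simp only [hI, symbolDeriv, Nat.cast_zero, sub_zero] at this
  exact this

end EdgeWave

end

/-! ### Uniqueness for the radial equation -/

noncomputable section

namespace EdgeWave
open MeasureTheory Filter Topology

/-- Solutions of the radial equation `(r d/dr)² φ + (r d/dr) φ = (ρ² - ρ + 2zσr - σ²r²) φ`. -/
structure IsRadialSolution (ρ σ z : ℂ) (φ₀ φ₁ : ℝ → ℂ) : Prop where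
  deriv_zero : ∀ r : ℝ, 0 < r → HasDerivAt φ₀ ((r : ℂ)⁻¹ * φ₁ r) r
  deriv_one : ∀ r : ℝ, 0 < r → HasDerivAt φ₁ ((r : ℂ)⁻¹ *
    ((ρ ^ 2 - ρ + 2 * z * σ * r - σ ^ 2 * r ^ 2) * φ₀ r - φ₁ r)) r

/-- The bound `r ^ β + r ^ C` is required on the whole half-line, so the exponent for infinity is
made nonnegative to be harmless at the origin. -/
lemma powerBdd_cpow_mul {φ : ℝ → ℂ} {ρ : ℂ} {w C K K' : ℝ} (hφ : ContinuousOn φ (Set.Ioi 0))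
    (h0 : ∀ r, 0 < r → r ≤ 1 → ‖φ r‖ ≤ K * r ^ w) (h1 : ∀ r, 1 ≤ r → ‖φ r‖ ≤ K' * r ^ C) :
    PowerBdd (ρ.re + w) (max 0 (ρ.re + C)) fun r => (r : ℂ) ^ ρ * φ r := by
  refine ⟨ContinuousOn.mul (fun r hr => (hasDerivAt_ofReal_cpow hr ρ).continuousAt.continuousWithinAt)
    hφ, |K| + |K'|, fun r hr => ?_⟩
  have hr' : 0 < r := hr
  rw [norm_mul, norm_ofReal_cpow hr']
  have p1 := Real.rpow_nonneg hr'.le (ρ.re + w)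
  have p2 := Real.rpow_nonneg hr'.le (max 0 (ρ.re + C))
  have p3 := Real.rpow_nonneg hr'.le ρ.re
  rcases le_or_gt r 1 with h | h
  · calc r ^ ρ.re * ‖φ r‖ ≤ r ^ ρ.re * (K * r ^ w) := mul_le_mul_of_nonneg_left (h0 r hr' h) p3
      _ = K * r ^ (ρ.re + w) := by rw [Real.rpow_add hr']; ring
      _ ≤ |K| * r ^ (ρ.re + w) := mul_le_mul_of_nonneg_right (le_abs_self K) p1
      _ ≤ _ := by nlinarith [mul_nonneg (abs_nonneg K) p2, mul_nonneg (abs_nonneg K') p1,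
          mul_nonneg (abs_nonneg K') p2]
  · have p4 := Real.rpow_le_rpow_of_exponent_le h.le (le_max_right 0 (ρ.re + C))
    calc r ^ ρ.re * ‖φ r‖ ≤ r ^ ρ.re * (K' * r ^ C) := mul_le_mul_of_nonneg_left (h1 r h.le) p3
      _ = K' * r ^ (ρ.re + C) := by rw [Real.rpow_add hr']; ring
      _ ≤ |K'| * r ^ (max 0 (ρ.re + C)) := mul_le_mul (le_abs_self K') p4
          (Real.rpow_nonneg hr'.le _) (abs_nonneg _)
      _ ≤ _ := by nlinarith [mul_nonneg (abs_nonneg K) p2, mul_nonneg (abs_nonneg K) p1,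
          mul_nonneg (abs_nonneg K') p1]

lemma PowerBdd.add {β C : ℝ} {f g : ℝ → ℂ} (hf : PowerBdd β C f) (hg : PowerBdd β C g) :
    PowerBdd β C fun r => f r + g r := by
  obtain ⟨K, hK⟩ := hf.2
  obtain ⟨L, hL⟩ := hg.2
  refine ⟨hf.1.add hg.1, K + L, fun r hr => (norm_add_le _ _).trans ?_⟩
  rw [add_mul]; exact add_le_add (hK r hr) (hL r hr)

lemma PowerBdd.const_mul {β C : ℝ} {f : ℝ → ℂ} (hf : PowerBdd β C f) (c : ℂ) :
    PowerBdd β C fun r => c * f r := by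
  obtain ⟨K, hK⟩ := hf.2
  refine ⟨continuousOn_const.mul hf.1, ‖c‖ * K, fun r hr => ?_⟩
  rw [norm_mul, mul_assoc]; exact mul_le_mul_of_nonneg_left (hK r hr) (norm_nonneg _)

lemma PowerBdd.tendsto_zero {β C : ℝ} {g : ℝ → ℂ} (hg : PowerBdd β C g) (hβ : 0 < β) (hC : 0 < C)
    (P : ℂ) : Tendsto (fun r : ℝ => Complex.exp (-P * r) * g r) (𝓝[>] 0) (𝓝 0) := by
  obtain ⟨K, hK⟩ := hg.2
  have h1 : Tendsto (fun r : ℝ => Real.exp (-P.re * r) * (K * (r ^ β + r ^ C))) (𝓝[>] 0) (𝓝 0) := by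
    have h2 : ContinuousAt (fun r : ℝ => Real.exp (-P.re * r) * (K * (r ^ β + r ^ C))) 0 := by
      have := Real.continuousAt_rpow_const 0 β (Or.inr hβ.le)
      have := Real.continuousAt_rpow_const 0 C (Or.inr hC.le)
      fun_prop
    have h3 := h2.tendsto
    simp only [Real.zero_rpow hβ.ne', Real.zero_rpow hC.ne', add_zero, mul_zero] at h3
    exact h3.mono_left nhdsWithin_le_nhds
  refine squeeze_zero_norm' ?_ h1
  filter_upwards [self_mem_nhdsWithin] with r hr
  rw [norm_mul, norm_exp_neg_mul]
  exact mul_le_mul_of_nonneg_left (hK r hr) (Real.exp_nonneg _)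

lemma PowerBdd.tendsto_atTop {β C : ℝ} {g : ℝ → ℂ} (hg : PowerBdd β C g) {P : ℂ} (hP : 0 < P.re) :
    Tendsto (fun r : ℝ => Complex.exp (-P * r) * g r) atTop (𝓝 0) := by
  obtain ⟨K, hK⟩ := hg.2
  have h1 := ((tendsto_rpow_mul_exp_neg_mul_atTop_nhds_zero β P.re hP).add
    (tendsto_rpow_mul_exp_neg_mul_atTop_nhds_zero C P.re hP)).const_mul K
  rw [add_zero, mul_zero] at h1
  refine squeeze_zero_norm' ?_ h1
  filter_upwards [eventually_gt_atTop 0] with r hr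
  rw [norm_mul, norm_exp_neg_mul]
  refine (mul_le_mul_of_nonneg_left (hK r hr) (Real.exp_nonneg _)).trans (le_of_eq (by ring))

lemma integral_Ioi_eq_zero {G G' : ℝ → ℂ} (hd : ∀ r ∈ Set.Ioi (0 : ℝ), HasDerivAt G (G' r) r)
    (hi : IntegrableOn G' (Set.Ioi 0)) (h0 : Tendsto G (𝓝[>] 0) (𝓝 0)) (h1 : Tendsto G atTop (𝓝 0)) :
    ∫ r in Set.Ioi 0, G' r = 0 := by
  have h := integral_Ioi_deriv_mul_eq_sub (a := (0 : ℝ)) (u := fun _ => (1 : ℂ)) (u' := fun _ => 0)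
    (a' := 0) (b' := 0) (fun r _ => hasDerivAt_const r 1) hd (hi.congr_fun (fun r _ => by simp)
      measurableSet_Ioi) (h0.congr fun r => by simp) (h1.congr fun r => by simp)
  simpa using h

/-- The first order equation for the Laplace transform of a radial solution. -/
lemma IsRadialSolution.lap_eq {ρ σ z : ℂ} {φ₀ φ₁ : ℝ → ℂ} (h : IsRadialSolution ρ σ z φ₀ φ₁)
    {β C : ℝ} (hβ : 0 < β) (hC : 0 < C) (h0 : PowerBdd β C fun r => (r : ℂ) ^ ρ * φ₀ r)
    (h1 : PowerBdd β C fun r => (r : ℂ) ^ ρ * φ₁ r) {P : ℂ} (hP : 0 < P.re) :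
    (P ^ 2 + σ ^ 2) * lap (fun r => r * ((r : ℂ) ^ ρ * φ₀ r)) P =
      (2 * ρ * P + 2 * z * σ) * lap (fun r => (r : ℂ) ^ ρ * φ₀ r) P := by
  set v : ℝ → ℂ := fun r => Complex.exp (-P * r) with hv
  have hdv : ∀ r : ℝ, HasDerivAt v (-P * v r) r := by
    intro r
    have h2 : HasDerivAt (fun r : ℝ => -P * (r : ℂ)) (-P * 1) r :=
      (Complex.ofRealCLM.hasDerivAt (x := r)).const_mul (-P)
    exact h2.cexp.congr_deriv (by simp only [hv]; ring)
  have hint : IntegrableOn (fun r : ℝ => (2 * ρ * P + 2 * z * σ) * (v r * ((r : ℂ) ^ ρ * φ₀ r)) -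
      (P ^ 2 + σ ^ 2) * (v r * (r * ((r : ℂ) ^ ρ * φ₀ r)))) (Set.Ioi 0) :=
    ((h0.integrable (by linarith) (by linarith) hP).const_mul _).sub
      ((h0.mul_id.integrable (by linarith) (by linarith) hP).const_mul _)
  have hA := h1.add (h0.const_mul (1 - ρ))
  have hB := h0.mul_id.const_mul P
  -- An antiderivative, by the radial equation, of the difference of the two integrands. The factor
  -- `r ^ ρ` removes the inverse powers of `r` from the equation. `G` vanishes at the origin because
  -- `β` and `C` are positive, and at infinity because `Re P > 0`.
  set G : ℝ → ℂ := fun r => v r * ((r : ℂ) ^ ρ * φ₁ r + (1 - ρ) * ((r : ℂ) ^ ρ * φ₀ r)) +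
    v r * (P * (r * ((r : ℂ) ^ ρ * φ₀ r))) with hG
  have hdG : ∀ r ∈ Set.Ioi (0 : ℝ), HasDerivAt G ((2 * ρ * P + 2 * z * σ) * (v r * ((r : ℂ) ^ ρ * φ₀ r)) -
      (P ^ 2 + σ ^ 2) * (v r * (r * ((r : ℂ) ^ ρ * φ₀ r)))) r := by
    intro r hr
    have hr' : 0 < r := hr
    have hrc : (r : ℂ) ≠ 0 := by exact_mod_cast hr'.ne'
    have d0 := (hasDerivAt_ofReal_cpow hr' ρ).mul (h.deriv_zero r hr')
    have d1 := (hasDerivAt_ofReal_cpow hr' ρ).mul (h.deriv_one r hr')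
    have did : HasDerivAt (fun r : ℝ => (r : ℂ)) 1 r := Complex.ofRealCLM.hasDerivAt
    have hfin := ((hdv r).mul (d1.add (d0.const_mul (1 - ρ)))).add
      ((hdv r).mul ((did.mul d0).const_mul P))
    refine hfin.congr_deriv ?_
    simp only [Pi.add_apply, Pi.mul_apply]
    field_simp
    ring
  have hlim0 : Tendsto G (𝓝[>] 0) (𝓝 0) := by
    have := (hA.tendsto_zero hβ hC P).add (hB.tendsto_zero (by linarith) (by linarith) P)
    rwa [add_zero] at this
  have hlim : Tendsto G atTop (𝓝 0) := by
    have := (hA.tendsto_atTop hP).add (hB.tendsto_atTop hP)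
    rwa [add_zero] at this
  have hI := integral_Ioi_eq_zero hdG hint hlim0 hlim
  rw [integral_sub, integral_const_mul, integral_const_mul, sub_eq_zero] at hI
  · exact hI.symm
  · exact (h0.integrable (by linarith) (by linarith) hP).const_mul _
  · exact (h0.mul_id.integrable (by linarith) (by linarith) hP).const_mul _

/-- A solution of `ε (ε - 2iσ) Y' = -(2ρ(ε - iσ) + 2zσ) Y` that stays bounded as `ε → 0` vanishes. -/
lemma eq_zero_of_bounded_of_ode {ρ σ : ℂ} {z : ℝ} (hρ : 0 < ρ.re) (hσ0 : σ ≠ 0) (hσ : 0 ≤ σ.im)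
    {Y Y' : ℝ → ℂ} (hY : ∀ ε, 0 < ε → HasDerivAt Y (Y' ε) ε)
    (hode : ∀ ε : ℝ, 0 < ε → ε * (ε - 2 * Complex.I * σ) * Y' ε =
      -((2 * ρ * (ε - Complex.I * σ) + 2 * z * σ) * Y ε)) {M : ℝ}
    (hM : ∀ ε, 0 < ε → ε ≤ 1 → ‖Y ε‖ ≤ M) {ε : ℝ} (hε : 0 < ε) : Y ε = 0 := by
  -- Solutions of the equation are multiples of `ε ^ (-b) (ε - 2iσ) ^ (-a)`. Since `z` is real, `Re
  -- b = Re ρ > 0`, so a nonzero one is unbounded as `ε → 0`.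
  set b : ℂ := ρ + Complex.I * z with hb
  set a : ℂ := ρ - Complex.I * z with ha
  have hbre : b.re = ρ.re := by simp [hb]
  -- The real part is `ε + 2 Im σ ≥ 0`; when it vanishes, `σ` is real and nonzero and the number is
  -- purely imaginary. Hence the second factor stays regular up to `ε = 0`.
  have hslit : ∀ ε : ℝ, 0 ≤ ε → (ε : ℂ) - 2 * Complex.I * σ ∈ Complex.slitPlane := by
    intro ε h
    rcases hσ.lt_or_eq with h1 | h1
    · left; simp; positivity
    · rcases h.lt_or_eq with h2 | h2
      · left; simp [← h1, h2]
      · right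
        simp only [← h2, Complex.sub_im, Complex.mul_im, Complex.ofReal_im, Complex.mul_re]
        intro h3
        refine hσ0 (Complex.ext ?_ h1.symm)
        simpa using h3
  -- `Y` times the integrating factor: it is constant by the equation and tends to `0` as `ε → 0` by
  -- boundedness of `Y`.
  set F : ℝ → ℂ := fun ε => (ε : ℂ) ^ b * (((ε : ℂ) - 2 * Complex.I * σ) ^ a * Y ε) with hF
  have hdF : ∀ ε : ℝ, 0 < ε → HasDerivAt F 0 ε := by
    intro ε h
    have hεc : (ε : ℂ) ≠ 0 := by exact_mod_cast h.ne'
    have hq := hslit ε h.le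
    have hq0 := Complex.slitPlane_ne_zero hq
    have d1 : HasDerivAt (fun ε : ℝ => (ε : ℂ) - 2 * Complex.I * σ) 1 ε :=
      (Complex.ofRealCLM.hasDerivAt (x := ε)).sub_const _
    have d2 : HasDerivAt (fun ε : ℝ => ((ε : ℂ) - 2 * Complex.I * σ) ^ a)
        (a * ((ε : ℂ) - 2 * Complex.I * σ) ^ (a - 1) * 1) ε :=
      (((hasDerivAt_id (ε : ℂ)).sub_const (2 * Complex.I * σ)).cpow_const
        (c := a) hq).comp_ofReal
    refine ((hasDerivAt_ofReal_cpow h b).mul (d2.mul (hY ε h))).congr_deriv ?_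
    simp only [Pi.mul_apply]
    have h3 : Y' ε = -((2 * ρ * (ε - Complex.I * σ) + 2 * z * σ) * Y ε) /
        (ε * (ε - 2 * Complex.I * σ)) := by
      rw [eq_div_iff (mul_ne_zero hεc hq0), ← hode ε h]; ring
    rw [h3, Complex.cpow_sub a 1 hq0, Complex.cpow_one]
    field_simp
    rw [ha, hb]
    ring_nf
    simp only [Complex.I_sq]
    ring
  have hconst : ∀ x y : ℝ, 0 < x → 0 < y → F x = F y := fun x y hx hy =>
    isOpen_Ioi.is_const_of_deriv_eq_zero isPreconnected_Ioi
      (fun t ht => (hdF t ht).differentiableAt.differentiableWithinAt)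
      (fun t ht => (hdF t ht).deriv) hx hy
  have hlim : Tendsto F (𝓝[>] 0) (𝓝 0) := by
    have h1 : ContinuousAt (fun ε : ℝ => ε ^ ρ.re * (‖((ε : ℂ) - 2 * Complex.I * σ) ^ a‖ * M)) 0 := by
      have h2 := Real.continuousAt_rpow_const 0 ρ.re (Or.inr hρ.le)
      have h3 : ContinuousAt (fun ε : ℝ => ((ε : ℂ) - 2 * Complex.I * σ) ^ a) 0 :=
        ContinuousAt.cpow (f := fun ε : ℝ => (ε : ℂ) - 2 * Complex.I * σ) (by fun_prop)
          continuousAt_const (hslit 0 le_rfl)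
      exact h2.mul (h3.norm.mul continuousAt_const)
    have h2 := h1.tendsto
    simp only [Real.zero_rpow hρ.ne', zero_mul] at h2
    refine squeeze_zero_norm' ?_ (h2.mono_left nhdsWithin_le_nhds)
    filter_upwards [Ioc_mem_nhdsGT one_pos] with t ht
    rw [hF, norm_mul, norm_mul, norm_ofReal_cpow ht.1, hbre]
    exact mul_le_mul_of_nonneg_left (mul_le_mul_of_nonneg_left (hM t ht.1 ht.2) (norm_nonneg _))
      (Real.rpow_nonneg ht.1.le _)
  have hF0 : F ε = 0 := by
    refine tendsto_nhds_unique (tendsto_const_nhds.congr' ?_) hlim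
    filter_upwards [self_mem_nhdsWithin] with t ht
    exact hconst _ _ hε ht
  have hεc : (ε : ℂ) ≠ 0 := by exact_mod_cast hε.ne'
  have h1 : (ε : ℂ) ^ b ≠ 0 := by simp [Complex.cpow_eq_zero_iff, hεc]
  have h2 : ((ε : ℂ) - 2 * Complex.I * σ) ^ a ≠ 0 := by
    simp [Complex.cpow_eq_zero_iff, Complex.slitPlane_ne_zero (hslit ε hε.le)]
  exact ((mul_eq_zero.1 ((mul_eq_zero.1 hF0).resolve_left h1))).resolve_left h2

/-- Radial solutions that are small at the origin and outgoing at infinity vanish. -/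
theorem IsRadialSolution.eq_zero {ρ σ : ℂ} {z : ℝ} {φ₀ φ₁ : ℝ → ℂ}
    (h : IsRadialSolution ρ σ z φ₀ φ₁) (hρ : 0 < ρ.re) {w C K : ℝ} (hw : 0 < ρ.re + w)
    (hσ0 : σ ≠ 0) (hσ : 0 ≤ σ.im)
    (hz0 : ∀ r, 0 < r → r ≤ 1 → ‖φ₀ r‖ ≤ K * r ^ w) (hz1 : ∀ r, 0 < r → r ≤ 1 → ‖φ₁ r‖ ≤ K * r ^ w)
    (hi0 : ∀ r, 1 ≤ r → ‖φ₀ r‖ ≤ K * r ^ C) (hi1 : ∀ r, 1 ≤ r → ‖φ₁ r‖ ≤ K * r ^ C)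
    (hout : σ.im = 0 → ∃ (ψ : ℕ → ℝ → ℂ) (C : ℝ), IsRadialSymbol ψ C ∧
      ∀ r, 1 ≤ r → φ₀ r = Complex.exp (Complex.I * σ * r) * ψ 0 r) {r : ℝ} (hr : 0 < r) :
    φ₀ r = 0 := by
  have hc0 : ContinuousOn φ₀ (Set.Ioi 0) := fun r hr =>
    (h.deriv_zero r hr).continuousAt.continuousWithinAt
  have hc1 : ContinuousOn φ₁ (Set.Ioi 0) := fun r hr =>
    (h.deriv_one r hr).continuousAt.continuousWithinAt
  -- Raising the growth exponent to at least `1` makes `D` positive, as `lap_eq` requires.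
  set C' : ℝ := max 1 C with hC'
  have hCC : ∀ {f : ℝ → ℂ}, (∀ r, 1 ≤ r → ‖f r‖ ≤ K * r ^ C) →
      ∀ r, 1 ≤ r → ‖f r‖ ≤ |K| * r ^ C' := fun hf r hr =>
    (hf r hr).trans (mul_le_mul (le_abs_self K)
      (Real.rpow_le_rpow_of_exponent_le hr (le_max_right _ _))
      (Real.rpow_nonneg (by linarith) _) (abs_nonneg K))
  have p0 := powerBdd_cpow_mul (ρ := ρ) hc0 hz0 (hCC hi0)
  have p1 := powerBdd_cpow_mul (ρ := ρ) hc1 hz1 (hCC hi1)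
  set D : ℝ := max 0 (ρ.re + C') with hD
  have hDp : 0 < D := lt_of_lt_of_le (by have := le_max_left 1 C; linarith) (le_max_right _ _)
  set g : ℝ → ℂ := fun r => (r : ℂ) ^ ρ * φ₀ r with hg
  have hder : ∀ {P : ℂ}, 0 < P.re → HasDerivAt (lap g) (-lap (fun r => r * g r) P) P := fun hP =>
    p0.hasDerivAt_lap (by linarith) (by linarith) hP
  -- If `Im σ > 0`, the limit point `-iσ` is interior to the half-plane of convergence. If `σ` is
  -- real, the outgoing factor `exp (iσr)` doubles the phase of the Laplace kernel instead of
  -- cancelling it, and the integral over `r > 1` oscillates with frequency `2σ`.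
  have hbd : ∃ M, ∀ ε : ℝ, 0 < ε → ε ≤ 1 → ‖lap g (-Complex.I * σ + ε)‖ ≤ M := by
    rcases hσ.lt_or_eq with him | him
    · have hcont : ContinuousOn (fun ε : ℝ => lap g (-Complex.I * σ + ε)) (Set.Icc 0 1) := by
        intro ε hε
        have h1 : 0 < (-Complex.I * σ + ε).re := by simp; linarith [hε.1]
        have h2 : ContinuousAt (fun ε : ℝ => -Complex.I * σ + (ε : ℂ)) ε := by fun_prop
        exact (ContinuousAt.comp (g := lap g)
          (f := fun ε : ℝ => -Complex.I * σ + (ε : ℂ)) (hder h1).continuousAt h2).continuousWithinAt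
      obtain ⟨M, hM⟩ := isCompact_Icc.exists_bound_of_continuousOn hcont
      exact ⟨M, fun ε h1 h2 => hM ε ⟨h1.le, h2⟩⟩
    · obtain ⟨ψ, C, hψ, hφψ⟩ := hout him.symm
      have hσr : σ = (σ.re : ℂ) := Complex.ext rfl (by simp [← him])
      have hτ : 2 * σ.re ≠ 0 := by
        intro h0; apply hσ0; rw [hσr]; simp at h0; simp [h0]
      obtain ⟨M, hM⟩ := oscillatory_bound hψ ρ hτ
      obtain ⟨L, hL⟩ := p0.2
      have hint1 : IntegrableOn (fun r : ℝ => L * (r ^ (ρ.re + w) + r ^ D)) (Set.Ioc 0 1) := by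
        have e1 : IntegrableOn (fun r : ℝ => r ^ (ρ.re + w)) (Set.Ioc 0 1) :=
          (intervalIntegrable_iff_integrableOn_Ioc_of_le zero_le_one).1
            (intervalIntegral.intervalIntegrable_rpow' (by linarith))
        have e2 : IntegrableOn (fun r : ℝ => r ^ D) (Set.Ioc 0 1) :=
          (intervalIntegrable_iff_integrableOn_Ioc_of_le zero_le_one).1
            (intervalIntegral.intervalIntegrable_rpow' (by linarith))
        exact (e1.add e2).const_mul L
      refine ⟨(∫ r in Set.Ioc (0 : ℝ) 1, L * (r ^ (ρ.re + w) + r ^ D)) + M, fun ε hε _ => ?_⟩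
      have hPre : 0 < (-Complex.I * σ + ε).re := by simp [← him, hε]
      have hi := p0.integrable (by linarith) (by linarith) hPre
      rw [lap, ← Set.Ioc_union_Ioi_eq_Ioi (zero_le_one (α := ℝ)),
        setIntegral_union (Set.Ioc_disjoint_Ioi le_rfl) measurableSet_Ioi
          (hi.mono_set Set.Ioc_subset_Ioi_self) (hi.mono_set (Set.Ioi_subset_Ioi zero_le_one))]
      refine (norm_add_le _ _).trans (add_le_add ?_ ?_)
      · refine norm_integral_le_of_norm_le hint1 ?_
        refine (ae_restrict_iff' measurableSet_Ioc).2 (ae_of_all _ fun r hr => ?_)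
        rw [norm_mul, norm_exp_neg_mul]
        have e1 : Real.exp (-(-Complex.I * σ + ε).re * r) ≤ 1 :=
          Real.exp_le_one_iff.2 (by nlinarith [hr.1])
        calc _ ≤ 1 * (L * (r ^ (ρ.re + w) + r ^ D)) :=
              mul_le_mul e1 (hL r hr.1) (norm_nonneg _) zero_le_one
          _ = _ := one_mul _
      · refine le_trans (le_of_eq ?_) (hM ε hε)
        congr 1
        refine setIntegral_congr_fun measurableSet_Ioi fun r hr => ?_
        have hr1 : 1 < r := hr
        simp only [hg]
        rw [hφψ r hr1.le, mul_left_comm _ (Complex.exp (Complex.I * σ * r)), ← mul_assoc,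
          ← Complex.exp_add, hσr]
        congr 2
        simp only [Complex.ofReal_re]
        push_cast
        ring
  obtain ⟨M, hM⟩ := hbd
  have hray : ∀ ε : ℝ, 0 < ε → lap g (-Complex.I * σ + ε) = 0 := by
    intro ε hε
    have hre : ∀ ε : ℝ, 0 < ε → 0 < (-Complex.I * σ + ε).re := fun ε hε => by simp; linarith
    refine eq_zero_of_bounded_of_ode (z := z) hρ hσ0 hσ
      (Y := fun ε : ℝ => lap g (-Complex.I * σ + ε))
      (Y' := fun ε => -lap (fun r => r * g r) (-Complex.I * σ + ε)) (fun ε hε => ?_) ?_ hM hε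
    · have h1 : HasDerivAt (fun ε : ℝ => -Complex.I * σ + (ε : ℂ)) 1 ε :=
        (Complex.ofRealCLM.hasDerivAt (x := ε)).const_add _
      have h2 := (hder (hre ε hε)).comp ε h1
      exact h2.congr_deriv (mul_one _)
    · intro ε hε
      have := h.lap_eq hw hDp p0 p1 (hre ε hε)
      have e1 : (-Complex.I * σ + ε) ^ 2 + σ ^ 2 = ε * (ε - 2 * Complex.I * σ) := by
        ring_nf; simp only [Complex.I_sq]; ring
      have e2 : (2 * ρ * (-Complex.I * σ + ε) + 2 * z * σ) = 2 * ρ * (ε - Complex.I * σ) + 2 * z * σ := by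
        ring
      rw [e1, e2] at this
      rw [mul_neg, this]
  -- The transform is holomorphic on the half-plane and vanishes on a ray, so the identity theorem
  -- applies.
  have hall : Set.EqOn (lap g) 0 {P : ℂ | 0 < P.re} := by
    have hopen : IsOpen {P : ℂ | 0 < P.re} := isOpen_lt continuous_const Complex.continuous_re
    have hP0 : -Complex.I * σ + ((1 : ℝ) : ℂ) ∈ {P : ℂ | 0 < P.re} := by simp; linarith
    refine AnalyticOnNhd.eqOn_zero_of_preconnected_of_frequently_eq_zero
      (DifferentiableOn.analyticOnNhd (fun P hP => (hder hP).differentiableAt.differentiableWithinAt)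
        hopen) (convex_halfSpace_re_gt 0).isPreconnected hP0 ?_
    have ht : Tendsto (fun ε : ℝ => -Complex.I * σ + (ε : ℂ)) (𝓝[>] 1)
        (𝓝[≠] (-Complex.I * σ + ((1 : ℝ) : ℂ))) := by
      refine tendsto_nhdsWithin_iff.2 ⟨?_, ?_⟩
      · have : ContinuousAt (fun ε : ℝ => -Complex.I * σ + (ε : ℂ)) 1 := by fun_prop
        exact this.tendsto.mono_left nhdsWithin_le_nhds
      · filter_upwards [self_mem_nhdsWithin] with ε hε h0
        have hε1 : (1 : ℝ) < ε := hε
        have := add_left_cancel h0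
        exact hε1.ne' (by exact_mod_cast this)
    refine ht.frequently (Eventually.frequently ?_)
    filter_upwards [self_mem_nhdsWithin] with ε hε
    have hε1 : (1 : ℝ) < ε := hε
    exact hray ε (by linarith)
  have := p0.eq_zero_of_lap_eq_zero (by linarith) (by linarith)
    (fun P hP => hall (by simp [hP])) hr
  have hrc : (r : ℂ) ≠ 0 := by exact_mod_cast hr.ne'
  exact (mul_eq_zero.1 this).resolve_left (by simp [Complex.cpow_eq_zero_iff, hrc])

end EdgeWave

end

/-! ### Pairing of spinors over spheres -/

noncomputable section

namespace EdgeWave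
open MeasureTheory Filter Topology

lemma angle_smul {r : ℝ} (hr : 0 < r) (x : Space 3) : angle (r • x) = angle x := by
  rw [angle, angle, norm_smul, Real.norm_of_nonneg hr.le, smul_smul]
  congr 1; field_simp

lemma norm_angle {x : Space 3} (hx : x ≠ 0) : ‖angle x‖ = 1 := by
  rw [angle, norm_smul, norm_inv, norm_norm, inv_mul_cancel₀ (norm_ne_zero_iff.2 hx)]

lemma angle_ne_zero {x : Space 3} (hx : x ≠ 0) : angle x ≠ 0 := by
  intro h; have := norm_angle hx; simp [h] at this

lemma norm_smul_angle (x : Space 3) : ‖x‖ • angle x = x := by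
  by_cases hx : x = 0
  · simp [hx]
  · exact smul_inv_smul₀ (norm_ne_zero_iff.2 hx) x

lemma contDiffOn_angle : ContDiffOn ℝ ∞ (angle : Space 3 → Space 3) {0}ᶜ :=
  ((contDiffOn_norm le_rfl).inv fun x hx => norm_ne_zero_iff.2 hx).smul contDiffOn_id

lemma differentiableAt_norm {x : Space 3} (hx : x ≠ 0) :
    DifferentiableAt ℝ (fun y : Space 3 => ‖y‖) x :=
  ((contDiffOn_norm le_rfl).contDiffAt (compl_zero_mem_nhds hx)).differentiableAt (by simp)

lemma fderiv_norm_apply {x : Space 3} (hx : x ≠ 0) (v : Space 3) :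
    fderiv ℝ (fun y : Space 3 => ‖y‖) x v = ‖x‖⁻¹ * inner ℝ x v := by
  have h3 := (differentiableAt_norm hx).hasFDerivAt.pow 2
  have h4 := (hasStrictFDerivAt_norm_sq x).hasFDerivAt
  have h5 := congrArg (fun L : Space 3 →L[ℝ] ℝ => L v) (h3.unique h4)
  simp at h5
  have : ‖x‖ ≠ 0 := norm_ne_zero_iff.2 hx
  field_simp
  linarith

lemma fderiv_norm_rot {x : Space 3} (hx : x ≠ 0) (i j : Fin 3) :
    fderiv ℝ (fun y : Space 3 => ‖y‖) x (x i • ee j - x j • ee i) = 0 := by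
  rw [fderiv_norm_apply hx, inner_sub_right, inner_smul_right, inner_smul_right]
  simp [ee, EuclideanSpace.inner_single_right]
  right; ring

/-- The derivative of the projection to a sphere along a rotation field. -/
lemma hasFDerivAt_smul_angle_rot (r : ℝ) {x : Space 3} (hx : x ≠ 0) (i j : Fin 3) :
    fderiv ℝ (fun x => r • angle x) x (x i • ee j - x j • ee i)
      = (r • angle x) i • ee j - (r • angle x) j • ee i := by
  have hrot : HasFDerivAt (fun y : Space 3 => ‖y‖⁻¹) _ x :=
    (hasDerivAt_inv (norm_ne_zero_iff.2 hx)).comp_hasFDerivAt x (differentiableAt_norm hx).hasFDerivAt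
  have h1 := ((hrot.smul (hasFDerivAt_id x)).const_smul r).fderiv
  have h2 := congrArg (fun L : Space 3 →L[ℝ] Space 3 => L (x i • ee j - x j • ee i)) h1
  refine Eq.trans ?_ (h2.trans ?_)
  · rfl
  · simp [fderiv_norm_rot hx, angle, smul_smul, smul_sub]

/-- The integrand of the pairing of `Y` with the restriction of `u` to the sphere of radius `r`. -/
def pairDensity (Y u : Sm) (q : ℝ × Space 3) : ℂ :=
  (bump q.2 : ℂ) * (star (Y.1 q.2) ⬝ᵥ u.1 (q.1 • angle q.2))

/-- The pairing of `Y` with the restriction of `u` to the sphere of radius `r`. -/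
def pair (Y u : Sm) (r : ℝ) : ℂ := ∫ x, pairDensity Y u (r, x)

lemma contDiffOn_star {E : Type*} [NormedAddCommGroup E] [NormedSpace ℝ E] {f : E → ℂ} {s : Set E}
    (hf : ContDiffOn ℝ ∞ f s) : ContDiffOn ℝ ∞ (fun x => star (f x)) s :=
  Complex.conjCLE.contDiff.comp_contDiffOn hf

lemma contDiffOn_star_dotProduct {E : Type*} [NormedAddCommGroup E] [NormedSpace ℝ E]
    {f g : E → SpinIdx → ℂ} {s : Set E} (hf : ContDiffOn ℝ ∞ f s) (hg : ContDiffOn ℝ ∞ g s) :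
    ContDiffOn ℝ ∞ (fun x => star (f x) ⬝ᵥ g x) s := by
  rw [contDiffOn_pi] at hf hg
  simp only [dotProduct]
  exact ContDiffOn.sum fun a _ => (contDiffOn_star (hf a)).mul (hg a)

/-- The domain of polar coordinates. -/
def polarDomain : Set (ℝ × Space 3) := {q | 0 < q.1 ∧ q.2 ≠ 0}

lemma isOpen_polarDomain : IsOpen polarDomain :=
  (isOpen_lt continuous_const continuous_fst).inter (isOpen_ne_fun continuous_snd continuous_const)

lemma contDiffOn_ofReal_bump {E : Type*} [NormedAddCommGroup E] [NormedSpace ℝ E] {f : E → Space 3}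
    {s : Set E} (hf : ContDiffOn ℝ ∞ f s) : ContDiffOn ℝ ∞ (fun q => (bump (f q) : ℂ)) s :=
  Complex.ofRealCLM.contDiff.comp_contDiffOn (contDiff_bump.comp_contDiffOn hf)

lemma contDiffOn_polar {u : Sm} :
    ContDiffOn ℝ ∞ (fun q : ℝ × Space 3 => u.1 (q.1 • angle q.2)) polarDomain := by
  refine u.2.1.comp (f := fun q : ℝ × Space 3 => q.1 • angle q.2) ?_ fun q hq =>
    smul_ne_zero hq.1.ne' (angle_ne_zero hq.2)
  exact contDiff_fst.contDiffOn.smul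
    (contDiffOn_angle.comp contDiff_snd.contDiffOn fun q hq => hq.2)

lemma contDiffOn_pairDensity (Y u : Sm) : ContDiffOn ℝ ∞ (pairDensity Y u) polarDomain :=
  (contDiffOn_ofReal_bump contDiff_snd.contDiffOn).mul (contDiffOn_star_dotProduct
    (Y.2.1.comp contDiff_snd.contDiffOn fun _ hq => hq.2) contDiffOn_polar)

lemma contDiff_pairDensity (Y u : Sm) {r : ℝ} (hr : 0 < r) :
    ContDiff ℝ ∞ fun x => pairDensity Y u (r, x) := by
  refine contDiff_of_zero_near ?_ one_pos fun x hx => ?_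
  · exact (contDiffOn_pairDensity Y u).comp (f := fun x => (r, x))
      (contDiff_const.prodMk contDiff_id).contDiffOn fun x hx => ⟨hr, hx⟩
  · simp [pairDensity, bump_eq_zero_of_le hx.le]

lemma hasCompactSupport_pairDensity (Y u : Sm) (r : ℝ) :
    HasCompactSupport fun x => pairDensity Y u (r, x) :=
  HasCompactSupport.intro (isCompact_closedBall (0 : Space 3) 4) fun x hx => by
    simp at hx; simp [pairDensity, bump_eq_zero_of_ge hx.le]

lemma integrable_pairDensity (Y u : Sm) {r : ℝ} (hr : 0 < r) :
    Integrable fun x => pairDensity Y u (r, x) :=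
  (contDiff_pairDensity Y u hr).continuous.integrable_of_hasCompactSupport
    (hasCompactSupport_pairDensity Y u r)

lemma pair_add_left (Y Y' u : Sm) {r : ℝ} (hr : 0 < r) :
    pair (Y + Y') u r = pair Y u r + pair Y' u r := by
  rw [pair, pair, pair, ← integral_add (integrable_pairDensity Y u hr) (integrable_pairDensity Y' u hr)]
  refine integral_congr_ae (ae_of_all _ fun x => ?_)
  simp [pairDensity, add_dotProduct, mul_add]

lemma pair_add_right (Y u u' : Sm) {r : ℝ} (hr : 0 < r) :
    pair Y (u + u') r = pair Y u r + pair Y u' r := by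
  rw [pair, pair, pair, ← integral_add (integrable_pairDensity Y u hr) (integrable_pairDensity Y u' hr)]
  refine integral_congr_ae (ae_of_all _ fun x => ?_)
  simp [pairDensity, dotProduct_add, mul_add]

lemma pair_smul_left (c : ℂ) (Y u : Sm) (r : ℝ) : pair (c • Y) u r = star c * pair Y u r := by
  rw [pair, pair, ← integral_const_mul]
  refine integral_congr_ae (ae_of_all _ fun x => ?_)
  simp [pairDensity, star_smul, smul_dotProduct]; ring

lemma pair_smul_right (c : ℂ) (Y u : Sm) (r : ℝ) : pair Y (c • u) r = c * pair Y u r := by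
  rw [pair, pair, ← integral_const_mul]
  refine integral_congr_ae (ae_of_all _ fun x => ?_)
  simp [pairDensity, dotProduct_smul]; ring

lemma pair_neg_left (Y u : Sm) (r : ℝ) : pair (-Y) u r = -pair Y u r := by
  have := pair_smul_left (-1) Y u r
  rw [sm_neg_smul, one_smul] at this
  simpa using this

lemma pair_neg_right (Y u : Sm) (r : ℝ) : pair Y (-u) r = -pair Y u r := by
  have := pair_smul_right (-1) Y u r
  rw [sm_neg_smul, one_smul] at this
  simpa using this

lemma pair_zero_left (u : Sm) (r : ℝ) : pair 0 u r = 0 := by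
  have := pair_smul_left 0 0 u r
  simpa using this

lemma pair_zero_right (Y : Sm) (r : ℝ) : pair Y 0 r = 0 := by
  have := pair_smul_right 0 Y 0 r
  simpa using this

lemma pair_sub_right (Y u u' : Sm) {r : ℝ} (hr : 0 < r) :
    pair Y (u - u') r = pair Y u r - pair Y u' r := by
  rw [sub_eq_add_neg, pair_add_right Y u _ hr, pair_neg_right, sub_eq_add_neg]

lemma pair_sub_left (Y Y' u : Sm) {r : ℝ} (hr : 0 < r) :
    pair (Y - Y') u r = pair Y u r - pair Y' u r := by
  rw [sub_eq_add_neg, pair_add_left Y _ u hr, pair_neg_left, sub_eq_add_neg]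

lemma pair_mat (M : Matrix SpinIdx SpinIdx ℂ) (Y u : Sm) (r : ℝ) :
    pair Y (mat M u) r = pair (mat Mᴴ Y) u r := by
  refine integral_congr_ae (ae_of_all _ fun x => ?_)
  simp only [pairDensity, mat_apply, Matrix.star_mulVec, Matrix.conjTranspose_conjTranspose,
    Matrix.dotProduct_mulVec]

lemma pair_rp (ξ : ℂ) (Y u : Sm) {r : ℝ} (hr : 0 < r) :
    pair Y (rp ξ u) r = (r : ℂ) ^ ξ * pair Y u r := by
  rw [pair, pair, ← integral_const_mul]
  refine integral_congr_ae (ae_of_all _ fun x => ?_)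
  by_cases hx : x = 0
  · simp [pairDensity, hx, bump_eq_zero_of_le]
  · simp only [pairDensity, rp_apply, norm_smul, norm_angle hx, Real.norm_of_nonneg hr.le, mul_one,
      dotProduct_smul, smul_eq_mul]
    ring

/-- The pointwise action of the Coulomb matrix. -/
lemma Al_apply (u : Sm) {x : Space 3} (hx : x ≠ 0) :
    (Al u).1 x = (∑ j, ((angle x j : ℝ) : ℂ) • (gammaZero * gamma j)) *ᵥ u.1 x := by
  have h1 : (GX u).1 x = ∑ j, gamma j *ᵥ (((x j : ℝ) : ℂ) • u.1 x) := by
    simp only [GX, Op.sum_apply, Op.mul_apply]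
    rw [Submodule.coe_sum, Finset.sum_apply]; rfl
  change ((‖x‖ : ℝ) : ℂ) ^ (-1 : ℂ) • (gammaZero *ᵥ (GX u).1 x) = _
  rw [h1, Complex.cpow_neg_one, Matrix.mulVec_sum, Matrix.sum_mulVec, Finset.smul_sum]
  refine Finset.sum_congr rfl fun j _ => ?_
  rw [Matrix.smul_mulVec, ← Matrix.mulVec_mulVec, Matrix.mulVec_smul, Matrix.mulVec_smul, smul_smul]
  congr 1
  simp [angle]

/-- Each `γ⁰γʲ` is Hermitian: `γʲ` is skew-Hermitian, and the reversal of the product costs a second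
sign by anticommutation. -/
lemma coulomb_conjTranspose (y : Space 3) :
    (∑ j, ((y j : ℝ) : ℂ) • (gammaZero * gamma j))ᴴ = ∑ j, ((y j : ℝ) : ℂ) • (gammaZero * gamma j) := by
  rw [Matrix.conjTranspose_sum]
  refine Finset.sum_congr rfl fun j _ => ?_
  rw [Matrix.conjTranspose_smul, Matrix.conjTranspose_mul, gamma_conjTranspose,
    gammaZero_conjTranspose, gammaZero_mul_gamma, neg_mul]
  simp

/-- The Coulomb matrix depends only on the direction, so it is the same Hermitian matrix at `x` and
at `r • angle x`. -/
lemma pair_Al (Y u : Sm) {r : ℝ} (hr : 0 < r) : pair Y (Al u) r = pair (Al Y) u r := by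
  refine integral_congr_ae (ae_of_all _ fun x => ?_)
  by_cases hx : x = 0
  · simp [pairDensity, hx, bump_eq_zero_of_le]
  · simp only [pairDensity]
    have hp : r • angle x ≠ 0 := smul_ne_zero hr.ne' (angle_ne_zero hx)
    have h2 : angle (r • angle x) = angle x := by
      rw [angle_smul hr]; exact angle_smul (inv_pos.2 (norm_pos_iff.2 hx)) x
    rw [Al_apply u hp, Al_apply Y hx, h2, Matrix.star_mulVec, coulomb_conjTranspose,
      Matrix.dotProduct_mulVec]

lemma rotE_apply (i j : Fin 3) (u : Sm) {x : Space 3} (hx : x ≠ 0) :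
    (rotE i j u).1 x = fderiv ℝ u.1 x (x i • ee j - x j • ee i) := by
  change ((x i : ℝ) : ℂ) • (pd j u).1 x - ((x j : ℝ) : ℂ) • (pd i u).1 x = _
  rw [pd_apply _ _ hx, pd_apply _ _ hx, map_sub, map_smul, map_smul]; rfl

/-- Rotation fields are divergence free: in `x_a ∂_b` with `a ≠ b`, integration by parts never
differentiates the coefficient. -/
lemma integral_rot_eq_zero {F : Space 3 → ℂ} (hF : ContDiff ℝ ∞ F) (hc : HasCompactSupport F)
    (i j : Fin 3) : ∫ x : Space 3, fderiv ℝ F x (x i • ee j - x j • ee i) = 0 := by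
  by_cases hij : i = j
  · simp [hij]
  have hcont := continuous_fderiv_apply hF
  have key : ∀ a b : Fin 3, a ≠ b → Integrable (fun x : Space 3 => x a • fderiv ℝ F x (ee b)) ∧
      ∫ x : Space 3, x a • fderiv ℝ F x (ee b) = 0 := by
    intro a b hab
    have hs := hasCompactSupport_fderiv_apply hc (ee b)
    have h1 : Integrable (fun x : Space 3 => x a • fderiv ℝ F x (ee b)) :=
      ((by fun_prop : Continuous fun x : Space 3 => x a).smul
        (hcont (ee b))).integrable_of_hasCompactSupport hs.smul_left
    have hz : ∀ x : Space 3, fderiv ℝ (fun x : Space 3 => x a) x (ee b) = 0 := by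
      intro x
      have : (fun x : Space 3 => x a) = EuclideanSpace.proj (𝕜 := ℝ) a := rfl
      rw [this, ContinuousLinearMap.fderiv]
      simp [ee, hab]
    have h := integral_smul_fderiv_eq_neg_fderiv_smul_of_integrable (μ := volume)
      (f := fun x : Space 3 => x a) (g := F) (v := ee b) ?_ h1 ?_ (fun x _ => by fun_prop)
      (fun x _ => hF.differentiable (by simp) x)
    · refine ⟨h1, ?_⟩
      rw [h]; simp [hz]
    · simp [hz]
    · exact ((by fun_prop : Continuous fun x : Space 3 => x a).smul
        hF.continuous).integrable_of_hasCompactSupport hc.smul_left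
  have h1 := key i j hij
  have h2 := key j i (Ne.symm hij)
  simp only [map_sub, map_smul]
  rw [integral_sub h1.1 h2.1, h1.2, h2.2, sub_zero]

lemma fderiv_star_dotProduct {f g : Space 3 → SpinIdx → ℂ} {x : Space 3}
    (hf : DifferentiableAt ℝ f x) (hg : DifferentiableAt ℝ g x) (v : Space 3) :
    fderiv ℝ (fun x => star (f x) ⬝ᵥ g x) x v =
      star (fderiv ℝ f x v) ⬝ᵥ g x + star (f x) ⬝ᵥ fderiv ℝ g x v := by
  have hfa : ∀ a, HasFDerivAt (fun x => f x a) ((ContinuousLinearMap.proj a).comp (fderiv ℝ f x)) x :=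
    fun a => hasFDerivAt_pi'.1 hf.hasFDerivAt a
  have hga : ∀ a, HasFDerivAt (fun x => g x a) ((ContinuousLinearMap.proj a).comp (fderiv ℝ g x)) x :=
    fun a => hasFDerivAt_pi'.1 hg.hasFDerivAt a
  have hsa : ∀ a, HasFDerivAt (fun x => star (f x a))
      ((Complex.conjCLE : ℂ →L[ℝ] ℂ).comp ((ContinuousLinearMap.proj a).comp (fderiv ℝ f x))) x :=
    fun a => (Complex.conjCLE : ℂ →L[ℝ] ℂ).hasFDerivAt.comp x (hfa a)
  have e : ∀ a, fderiv ℝ (fun x => star (f x a) * g x a) x v =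
      star (fderiv ℝ f x v a) * g x a + star (f x a) * fderiv ℝ g x v a := by
    intro a
    rw [((hsa a).fun_mul (hga a)).fderiv]
    simp only [add_apply, smul_apply, smul_eq_mul, ContinuousLinearMap.comp_apply]
    rw [add_comm, mul_comm]; rfl
  simp only [dotProduct, Pi.star_apply]
  rw [fderiv_fun_sum fun a _ => ((hsa a).fun_mul (hga a)).differentiableAt, sum_apply]
  simp only [e, Finset.sum_add_distrib]

lemma fderiv_bump_rot (x : Space 3) (i j : Fin 3) :
    fderiv ℝ bump x (x i • ee j - x j • ee i) = 0 := by
  by_cases hx : x = 0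
  · simp [hx]
  have h : bump = fun y => bump (‖y‖ • ee 0) := by
    funext y
    refine bump_congr ?_
    rw [norm_smul, norm_norm]; simp [ee]
  have hn := (differentiableAt_norm hx).hasFDerivAt.smul_const (ee 0)
  have h2 := ((contDiff_bump.differentiable (by simp) (‖x‖ • ee 0)).hasFDerivAt.comp x hn).fderiv
  have h3 := congrArg (fun L : Space 3 →L[ℝ] ℝ => L (x i • ee j - x j • ee i)) h2
  rw [h]
  refine h3.trans ?_
  simp [fderiv_norm_rot hx]

/-- Rotation fields are antisymmetric for the pairing. -/
lemma pair_rotE (i j : Fin 3) (Y u : Sm) {r : ℝ} (hr : 0 < r) :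
    pair Y (rotE i j u) r = -pair (rotE i j Y) u r := by
  rw [eq_neg_iff_add_eq_zero, pair, pair,
    ← integral_add (integrable_pairDensity _ _ hr) (integrable_pairDensity _ _ hr),
    ← integral_rot_eq_zero (contDiff_pairDensity Y u hr) (hasCompactSupport_pairDensity Y u r) i j]
  refine integral_congr_ae (ae_of_all _ fun x => ?_)
  by_cases hx : x = 0
  · simp [pairDensity, hx, bump_eq_zero_of_le]
  have hp : r • angle x ≠ 0 := smul_ne_zero hr.ne' (angle_ne_zero hx)
  have ha : DifferentiableAt ℝ (fun x : Space 3 => r • angle x) x :=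
    ((contDiffOn_angle.contDiffAt (compl_zero_mem_nhds hx)).differentiableAt (by simp)).const_smul r
  have hu : HasFDerivAt (fun x => u.1 (r • angle x)) _ x :=
    (differentiableAt_sm u hp).hasFDerivAt.comp x ha.hasFDerivAt
  have hY := differentiableAt_sm Y hx
  have hb : HasFDerivAt (fun x => (bump x : ℂ)) (Complex.ofRealCLM.comp (fderiv ℝ bump x)) x :=
    Complex.ofRealCLM.hasFDerivAt.comp x (contDiff_bump.differentiable (by simp) x).hasFDerivAt
  have hd : DifferentiableAt ℝ (fun x => star (Y.1 x) ⬝ᵥ u.1 (r • angle x)) x := by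
    have := contDiffOn_star_dotProduct (s := {0}ᶜ) Y.2.1
      (contDiffOn_polar.comp (f := fun x => (r, x)) (contDiff_const.prodMk contDiff_id).contDiffOn
        fun x hx => ⟨hr, hx⟩ : ContDiffOn ℝ ∞ (fun x => u.1 (r • angle x)) {0}ᶜ)
    exact (this.contDiffAt (compl_zero_mem_nhds hx)).differentiableAt (by simp)
  have h := (hb.mul hd.hasFDerivAt).fderiv
  have h' := congrArg (fun L : Space 3 →L[ℝ] ℂ => L (x i • ee j - x j • ee i)) h
  refine Eq.symm (h'.trans ?_)
  have e1 := hasFDerivAt_smul_angle_rot r hx i j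
  have e2 : (Complex.ofRealCLM.comp (fderiv ℝ bump x)) (x i • ee j - x j • ee i) = 0 := by
    rw [ContinuousLinearMap.comp_apply, fderiv_bump_rot, map_zero]
  simp only [add_apply, smul_apply, e2,
    fderiv_star_dotProduct hY hu.differentiableAt, hu.fderiv, ContinuousLinearMap.comp_apply, e1,
    pairDensity, rotE_apply _ _ _ hp, rotE_apply _ _ _ hx, smul_eq_mul]
  ring

end EdgeWave

end

/-! ### Symmetry of the angular operators and reduction to radial equations -/

noncomputable section

namespace EdgeWave
open MeasureTheory Filter Topology

lemma rotE_G (i j k : Fin 3) : rotE i j * G k = G k * rotE i j := by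
  simp only [rotE, sub_mul, mul_sub]
  rw [mul_assoc, pd_G, ← mul_assoc, X_G, mul_assoc, mul_assoc (X j), pd_G, ← mul_assoc (X j), X_G,
    mul_assoc (G k)]

lemma pair_G (k : Fin 3) (Y u : Sm) (r : ℝ) : pair Y (G k u) r = -pair (G k Y) u r := by
  rw [G, pair_mat, gamma_conjTranspose, ← pair_neg_left]
  congr 1
  refine Sm_ext fun x _ => ?_
  change -gamma k *ᵥ Y.1 x = -(gamma k *ᵥ Y.1 x)
  rw [Matrix.neg_mulVec]

/-- Three antisymmetric factors give a sign and the reverse order; restoring the order of the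
Clifford factors gives a second sign. -/
lemma pair_G_G_rotE {i j : Fin 3} (hij : i ≠ j) (Y u : Sm) {r : ℝ} (hr : 0 < r) :
    pair Y ((G i * G j * rotE i j) u) r = pair ((G i * G j * rotE i j) Y) u r := by
  have h : (G i * G j * rotE i j) Y = -(rotE i j (G j (G i Y))) := by
    have h1 : rotE i j * (G j * G i) = -(G i * G j * rotE i j) := by
      have h2 := G_anticomm j i
      rw [if_neg hij.symm] at h2
      rw [← mul_assoc, rotE_G, mul_assoc, rotE_G, ← mul_assoc, eq_neg_of_add_eq_zero_left h2, neg_mul]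
    have h3 := congrArg (fun a : Op => a Y) h1
    simp only [Op.mul_apply, Op.neg_apply] at h3 ⊢
    rw [h3, neg_neg]
  rw [h, pair_neg_left, ← pair_rotE _ _ _ _ hr]
  simp only [Op.mul_apply]
  rw [pair_G, pair_G, neg_neg]

lemma pair_K (Y u : Sm) {r : ℝ} (hr : 0 < r) : pair Y (K u) r = pair (K Y) u r := by
  rw [K_eq_rot]
  simp only [Op.add_apply, Op.one_apply, pair_add_left _ _ _ hr, pair_add_right _ _ _ hr,
    pair_G_G_rotE (show (0 : Fin 3) ≠ 1 by decide) _ _ hr,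
    pair_G_G_rotE (show (0 : Fin 3) ≠ 2 by decide) _ _ hr,
    pair_G_G_rotE (show (1 : Fin 3) ≠ 2 by decide) _ _ hr]

/-- `K` and `Al` are symmetric, but the coefficient of `Al` is imaginary, so its sign flips under
the adjoint. -/
lemma pair_T (z : ℝ) (Y u : Sm) {r : ℝ} (hr : 0 < r) :
    pair Y (T z u) r = pair (T (-z) Y) u r := by
  simp only [T, Op.sub_apply, Op.smul_apply, pair_sub_left _ _ _ hr, pair_sub_right _ _ _ hr,
    pair_smul_left, pair_smul_right, pair_K _ _ hr, pair_Al _ _ hr]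
  simp

/-- The support of the radial bump function. -/
def shell : Set (Space 3) := {x | 1 ≤ ‖x‖ ∧ ‖x‖ ≤ 4}

lemma isCompact_shell : IsCompact shell := by
  refine (isCompact_closedBall (0 : Space 3) 4).of_isClosed_subset ?_ fun x hx => by simpa using hx.2
  exact (isClosed_le continuous_const continuous_norm).inter (isClosed_le continuous_norm continuous_const)

lemma shell_ne_zero {x : Space 3} (hx : x ∈ shell) : x ≠ 0 := by
  rintro rfl; have := hx.1; simp at this; linarith

lemma bump_eq_zero_of_notMem_shell {x : Space 3} (hx : x ∉ shell) : bump x = 0 := by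
  by_cases h : 1 ≤ ‖x‖
  · exact bump_eq_zero_of_ge (le_of_lt (lt_of_not_ge fun h4 => hx ⟨h, h4⟩))
  · exact bump_eq_zero_of_le (le_of_not_ge h)

lemma pair_eq_setIntegral (Y u : Sm) (r : ℝ) :
    pair Y u r = ∫ x in shell, pairDensity Y u (r, x) :=
  (setIntegral_eq_integral_of_forall_compl_eq_zero fun x hx => by
    simp [pairDensity, bump_eq_zero_of_notMem_shell hx]).symm

lemma deriv_pairDensity (Y u : Sm) {r : ℝ} (hr : 0 < r) {x : Space 3} (hx : x ≠ 0) :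
    fderiv ℝ (fun r => pairDensity Y u (r, x)) r 1 = (r : ℂ)⁻¹ * pairDensity Y (R u) (r, x) := by
  have hp : r • angle x ≠ 0 := smul_ne_zero hr.ne' (angle_ne_zero hx)
  have hrc : (r : ℂ) ≠ 0 := by exact_mod_cast hr.ne'
  have h1 : HasDerivAt (fun r : ℝ => r • angle x) (angle x) r := by
    simpa using (hasDerivAt_id r).smul_const (angle x)
  have h2 : HasDerivAt (fun r : ℝ => u.1 (r • angle x)) (fderiv ℝ u.1 (r • angle x) (angle x)) r :=
    (differentiableAt_sm u hp).hasFDerivAt.comp_hasDerivAt r h1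
  have h3 : fderiv ℝ u.1 (r • angle x) (angle x) = (r : ℂ)⁻¹ • (R u).1 (r • angle x) := by
    rw [R_apply u hp, map_smul, ← Complex.coe_smul, inv_smul_smul₀ hrc]
  have h4 : HasDerivAt (fun r => pairDensity Y u (r, x))
      ((bump x : ℂ) * ∑ a, star (Y.1 x a) * (fderiv ℝ u.1 (r • angle x) (angle x)) a) r :=
    (HasDerivAt.fun_sum (u := Finset.univ) fun a _ =>
      ((hasDerivAt_pi.1 h2 a).const_mul (star (Y.1 x a)))).const_mul (bump x : ℂ)
  rw [fderiv_apply_one_eq_deriv, h4.deriv, h3]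
  simp only [pairDensity, dotProduct, Pi.star_apply, Pi.smul_apply, smul_eq_mul, Finset.mul_sum]
  exact Finset.sum_congr rfl fun a _ => by ring

lemma polar_prod_subset : Set.Ioi (0 : ℝ) ×ˢ shell ⊆ polarDomain := fun _ hq =>
  ⟨hq.1, shell_ne_zero hq.2⟩

lemma hasDerivAt_pair (Y u : Sm) {r : ℝ} (hr : 0 < r) :
    HasDerivAt (pair Y u) ((r : ℂ)⁻¹ * pair Y (R u) r) r := by
  have hi : IntegrableOn (fun _ : Space 3 => (1 : ℂ)) shell :=
    integrableOn_const isCompact_shell.measure_lt_top.ne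
  have he : pair Y u = fun r => ∫ x in shell, (1 : ℂ) • pairDensity Y u (r, x) := by
    funext r; simp only [one_smul]; exact pair_eq_setIntegral Y u r
  have hs : ContDiffOn ℝ ∞ (fun r => ∫ x in shell, (1 : ℂ) • pairDensity Y u (r, x)) (Set.Ioi 0) :=
    contDiffOn_integral_compact isOpen_polarDomain isCompact_shell hi isOpen_Ioi polar_prod_subset
      (contDiffOn_pairDensity Y u)
  have hd : DifferentiableAt ℝ (pair Y u) r := by
    rw [he]; exact (hs.contDiffAt (Ioi_mem_nhds hr)).differentiableAt (by simp)
  have h1 := fderiv_integral_compact isOpen_polarDomain ((contDiffOn_pairDensity Y u).of_le (by simp))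
    isCompact_shell hi (x₀ := r)
    ((Set.prod_mono (Set.singleton_subset_iff.2 hr) le_rfl).trans polar_prod_subset) 1
  refine hd.hasDerivAt.congr_deriv ?_
  rw [← fderiv_apply_one_eq_deriv, he, h1, pair_eq_setIntegral, ← integral_const_mul]
  refine setIntegral_congr_fun isCompact_shell.measurableSet fun x hx => ?_
  simp only [one_smul]
  exact deriv_pairDensity Y u hr (shell_ne_zero hx)

lemma exists_pair_bound (Y : Sm) : ∃ M, 0 ≤ M ∧ ∀ (u : Sm) (r B : ℝ), 0 < r →
    (∀ x, ‖x‖ = r → ‖u.1 x‖ ≤ B) → ‖pair Y u r‖ ≤ M * B := by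
  obtain ⟨b, hb⟩ := isCompact_shell.exists_bound_of_continuousOn contDiff_bump.continuous.continuousOn
  obtain ⟨y, hy⟩ := isCompact_shell.exists_bound_of_continuousOn
    (Y.2.1.continuousOn.mono fun x hx => shell_ne_zero hx)
  refine ⟨|b| * (Fintype.card SpinIdx * |y|) * volume.real shell, by positivity, fun u r B hr h => ?_⟩
  rw [pair_eq_setIntegral]
  have hB : 0 ≤ B := (norm_nonneg _).trans (h (r • ee 0) (by
    rw [norm_smul, Real.norm_of_nonneg hr.le]; simp [ee]))
  refine (norm_setIntegral_le_of_norm_le_const (C := |b| * (Fintype.card SpinIdx * |y|) * B)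
    isCompact_shell.measure_lt_top fun x hx => ?_).trans (le_of_eq (by ring))
  have h1 : ‖u.1 (r • angle x)‖ ≤ B := h _ (by
    rw [norm_smul, norm_angle (shell_ne_zero hx), Real.norm_of_nonneg hr.le, mul_one])
  rw [pairDensity, norm_mul, Complex.norm_real, mul_assoc]
  refine mul_le_mul ((hb x hx).trans (le_abs_self b)) ?_ (norm_nonneg _) (abs_nonneg _)
  refine (norm_sum_le _ _).trans ?_
  calc ∑ a, ‖star (Y.1 x) a * u.1 (r • angle x) a‖ ≤ ∑ _a : SpinIdx, |y| * B := by
        refine Finset.sum_le_sum fun a _ => ?_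
        rw [norm_mul, Pi.star_apply, norm_star]
        exact mul_le_mul ((norm_le_pi_norm _ a).trans ((hy x hx).trans (le_abs_self y)))
          ((norm_le_pi_norm _ a).trans h1) (norm_nonneg _) (abs_nonneg _)
    _ = _ := by simp [mul_assoc]

/-- The squared Dirac operator of Coulomb type at frequency `σ`, applied to `u`, in polar form. -/
def coulombOp (z : ℝ) (σ : ℂ) : Op :=
  T z * T z - T z - R * R - R - (σ ^ 2) • rp 2 + (2 * z * σ) • rp 1

/-- The Cartesian form, suited to comparison with the normal family: relative to `K² - K`, which
belongs to the Laplacian, `T² - T` adds the terms `-z²` and `iz Al`. -/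
lemma coulombOp_eq (z : ℝ) (σ : ℂ) :
    coulombOp z σ = rp 2 * (-∑ j, pd j * pd j) - ((z : ℂ) ^ 2) • 1 + (Complex.I * z) • Al
      - σ ^ 2 • rp 2 + (2 * z * σ) • rp 1 := by
  rw [coulombOp, T_sq, rp_two_laplacian, T]; abel

/-- Admissible growth: `u = O(r ^ w)` at the origin, outgoing and polynomially bounded at infinity. -/
structure IsOutgoing (σ : ℂ) (w : ℝ) (u : Sm) : Prop where
  near : ∃ K, ∀ x, x ≠ 0 → ‖x‖ ≤ 1 → ‖u.1 x‖ ≤ K * ‖x‖ ^ w ∧ ‖(R u).1 x‖ ≤ K * ‖x‖ ^ w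
  far : ∃ K C : ℝ, ∀ x, 1 ≤ ‖x‖ → ‖u.1 x‖ ≤ K * ‖x‖ ^ C ∧ ‖(R u).1 x‖ ≤ K * ‖x‖ ^ C
  osc : σ.im = 0 → ∃ (v : Sm) (C : ℝ),
    (∀ x, u.1 x = Complex.exp (Complex.I * σ * ‖x‖) • v.1 x) ∧
    ∀ j : ℕ, ∃ K, ∀ x, 1 ≤ ‖x‖ → ‖((fun u => R u)^[j] v).1 x‖ ≤ K * ‖x‖ ^ C

lemma pair_coulombOp (z : ℝ) (σ : ℂ) (Y u : Sm) {r : ℝ} (hr : 0 < r) :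
    pair Y (coulombOp z σ u) r = pair (T (-z) (T (-z) Y) - T (-z) Y) u r - pair Y (R (R u)) r
      - pair Y (R u) r - σ ^ 2 * r ^ 2 * pair Y u r + 2 * z * σ * r * pair Y u r := by
  simp only [coulombOp, Op.sub_apply, Op.add_apply, Op.smul_apply, Op.mul_apply,
    pair_sub_right _ _ _ hr, pair_add_right _ _ _ hr, pair_smul_right, pair_rp _ _ _ hr, pair_T _ _ _ hr,
    pair_sub_left _ _ _ hr, Complex.cpow_one, Complex.cpow_ofNat]
  ring

/-- Only the combination `s² - s` enters the radial equation, which leaves the choice between `s`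
and `1 - s` for the exponent `ρ`. -/
lemma isRadialSolution_pair {z : ℝ} {σ s ρ : ℂ} {u Y : Sm} (hu : coulombOp z σ u = 0)
    (hY : ∀ r, 0 < r → pair (T (-z) (T (-z) Y) - T (-z) Y) u r = (s ^ 2 - s) * pair Y u r)
    (hρ : ρ ^ 2 - ρ = s ^ 2 - s) : IsRadialSolution ρ σ z (pair Y u) (pair Y (R u)) := by
  refine ⟨fun r hr => hasDerivAt_pair Y u hr, fun r hr => ?_⟩
  refine (hasDerivAt_pair Y (R u) hr).congr_deriv ?_
  have h := pair_coulombOp z σ Y u hr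
  rw [hu, pair_zero_right, hY r hr] at h
  congr 1
  rw [hρ]
  linear_combination h

lemma pair_eq_zero_of_radial {z : ℝ} {σ ρ : ℂ} {w : ℝ} {u Y : Sm}
    (h : IsRadialSolution ρ σ z (pair Y u) (pair Y (R u))) (ho : IsOutgoing σ w u)
    (hσ0 : σ ≠ 0) (hσ : 0 ≤ σ.im) (hρ : 0 < ρ.re) (hw : 0 < ρ.re + w) {r : ℝ} (hr : 0 < r) :
    pair Y u r = 0 := by
  obtain ⟨M, hM0, hM⟩ := exists_pair_bound Y
  obtain ⟨K1, h1⟩ := ho.near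
  obtain ⟨K2, C, h2⟩ := ho.far
  have hK : ∀ {a b : ℝ} (K K' p : ℝ), 0 ≤ p → a ≤ M * (K * p) → a ≤ M * (|K| + |K'|) * p := by
    intro a b K K' p hp h
    refine h.trans ?_
    rw [mul_assoc]
    exact mul_le_mul_of_nonneg_left (mul_le_mul_of_nonneg_right
      ((le_abs_self K).trans (le_add_of_nonneg_right (abs_nonneg _))) hp) hM0
  have hpos : ∀ {x : Space 3} {r : ℝ}, 0 < r → ‖x‖ = r → x ≠ 0 := fun hr hx h0 => by
    rw [h0, norm_zero] at hx; linarith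
  refine h.eq_zero hρ (w := w) (C := C) (K := M * (|K1| + |K2|)) hw hσ0 hσ ?_ ?_ ?_ ?_ ?_ hr
  · intro r hr hr1
    refine hK (b := 0) K1 K2 _ (Real.rpow_nonneg hr.le _) (hM u r _ hr fun x hx => ?_)
    have := (h1 x (hpos hr hx) (hx.le.trans hr1)).1
    rwa [hx] at this
  · intro r hr hr1
    refine hK (b := 0) K1 K2 _ (Real.rpow_nonneg hr.le _) (hM (R u) r _ hr fun x hx => ?_)
    have := (h1 x (hpos hr hx) (hx.le.trans hr1)).2
    rwa [hx] at this
  · intro r hr1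
    have hr : 0 < r := by linarith
    rw [add_comm |K1|]
    refine hK (b := 0) K2 K1 _ (Real.rpow_nonneg hr.le _) (hM u r _ hr fun x hx => ?_)
    have := (h2 x (hr1.trans hx.ge)).1
    rwa [hx] at this
  · intro r hr1
    have hr : 0 < r := by linarith
    rw [add_comm |K1|]
    refine hK (b := 0) K2 K1 _ (Real.rpow_nonneg hr.le _) (hM (R u) r _ hr fun x hx => ?_)
    have := (h2 x (hr1.trans hx.ge)).2
    rwa [hx] at this
  · intro him
    obtain ⟨v, C, huv, hb⟩ := ho.osc him
    refine ⟨fun j => pair Y ((fun u => R u)^[j] v), C, ⟨fun j r hr => ?_, fun j => ?_⟩, fun r hr1 => ?_⟩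
    · simp only [Function.iterate_succ_apply']
      exact hasDerivAt_pair Y _ hr
    · obtain ⟨K, hK⟩ := hb j
      refine ⟨M * K, fun r hr1 => ?_⟩
      have hr : 0 < r := by linarith
      rw [mul_assoc]
      refine hM _ r _ hr fun x hx => ?_
      have := hK x (hr1.trans hx.ge)
      rwa [hx] at this
    · have hr : 0 < r := by linarith
      simp only [Function.iterate_zero, id]
      rw [pair, pair, ← integral_const_mul]
      refine integral_congr_ae (ae_of_all _ fun x => ?_)
      by_cases hx : x = 0
      · simp [pairDensity, hx, bump_eq_zero_of_le]
      · simp only [pairDensity]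
        rw [huv, norm_smul, norm_angle hx, Real.norm_of_nonneg hr.le, mul_one, dotProduct_smul,
          smul_eq_mul]
        ring

/-- Every exponent at weight `w` admits a representative for which the radial lemma applies. -/
def GoodExponents (z w : ℝ) : Prop := ∀ s : ℂ, (∃ κ : ℤ, κ ≠ 0 ∧ s ^ 2 + (z : ℂ) ^ 2 = (κ : ℂ) ^ 2) →
  ∃ ρ : ℂ, ρ ^ 2 - ρ = s ^ 2 - s ∧ 0 < ρ.re ∧ 0 < ρ.re + w

lemma exists_kappa_of_eigenvector {z : ℝ} {μ : ℂ} {Y : Sm} (hR : R Y = 0) (hY : Y ≠ 0)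
    (hT : T z Y = μ • Y) : ∃ κ : ℤ, κ ≠ 0 ∧ μ ^ 2 + (z : ℂ) ^ 2 = (κ : ℂ) ^ 2 := by
  by_contra! h
  exact hY ((sphere_T h).1 Y hR (by rw [Op.sub_apply, hT, Op.smul_apply, Op.one_apply, sub_self]))

lemma star_kappa {z : ℝ} {μ : ℂ} (h : ∃ κ : ℤ, κ ≠ 0 ∧ μ ^ 2 + ((-z : ℝ) : ℂ) ^ 2 = (κ : ℂ) ^ 2) :
    ∃ κ : ℤ, κ ≠ 0 ∧ (star μ) ^ 2 + (z : ℂ) ^ 2 = (κ : ℂ) ^ 2 := by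
  obtain ⟨κ, h0, h⟩ := h
  refine ⟨κ, h0, ?_⟩
  have := congrArg star h
  simpa using this

/-- Induction on the height of the generalized eigenvector. Modulo `Y` itself, `T² Y - T Y` consists
of generalized eigenvectors of smaller height, whose pairings vanish already, so the pairing with
`Y` solves the same scalar equation as for a genuine eigenvector. -/
lemma pair_eq_zero_of_genEigenvector {z : ℝ} {σ : ℂ} {w : ℝ} {u : Sm} (hu : coulombOp z σ u = 0)
    (ho : IsOutgoing σ w u) (hσ0 : σ ≠ 0) (hσ : 0 ≤ σ.im) (hg : GoodExponents z w) {μ : ℂ} (k : ℕ)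
    {Y : Sm} (hR : R Y = 0) (hY : ((T (-z) - μ • 1) ^ k) Y = 0) {r : ℝ} (hr : 0 < r) :
    pair Y u r = 0 := by
  induction k generalizing Y r with
  | zero => rw [pow_zero, Op.one_apply] at hY; rw [hY, pair_zero_left]
  | succ k ih =>
    set B : Op := T (-z) - μ • 1 with hB
    have hRB : R * B = B * R := R_mul_sub_smul (R_T _) _
    have hRT := R_T (-z)
    have hTB : T (-z) * B = B * T (-z) := by
      rw [hB, mul_sub, sub_mul, mul_smul_comm, smul_mul_assoc, mul_one, one_mul]
    by_cases hY0 : Y = 0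
    · rw [hY0, pair_zero_left]
    by_cases hk : ∀ j ≤ k, (B ^ j) Y ≠ 0
    · -- the vector `B ^ k Y` is an eigenvector
      have hev : T (-z) ((B ^ k) Y) = μ • (B ^ k) Y := by
        have h1 : B ((B ^ k) Y) = 0 := by rw [← Op.mul_apply, ← pow_succ']; exact hY
        rw [hB, Op.sub_apply, Op.smul_apply, Op.one_apply, sub_eq_zero] at h1
        exact h1
      have hRk : R ((B ^ k) Y) = 0 := by
        rw [← Op.mul_apply, (Commute.pow_right (show Commute R B from hRB) k).eq, Op.mul_apply, hR,
          map_zero]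
      obtain ⟨ρ, hρ, hρ0, hρw⟩ := hg _ (star_kappa (exists_kappa_of_eigenvector hRk (hk k le_rfl) hev))
      refine pair_eq_zero_of_radial (isRadialSolution_pair (Y := Y) hu (fun r hr => ?_) hρ) ho hσ0 hσ
        hρ0 hρw hr
      have hRBY : R (B Y) = 0 := by rw [← Op.mul_apply, hRB, Op.mul_apply, hR, map_zero]
      have z1 : pair (B Y) u r = 0 := ih hRBY (by rw [← Op.mul_apply, ← pow_succ]; exact hY) hr
      have z2 : pair (T (-z) (B Y)) u r = 0 := by
        refine ih ?_ ?_ hr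
        · rw [← Op.mul_apply, hRT, Op.mul_apply, hRBY, map_zero]
        · have h1 : B ^ k * (T (-z) * B) = T (-z) * B ^ (k + 1) := by
            rw [← mul_assoc, ← (Commute.pow_right (show Commute (T (-z)) B from hTB) k).eq, mul_assoc,
              pow_succ]
          have h2 := congrArg (fun a : Op => a Y) h1
          simp only [Op.mul_apply] at h2
          rw [h2, hY, map_zero]
      have h3 : T (-z) (T (-z) Y) - T (-z) Y = (μ ^ 2 - μ) • Y + T (-z) (B Y) + (μ - 1) • B Y := by
        rw [hB]
        simp only [Op.sub_apply, Op.smul_apply, Op.one_apply, map_sub, map_smul]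
        module
      rw [h3, pair_add_left _ _ _ hr, pair_add_left _ _ _ hr, pair_smul_left, pair_smul_left, z1, z2]
      simp
    -- Here an earlier power of `B` already annihilates `Y`, so its height is at most `k`.
    · push Not at hk
      obtain ⟨j, hj, hj0⟩ := hk
      refine ih hR ?_ hr
      rw [← Nat.sub_add_cancel hj, pow_add, Op.mul_apply, hj0, map_zero]

end EdgeWave

end

/-! ### Polynomial spinors on the sphere and completeness -/

noncomputable section

namespace EdgeWave
open MeasureTheory Filter Topology

/-- The linear map underlying an operator. -/
def Op.lin (a : Op) : Sm →ₗ[ℂ] Sm := a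

/-- Constant spinors. -/
def constSpinor : (SpinIdx → ℂ) →ₗ[ℂ] Sm where
  toFun v := cut (fun _ => v) contDiffOn_const
  map_add' v w := Sm_ext fun x hx => by simp [cut_apply, hx]
  map_smul' c v := Sm_ext fun x hx => by simp [cut_apply, hx]

lemma constSpinor_apply (v : SpinIdx → ℂ) {x : Space 3} (hx : x ≠ 0) : (constSpinor v).1 x = v :=
  cut_apply (u := fun _ => v) contDiffOn_const hx

lemma pd_constSpinor (j : Fin 3) (v : SpinIdx → ℂ) : pd j (constSpinor v) = 0 := by
  refine Sm_ext fun x hx => ?_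
  have h : (constSpinor v).1 =ᶠ[nhds x] fun _ => v := cut_eventuallyEq contDiffOn_const hx
  rw [pd_apply _ _ hx, h.fderiv_eq]; simp

/-- Multiplication by the component `ω_j` of `x / |x|`. -/
def Om (j : Fin 3) : Op := rp (-1) * X j

lemma Om_apply (j : Fin 3) (u : Sm) {x : Space 3} : (Om j u).1 x = ((angle x j : ℝ) : ℂ) • u.1 x := by
  change ((‖x‖ : ℝ) : ℂ) ^ (-1 : ℂ) • ((x j : ℝ) : ℂ) • u.1 x = _
  rw [Complex.cpow_neg_one, smul_smul]
  simp [angle]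

lemma rotE_rp (i j : Fin 3) (ξ : ℂ) : rotE i j * rp ξ = rp ξ * rotE i j := by
  simp only [rotE, sub_mul, mul_sub, mul_assoc, pd_rp, mul_add, mul_smul_comm]
  rw [← mul_assoc (X i) (rp _) (X j), ← mul_assoc (X j) (rp _) (X i), ← rp_X, ← rp_X, mul_assoc, mul_assoc,
    X_comm j i, ← mul_assoc (X i) (rp ξ), ← mul_assoc (X j) (rp ξ), ← rp_X, ← rp_X, mul_assoc, mul_assoc]
  abel

lemma rotE_X (i j k : Fin 3) : rotE i j * X k =
    X k * rotE i j + ((if j = k then X i else 0) - if i = k then X j else 0) := by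
  simp only [rotE, sub_mul, mul_sub, mul_assoc, pd_X, mul_add]
  rw [← mul_assoc (X i) (X k), ← mul_assoc (X j) (X k), X_comm i k, X_comm j k, mul_assoc, mul_assoc]
  split_ifs <;> simp <;> abel

lemma rotE_Om (i j k : Fin 3) : rotE i j * Om k =
    Om k * rotE i j + ((if j = k then Om i else 0) - if i = k then Om j else 0) := by
  rw [Om, ← mul_assoc, rotE_rp, mul_assoc, rotE_X, mul_add, ← mul_assoc, mul_sub]
  congr 2 <;> split_ifs <;> simp [Om]

lemma G_Om (i j : Fin 3) : G i * Om j = Om j * G i := by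
  rw [Om, ← mul_assoc, ← rp_G, mul_assoc, ← X_G, mul_assoc]

lemma R_Om (j : Fin 3) : R * Om j = Om j * R := by
  rw [Om, ← mul_assoc, R_rp, add_mul, mul_assoc, R_X, mul_add, smul_mul_assoc, neg_smul, one_smul,
    mul_assoc]
  abel

/-- Spinor-valued polynomials of degree `≤ d` in `x / |x|`. -/
def spherePoly : ℕ → Submodule ℂ Sm
  | 0 => LinearMap.range constSpinor
  | d + 1 => spherePoly d ⊔ ⨆ j, (spherePoly d).map (Om j).lin

lemma spherePoly_le_succ (d : ℕ) : spherePoly d ≤ spherePoly (d + 1) := le_sup_left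

lemma spherePoly_mono : Monotone spherePoly := monotone_nat_of_le_succ spherePoly_le_succ

lemma Om_mem {d : ℕ} {Y : Sm} (hY : Y ∈ spherePoly d) (j : Fin 3) : Om j Y ∈ spherePoly (d + 1) :=
  Submodule.mem_sup_right (Submodule.mem_iSup_of_mem j ⟨Y, hY, rfl⟩)

lemma finiteDimensional_spherePoly (d : ℕ) : FiniteDimensional ℂ (spherePoly d) := by
  induction d with
  | zero => exact inferInstanceAs (FiniteDimensional ℂ (LinearMap.range constSpinor))
  | succ d ih =>
    exact inferInstanceAs (FiniteDimensional ℂ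
      (spherePoly d ⊔ ⨆ j, (spherePoly d).map (Om j).lin : Submodule ℂ Sm))

lemma spherePoly_succ_le {d : ℕ} {N : Submodule ℂ Sm} (h0 : spherePoly d ≤ N)
    (h1 : ∀ j, ∀ Y ∈ spherePoly d, Om j Y ∈ N) : spherePoly (d + 1) ≤ N := by
  refine sup_le h0 (iSup_le fun j => ?_)
  rintro _ ⟨Y, hY, rfl⟩
  exact h1 j Y hY

lemma G_mem {d : ℕ} (i : Fin 3) : ∀ Y ∈ spherePoly d, G i Y ∈ spherePoly d := by
  change spherePoly d ≤ (spherePoly d).comap (G i).lin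
  induction d with
  | zero =>
    rintro _ ⟨v, rfl⟩
    refine ⟨gamma i *ᵥ v, Sm_ext fun x hx => ?_⟩
    change _ = gamma i *ᵥ (constSpinor v).1 x
    rw [constSpinor_apply _ hx, constSpinor_apply _ hx]
  | succ d ih =>
    refine spherePoly_succ_le (ih.trans (Submodule.comap_mono (spherePoly_le_succ d))) fun j Y hY => ?_
    change G i (Om j Y) ∈ spherePoly (d + 1)
    rw [← Op.mul_apply, G_Om]
    exact Om_mem (ih hY) j

lemma rotE_mem {d : ℕ} (i j : Fin 3) : ∀ Y ∈ spherePoly d, rotE i j Y ∈ spherePoly d := by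
  change spherePoly d ≤ (spherePoly d).comap (rotE i j).lin
  induction d with
  | zero =>
    rintro _ ⟨v, rfl⟩
    change rotE i j (constSpinor v) ∈ spherePoly 0
    simp only [rotE, Op.sub_apply, Op.mul_apply, pd_constSpinor, map_zero, sub_zero]
    exact Submodule.zero_mem _
  | succ d ih =>
    refine spherePoly_succ_le (ih.trans (Submodule.comap_mono (spherePoly_le_succ d))) fun k Y hY => ?_
    change rotE i j (Om k Y) ∈ spherePoly (d + 1)
    rw [← Op.mul_apply, rotE_Om]
    refine Submodule.add_mem _ (Om_mem (ih hY) k) (Submodule.sub_mem _ ?_ ?_) <;> split_ifs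
    · exact Om_mem hY i
    · exact Submodule.zero_mem _
    · exact Om_mem hY j
    · exact Submodule.zero_mem _

lemma R_spherePoly {d : ℕ} : ∀ Y ∈ spherePoly d, R Y = 0 := by
  change spherePoly d ≤ LinearMap.ker R.lin
  induction d with
  | zero =>
    rintro _ ⟨v, rfl⟩
    change R (constSpinor v) = 0
    rw [R_eq_sum]; simp [pd_constSpinor]
  | succ d ih =>
    refine spherePoly_succ_le ih fun k Y hY => ?_
    change R (Om k Y) = 0
    have h : R Y = 0 := ih hY
    rw [← Op.mul_apply, R_Om, Op.mul_apply, h, map_zero]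

lemma K_mem {d : ℕ} {Y : Sm} (hY : Y ∈ spherePoly d) : K Y ∈ spherePoly d := by
  rw [K_eq_rot]
  simp only [Op.add_apply, Op.one_apply, Op.mul_apply]
  refine Submodule.add_mem _ hY (Submodule.add_mem _ (Submodule.add_mem _ ?_ ?_) ?_) <;>
    exact G_mem _ _ (G_mem _ _ (rotE_mem _ _ _ hY))

/-- The finite-dimensional spaces of spinors on the sphere that are invariant under `T z`. -/
def sphereSpace (d : ℕ) : Submodule ℂ Sm := spherePoly d ⊔ (spherePoly d).map Al.lin

lemma R_sphereSpace {d : ℕ} : ∀ Y ∈ sphereSpace d, R Y = 0 := by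
  change sphereSpace d ≤ LinearMap.ker R.lin
  refine sup_le R_spherePoly ?_
  rintro _ ⟨Y, hY, rfl⟩
  change R (Al Y) = 0
  rw [← Op.mul_apply, R_Al, Op.mul_apply, R_spherePoly Y hY, map_zero]

/-- `K` preserves polynomial degree but `Al` need not. Adjoining the image of `Al` is enough,
because `Al` squares to one and anticommutes with `K`. -/
lemma T_mem {d : ℕ} (z : ℝ) : ∀ Y ∈ sphereSpace d, T z Y ∈ sphereSpace d := by
  have hA : ∀ {Y}, Y ∈ spherePoly d → Y ∈ sphereSpace d := fun h => Submodule.mem_sup_left h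
  have hB : ∀ {Y}, Y ∈ spherePoly d → Al Y ∈ sphereSpace d := fun h =>
    Submodule.mem_sup_right ⟨_, h, rfl⟩
  change sphereSpace d ≤ (sphereSpace d).comap (T z).lin
  refine sup_le (fun Y hY => ?_) ?_
  · change T z Y ∈ sphereSpace d
    simp only [T, Op.sub_apply, Op.smul_apply]
    exact Submodule.sub_mem _ (hA (K_mem hY)) (Submodule.smul_mem _ _ (hB hY))
  · rintro _ ⟨Y, hY, rfl⟩
    change T z (Al Y) ∈ sphereSpace d
    simp only [T, Op.sub_apply, Op.smul_apply]
    rw [← Op.mul_apply, K_Al, ← Op.mul_apply, Al_sq]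
    exact Submodule.sub_mem _ (Submodule.neg_mem _ (hB (K_mem hY))) (Submodule.smul_mem _ _ (hA hY))

lemma finiteDimensional_sphereSpace (d : ℕ) : FiniteDimensional ℂ (sphereSpace d) := by
  have := finiteDimensional_spherePoly d
  exact inferInstanceAs (FiniteDimensional ℂ
    (spherePoly d ⊔ (spherePoly d).map Al.lin : Submodule ℂ Sm))

/-- A finite-dimensional invariant subspace is contained in any subspace that contains its
generalized eigenvectors. -/
lemma le_of_forall_genEigenvector {E : Type*} [AddCommGroup E] [Module ℂ E] (f : Module.End ℂ E)
    {V N : Submodule ℂ E} [FiniteDimensional ℂ V] (hV : ∀ v ∈ V, f v ∈ V)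
    (h : ∀ (μ : ℂ) (k : ℕ), ∀ v ∈ V, ((f - μ • 1) ^ k) v = 0 → v ∈ N) : V ≤ N := by
  set g : Module.End ℂ V := f.restrict hV with hg
  have hpow : ∀ (μ : ℂ) (k : ℕ) (v : V), ((((g - μ • 1) ^ k) v : V) : E) = ((f - μ • 1) ^ k) v.1 := by
    intro μ k
    induction k with
    | zero => intro v; rfl
    | succ k ih =>
      intro v
      rw [pow_succ, pow_succ, Module.End.mul_apply, Module.End.mul_apply, ih]
      rfl
  have hN : (⊤ : Submodule ℂ V) ≤ N.comap V.subtype := by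
    rw [← Module.End.iSup_maxGenEigenspace_eq_top g]
    refine iSup_le fun μ v hv => ?_
    obtain ⟨k, hk⟩ := (Module.End.mem_maxGenEigenspace g μ v).1 hv
    refine h μ k v.1 v.2 ?_
    rw [← hpow, hk]; rfl
  exact fun v hv => hN (Submodule.mem_top (x := (⟨v, hv⟩ : V)))

/-- Over `ℂ`, generalized eigenvectors of `T (-z)` span the finite-dimensional invariant space, and
the spinors with vanishing pairing form a subspace. -/
lemma pair_eq_zero_of_mem_sphereSpace {z : ℝ} {σ : ℂ} {w : ℝ} {u : Sm} (hu : coulombOp z σ u = 0)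
    (ho : IsOutgoing σ w u) (hσ0 : σ ≠ 0) (hσ : 0 ≤ σ.im) (hg : GoodExponents z w) {d : ℕ} {Y : Sm}
    (hY : Y ∈ sphereSpace d) {r : ℝ} (hr : 0 < r) : pair Y u r = 0 := by
  have := finiteDimensional_sphereSpace d
  let N : Submodule ℂ Sm :=
    { carrier := {v | pair v u r = 0}
      add_mem' := fun {a b} ha hb => by
        change pair (a + b) u r = 0
        rw [pair_add_left _ _ _ hr, show pair a u r = 0 from ha, show pair b u r = 0 from hb,
          add_zero]
      zero_mem' := pair_zero_left u r
      smul_mem' := fun c a ha => by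
        change pair (c • a) u r = 0
        rw [pair_smul_left, show pair a u r = 0 from ha, mul_zero] }
  exact le_of_forall_genEigenvector (N := N) (T (-z)).lin (T_mem (-z)) (fun μ k v hv hk =>
    pair_eq_zero_of_genEigenvector hu ho hσ0 hσ hg (μ := μ) k (R_sphereSpace v hv) hk hr) hY

/-- The unit sphere. -/
abbrev USphere : Type := Metric.sphere (0 : Space 3) 1

/-- Coordinates on the unit sphere. -/
def sphereCoord (j : Fin 3) : C(USphere, ℝ) := ⟨fun s => s.1 j, by fun_prop⟩

/-- Stone–Weierstrass: the coordinates separate the points of the compact sphere. -/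
lemma adjoin_sphereCoord_dense :
    (Algebra.adjoin ℝ (Set.range sphereCoord)).topologicalClosure = ⊤ := by
  refine ContinuousMap.subalgebra_topologicalClosure_eq_top_of_separatesPoints _ fun x y hxy => ?_
  have : ∃ j, x.1 j ≠ y.1 j := by
    by_contra! h
    exact hxy (Subtype.ext (PiLp.ext h))
  obtain ⟨j, hj⟩ := this
  exact ⟨_, ⟨sphereCoord j, Algebra.subset_adjoin ⟨j, rfl⟩, rfl⟩, hj⟩

lemma exists_mul_spherePoly {p : C(USphere, ℝ)} (hp : p ∈ Algebra.adjoin ℝ (Set.range sphereCoord)) :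
    ∀ d, ∀ Y ∈ spherePoly d, ∃ d', ∃ Y' ∈ spherePoly d', ∀ x ≠ 0, ∀ s : USphere, s.1 = angle x →
      Y'.1 x = ((p s : ℝ) : ℂ) • Y.1 x := by
  induction hp using Algebra.adjoin_induction with
  | mem p hp =>
    obtain ⟨j, rfl⟩ := hp
    intro d Y hY
    refine ⟨d + 1, Om j Y, Om_mem hY j, fun x _ s hs => ?_⟩
    rw [Om_apply, ← hs]; rfl
  | algebraMap c =>
    intro d Y hY
    exact ⟨d, (c : ℂ) • Y, Submodule.smul_mem _ _ hY, fun x _ s _ => rfl⟩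
  | add p q _ _ ihp ihq =>
    intro d Y hY
    obtain ⟨d1, Y1, h1, e1⟩ := ihp d Y hY
    obtain ⟨d2, Y2, h2, e2⟩ := ihq d Y hY
    refine ⟨max d1 d2, Y1 + Y2, Submodule.add_mem _ (spherePoly_mono (le_max_left _ _) h1)
      (spherePoly_mono (le_max_right _ _) h2), fun x hx s hs => ?_⟩
    change Y1.1 x + Y2.1 x = _
    rw [e1 x hx s hs, e2 x hx s hs, ← add_smul]; simp
  | mul p q _ _ ihp ihq =>
    intro d Y hY
    obtain ⟨d2, Y2, h2, e2⟩ := ihq d Y hY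
    obtain ⟨d1, Y1, h1, e1⟩ := ihp d2 Y2 h2
    refine ⟨d1, Y1, h1, fun x hx s hs => ?_⟩
    rw [e1 x hx s hs, e2 x hx s hs, smul_smul]; simp

/-- A spinor whose pairings with all polynomials on the sphere vanish is zero. -/
lemma eq_zero_of_pair_eq_zero {u : Sm}
    (h : ∀ d, ∀ Y ∈ spherePoly d, ∀ r, 0 < r → pair Y u r = 0) : u = 0 := by
  have main : ∀ (r : ℝ), 0 < r → ∀ a : SpinIdx, ∀ x : Space 3, ‖x‖ = 2 → u.1 (r • angle x) a = 0 := by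
    intro r hr a
    set f : Space 3 → ℂ := fun x => u.1 (r • angle x) a with hf
    have hfs : ContDiffOn ℝ ∞ f {0}ᶜ := by
      have h1 : ContDiffOn ℝ ∞ (fun x => u.1 (r • angle x)) {0}ᶜ :=
        contDiffOn_polar.comp (f := fun x => (r, x)) (contDiff_const.prodMk contDiff_id).contDiffOn
          fun x hx => ⟨hr, hx⟩
      exact contDiffOn_pi.1 h1 a
    -- The value at the origin is arbitrary, since all integrals are over `shell`.
    obtain ⟨proj, hproj⟩ : ∃ proj : Space 3 → USphere, ∀ x ≠ 0, (proj x).1 = angle x := by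
      classical
      refine ⟨fun x => if hx : x = 0 then ⟨ee 0, by simp [ee]⟩ else ⟨angle x, by
        simpa using norm_angle hx⟩, fun x hx => by simp [hx]⟩
    have hprojc : ContinuousOn proj {0}ᶜ := by
      rw [Topology.IsInducing.subtypeVal.continuousOn_iff]
      exact contDiffOn_angle.continuousOn.congr fun x hx => hproj x hx
    have hcq : ∀ q : C(USphere, ℝ), ContinuousOn (fun x => (bump x : ℂ) * (((q (proj x) : ℝ) : ℂ) * f x))
        shell := by
      intro q
      have h0 : shell ⊆ {0}ᶜ := fun x hx => shell_ne_zero hx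
      have h1 : ContinuousOn (fun x => ((q (proj x) : ℝ) : ℂ)) shell :=
        Complex.continuous_ofReal.comp_continuousOn (q.continuous.comp_continuousOn (hprojc.mono h0))
      have h2 : ContinuousOn (fun x => (bump x : ℂ)) shell :=
        (Complex.continuous_ofReal.comp contDiff_bump.continuous).continuousOn
      exact h2.mul (h1.mul (hfs.continuousOn.mono h0))
    have hP : ∀ p ∈ Algebra.adjoin ℝ (Set.range sphereCoord),
        ∫ x in shell, (bump x : ℂ) * (((p (proj x) : ℝ) : ℂ) * f x) = 0 := by
      intro p hp
      obtain ⟨d, Y, hY, e⟩ := exists_mul_spherePoly hp 0 (constSpinor (Pi.single a 1)) ⟨_, rfl⟩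
      rw [← h d Y hY r hr, pair_eq_setIntegral]
      refine setIntegral_congr_fun isCompact_shell.measurableSet fun x hx => ?_
      have hx0 := shell_ne_zero hx
      simp only [pairDensity]
      rw [e x hx0 (proj x) (hproj x hx0), constSpinor_apply _ hx0, star_smul, smul_dotProduct]
      simp [hf, dotProduct, Pi.single_apply]
    obtain ⟨b, hb⟩ := isCompact_shell.exists_bound_of_continuousOn
      (hcq 1)
    -- Uniform approximation of `q` by polynomials on the sphere; the error is controlled by the
    -- bound on `bump * f`.
    have hall : ∀ q : C(USphere, ℝ), ∫ x in shell, (bump x : ℂ) * (((q (proj x) : ℝ) : ℂ) * f x) = 0 := by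
      intro q
      rw [← norm_le_zero_iff]
      refine le_of_forall_pos_le_add fun ε hε => ?_
      rw [zero_add]
      set M : ℝ := |b| * volume.real shell with hM
      have hM0 : 0 ≤ M := by positivity
      have hq : q ∈ (Algebra.adjoin ℝ (Set.range sphereCoord)).topologicalClosure := by
        rw [adjoin_sphereCoord_dense]; trivial
      obtain ⟨p, hp, hpq⟩ := Metric.mem_closure_iff.1 hq (ε / (M + 1)) (by positivity)
      have hint : ∀ q : C(USphere, ℝ), IntegrableOn
          (fun x => (bump x : ℂ) * (((q (proj x) : ℝ) : ℂ) * f x)) shell := fun q =>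
        (hcq q).integrableOn_compact isCompact_shell
      rw [← sub_zero (∫ x in shell, _), ← hP p hp, ← integral_sub (hint q) (hint p)]
      refine (norm_setIntegral_le_of_norm_le_const (C := ε / (M + 1) * |b|)
        isCompact_shell.measure_lt_top fun x hx => ?_).trans ?_
      · have e1 : (bump x : ℂ) * (((q (proj x) : ℝ) : ℂ) * f x) - (bump x : ℂ) * (((p (proj x) : ℝ) : ℂ) * f x)
            = ((q (proj x) - p (proj x) : ℝ) : ℂ) * ((bump x : ℂ) * ((((1 : C(USphere, ℝ)) (proj x) : ℝ) : ℂ) * f x)) := by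
          push_cast; simp; ring
        rw [e1, norm_mul, Complex.norm_real]
        refine mul_le_mul ?_ ((hb x hx).trans (le_abs_self b)) (norm_nonneg _) (by positivity)
        rw [← dist_eq_norm]
        exact (ContinuousMap.dist_apply_le_dist _).trans hpq.le
      · rw [mul_assoc, ← hM, div_mul_eq_mul_div, div_le_iff₀ (by positivity)]
        nlinarith
    -- Testing against the real and imaginary parts of the component itself produces its weighted
    -- square norm.
    have hre := hall ⟨fun s => (u.1 (r • s.1) a).re, by
      have h1 : ContinuousOn (fun y => (u.1 y a).re) {0}ᶜ :=
        Complex.continuous_re.comp_continuousOn ((continuous_apply a).comp_continuousOn u.2.1.continuousOn)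
      exact h1.comp_continuous (by fun_prop) fun s => smul_ne_zero hr.ne' (by
        intro h0; have := s.2; rw [h0] at this; simp at this)⟩
    have him := hall ⟨fun s => (u.1 (r • s.1) a).im, by
      have h1 : ContinuousOn (fun y => (u.1 y a).im) {0}ᶜ :=
        Complex.continuous_im.comp_continuousOn ((continuous_apply a).comp_continuousOn u.2.1.continuousOn)
      exact h1.comp_continuous (by fun_prop) fun s => smul_ne_zero hr.ne' (by
        intro h0; have := s.2; rw [h0] at this; simp at this)⟩
    have hsq : ∫ x in shell, bump x * ‖f x‖ ^ 2 = 0 := by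
      have h1 : ∫ x in shell, ((bump x * ‖f x‖ ^ 2 : ℝ) : ℂ) = 0 := by
        have h2 := congrArg₂ (fun a b : ℂ => a - Complex.I * b) hre him
        simp only [mul_zero, sub_zero] at h2
        rw [← integral_const_mul, ← integral_sub ((hcq _).integrableOn_compact isCompact_shell)
          (((hcq _).integrableOn_compact isCompact_shell).const_mul _)] at h2
        rw [← h2]
        refine setIntegral_congr_fun isCompact_shell.measurableSet fun x hx => ?_
        simp only [ContinuousMap.coe_mk, hproj x (shell_ne_zero hx)]
        change _ = (bump x : ℂ) * (((f x).re : ℂ) * f x) - Complex.I * ((bump x : ℂ) * (((f x).im : ℂ) * f x))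
        have h3 : (((f x).re : ℂ) - Complex.I * (f x).im) * f x = ((‖f x‖ ^ 2 : ℝ) : ℂ) := by
          rw [← Complex.normSq_eq_norm_sq, Complex.normSq_eq_conj_mul_self]
          congr 1
          apply Complex.ext <;> simp
        push_cast at h3 ⊢
        rw [← h3]; ring
      have h5 : ((∫ x in shell, bump x * ‖f x‖ ^ 2 : ℝ) : ℂ) = 0 := by
        rw [← h1]; exact integral_complex_ofReal.symm
      exact_mod_cast h5
    have hcont : ContinuousOn (fun x => bump x * ‖f x‖ ^ 2) {0}ᶜ :=
      contDiff_bump.continuous.continuousOn.mul (hfs.continuousOn.norm.pow 2)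
    intro x hx
    have hx0 : x ≠ 0 := by rintro rfl; simp at hx
    have hae := (setIntegral_eq_zero_iff_of_nonneg_ae (ae_of_all _ fun x =>
      mul_nonneg (bump_nonneg x) (by positivity))
      ((hcont.mono fun x hx => shell_ne_zero hx).integrableOn_compact isCompact_shell)).1 hsq
    have hopen : IsOpen {x : Space 3 | 1 < ‖x‖ ∧ ‖x‖ < 4} :=
      (isOpen_lt continuous_const continuous_norm).inter (isOpen_lt continuous_norm continuous_const)
    have hsub : {x : Space 3 | 1 < ‖x‖ ∧ ‖x‖ < 4} ⊆ shell := fun x hx => ⟨hx.1.le, hx.2.le⟩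
    -- Continuity upgrades almost everywhere to everywhere on the open shell, in particular to `|x|
    -- = 2`, where `bump` equals one.
    have heq := Measure.eqOn_open_of_ae_eq (ae_restrict_of_ae_restrict_of_subset hsub hae) hopen
      (hcont.mono fun x hx => shell_ne_zero (hsub hx)) continuousOn_const
    have h1 := heq (show x ∈ {x : Space 3 | 1 < ‖x‖ ∧ ‖x‖ < 4} from by
      rw [Set.mem_ofPred_eq, hx]; norm_num)
    simp only [bump_eq_one hx, one_mul, Pi.zero_apply] at h1
    exact norm_eq_zero.1 (pow_eq_zero_iff two_ne_zero |>.1 h1)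
  refine Sm_ext fun y hy => funext fun a => ?_
  have hn := norm_pos_iff.2 hy
  have h1 := main ‖y‖ hn a ((2 : ℝ) • angle y) (by rw [norm_smul, norm_angle hy]; norm_num)
  rw [angle_smul two_pos, show angle (angle y) = angle y from angle_smul (inv_pos.2 hn) y,
    norm_smul_angle] at h1
  exact h1

/-- Triviality of the outgoing kernel of the model operator. -/
theorem eq_zero_of_coulombOp_eq_zero {z : ℝ} {σ : ℂ} {w : ℝ} {u : Sm} (hu : coulombOp z σ u = 0)
    (ho : IsOutgoing σ w u) (hσ0 : σ ≠ 0) (hσ : 0 ≤ σ.im) (hg : GoodExponents z w) : u = 0 :=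
  eq_zero_of_pair_eq_zero fun _ _ hY _ hr =>
    pair_eq_zero_of_mem_sphereSpace hu ho hσ0 hσ hg (Submodule.mem_sup_left hY) hr

end EdgeWave

end

/-! ### Covariant derivatives and the square of the Dirac operator -/

noncomputable section

namespace EdgeWave
open Filter Topology

/-- The complement of the world line of the origin. -/
def offAxis : Set (ℝ × Space 3) := {p | p.2 ≠ 0}

lemma isOpen_offAxis : IsOpen offAxis := isOpen_ne_fun continuous_snd continuous_const

/-- The covariant derivative along the constant vector field `e` with potential `B`. -/
def cov (e : ℝ × Space 3) (B : ℝ × Space 3 → ℂ) (ψ : ℝ × Space 3 → SpinIdx → ℂ)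
    (p : ℝ × Space 3) : SpinIdx → ℂ := fderiv ℝ ψ p e + (Complex.I * B p) • ψ p

section Cov
variable {e e' : ℝ × Space 3} {B B' : ℝ × Space 3 → ℂ} {ψ χ : ℝ × Space 3 → SpinIdx → ℂ}
  {p : ℝ × Space 3}

lemma contDiffOn_cov (hB : ContDiffOn ℝ ∞ B offAxis) (hψ : ContDiffOn ℝ ∞ ψ offAxis) :
    ContDiffOn ℝ ∞ (cov e B ψ) offAxis :=
  ((hψ.fderiv_of_isOpen isOpen_offAxis (m := ∞) (by simp)).clm_apply contDiffOn_const).add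
    ((contDiffOn_const.mul hB).smul hψ)

lemma differentiableAt_of_offAxis {F : Type*} [NormedAddCommGroup F] [NormedSpace ℝ F]
    {f : ℝ × Space 3 → F} (hf : ContDiffOn ℝ ∞ f offAxis) (hp : p ∈ offAxis) :
    DifferentiableAt ℝ f p :=
  (hf.contDiffAt (isOpen_offAxis.mem_nhds hp)).differentiableAt (by simp)

lemma cov_add (hψ : DifferentiableAt ℝ ψ p) (hχ : DifferentiableAt ℝ χ p) :
    cov e B (fun q => ψ q + χ q) p = cov e B ψ p + cov e B χ p := by
  simp only [cov, fderiv_fun_add hψ hχ, add_apply, smul_add]; abel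

lemma cov_smul (c : ℂ) (hψ : DifferentiableAt ℝ ψ p) :
    cov e B (fun q => c • ψ q) p = c • cov e B ψ p := by
  simp only [cov, fderiv_fun_const_smul hψ, smul_apply, smul_add, smul_comm c]

lemma cov_mulVec (M : Matrix SpinIdx SpinIdx ℂ) (hψ : DifferentiableAt ℝ ψ p) :
    cov e B (fun q => M *ᵥ ψ q) p = M *ᵥ cov e B ψ p := by
  simp only [cov, fderiv_mulVec M hψ, Matrix.mulVec_add, Matrix.mulVec_smul]

lemma cov_sum {φ : Fin 3 → ℝ × Space 3 → SpinIdx → ℂ} (h : ∀ j, DifferentiableAt ℝ (φ j) p) :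
    cov e B (fun q => ∑ j, φ j q) p = ∑ j, cov e B (φ j) p := by
  simp only [cov, fderiv_fun_sum fun j _ => h j, sum_apply, Finset.smul_sum,
    Finset.sum_add_distrib]

lemma cov_cov (hB : ContDiffOn ℝ ∞ B' offAxis) (hψ : ContDiffOn ℝ ∞ ψ offAxis) (hp : p ∈ offAxis) :
    cov e B (cov e' B' ψ) p = fderiv ℝ (fun q => fderiv ℝ ψ q e') p e
      + (Complex.I * B' p) • fderiv ℝ ψ p e + (Complex.I * B p) • fderiv ℝ ψ p e'
      + (Complex.I * fderiv ℝ B' p e - B p * B' p) • ψ p := by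
  have h1 : DifferentiableAt ℝ (fun q => fderiv ℝ ψ q e') p := differentiableAt_of_offAxis
    ((hψ.fderiv_of_isOpen isOpen_offAxis (m := ∞) (by simp)).clm_apply contDiffOn_const) hp
  have h2 := differentiableAt_of_offAxis hψ hp
  have h3 := differentiableAt_of_offAxis hB hp
  have h4 : fderiv ℝ (cov e' B' ψ) p e = fderiv ℝ (fun q => fderiv ℝ ψ q e') p e
      + ((Complex.I * B' p) • fderiv ℝ ψ p e + (Complex.I * fderiv ℝ B' p e) • ψ p) := by
    have : cov e' B' ψ = fun q => fderiv ℝ ψ q e' + (Complex.I * B' q) • ψ q := rfl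
    have h5 : DifferentiableAt ℝ (fun q => (Complex.I * B' q) • ψ q) p := (h3.const_mul _).smul h2
    rw [this, fderiv_fun_add h1 h5, add_apply,
      fderiv_fun_smul (h3.const_mul _) h2, fderiv_const_mul h3]
    rfl
  rw [cov, h4, cov]
  simp only [smul_add, smul_smul, sub_smul]
  have h5 : Complex.I * B p * (Complex.I * B' p) = -(B p * B' p) := by
    linear_combination B p * B' p * Complex.I_mul_I
  rw [h5, neg_smul]
  abel

lemma fderiv_fderiv_comm (hψ : ContDiffOn ℝ ∞ ψ offAxis) (hp : p ∈ offAxis) :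
    fderiv ℝ (fun q => fderiv ℝ ψ q e') p e = fderiv ℝ (fun q => fderiv ℝ ψ q e) p e' := by
  have h1 : ContDiffAt ℝ ∞ ψ p := hψ.contDiffAt (isOpen_offAxis.mem_nhds hp)
  have h2 : DifferentiableAt ℝ (fderiv ℝ ψ) p := differentiableAt_of_offAxis
    (hψ.fderiv_of_isOpen isOpen_offAxis (m := ∞) (by simp)) hp
  have h3 : IsSymmSndFDerivAt ℝ ψ p := h1.isSymmSndFDerivAt (by
    simp only [minSmoothness_of_isRCLikeNormedField]
    exact WithTop.coe_le_coe.2 (le_top : (2 : ℕ∞) ≤ ⊤))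
  have h4 : ∀ v w, fderiv ℝ (fun q => fderiv ℝ ψ q v) p w = fderiv ℝ (fderiv ℝ ψ) p w v := by
    intro v w
    rw [fderiv_clm_apply h2 (differentiableAt_const v)]
    simp
  rw [h4, h4]
  exact h3.eq _ _

/-- The second and first order terms are symmetric in the two directions, so only the curvature of
the potential survives. -/
lemma cov_comm (hB : ContDiffOn ℝ ∞ B offAxis) (hB' : ContDiffOn ℝ ∞ B' offAxis)
    (hψ : ContDiffOn ℝ ∞ ψ offAxis) (hp : p ∈ offAxis) :
    cov e B (cov e' B' ψ) p - cov e' B' (cov e B ψ) p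
      = (Complex.I * (fderiv ℝ B' p e - fderiv ℝ B p e')) • ψ p := by
  rw [cov_cov hB' hψ hp, cov_cov hB hψ hp, fderiv_fderiv_comm hψ hp, mul_comm (B' p), mul_sub]
  simp only [sub_smul]
  abel

end Cov

/-- The time direction. -/
def e0 : ℝ × Space 3 := (1, 0)
/-- The coordinate directions. -/
def es (j : Fin 3) : ℝ × Space 3 := (0, ee j)

/-- The Dirac operator of a general potential. -/
def diracB (B₀ : ℝ × Space 3 → ℂ) (B : Fin 3 → ℝ × Space 3 → ℂ) (ψ : ℝ × Space 3 → SpinIdx → ℂ)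
    (p : ℝ × Space 3) : SpinIdx → ℂ :=
  gammaZero *ᵥ cov e0 B₀ ψ p + ∑ j, gamma j *ᵥ cov (es j) (B j) ψ p

section Square
variable {B₀ : ℝ × Space 3 → ℂ} {B : Fin 3 → ℝ × Space 3 → ℂ} {ψ χ : ℝ × Space 3 → SpinIdx → ℂ}
  {p : ℝ × Space 3}

lemma contDiffOn_diracB (h0 : ContDiffOn ℝ ∞ B₀ offAxis) (hB : ∀ j, ContDiffOn ℝ ∞ (B j) offAxis)
    (hψ : ContDiffOn ℝ ∞ ψ offAxis) : ContDiffOn ℝ ∞ (diracB B₀ B ψ) offAxis :=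
  (contDiff_mulVec _ (contDiffOn_cov h0 hψ)).add
    (ContDiffOn.sum fun j _ => contDiff_mulVec _ (contDiffOn_cov (hB j) hψ))

lemma diracB_add (hψ : DifferentiableAt ℝ ψ p) (hχ : DifferentiableAt ℝ χ p) :
    diracB B₀ B (fun q => ψ q + χ q) p = diracB B₀ B ψ p + diracB B₀ B χ p := by
  simp only [diracB, cov_add hψ hχ, Matrix.mulVec_add, Finset.sum_add_distrib]; abel

lemma diracB_smul (c : ℂ) (hψ : DifferentiableAt ℝ ψ p) :
    diracB B₀ B (fun q => c • ψ q) p = c • diracB B₀ B ψ p := by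
  simp only [diracB, cov_smul c hψ, Matrix.mulVec_smul, smul_add, Finset.smul_sum]

lemma cov_diracB (e : ℝ × Space 3) (b : ℝ × Space 3 → ℂ) (h0 : ContDiffOn ℝ ∞ B₀ offAxis)
    (hB : ∀ j, ContDiffOn ℝ ∞ (B j) offAxis) (hψ : ContDiffOn ℝ ∞ ψ offAxis) (hp : p ∈ offAxis) :
    cov e b (diracB B₀ B ψ) p = gammaZero *ᵥ cov e b (cov e0 B₀ ψ) p
      + ∑ j, gamma j *ᵥ cov e b (cov (es j) (B j) ψ) p := by
  have d0 := differentiableAt_of_offAxis (contDiffOn_cov (e := e0) h0 hψ) hp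
  have dj := fun j => differentiableAt_of_offAxis (contDiffOn_cov (e := es j) (hB j) hψ) hp
  have d0' := differentiableAt_of_offAxis (contDiff_mulVec gammaZero (contDiffOn_cov (e := e0) h0 hψ)) hp
  have dj' := fun j => differentiableAt_of_offAxis
    (contDiff_mulVec (gamma j) (contDiffOn_cov (e := es j) (hB j) hψ)) hp
  have : diracB B₀ B ψ = fun q => gammaZero *ᵥ cov e0 B₀ ψ q + ∑ j, gamma j *ᵥ cov (es j) (B j) ψ q := rfl
  rw [this, cov_add d0' (DifferentiableAt.fun_sum fun j _ => dj' j), cov_mulVec _ d0, cov_sum dj']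
  simp only [cov_mulVec _ (dj _)]

/-- The square of the Dirac operator (Lichnerowicz formula). -/
lemma diracB_sq (h0 : ContDiffOn ℝ ∞ B₀ offAxis) (hB : ∀ j, ContDiffOn ℝ ∞ (B j) offAxis)
    (hψ : ContDiffOn ℝ ∞ ψ offAxis) (hp : p ∈ offAxis) :
    diracB B₀ B (diracB B₀ B ψ) p = cov e0 B₀ (cov e0 B₀ ψ) p
      - ∑ j, cov (es j) (B j) (cov (es j) (B j) ψ) p
      + ∑ j, (Complex.I * (fderiv ℝ (B j) p e0 - fderiv ℝ B₀ p (es j))) •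
          (gammaZero * gamma j) *ᵥ ψ p
      + ((Complex.I * (fderiv ℝ (B 1) p (es 0) - fderiv ℝ (B 0) p (es 1))) •
            (gamma 0 * gamma 1) *ᵥ ψ p
        + (Complex.I * (fderiv ℝ (B 2) p (es 0) - fderiv ℝ (B 0) p (es 2))) •
            (gamma 0 * gamma 2) *ᵥ ψ p
        + (Complex.I * (fderiv ℝ (B 2) p (es 1) - fderiv ℝ (B 1) p (es 2))) •
            (gamma 1 * gamma 2) *ᵥ ψ p) := by
  rw [diracB, cov_diracB _ _ h0 hB hψ hp]
  simp only [cov_diracB _ _ h0 hB hψ hp]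
  -- Mixed covariant derivatives are brought into a fixed order. The anticommuting matrices then
  -- cancel them, and the commutators remain as field strengths.
  have c0 : ∀ j, cov e0 B₀ (cov (es j) (B j) ψ) p = cov (es j) (B j) (cov e0 B₀ ψ) p
      + (Complex.I * (fderiv ℝ (B j) p e0 - fderiv ℝ B₀ p (es j))) • ψ p := fun j => by
    rw [← cov_comm h0 (hB j) hψ hp]; abel
  have cj : ∀ i j, cov (es i) (B i) (cov (es j) (B j) ψ) p = cov (es j) (B j) (cov (es i) (B i) ψ) p
      + (Complex.I * (fderiv ℝ (B j) p (es i) - fderiv ℝ (B i) p (es j))) • ψ p := fun i j => by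
    rw [← cov_comm (hB i) (hB j) hψ hp]; abel
  have hsq : ∀ j, gamma j * gamma j = -1 := fun j => by
    have := gamma_mul_gamma j j
    simp only [if_true] at this
    have h2 : (2 : ℂ) • (gamma j * gamma j) = (2 : ℂ) • (-1) := by
      rw [two_smul, this]; module
    exact smul_right_injective _ two_ne_zero h2
  have hanti : ∀ i j, i ≠ j → gamma j * gamma i = -(gamma i * gamma j) := fun i j hij => by
    have := gamma_mul_gamma j i
    rw [if_neg hij.symm] at this
    exact eq_neg_of_add_eq_zero_left this
  simp only [Fin.sum_univ_three, Matrix.mulVec_add, Matrix.mulVec_mulVec, gammaZero_sq, c0,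
    cj 0 1, cj 0 2, cj 1 2, hsq, hanti 0 1 (by decide), hanti 0 2 (by decide), hanti 1 2 (by decide),
    gammaZero_mul_gamma, Matrix.neg_mulVec, Matrix.one_mulVec, Matrix.mulVec_smul, smul_neg]
  abel

end Square

end EdgeWave

end

/-! ### Coefficients on the blow-up and presentation of the squared operator -/

noncomputable section

namespace EdgeWave
open Filter Topology

section Blowup
variable {F : ℝ × Space 3 → ℂ} {f : Space 3 → ℂ}

lemma fderiv_angle_apply {x : Space 3} (hx : x ≠ 0) (v : Space 3) :
    fderiv ℝ (angle : Space 3 → Space 3) x v = ‖x‖⁻¹ • (v - inner ℝ (angle x) v • angle x) := by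
  have hrot : HasFDerivAt (fun y : Space 3 => ‖y‖⁻¹) _ x :=
    (hasDerivAt_inv (norm_ne_zero_iff.2 hx)).comp_hasFDerivAt x (differentiableAt_norm hx).hasFDerivAt
  have h1 := (hrot.smul (hasFDerivAt_id x)).fderiv
  have h2 := congrArg (fun L : Space 3 →L[ℝ] Space 3 => L v) h1
  refine Eq.trans ?_ (h2.trans ?_)
  · rfl
  · have hr : ‖x‖ ≠ 0 := norm_ne_zero_iff.2 hx
    simp only [add_apply, smul_apply, ContinuousLinearMap.smulRight_apply, fderiv_norm_apply hx,
      angle, real_inner_smul_left, id, ContinuousLinearMap.id_apply, smul_eq_mul]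
    match_scalars <;> field_simp

lemma contDiffOn_blowup (hF : ContDiff ℝ ∞ F) (hf : ∀ x, x ≠ 0 → f x = F (‖x‖, angle x)) :
    ContDiffOn ℝ ∞ f {0}ᶜ := by
  have h : ContDiffOn ℝ ∞ (fun x => F (‖x‖, angle x)) {0}ᶜ :=
    hF.comp_contDiffOn ((contDiffOn_norm le_rfl).prodMk contDiffOn_angle)
  exact h.congr fun x hx => hf x hx

/-- `r² ∂_{x_j}` in polar coordinates. -/
def polarDeriv (F : ℝ × Space 3 → ℂ) (j : Fin 3) (y : ℝ × Space 3) : ℂ :=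
  fderiv ℝ F y (y.1 ^ 2 * y.2 j, y.1 • (ee j - y.2 j • y.2))

lemma contDiff_coord_snd (j : Fin 3) : ContDiff ℝ ∞ fun y : ℝ × Space 3 => y.2 j :=
  (contDiff_piLp_apply 2).comp contDiff_snd

lemma contDiff_polarDeriv (hF : ContDiff ℝ ∞ F) (j : Fin 3) : ContDiff ℝ ∞ (polarDeriv F j) := by
  have h := contDiff_coord_snd j
  exact (hF.fderiv_right (m := ∞) (by simp)).clm_apply
    (((contDiff_fst.pow 2).mul h).prodMk (contDiff_fst.smul (contDiff_const.sub (h.smul contDiff_snd))))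

/-- Chain rule with `∂_j r = ω_j` and `∂_j ω = r⁻¹ (e_j - ω_j ω)`. Multiplied by `r²`, both
coefficients become polynomial in `(r, ω)`. -/
lemma fderiv_blowup (hF : ContDiff ℝ ∞ F) (hf : ∀ x, x ≠ 0 → f x = F (‖x‖, angle x))
    {x : Space 3} (hx : x ≠ 0) (j : Fin 3) :
    fderiv ℝ f x (ee j) = (((‖x‖ : ℝ) : ℂ) ^ 2)⁻¹ * polarDeriv F j (‖x‖, angle x) := by
  have he : f =ᶠ[𝓝 x] fun x => F (‖x‖, angle x) := (eventually_ne_zero hx).mono hf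
  have hr : ‖x‖ ≠ 0 := norm_ne_zero_iff.2 hx
  have hd := ((hF.differentiable (by simp) (‖x‖, angle x)).hasFDerivAt.comp x
    ((differentiableAt_norm hx).hasFDerivAt.prodMk
      ((contDiffOn_angle.contDiffAt (compl_zero_mem_nhds hx)).differentiableAt (by simp)).hasFDerivAt)).fderiv
  have h2 := congrArg (fun L : Space 3 →L[ℝ] ℂ => L (ee j)) hd
  rw [he.fderiv_eq]
  refine (Eq.trans ?_ h2).trans ?_
  · rfl
  · simp only [ContinuousLinearMap.comp_apply, ContinuousLinearMap.prod_apply, fderiv_norm_apply hx,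
      fderiv_angle_apply hx, polarDeriv]
    have hin : ∀ v : Space 3, inner ℝ v (ee j) = v j := fun v => by
      simp [ee, EuclideanSpace.inner_single_right]
    rw [hin, hin]
    have hv : ((‖x‖ ^ 2 * angle x j, ‖x‖ • (ee j - angle x j • angle x)) : ℝ × Space 3)
        = (‖x‖ ^ 2) • (‖x‖⁻¹ * x j, ‖x‖⁻¹ • (ee j - angle x j • angle x)) := by
      rw [Prod.smul_mk, smul_smul]
      congr 2
      field_simp
    rw [hv, map_smul, ← Complex.coe_smul, smul_eq_mul]
    push_cast
    rw [inv_mul_cancel_left₀ (pow_ne_zero 2 (by exact_mod_cast hr))]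

lemma fderiv_comp_snd {p : ℝ × Space 3} (hf : DifferentiableAt ℝ f p.2) (e : ℝ × Space 3) :
    fderiv ℝ (fun q : ℝ × Space 3 => f q.2) p e = fderiv ℝ f p.2 e.2 := by
  have h := (hf.hasFDerivAt.comp p hasFDerivAt_snd).fderiv
  exact congrArg (fun L : ℝ × Space 3 →L[ℝ] ℂ => L e) h

end Blowup

section Coefficients
variable (m : ℝ) (Z : ℝ → ℂ) (F : ℝ × Space 3 → ℂ) (G : Fin 3 → ℝ × Space 3 → ℂ)

/-- The scalar part of the zeroth order coefficient. -/
def potScalar (y : ℝ × ℝ × Space 3) : ℂ :=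
  Complex.I * y.2.1 * deriv Z y.1 - (Z y.1 + y.2.1 * F y.2) ^ 2
    - ∑ j, (Complex.I * polarDeriv (G j) j y.2 - y.2.1 ^ 2 * G j y.2 ^ 2) + m ^ 2 * y.2.1 ^ 2

/-- The electric part of the zeroth order coefficient. -/
def potElectric (j : Fin 3) (y : ℝ × ℝ × Space 3) : ℂ :=
  -(Complex.I * (-(Z y.1 * y.2.2 j) + polarDeriv F j y.2))

/-- The magnetic part of the zeroth order coefficient. -/
def potMagnetic (j k : Fin 3) (y : ℝ × ℝ × Space 3) : ℂ :=
  Complex.I * (polarDeriv (G k) j y.2 - polarDeriv (G j) k y.2)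

/-- The zeroth order coefficient of the squared Dirac operator. -/
def potential (y : ℝ × ℝ × Space 3) : Matrix SpinIdx SpinIdx ℂ :=
  potScalar m Z F G y • 1 + ∑ j, potElectric Z F j y • (gammaZero * gamma j)
    + (potMagnetic G 0 1 y • (gamma 0 * gamma 1) + potMagnetic G 0 2 y • (gamma 0 * gamma 2)
      + potMagnetic G 1 2 y • (gamma 1 * gamma 2))

variable {Z F G}

lemma contDiff_entry {E : Type*} [NormedAddCommGroup E] [NormedSpace ℝ E] {s : E → ℂ}
    (hs : ContDiff ℝ ∞ s) (M : Matrix SpinIdx SpinIdx ℂ) (k l : SpinIdx) :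
    ContDiff ℝ ∞ fun y => (s y • M) k l := hs.mul contDiff_const

lemma contDiff_fst_snd : ContDiff ℝ ∞ fun y : ℝ × ℝ × Space 3 => ((y.2.1 : ℝ) : ℂ) :=
  Complex.ofRealCLM.contDiff.comp (contDiff_fst.comp contDiff_snd)

lemma contDiff_potential (hZ : ContDiff ℝ ∞ Z) (hF : ContDiff ℝ ∞ F) (hG : ∀ j, ContDiff ℝ ∞ (G j))
    (k l : SpinIdx) : ContDiff ℝ ∞ fun y => potential m Z F G y k l := by
  have hZ1 : ContDiff ℝ ∞ fun y : ℝ × ℝ × Space 3 => Z y.1 := hZ.comp contDiff_fst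
  have hZ2 : ContDiff ℝ ∞ fun y : ℝ × ℝ × Space 3 => deriv Z y.1 :=
    ((contDiff_infty_iff_deriv.1 hZ).2).comp contDiff_fst
  have hs := contDiff_fst_snd
  have hc : ∀ {f : ℝ × Space 3 → ℂ}, ContDiff ℝ ∞ f → ContDiff ℝ ∞ fun y : ℝ × ℝ × Space 3 => f y.2 :=
    fun hf => hf.comp contDiff_snd
  have h1 : ContDiff ℝ ∞ (potScalar m Z F G) :=
    ((((contDiff_const.mul hs).mul hZ2).sub ((hZ1.add (hs.mul (hc hF))).pow 2)).sub
      (ContDiff.sum fun j _ => (contDiff_const.mul (hc (contDiff_polarDeriv (hG j) j))).sub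
        ((hs.pow 2).mul ((hc (hG j)).pow 2)))).add (contDiff_const.mul (hs.pow 2))
  have hw : ∀ j, ContDiff ℝ ∞ fun y : ℝ × ℝ × Space 3 => ((y.2.2 j : ℝ) : ℂ) := fun j =>
    Complex.ofRealCLM.contDiff.comp ((contDiff_coord_snd j).comp contDiff_snd)
  have h2 : ∀ j, ContDiff ℝ ∞ (potElectric Z F j) := fun j =>
    (contDiff_const.mul ((hZ1.mul (hw j)).neg.add (hc (contDiff_polarDeriv hF j)))).neg
  have h3 : ∀ j k, ContDiff ℝ ∞ (potMagnetic G j k) := fun j k =>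
    contDiff_const.mul ((hc (contDiff_polarDeriv (hG k) j)).sub (hc (contDiff_polarDeriv (hG j) k)))
  simp only [potential, Matrix.add_apply, Matrix.sum_apply]
  exact ((contDiff_entry h1 _ k l).add (ContDiff.sum fun j _ => contDiff_entry (h2 j) _ k l)).add
    (((contDiff_entry (h3 0 1) _ k l).add (contDiff_entry (h3 0 2) _ k l)).add
      (contDiff_entry (h3 1 2) _ k l))

/-- The squared Dirac operator as a wave operator of edge type. -/
def diracWaveOp (hZ : ContDiff ℝ ∞ Z) (hF : ContDiff ℝ ∞ F) (hG : ∀ j, ContDiff ℝ ∞ (G j)) :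
    WaveOp 3 SpinIdx where
  a y := (2 * Complex.I * (Z y.1 + y.2.1 * F y.2)) • 1
  b j y := (-(2 * Complex.I * (y.2.1 * G j y.2))) • 1
  c := potential m Z F G
  smooth_a k l := contDiff_entry (contDiff_const.mul ((hZ.comp contDiff_fst).add
    (contDiff_fst_snd.mul (hF.comp contDiff_snd)))) _ k l
  smooth_b j k l := contDiff_entry (contDiff_const.mul
    (contDiff_fst_snd.mul ((hG j).comp contDiff_snd))).neg _ k l
  smooth_c := contDiff_potential m hZ hF hG

end Coefficients

section Represents
variable {m : ℝ} {Z : ℝ → ℂ} {F : ℝ × Space 3 → ℂ} {G : Fin 3 → ℝ × Space 3 → ℂ}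
  {V : Space 3 → ℂ} {A : Fin 3 → Space 3 → ℂ}

/-- The terms linear in `m` cancel because `m` is constant. -/
lemma diracCoulombWave_eq {B₀ : ℝ × Space 3 → ℂ} {B : Fin 3 → ℝ × Space 3 → ℂ}
    (hB₀ : B₀ = fun p => Z p.1 / ‖p.2‖ + V p.2) (hB : B = fun j p => A j p.2)
    (h0 : ContDiffOn ℝ ∞ B₀ offAxis) (h1 : ∀ j, ContDiffOn ℝ ∞ (B j) offAxis)
    {ψ : ℝ × Space 3 → SpinIdx → ℂ} (hψ : ContDiffOn ℝ ∞ ψ offAxis) {p : ℝ × Space 3}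
    (hp : p ∈ offAxis) :
    diracCoulombWave m Z V A ψ p = diracB B₀ B (diracB B₀ B ψ) p + (m : ℂ) ^ 2 • ψ p := by
  have hD : ∀ φ, dirac Z V A φ = diracB B₀ B φ := fun φ => by subst hB₀ hB; rfl
  have d1 := differentiableAt_of_offAxis (contDiffOn_diracB h0 h1 hψ) hp
  have d2 := differentiableAt_of_offAxis hψ hp
  have h2 : massiveDirac (-m) Z V A ψ = fun q => Complex.I • diracB B₀ B ψ q + (-m : ℂ) • ψ q := by
    funext q; rw [massiveDirac, hD]
  rw [diracCoulombWave, h2, massiveDirac, hD,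
    diracB_add (ψ := fun q => Complex.I • diracB B₀ B ψ q) (χ := fun q => (-m : ℂ) • ψ q)
      (d1.const_smul Complex.I) (d2.const_smul (-m : ℂ)), diracB_smul _ d1, diracB_smul _ d2]
  simp only [smul_add, smul_smul, Complex.I_mul_I]
  module

/-- In the Lichnerowicz formula the most singular terms are the square of `Z / r` and its gradient,
both of size `r⁻²`, and the time derivative of `Z / r` is only of size `r⁻¹`. The factor `r²`
therefore makes every coefficient smooth, and the identity is checked term by term. -/
theorem diracWaveOp_represents (hZ : ContDiff ℝ ∞ Z) (hF : ContDiff ℝ ∞ F)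
    (hG : ∀ j, ContDiff ℝ ∞ (G j)) (hV : ∀ x, x ≠ 0 → V x = F (‖x‖, angle x))
    (hA : ∀ j x, x ≠ 0 → A j x = G j (‖x‖, angle x)) :
    (diracWaveOp m hZ hF hG).Represents (diracCoulombWave m Z V A) := by
  intro ψ hψ p hp
  change ContDiffOn ℝ ∞ ψ offAxis at hψ
  have hp' : p ∈ offAxis := hp
  have hn : ContDiffOn ℝ ∞ (fun q : ℝ × Space 3 => ((‖q.2‖ : ℝ) : ℂ)) offAxis :=
    Complex.ofRealCLM.contDiff.comp_contDiffOn
      ((contDiffOn_norm le_rfl).comp contDiff_snd.contDiffOn fun q hq => hq)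
  have hVs := contDiffOn_blowup hF hV
  have hAs := fun j => contDiffOn_blowup (hG j) (hA j)
  have hZs : ContDiffOn ℝ ∞ (fun q : ℝ × Space 3 => Z q.1) offAxis :=
    (hZ.comp contDiff_fst).contDiffOn
  have hr : ((‖p.2‖ : ℝ) : ℂ) ≠ 0 := by simpa using hp
  have hZr : ContDiffOn ℝ ∞ (fun q : ℝ × Space 3 => Z q.1 / ((‖q.2‖ : ℝ) : ℂ)) offAxis :=
    hZs.mul (hn.inv fun q hq => by simpa using (show q.2 ≠ 0 from hq))
  have hV2 : ContDiffOn ℝ ∞ (fun q : ℝ × Space 3 => V q.2) offAxis :=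
    hVs.comp contDiff_snd.contDiffOn fun q hq => hq
  obtain ⟨B₀, hB₀⟩ : ∃ B₀ : ℝ × Space 3 → ℂ, B₀ = fun p => Z p.1 / ‖p.2‖ + V p.2 := ⟨_, rfl⟩
  obtain ⟨B, hB⟩ : ∃ B : Fin 3 → ℝ × Space 3 → ℂ, B = fun j p => A j p.2 := ⟨_, rfl⟩
  have h0 : ContDiffOn ℝ ∞ B₀ offAxis := by rw [hB₀]; exact hZr.add hV2
  have h1 : ∀ j, ContDiffOn ℝ ∞ (B j) offAxis := fun j => by
    rw [hB]; exact (hAs j).comp contDiff_snd.contDiffOn fun q hq => hq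
  have dV := (hVs.contDiffAt (compl_zero_mem_nhds hp)).differentiableAt (by simp)
  have dA := fun j => ((hAs j).contDiffAt (compl_zero_mem_nhds hp)).differentiableAt (by simp)
  have eB : ∀ e : ℝ × Space 3, fderiv ℝ B₀ p e = (((‖p.2‖ : ℝ) : ℂ))⁻¹ * (deriv Z p.1 * (e.1 : ℂ))
      - Z p.1 * (((‖p.2‖ : ℝ) : ℂ) ^ 2)⁻¹ * ((‖p.2‖⁻¹ * inner ℝ p.2 e.2 : ℝ) : ℂ)
      + fderiv ℝ V p.2 e.2 := by
    intro e
    have g1 : HasFDerivAt (fun q : ℝ × Space 3 => Z q.1) _ p :=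
      (hZ.differentiable (by simp) p.1).hasFDerivAt.comp p hasFDerivAt_fst
    have g2 : HasFDerivAt (fun q : ℝ × Space 3 => ((‖q.2‖ : ℝ) : ℂ)) _ p :=
      Complex.ofRealCLM.hasFDerivAt.comp p ((differentiableAt_norm hp).hasFDerivAt.comp p hasFDerivAt_snd)
    have g3 : HasFDerivAt (fun q : ℝ × Space 3 => (((‖q.2‖ : ℝ) : ℂ))⁻¹) _ p :=
      (hasDerivAt_inv hr).comp_hasFDerivAt_of_eq p g2 rfl
    have g4 := (g1.mul g3)
    have g5 : HasFDerivAt (fun q : ℝ × Space 3 => V q.2) _ p := dV.hasFDerivAt.comp p hasFDerivAt_snd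
    have g6 := congrArg (fun L : ℝ × Space 3 →L[ℝ] ℂ => L e) (g4.add g5).fderiv
    rw [hB₀]
    refine (Eq.trans ?_ g6).trans ?_
    · rfl
    · have : fderiv ℝ Z p.1 e.1 = deriv Z p.1 * (e.1 : ℂ) := by
        rw [← toSpanSingleton_deriv]; simp [mul_comm]
      simp [fderiv_norm_apply hp, this]
      ring
  have eA : ∀ j e, fderiv ℝ (B j) p e = fderiv ℝ (A j) p.2 e.2 := fun j e => by
    rw [hB]; exact fderiv_comp_snd (dA j) e
  have eB0 : fderiv ℝ B₀ p e0 = (((‖p.2‖ : ℝ) : ℂ))⁻¹ * deriv Z p.1 := by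
    rw [eB]; simp [e0]
  have eBj : ∀ j, fderiv ℝ B₀ p (es j) = (((‖p.2‖ : ℝ) : ℂ) ^ 2)⁻¹ *
      (-(Z p.1 * angle p.2 j) + polarDeriv F j (‖p.2‖, angle p.2)) := fun j => by
    rw [eB]
    simp only [es, fderiv_blowup hF hV hp]
    simp [angle, ee, EuclideanSpace.inner_single_right]
    ring
  have eA0 : ∀ j, fderiv ℝ (B j) p e0 = 0 := fun j => by rw [eA]; simp [e0]
  have eAj : ∀ j k, fderiv ℝ (B j) p (es k) = (((‖p.2‖ : ℝ) : ℂ) ^ 2)⁻¹ *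
      polarDeriv (G j) k (‖p.2‖, angle p.2) := fun j k => by
    rw [eA]; exact fderiv_blowup (hG j) (hA j) hp k
  have vB0 : B₀ p = Z p.1 / ((‖p.2‖ : ℝ) : ℂ) + F (‖p.2‖, angle p.2) := by rw [hB₀, ← hV _ hp]
  have vB : ∀ j, B j p = G j (‖p.2‖, angle p.2) := fun j => by rw [hB]; exact hA j _ hp
  rw [diracCoulombWave_eq hB₀ hB h0 h1 hψ hp', diracB_sq h0 h1 hψ hp', WaveOp.apply]
  simp only [cov_cov h0 hψ hp', cov_cov (h1 _) hψ hp', eB0, eBj, eA0, eAj, vB0, vB]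
  have hdt : ∀ φ : ℝ × Space 3 → SpinIdx → ℂ, dt φ = fun q => fderiv ℝ φ q e0 := fun _ => rfl
  have hdx : ∀ j, ∀ φ : ℝ × Space 3 → SpinIdx → ℂ, dx j φ = fun q => fderiv ℝ φ q (es j) :=
    fun _ _ => rfl
  simp only [hdt, hdx, diracWaveOp, potential, potScalar, potElectric, potMagnetic,
    Matrix.add_mulVec, Matrix.smul_mulVec, Matrix.one_mulVec,
    Fin.sum_univ_three, ← Complex.coe_smul, Complex.ofReal_pow, smul_smul]
  generalize hr' : ((‖p.2‖ : ℝ) : ℂ) = r at *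
  match_scalars <;> field_simp <;> ring

end Represents

end EdgeWave

end

/-! ### The edge normal operator as a Coulomb model -/

noncomputable section

namespace EdgeWave
open Filter Topology

variable {m : ℝ} {Z : ℝ → ℂ} {F : ℝ × Space 3 → ℂ} {G : Fin 3 → ℝ × Space 3 → ℂ}

lemma partialX_sm (j : Fin 3) (u : Sm) {x : Space 3} (hx : x ≠ 0) :
    partialX j u.1 x = (pd j u).1 x := (pd_apply j u hx).symm

lemma partialX_partialX_sm (j : Fin 3) (u : Sm) {x : Space 3} (hx : x ≠ 0) :
    partialX j (partialX j u.1) x = (pd j (pd j u)).1 x := by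
  rw [← partialX_sm j _ hx, partialX, partialX, Filter.EventuallyEq.fderiv_eq]
  exact (eventually_ne_zero hx).mono fun y hy => partialX_sm j u hy

/-- The direction of differentiation carries a factor `r`. This is why the derivatives of `V` and
`A` do not reach the normal operator. -/
lemma polarDeriv_zero (j : Fin 3) (w : Space 3) : polarDeriv F j (0, w) = 0 := by
  simp [polarDeriv, show ((0 : ℝ), (0 : Space 3)) = 0 from rfl]

/-- The spectral family of the edge normal operator of the squared Dirac operator. -/
theorem normalFamily_diracWaveOp (hZ : ContDiff ℝ ∞ Z) (hF : ContDiff ℝ ∞ F)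
    (hG : ∀ j, ContDiff ℝ ∞ (G j)) {t z : ℝ} (hz : Z t = z) (σ : ℂ) (u : Sm) {x : Space 3}
    (hx : x ≠ 0) :
    (diracWaveOp m hZ hF hG).normalFamily t σ u.1 x = (coulombOp z σ u).1 x := by
  have hc : potential m Z F G (t, 0, angle x) = (-(z : ℂ) ^ 2) • 1
      + (Complex.I * z) • ∑ j, ((angle x j : ℝ) : ℂ) • (gammaZero * gamma j) := by
    simp only [potential, potScalar, potElectric, potMagnetic, polarDeriv_zero, hz]
    simp only [Finset.smul_sum, smul_smul]
    simp [mul_assoc]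
  have hs : ((∑ j, pd j * pd j) u).1 x = ∑ j, partialX j (partialX j u.1) x := by
    rw [Op.sum_apply, Submodule.coe_sum, Finset.sum_apply]
    exact Finset.sum_congr rfl fun j _ => (partialX_partialX_sm j u hx).symm
  have h1 : (coulombOp z σ u).1 x = ((‖x‖ : ℝ) : ℂ) ^ (2 : ℂ) • -((∑ j, pd j * pd j) u).1 x
      - ((z : ℂ) ^ 2) • u.1 x + (Complex.I * z) • (Al u).1 x
      - σ ^ 2 • (((‖x‖ : ℝ) : ℂ) ^ (2 : ℂ) • u.1 x)
      + (2 * z * σ) • (((‖x‖ : ℝ) : ℂ) ^ (1 : ℂ) • u.1 x) := by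
    rw [coulombOp_eq]; rfl
  rw [h1, hs, Al_apply u hx, Complex.cpow_ofNat, Complex.cpow_one, WaveOp.normalFamily]
  simp only [diracWaveOp, hc, hz, Matrix.add_mulVec, Matrix.smul_mulVec, Matrix.one_mulVec,
    ← Complex.coe_smul, Complex.ofReal_pow, Complex.ofReal_zero, zero_mul, mul_zero, neg_zero,
    zero_smul, add_zero, Matrix.mulVec_smul, smul_smul]
  have hI : ((‖x‖ : ℝ) : ℂ) * -(Complex.I * σ) * (2 * Complex.I * (z : ℂ)) = 2 * z * σ * ((‖x‖ : ℝ) : ℂ) := by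
    linear_combination (-2 * z * σ * ((‖x‖ : ℝ) : ℂ)) * Complex.I_mul_I
  rw [hI]
  simp only [Matrix.zero_mulVec, smul_zero, Finset.sum_const_zero]
  module

lemma normalFamily_congr {L : WaveOp 3 SpinIdx} {t : ℝ} {σ : ℂ} {u v : Space 3 → SpinIdx → ℂ}
    {x : Space 3} (h : u =ᶠ[𝓝 x] v) : L.normalFamily t σ u x = L.normalFamily t σ v x := by
  have h1 : ∀ {u v : Space 3 → SpinIdx → ℂ} {y : Space 3} (j : Fin 3), u =ᶠ[𝓝 y] v →
      partialX j u y = partialX j v y := fun j h => by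
    rw [partialX, partialX, h.fderiv_eq]
  have h2 : ∀ j, partialX j (partialX j u) x = partialX j (partialX j v) x := fun j =>
    h1 j (h.eventuallyEq_nhds.mono fun y hy => h1 j hy)
  simp only [WaveOp.normalFamily, h1 _ h, h2, h.eq_of_nhds]

theorem normalFamily_diracWaveOp_cut (hZ : ContDiff ℝ ∞ Z) (hF : ContDiff ℝ ∞ F)
    (hG : ∀ j, ContDiff ℝ ∞ (G j)) {t z : ℝ} (hz : Z t = z) (σ : ℂ) {u : Space 3 → SpinIdx → ℂ}
    (hu : ContDiffOn ℝ ∞ u {0}ᶜ) {x : Space 3} (hx : x ≠ 0) :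
    (diracWaveOp m hZ hF hG).normalFamily t σ u x = (coulombOp z σ (cut u hu)).1 x := by
  rw [← normalFamily_diracWaveOp hZ hF hG hz σ _ hx]
  exact normalFamily_congr (cut_eventuallyEq hu hx).symm

end EdgeWave

end

noncomputable section

namespace EdgeWave
open Filter Topology

/-! ### Indicial roots -/

/-- A complex square root of a real number is either real or purely imaginary; in the second case
the convention that `Real.sqrt` is zero on negative numbers matches the vanishing real part. -/
lemma abs_re_of_sq_eq_ofReal {s : ℂ} {d : ℝ} (h : s ^ 2 = d) : |s.re| = Real.sqrt d := by
  have h1 := congrArg Complex.re h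
  have h2 := congrArg Complex.im h
  simp only [pow_two, Complex.mul_re, Complex.mul_im, Complex.ofReal_re, Complex.ofReal_im] at h1 h2
  have h3 : s.re * s.im = 0 := by linarith
  rcases mul_eq_zero.1 h3 with h4 | h4
  · rw [h4, abs_zero, Real.sqrt_eq_zero_of_nonpos]
    nlinarith [mul_self_nonneg s.im]
  · rw [← Real.sqrt_sq_eq_abs]; congr 1
    rw [← h1, h4]; ring

lemma re_ofReal_cpow_half (d : ℝ) : ((d : ℂ) ^ (1 / 2 : ℂ)).re = Real.sqrt d := by
  rcases le_or_gt 0 d with hd | hd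
  · have h : ((d : ℂ) ^ (1 / 2 : ℂ)) = ((d ^ (1 / 2 : ℝ) : ℝ) : ℂ) := by
      rw [Complex.ofReal_cpow hd]; norm_num
    rw [h, Complex.ofReal_re, Real.sqrt_eq_rpow]
  · have h : ((d : ℂ) ^ (1 / 2 : ℂ)) ^ 2 = d := by
      rw [← Complex.cpow_nat_mul]; simp
    have h1 := abs_re_of_sq_eq_ofReal h
    rw [Real.sqrt_eq_zero_of_nonpos hd.le] at h1 ⊢
    exact abs_eq_zero.1 h1

/-- The distance of the indicial roots to the critical weight. -/
def indicialGap (z : ℝ) (κ : ℤ) : ℝ := |1 / 2 - Real.sqrt ((κ : ℝ) ^ 2 - z ^ 2)|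

lemma indicialGap_eq (z : ℝ) (κ : ℤ) :
    |1 / 2 - (((κ : ℂ) ^ 2 - (z : ℂ) ^ 2) ^ (1 / 2 : ℂ)).re| = indicialGap z κ := by
  rw [indicialGap, ← re_ofReal_cpow_half]; push_cast; rfl

lemma indicialGap_one_le (z : ℝ) : indicialGap z 1 ≤ 1 / 2 := by
  have h1 : Real.sqrt (((1 : ℤ) : ℝ) ^ 2 - z ^ 2) ≤ 1 := by
    refine Real.sqrt_le_iff.2 ⟨zero_le_one, ?_⟩; push_cast; nlinarith [sq_nonneg z]
  have h2 : ∀ a : ℝ, 0 ≤ a → a ≤ 1 → |1 / 2 - a| ≤ 1 / 2 := fun a _ _ => by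
    rw [abs_le]; constructor <;> linarith
  exact h2 _ (Real.sqrt_nonneg _) h1

lemma sq_le_of_indicialGap_le {z : ℝ} {κ : ℤ} (h : indicialGap z κ ≤ 1 / 2) : (κ : ℝ) ^ 2 ≤ 1 + z ^ 2 := by
  have h1 : Real.sqrt ((κ : ℝ) ^ 2 - z ^ 2) ≤ 1 := by linarith [(abs_le.1 h).1]
  linarith [(Real.sqrt_le_iff.1 h1).2]

/-- The gap at `κ = 1` is at most `1/2`, and a gap of at most `1/2` confines `κ` to the finite set
`κ² ≤ 1 + z²`. -/
lemma exists_min_indicialGap (z : ℝ) :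
    ∃ κ : ℤ, κ ≠ 0 ∧ ∀ κ' : ℤ, κ' ≠ 0 → indicialGap z κ ≤ indicialGap z κ' := by
  have hfin : {κ : ℤ | κ ≠ 0 ∧ (κ : ℝ) ^ 2 ≤ 1 + z ^ 2}.Finite := by
    obtain ⟨N, hN⟩ := exists_nat_gt (1 + z ^ 2)
    refine (Set.finite_Icc (-(N : ℤ)) N).subset fun κ hκ => ?_
    have h1 : (κ : ℝ) ^ 2 < N := lt_of_le_of_lt hκ.2 hN
    have h2 : κ ^ 2 < N := by exact_mod_cast h1
    constructor <;> nlinarith [sq_nonneg (κ + 1), sq_nonneg (κ - 1)]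
  obtain ⟨κ, hκ, hmin⟩ := Set.exists_min_image _ (indicialGap z) hfin
    ⟨1, one_ne_zero, sq_le_of_indicialGap_le (indicialGap_one_le z)⟩
  refine ⟨κ, hκ.1, fun κ' h0 => ?_⟩
  by_cases h : indicialGap z κ' ≤ 1 / 2
  · exact hmin κ' ⟨h0, sq_le_of_indicialGap_le h⟩
  · exact (hmin 1 ⟨one_ne_zero, sq_le_of_indicialGap_le (indicialGap_one_le z)⟩).trans
      ((indicialGap_one_le z).trans (not_le.1 h).le)

section Gap
variable {z δ : ℝ}

/-- For `Re s ≥ 0` the distance is the gap of `κ` itself. For `Re s < 0` it exceeds `1/2`, which is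
already at least `δ` because of the gap at `κ = 1`. -/
lemma le_abs_re_sub_half (hδ : ∀ κ : ℤ, κ ≠ 0 → δ ≤ indicialGap z κ) {s : ℂ} {κ : ℤ} (hκ : κ ≠ 0)
    (h : s ^ 2 + (z : ℂ) ^ 2 = (κ : ℂ) ^ 2) : δ ≤ |s.re - 1 / 2| := by
  have hs : s ^ 2 = (((κ : ℝ) ^ 2 - z ^ 2 : ℝ) : ℂ) := by push_cast; linear_combination h
  have h1 := abs_re_of_sq_eq_ofReal hs
  have h2 := hδ κ hκ
  have h3 := (hδ 1 one_ne_zero).trans (indicialGap_one_le z)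
  rw [indicialGap, ← h1] at h2
  rcases abs_cases s.re with ⟨e, _⟩ | ⟨e, hneg⟩
  · rwa [e, abs_sub_comm] at h2
  · rw [abs_of_neg (by linarith)]; linarith

/-- Of `s` and `1 - s`, which are symmetric about `1/2`, one has real part at least `1/2 + δ`. -/
lemma goodExponents_of_gap (hδ0 : 0 ≤ δ) (hδ : ∀ κ : ℤ, κ ≠ 0 → δ ≤ indicialGap z κ) {w : ℝ}
    (hw : -(1 / 2) - δ < w) : GoodExponents z w := by
  rintro s ⟨κ, hκ, h⟩
  have h1 := le_abs_re_sub_half hδ hκ h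
  rcases le_abs.1 h1 with h2 | h2
  · exact ⟨s, rfl, by linarith, by linarith⟩
  · refine ⟨1 - s, by ring, ?_, ?_⟩ <;> simp only [Complex.sub_re, Complex.one_re] <;> linarith

/-! ### The indicial family -/

/-- On `rp ξ s` the radial field is the scalar `ξ`, and the polynomial `T² - T - ξ(ξ + 1)` has the
roots `-ξ` and `ξ + 1`. -/
lemma coulombOp_zero_rp {ξ : ℂ} {s : Sm} (hs : R s = 0) :
    coulombOp z 0 (rp ξ s) = rp ξ (((T z - (-ξ) • 1) * (T z - (ξ + 1) • 1)) s) := by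
  have hs' : R s = (0 : ℂ) • s := by rw [hs, zero_smul]
  have h1 : R (rp ξ s) = ξ • rp ξ s := by rw [R_rp_apply hs', zero_add]
  have hT : ∀ u, T z (rp ξ u) = rp ξ (T z u) := fun u => by rw [← Op.mul_apply, T_rp]; rfl
  have h2 : (T z - (-ξ) • 1) * (T z - (ξ + 1) • 1) = T z * T z - T z - (ξ ^ 2 + ξ) • 1 := by
    simp only [neg_smul, sub_neg_eq_add, mul_sub, add_mul, mul_smul_comm, smul_mul_assoc, mul_one,
      one_mul]
    module
  rw [h2]
  simp only [coulombOp, Op.sub_apply, Op.add_apply, Op.smul_apply, Op.mul_apply, Op.one_apply, hT, h1,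
    map_smul, map_sub]
  rw [show (2 * (z : ℂ) * 0) = 0 by ring, zero_smul, zero_pow two_ne_zero, zero_smul]
  module

variable {m : ℝ} {Z : ℝ → ℂ} {F : ℝ × Space 3 → ℂ} {G : Fin 3 → ℝ × Space 3 → ℂ}

/-- The extension of a spinor on the sphere that is homogeneous of degree `0`. -/
def sphereSpinor (v : Space 3 → SpinIdx → ℂ) (hv : IsSmoothOnSphere v) : Sm :=
  cut (fun x => v (angle x)) hv

lemma sphereSpinor_apply {v : Space 3 → SpinIdx → ℂ} (hv : IsSmoothOnSphere v) {x : Space 3}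
    (hx : x ≠ 0) : (sphereSpinor v hv).1 x = v (angle x) :=
  cut_apply (u := fun x => v (angle x)) hv hx

lemma R_sphereSpinor {v : Space 3 → SpinIdx → ℂ} (hv : IsSmoothOnSphere v) : R (sphereSpinor _ hv) = 0 := by
  rw [← zero_smul ℂ (sphereSpinor _ hv)]
  refine R_of_homogeneous fun x hx t ht => ?_
  rw [sphereSpinor_apply _ (smul_ne_zero ht.ne' hx), sphereSpinor_apply _ hx, angle_smul ht, Complex.cpow_zero, one_smul]

lemma angle_of_norm_eq_one {y : Space 3} (hy : ‖y‖ = 1) : angle y = y := by simp [angle, hy]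

lemma indicialFamily_diracWaveOp (hZ : ContDiff ℝ ∞ Z) (hF : ContDiff ℝ ∞ F)
    (hG : ∀ j, ContDiff ℝ ∞ (G j)) {t : ℝ} (hz : Z t = z) (ξ : ℂ) {v : Space 3 → SpinIdx → ℂ}
    (hv : IsSmoothOnSphere v) {y : Space 3} (hy : ‖y‖ = 1) :
    (diracWaveOp m hZ hF hG).indicialFamily t ξ v y
      = (((T z - (-ξ) • 1) * (T z - (ξ + 1) • 1)) (sphereSpinor _ hv)).1 y := by
  have hy0 : y ≠ 0 := by rintro rfl; simp at hy
  have he : (fun x => ((‖x‖ : ℂ) ^ ξ) • v (angle x)) =ᶠ[𝓝 y] (rp ξ (sphereSpinor _ hv)).1 :=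
    (eventually_ne_zero hy0).mono fun x hx => by rw [rp_apply, sphereSpinor_apply _ hx]
  rw [WaveOp.indicialFamily, normalFamily_congr he, normalFamily_diracWaveOp hZ hF hG hz _ _ hy0,
    coulombOp_zero_rp (R_sphereSpinor hv), rp_apply, hy, Complex.ofReal_one, Complex.one_cpow, one_smul]

lemma eq_of_R_eq_zero {w : Sm} (hw : R w = 0) {x : Space 3} (hx : x ≠ 0) : w.1 (angle x) = w.1 x := by
  have := homogeneous_of_R (lam := 0) (by rw [hw, zero_smul]) hx (inv_pos.2 (norm_pos_iff.2 hx))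
  rwa [Complex.cpow_zero, one_smul] at this

/-- The real parts of `-ξ` and `ξ + 1` both lie at distance `|w + 1/2| < δ` from `1/2`, closer than
any exceptional value of `sphere_T`, so both factors of the indicial operator are invertible. -/
theorem isNonIndicial_diracWaveOp (hZ : ContDiff ℝ ∞ Z) (hF : ContDiff ℝ ∞ F)
    (hG : ∀ j, ContDiff ℝ ∞ (G j)) {t : ℝ} (hz : Z t = z)
    (hδ : ∀ κ : ℤ, κ ≠ 0 → δ ≤ indicialGap z κ) {w : ℝ} (hw : |w + 1 / 2| < δ) :
    (diracWaveOp m hZ hF hG).IsNonIndicial t w := by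
  intro ξ hξ
  have h1 := sphere_T (z := z) (ν := -ξ) fun κ hκ h => by
    refine absurd (le_abs_re_sub_half hδ hκ h) (not_le.2 ?_)
    rwa [Complex.neg_re, hξ, ← neg_add', abs_neg]
  have h2 := sphere_T (z := z) (ν := ξ + 1) fun κ hκ h => by
    refine absurd (le_abs_re_sub_half hδ hκ h) (not_le.2 ?_)
    rw [Complex.add_re, Complex.one_re, hξ]
    rwa [show w + 1 - 1 / 2 = w + 1 / 2 by ring]
  have hR := R_mul_sub_smul (R_T z)
  refine ⟨fun v hv h y hy => ?_, fun f hf => ?_⟩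
  · have hy0 : y ≠ 0 := by rintro rfl; simp at hy
    have h3 : sphereSpinor _ hv = 0 := by
      refine (h1.1.mul h2.1 (hR _)) _ (R_sphereSpinor hv) (Sm_ext fun x hx => ?_)
      rw [← eq_of_R_eq_zero _ hx, ← indicialFamily_diracWaveOp hZ hF hG hz ξ hv (norm_angle hx),
        h _ (norm_angle hx)]
      · rfl
      · rw [Op.mul_apply, ← Op.mul_apply, hR, Op.mul_apply, ← Op.mul_apply R, hR, Op.mul_apply,
          R_sphereSpinor hv, map_zero, map_zero]
    have h4 := sphereSpinor_apply hv hy0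
    rw [h3, angle_of_norm_eq_one hy] at h4
    exact h4.symm
  · obtain ⟨s, hs, hA⟩ := (h1.2.mul h2.2) _ (R_sphereSpinor hf)
    have hsv : IsSmoothOnSphere s.1 := s.2.1.congr fun x hx => eq_of_R_eq_zero hs hx
    have hcut : sphereSpinor _ hsv = s := Sm_ext fun x hx => by rw [sphereSpinor_apply _ hx, eq_of_R_eq_zero hs hx]
    refine ⟨s.1, hsv, fun y hy => ?_⟩
    have hy0 : y ≠ 0 := by rintro rfl; simp at hy
    rw [indicialFamily_diracWaveOp hZ hF hG hz ξ hsv hy, hcut, hA, sphereSpinor_apply _ hy0, angle_of_norm_eq_one hy]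

end Gap

end EdgeWave

end

noncomputable section

namespace EdgeWave
open MeasureTheory Filter Topology

variable {m z : ℝ} {Z : ℝ → ℂ} {F : ℝ × Space 3 → ℂ} {G : Fin 3 → ℝ × Space 3 → ℂ}

/-! ### The kernel of the reduced normal operator -/

lemma reducedNormal_diracWaveOp_cut (hZ : ContDiff ℝ ∞ Z) (hF : ContDiff ℝ ∞ F)
    (hG : ∀ j, ContDiff ℝ ∞ (G j)) {t : ℝ} (hz : Z t = z) (σ : ℂ) {u : Space 3 → SpinIdx → ℂ}
    (hu : ContDiffOn ℝ ∞ u {0}ᶜ) {x : Space 3} (hx : x ≠ 0) :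
    (diracWaveOp m hZ hF hG).reducedNormal t σ u x = ((rp (-2) * coulombOp z σ) (cut u hu)).1 x := by
  rw [WaveOp.reducedNormal, normalFamily_diracWaveOp_cut hZ hF hG hz σ hu hx, Op.mul_apply, rp_apply,
    ← Complex.coe_smul, Complex.cpow_neg, Complex.cpow_ofNat]
  push_cast; rfl

lemma coulombOp_eq_zero_of_reducedNormal (hZ : ContDiff ℝ ∞ Z) (hF : ContDiff ℝ ∞ F)
    (hG : ∀ j, ContDiff ℝ ∞ (G j)) {t : ℝ} (hz : Z t = z) {σ : ℂ} {u : Space 3 → SpinIdx → ℂ}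
    (hu : ContDiffOn ℝ ∞ u {0}ᶜ)
    (h : ∀ x, x ≠ 0 → (diracWaveOp m hZ hF hG).reducedNormal t σ u x = 0) :
    coulombOp z σ (cut u hu) = 0 :=
  rp_injective (-2) (Sm_ext fun x hx => by
    have := h x hx
    rw [reducedNormal_diracWaveOp_cut hZ hF hG hz σ hu hx] at this
    exact this)

lemma R_cut_apply {u : Space 3 → SpinIdx → ℂ} (hu : ContDiffOn ℝ ∞ u {0}ᶜ) {x : Space 3} (hx : x ≠ 0) :
    (R (cut u hu)).1 x = rDr u x := by
  rw [R_apply _ hx, (cut_eventuallyEq hu hx).fderiv_eq]; rfl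

lemma iterate_R_cut_apply {u : Space 3 → SpinIdx → ℂ} (hu : ContDiffOn ℝ ∞ u {0}ᶜ) (j : ℕ)
    {x : Space 3} (hx : x ≠ 0) : ((fun u => R u)^[j] (cut u hu)).1 x = rDr^[j] u x := by
  induction j generalizing x with
  | zero => exact cut_apply hu hx
  | succ j ih =>
    rw [Function.iterate_succ_apply', Function.iterate_succ_apply', R_apply _ hx, rDr]
    have h : ((fun u => R u)^[j] (cut u hu)).1 =ᶠ[𝓝 x] rDr^[j] u :=
      (eventually_ne_zero hx).mono fun y hy => ih hy
    rw [h.fderiv_eq]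

lemma contDiffOn_exp_norm (τ : ℂ) :
    ContDiffOn ℝ ∞ (fun x : Space 3 => Complex.exp (Complex.I * τ * ((‖x‖ : ℝ) : ℂ))) {0}ᶜ :=
  (Complex.contDiff_exp (𝕜 := ℝ) (n := ∞)).comp_contDiffOn
    (contDiffOn_const.mul (Complex.ofRealCLM.contDiff.comp_contDiffOn (contDiffOn_norm le_rfl)))

lemma contDiffOn_phase (τ : ℂ) {u : Space 3 → SpinIdx → ℂ} (hu : ContDiffOn ℝ ∞ u {0}ᶜ) :
    ContDiffOn ℝ ∞ (phase τ u) {0}ᶜ := (contDiffOn_exp_norm τ).smul hu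

lemma R_exp_smul {σ : ℂ} {u v : Sm}
    (h : ∀ x, u.1 x = Complex.exp (Complex.I * σ * ((‖x‖ : ℝ) : ℂ)) • v.1 x) {x : Space 3} (hx : x ≠ 0) :
    (R u).1 x = Complex.exp (Complex.I * σ * ((‖x‖ : ℝ) : ℂ)) •
      ((Complex.I * σ * ((‖x‖ : ℝ) : ℂ)) • v.1 x + (R v).1 x) := by
  have hu : u.1 = fun x => Complex.exp (Complex.I * σ * ((‖x‖ : ℝ) : ℂ)) • v.1 x := funext h
  have h1 : HasFDerivAt (fun y : Space 3 => ((‖y‖ : ℝ) : ℂ))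
      (Complex.ofRealCLM.comp (fderiv ℝ (fun y : Space 3 => ‖y‖) x)) x :=
    Complex.ofRealCLM.hasFDerivAt.comp x (differentiableAt_norm hx).hasFDerivAt
  have h2 := (h1.const_mul (Complex.I * σ)).cexp
  have h3 := congrArg (fun L : Space 3 →L[ℝ] _ => L x)
    (h2.fun_smul (differentiableAt_sm v hx).hasFDerivAt).fderiv
  rw [R_apply u hx, R_apply v hx, hu]
  refine h3.trans ?_
  have h4 : ‖x‖⁻¹ * inner ℝ x x = ‖x‖ := by
    rw [real_inner_self_eq_norm_sq]
    have : ‖x‖ ≠ 0 := norm_ne_zero_iff.2 hx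
    field_simp
  simp only [add_apply, smul_apply, ContinuousLinearMap.smulRight_apply, ContinuousLinearMap.comp_apply,
    fderiv_norm_apply hx, h4, Complex.ofRealCLM_apply, smul_eq_mul]
  module

/-- Angular derivatives play no role in the radial argument, so the bounds are used with the empty
list of rotation fields only. -/
lemma isOutgoing_cut {σ : ℂ} {w : ℝ} {u : Space 3 → SpinIdx → ℂ} (hu : ContDiffOn ℝ ∞ u {0}ᶜ)
    (hσ : 0 ≤ σ.im) (h0 : ConormalAtZero w u)
    (h1 : σ.im = 0 → ConormalAtInfinity (phase (-σ) u)) (h2 : 0 < σ.im → RapidlyDecaying u) :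
    IsOutgoing σ w (cut u hu) := by
  have hne : ∀ {x : Space 3}, 1 ≤ ‖x‖ → x ≠ 0 := fun h => by
    rintro rfl; rw [norm_zero] at h; linarith
  obtain ⟨v, hv⟩ : ∃ v : Sm, v = cut _ (contDiffOn_phase (-σ) hu) := ⟨_, rfl⟩
  have huv : ∀ x, (cut u hu).1 x = Complex.exp (Complex.I * σ * ((‖x‖ : ℝ) : ℂ)) • v.1 x := by
    intro x
    by_cases hx : x = 0
    · rw [hx, (cut u hu).2.2, v.2.2, smul_zero]
    · rw [hv, cut_apply _ hx, cut_apply _ hx, phase, smul_smul, ← Complex.exp_add]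
      rw [show Complex.I * σ * ((‖x‖ : ℝ) : ℂ) + Complex.I * -σ * ((‖x‖ : ℝ) : ℂ) = 0 by ring,
        Complex.exp_zero, one_smul]
  refine ⟨?_, ?_, fun him => ?_⟩
  · obtain ⟨K0, hK0⟩ := h0 0 []
    obtain ⟨K1, hK1⟩ := h0 1 []
    refine ⟨max K0 K1, fun x hx hx1 => ?_⟩
    have hp := Real.rpow_nonneg (norm_nonneg x) w
    rw [cut_apply hu hx, R_cut_apply hu hx]
    exact ⟨(hK0 x hx hx1).trans (mul_le_mul_of_nonneg_right (le_max_left _ _) hp),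
      (hK1 x hx hx1).trans (mul_le_mul_of_nonneg_right (le_max_right _ _) hp)⟩
  · rcases hσ.eq_or_lt with him | him
    · obtain ⟨C, hC⟩ := h1 him.symm
      obtain ⟨K0, hK0⟩ := hC 0 []
      obtain ⟨K1, hK1⟩ := hC 1 []
      -- The field `r∂_r` applied to the phase factor brings down `iσr`, which costs one power of
      -- `r`.
      refine ⟨|K0| + (‖σ‖ * |K0| + |K1|), C + 1, fun x hx => ?_⟩
      have hx0 := hne hx
      have hp := Real.rpow_nonneg (norm_nonneg x) C
      have hpow : ‖x‖ ^ (C + 1) = ‖x‖ ^ C * ‖x‖ := by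
        rw [Real.rpow_add (norm_pos_iff.2 hx0), Real.rpow_one]
      have hle : ‖x‖ ^ C ≤ ‖x‖ ^ C * ‖x‖ := le_mul_of_one_le_right hp hx
      have hexp : ‖Complex.exp (Complex.I * σ * ((‖x‖ : ℝ) : ℂ))‖ = 1 := by
        rw [Complex.norm_exp]; simp [← him]
      have hv0 : ‖v.1 x‖ ≤ |K0| * ‖x‖ ^ C := by
        rw [hv, cut_apply _ hx0]
        exact (hK0 x hx).trans (mul_le_mul_of_nonneg_right (le_abs_self _) hp)
      have hv1 : ‖(R v).1 x‖ ≤ |K1| * ‖x‖ ^ C := by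
        rw [hv, R_cut_apply _ hx0]
        exact (hK1 x hx).trans (mul_le_mul_of_nonneg_right (le_abs_self _) hp)
      have e0 : |K0| * ‖x‖ ^ C ≤ |K0| * (‖x‖ ^ C * ‖x‖) := mul_le_mul_of_nonneg_left hle (abs_nonneg _)
      have e1 : |K1| * ‖x‖ ^ C ≤ |K1| * (‖x‖ ^ C * ‖x‖) := mul_le_mul_of_nonneg_left hle (abs_nonneg _)
      have hq : 0 ≤ ‖x‖ ^ C * ‖x‖ := mul_nonneg hp (norm_nonneg _)
      rw [R_exp_smul huv hx0, huv x, norm_smul, norm_smul, hexp, one_mul, one_mul, hpow]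
      constructor
      · have : 0 ≤ (‖σ‖ * |K0| + |K1|) * (‖x‖ ^ C * ‖x‖) := by positivity
        linarith
      · have e2 : ‖(Complex.I * σ * ((‖x‖ : ℝ) : ℂ)) • v.1 x‖ ≤ ‖σ‖ * |K0| * (‖x‖ ^ C * ‖x‖) := by
          rw [norm_smul, norm_mul, norm_mul, Complex.norm_I, one_mul, Complex.norm_real, norm_norm]
          calc ‖σ‖ * ‖x‖ * ‖v.1 x‖ ≤ ‖σ‖ * ‖x‖ * (|K0| * ‖x‖ ^ C) := by gcongr
            _ = _ := by ring
        have : 0 ≤ |K0| * (‖x‖ ^ C * ‖x‖) := by positivity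
        linarith [norm_add_le ((Complex.I * σ * ((‖x‖ : ℝ) : ℂ)) • v.1 x) ((R v).1 x)]
    -- Boundedness of `u` and `∂_r u`, the case `N = 0`, is enough; passing to `r∂_r` accounts for
    -- the exponent `1`.
    · obtain ⟨K0, hK0⟩ := h2 him 0 [] 0
      obtain ⟨K1, hK1⟩ := h2 him 1 [] 0
      refine ⟨|K0| + |K1|, 1, fun x hx => ?_⟩
      have hx0 := hne hx
      have b0 : ‖u x‖ ≤ K0 := by simpa [angular] using hK0 x hx
      have b1 : ‖dr u x‖ ≤ K1 := by simpa [angular] using hK1 x hx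
      have hR : rDr u x = ‖x‖ • dr u x := by
        rw [rDr, dr, ← map_smul, norm_smul_angle]
      rw [cut_apply hu hx0, R_cut_apply hu hx0, hR, norm_smul, norm_norm, Real.rpow_one]
      have a0 := le_abs_self K0
      have a1 := le_abs_self K1
      constructor
      · nlinarith [abs_nonneg K0, abs_nonneg K1]
      · nlinarith [abs_nonneg K0, abs_nonneg K1]
  · obtain ⟨C, hC⟩ := h1 him
    refine ⟨v, C, huv, fun j => ?_⟩
    obtain ⟨K, hK⟩ := hC j []
    refine ⟨K, fun x hx => ?_⟩
    rw [hv, iterate_R_cut_apply _ _ (hne hx)]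
    exact hK x hx

theorem directInjective_diracWaveOp (hZ : ContDiff ℝ ∞ Z) (hF : ContDiff ℝ ∞ F)
    (hG : ∀ j, ContDiff ℝ ∞ (G j)) {t : ℝ} (hz : Z t = z) {σ : ℂ} (hσ0 : σ ≠ 0) (hσ : 0 ≤ σ.im) {ℓ : ℝ}
    (hg : GoodExponents z (ℓ - (3 : ℕ) / 2)) : (diracWaveOp m hZ hF hG).DirectInjective t ℓ σ := by
  intro u hu hN h0 h1 h2 x hx
  have := eq_zero_of_coulombOp_eq_zero (coulombOp_eq_zero_of_reducedNormal hZ hF hG hz hu hN)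
    (isOutgoing_cut hu hσ h0 h1 h2) hσ0 hσ hg
  rw [← cut_apply hu hx, this]; rfl

end EdgeWave

end

/-! ### The formal adjoint and the adjoint kernel -/

noncomputable section

namespace EdgeWave
open MeasureTheory Filter Topology

/-- Smooth spinors with compact support in `ℝ³ ∖ {0}`. -/
def IsTest (φ : Sm) : Prop := (∃ r > 0, ∀ x, ‖x‖ < r → φ.1 x = 0) ∧ HasCompactSupport φ.1

/-- The inner product of a spinor with a test spinor. -/
def ip (u φ : Sm) : ℂ := ∫ x, star (u.1 x) ⬝ᵥ φ.1 x

section Test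
variable {u φ : Sm}

lemma IsTest.contDiff_dotProduct (h : IsTest φ) (u : Sm) :
    ContDiff ℝ ∞ fun x => star (u.1 x) ⬝ᵥ φ.1 x := by
  obtain ⟨r, hr, h0⟩ := h.1
  exact contDiff_of_zero_near (contDiffOn_star_dotProduct u.2.1 φ.2.1) hr fun x hx => by simp [h0 x hx]

lemma IsTest.hasCompactSupport_dotProduct (h : IsTest φ) (u : Sm) :
    HasCompactSupport fun x => star (u.1 x) ⬝ᵥ φ.1 x :=
  h.2.mono fun x hx => by
    rw [Function.mem_support] at hx ⊢
    contrapose! hx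
    simp [hx]

lemma IsTest.integrable (h : IsTest φ) (u : Sm) : Integrable fun x => star (u.1 x) ⬝ᵥ φ.1 x :=
  (h.contDiff_dotProduct u).continuous.integrable_of_hasCompactSupport
    (h.hasCompactSupport_dotProduct u)

lemma IsTest.pd (h : IsTest φ) (j : Fin 3) : IsTest (pd j φ) := by
  obtain ⟨r, hr, h0⟩ := h.1
  refine ⟨⟨r, hr, fun x hx => ?_⟩, ?_⟩
  · by_cases hx0 : x = 0
    · rw [hx0, (EdgeWave.pd j φ).2.2]
    · have he : φ.1 =ᶠ[𝓝 x] fun _ => 0 := by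
        filter_upwards [(isOpen_lt continuous_norm continuous_const).mem_nhds hx] with y hy
        exact h0 y hy
      rw [pd_apply _ _ hx0, he.fderiv_eq]; simp
  · refine (h.2.fderiv (𝕜 := ℝ)).mono fun x hx => ?_
    rw [Function.mem_support] at hx ⊢
    contrapose! hx
    by_cases hx0 : x = 0
    · rw [hx0, (EdgeWave.pd j φ).2.2]
    · rw [pd_apply _ _ hx0, hx]; rfl

lemma integral_fderiv_apply_eq_zero {f : Space 3 → ℂ} (hf : ContDiff ℝ ∞ f) (hc : HasCompactSupport f)
    (v : Space 3) : ∫ x, fderiv ℝ f x v = 0 := by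
  have hi : Integrable fun x => fderiv ℝ f x v :=
    (continuous_fderiv_apply hf v).integrable_of_hasCompactSupport (hasCompactSupport_fderiv_apply hc v)
  have h := integral_smul_fderiv_eq_neg_fderiv_smul_of_integrable (μ := volume)
    (f := fun _ : Space 3 => (1 : ℝ)) (g := f) (v := v) (by simp) (by simpa using hi)
    (by simpa using hf.continuous.integrable_of_hasCompactSupport hc)
    (fun x _ => differentiableAt_const _) (fun x _ => hf.differentiable (by simp) x)
  simpa using h

lemma ip_pd (h : IsTest φ) (u : Sm) (j : Fin 3) : ip u (pd j φ) = -ip (pd j u) φ := by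
  rw [eq_neg_iff_add_eq_zero, ip, ip, ← integral_add ((h.pd j).integrable u) (h.integrable _),
    ← integral_fderiv_apply_eq_zero (h.contDiff_dotProduct u) (h.hasCompactSupport_dotProduct u) (ee j)]
  refine integral_congr_ae ?_
  filter_upwards [Measure.ae_ne volume (0 : Space 3)] with x hx
  rw [fderiv_star_dotProduct (differentiableAt_sm u hx) (differentiableAt_sm φ hx), pd_apply _ _ hx,
    pd_apply _ _ hx, add_comm]

/-- The potential of the reduced normal operator. -/
def normalPotential (z : ℝ) (σ : ℂ) (x : Space 3) : Matrix SpinIdx SpinIdx ℂ :=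
  (-((z ^ 2 * (‖x‖ ^ 2)⁻¹ : ℝ) : ℂ) - σ ^ 2 + 2 * σ * ((z * ‖x‖⁻¹ : ℝ) : ℂ)) • 1
    + (Complex.I * ((z * (‖x‖ ^ 2)⁻¹ : ℝ) : ℂ)) • ∑ j, ((angle x j : ℝ) : ℂ) • (gammaZero * gamma j)

/-- Conjugation turns `σ²` and `zσ` into `σ̄²` and `zσ̄`, values shared by the pair `(-z, -σ̄)`, and
reverses the sign of the skew term `izα`. The adjoint thus stays in the same family, with `Im (-σ̄)
= Im σ`. -/
lemma normalPotential_conjTranspose (z : ℝ) (σ : ℂ) (x : Space 3) :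
    (normalPotential z σ x)ᴴ = normalPotential (-z) (-star σ) x := by
  rw [normalPotential, normalPotential, Matrix.conjTranspose_add, Matrix.conjTranspose_smul,
    Matrix.conjTranspose_smul, coulomb_conjTranspose, Matrix.conjTranspose_one]
  congr 2
  · simp
  · simp

lemma rp_neg_two_mul_coulombOp_apply (z : ℝ) (σ : ℂ) (u : Sm) (x : Space 3) :
    ((rp (-2) * coulombOp z σ) u).1 x
      = -∑ j, (pd j (pd j u)).1 x + normalPotential z σ x *ᵥ u.1 x := by
  by_cases hx : x = 0
  · subst hx
    have h : ∀ v : Sm, v.1 0 = 0 := fun v => v.2.2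
    simp [h]
  have hx' : ((‖x‖ : ℝ) : ℂ) ≠ 0 := by simpa using hx
  have hs : ((∑ j, pd j * pd j) u).1 x = ∑ j, (pd j (pd j u)).1 x := by
    rw [Op.sum_apply, Submodule.coe_sum, Finset.sum_apply]; rfl
  have h1 : ((rp (-2) * coulombOp z σ) u).1 x = ((‖x‖ : ℝ) : ℂ) ^ (-2 : ℂ) •
      (((‖x‖ : ℝ) : ℂ) ^ (2 : ℂ) • -((∑ j, pd j * pd j) u).1 x
      - ((z : ℂ) ^ 2) • u.1 x + (Complex.I * z) • (Al u).1 x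
      - σ ^ 2 • (((‖x‖ : ℝ) : ℂ) ^ (2 : ℂ) • u.1 x)
      + (2 * z * σ) • (((‖x‖ : ℝ) : ℂ) ^ (1 : ℂ) • u.1 x)) := by
    rw [coulombOp_eq]; rfl
  rw [h1, hs, Al_apply u hx, Complex.cpow_neg, Complex.cpow_ofNat, Complex.cpow_one, normalPotential,
    Matrix.add_mulVec, Matrix.smul_mulVec, Matrix.smul_mulVec, Matrix.one_mulVec]
  push_cast
  match_scalars <;> field_simp

lemma dotProduct_normalPotential_mulVec (u : Sm) (z : ℝ) (σ : ℂ) (x : Space 3) :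
    star (u.1 x) ⬝ᵥ (normalPotential z σ x *ᵥ φ.1 x)
      = star (normalPotential (-z) (-star σ) x *ᵥ u.1 x) ⬝ᵥ φ.1 x := by
  rw [← normalPotential_conjTranspose, Matrix.star_mulVec, Matrix.conjTranspose_conjTranspose,
    Matrix.dotProduct_mulVec]

/-- The formal adjoint of the reduced normal operator. -/
lemma ip_reducedNormal (h : IsTest φ) (u : Sm) (z : ℝ) (σ : ℂ) :
    ip u ((rp (-2) * coulombOp z σ) φ) = ip ((rp (-2) * coulombOp (-z) (-star σ)) u) φ := by
  have hpd : ∀ j, ip u (pd j (pd j φ)) = ip (pd j (pd j u)) φ := fun j => by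
    rw [ip_pd (h.pd j), ip_pd h, neg_neg]
  obtain ⟨w, hw⟩ : ∃ w : Sm, w = (rp (-2) * coulombOp (-z) (-star σ)) u + ∑ j, pd j (pd j u) :=
    ⟨_, rfl⟩
  have hw' : ∀ x, w.1 x = normalPotential (-z) (-star σ) x *ᵥ u.1 x := fun x => by
    have e : w.1 x = ((rp (-2) * coulombOp (-z) (-star σ)) u).1 x + (∑ j, pd j (pd j u)).1 x := by
      rw [hw]; rfl
    rw [e, rp_neg_two_mul_coulombOp_apply, Submodule.coe_sum, Finset.sum_apply]
    abel
  have h1 : ip u ((rp (-2) * coulombOp z σ) φ) = -∑ j, ip u (pd j (pd j φ)) + ip w φ := by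
    simp only [ip, neg_add_eq_sub]
    rw [← integral_finsetSum _ fun j _ => ((h.pd j).pd j).integrable u,
      ← integral_sub (h.integrable w) (integrable_finsetSum _ fun j _ => ((h.pd j).pd j).integrable u)]
    refine integral_congr_ae (ae_of_all _ fun x => ?_)
    simp only [rp_neg_two_mul_coulombOp_apply, neg_add_eq_sub, dotProduct_sub, dotProduct_sum, dotProduct_normalPotential_mulVec,
      hw']
  have h2 : ip ((rp (-2) * coulombOp (-z) (-star σ)) u) φ
      = -∑ j, ip (pd j (pd j u)) φ + ip w φ := by
    simp only [ip, neg_add_eq_sub]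
    rw [← integral_finsetSum _ fun j _ => h.integrable _,
      ← integral_sub (h.integrable w) (integrable_finsetSum _ fun j _ => h.integrable _)]
    refine integral_congr_ae (ae_of_all _ fun x => ?_)
    simp only [rp_neg_two_mul_coulombOp_apply, neg_add_eq_sub, star_sub, star_sum, sub_dotProduct, sum_dotProduct, hw']
  rw [h1, h2]
  simp only [hpd]

lemma isTest_cut {φ : Space 3 → SpinIdx → ℂ} (hφ : ContDiff ℝ ∞ φ) (hc : HasCompactSupport φ)
    (h0 : tsupport φ ⊆ {0}ᶜ) : IsTest (cut φ hφ.contDiffOn) := by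
  have h1 : (0 : Space 3) ∉ tsupport φ := fun h => h0 h rfl
  obtain ⟨r, hr, h2⟩ := Metric.eventually_nhds_iff.1 (notMem_tsupport_iff_eventuallyEq.1 h1)
  refine ⟨⟨r, hr, fun x hx => ?_⟩, hc.mono fun x hx => ?_⟩
  · by_cases hx0 : x = 0
    · rw [hx0, (cut φ hφ.contDiffOn).2.2]
    · rw [cut_apply _ hx0]; exact h2 (by simpa using hx)
  · rw [Function.mem_support] at hx ⊢
    contrapose! hx
    by_cases hx0 : x = 0
    · rw [hx0, (cut φ hφ.contDiffOn).2.2]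
    · rw [cut_apply _ hx0, hx]

/-- The fundamental lemma of the calculus of variations, applied to each component with test spinors
in a single coordinate direction. -/
lemma eq_zero_of_ip_eq_zero {w : Sm} (h : ∀ φ, IsTest φ → ip w φ = 0) : w = 0 := by
  have hc : ∀ a, ContinuousOn (fun x => star (w.1 x a)) {0}ᶜ := fun a =>
    (contDiffOn_star (contDiffOn_pi.1 w.2.1 a)).continuousOn
  refine Sm_ext fun x hx => funext fun a => ?_
  have h1 := isOpen_compl_zero.ae_eq_zero_of_integral_contDiff_smul_eq_zero (μ := volume)
    ((hc a).locallyIntegrableOn isOpen_compl_zero.measurableSet) fun g hg hgc hg0 => by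
      have hφ : ContDiff ℝ ∞ fun x => ((g x : ℝ) : ℂ) • (Pi.single a 1 : SpinIdx → ℂ) :=
        (Complex.ofRealCLM.contDiff.comp hg).smul contDiff_const
      have hsub : Function.support (fun x => ((g x : ℝ) : ℂ) • (Pi.single a 1 : SpinIdx → ℂ))
          ⊆ Function.support g := fun x hx => by
        rw [Function.mem_support] at hx ⊢
        contrapose! hx
        simp [hx]
      rw [← h _ (isTest_cut hφ (hgc.mono hsub) ((closure_mono hsub).trans hg0)), ip]
      refine integral_congr_ae ?_
      filter_upwards [Measure.ae_ne volume (0 : Space 3)] with x hx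
      rw [cut_apply _ hx]
      simp
  have h2 := Measure.eqOn_open_of_ae_eq (g := fun _ => (0 : ℂ))
    ((ae_restrict_iff' isOpen_compl_zero.measurableSet).2 h1) isOpen_compl_zero (hc a) continuousOn_const hx
  simpa using h2

end Test

section Adjoint
variable {m z : ℝ} {Z : ℝ → ℂ} {F : ℝ × Space 3 → ℂ} {G : Fin 3 → ℝ × Space 3 → ℂ}

/-- Weak solutions of the adjoint equation are classical solutions. -/
lemma coulombOp_eq_zero_of_adjointKernel (hZ : ContDiff ℝ ∞ Z) (hF : ContDiff ℝ ∞ F)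
    (hG : ∀ j, ContDiff ℝ ∞ (G j)) {t : ℝ} (hz : Z t = z) {σ : ℂ} {u : Space 3 → SpinIdx → ℂ}
    (hu : ContDiffOn ℝ ∞ u {0}ᶜ) (h : (diracWaveOp m hZ hF hG).AdjointKernel t σ u) :
    coulombOp (-z) (-star σ) (cut u hu) = 0 := by
  refine rp_injective (-2) (eq_zero_of_ip_eq_zero fun φ hφ => ?_)
  rw [← Op.mul_apply, ← ip_reducedNormal hφ]
  obtain ⟨r, hr, h0⟩ := hφ.1
  have hs : tsupport φ.1 ⊆ {0}ᶜ := by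
    intro x hx h1
    rw [Set.mem_singleton_iff.1 h1] at hx
    refine notMem_tsupport_iff_eventuallyEq.2 ?_ hx
    filter_upwards [Metric.ball_mem_nhds (0 : Space 3) hr] with y hy
    exact h0 y (by simpa using hy)
  rw [← h φ.1 (contDiff_of_zero_near φ.2.1 hr h0) hφ.2 hs, ip]
  refine integral_congr_ae ?_
  filter_upwards [Measure.ae_ne volume (0 : Space 3)] with x hx
  have hcut : cut φ.1 φ.2.1 = φ := Sm_ext fun y hy => cut_apply _ hy
  rw [reducedNormal_diracWaveOp_cut hZ hF hG hz σ φ.2.1 hx, hcut, cut_apply hu hx]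

theorem adjointInjective_diracWaveOp (hZ : ContDiff ℝ ∞ Z) (hF : ContDiff ℝ ∞ F)
    (hG : ∀ j, ContDiff ℝ ∞ (G j)) {t : ℝ} (hz : Z t = z) {σ : ℂ} (hσ0 : σ ≠ 0) (hσ : 0 ≤ σ.im) {ℓ : ℝ}
    (hg : GoodExponents (-z) (-((((3 : ℕ) : ℝ) - 4) / 2) - ℓ)) :
    (diracWaveOp m hZ hF hG).AdjointInjective t ℓ σ := by
  intro u hu hN h0 h1 h2 x hx
  have him : (-star σ).im = σ.im := by simp
  have ho : IsOutgoing (-star σ) (-((((3 : ℕ) : ℝ) - 4) / 2) - ℓ) (cut u hu) := by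
    refine isOutgoing_cut hu (him.symm ▸ hσ) h0 (fun h => ?_) fun h => h2 (him ▸ h)
    rw [him] at h
    -- For real `σ`, being outgoing at the frequency `-σ̄ = -σ` is the condition with the phase `exp
    -- (iσr)`.
    have : -(-star σ) = σ := by rw [neg_neg]; exact Complex.conj_eq_iff_im.2 h
    rw [this]; exact h1 h
  have := eq_zero_of_coulombOp_eq_zero (coulombOp_eq_zero_of_adjointKernel hZ hF hG hz hu hN) ho
    (neg_ne_zero.2 (star_ne_zero.2 hσ0)) (him.symm ▸ hσ) hg
  rw [← cut_apply hu hx, this]; rfl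

end Adjoint

/-- The squared Dirac–Coulomb operator is spectrally admissible. -/
theorem isSpectrallyAdmissible_diracCoulombWave (m : ℝ) {Z : ℝ → ℂ} (hZ : ContDiff ℝ ∞ Z)
    {V : Space 3 → ℂ} (hV : IsSmoothOnBlowup V) {A : Fin 3 → Space 3 → ℂ}
    (hA : ∀ j, IsSmoothOnBlowup (A j)) {t z δ : ℝ} (hz : Z t = z)
    (hδ : ∀ κ : ℤ, κ ≠ 0 → δ ≤ indicialGap z κ) {ℓ : ℝ} (hℓ : ℓ ∈ Set.Ioo (1 - δ) (1 + δ)) :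
    IsSpectrallyAdmissible (diracCoulombWave m Z V A) ℓ t := by
  obtain ⟨F, hF, hVF⟩ := hV
  choose G hG hAG using hA
  have hδ0 : 0 ≤ δ := by linarith [hℓ.1, hℓ.2]
  have hδ' : ∀ κ : ℤ, κ ≠ 0 → δ ≤ indicialGap (-z) κ := fun κ hκ => by
    rw [indicialGap, neg_sq]; exact hδ κ hκ
  refine ⟨diracWaveOp m hZ hF hG, diracWaveOp_represents hZ hF hG hVF hAG,
    isNonIndicial_diracWaveOp hZ hF hG hz hδ ?_, fun σ hσ hσ1 => ?_⟩
  · rw [abs_lt]; push_cast; constructor <;> linarith [hℓ.1, hℓ.2]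
  · have hσ0 : σ ≠ 0 := by rintro rfl; simp at hσ1
    -- The direct problem has weight `ℓ - 3/2` and uses `ℓ > 1 - δ`; the adjoint problem has weight
    -- `1/2 - ℓ` and uses `ℓ < 1 + δ`.
    exact ⟨directInjective_diracWaveOp hZ hF hG hz hσ0 hσ
        (goodExponents_of_gap hδ0 hδ (by push_cast; linarith [hℓ.1])),
      adjointInjective_diracWaveOp hZ hF hG hz hσ0 hσ
        (goodExponents_of_gap hδ0 hδ' (by push_cast; linarith [hℓ.2]))⟩

end EdgeWave

end

theorem lemma4p8 (m : ℝ) (Z : ℝ → ℂ) (hZ : ContDiff ℝ ∞ Z)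
    (V : EdgeWave.Space 3 → ℂ) (hV : EdgeWave.IsSmoothOnBlowup V)
    (A : Fin 3 → EdgeWave.Space 3 → ℂ) (hA : ∀ j, EdgeWave.IsSmoothOnBlowup (A j))
    (t₀ z : ℝ) (hz : Z t₀ = (z : ℂ))
    (hκ : ∀ κ : ℤ, κ ≠ 0 → |z| ≠ Real.sqrt ((κ : ℝ) ^ 2 - 1 / 4)) :
    ∃ δ : ℝ,
      IsLeast {d : ℝ | ∃ κ : ℤ, κ ≠ 0 ∧
        d = |1 / 2 - (((κ : ℂ) ^ 2 - (z : ℂ) ^ 2) ^ (1 / 2 : ℂ)).re|} δ ∧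
      ∀ ℓ ∈ Set.Ioo (1 - δ) (1 + δ),
        EdgeWave.IsSpectrallyAdmissible (EdgeWave.diracCoulombWave m Z V A) ℓ t₀ := by
  obtain ⟨κ, hκ0, hmin⟩ := EdgeWave.exists_min_indicialGap z
  refine ⟨EdgeWave.indicialGap z κ, ⟨⟨κ, hκ0, (EdgeWave.indicialGap_eq z κ).symm⟩, ?_⟩, fun ℓ hℓ =>
    EdgeWave.isSpectrallyAdmissible_diracCoulombWave m hZ hV hA hz hmin hℓ⟩
  rintro _ ⟨κ', hκ', rfl⟩
  rw [EdgeWave.indicialGap_eq]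
  exact hmin κ' hκ'
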